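/- Let $(M^n,g)$ be a smooth closed Riemannian manifold of dimension $n\ge 5$. Let $A_g=\frac1{n-2}\left(\mathrm{Ric}_g-\frac{R_g}{2(n-1)}g\right)$ be the Schouten tensor, $\sigma_k(A_g)$ the $k$-th elementary symmetric function of its eigenvalues, $$Q_g=-\Delta_g\sigma_1(A_g)+4\sigma_2(A_g)+\tfrac{n-4}{2}\sigma_1(A_g)^2,$$ $$P_gu=\Delta_g^2u+\mathrm{div}_g\{(4A_g-(n-2)\sigma_1(A_g)g)(\nabla_gu,\cdot)\}+\tfrac{n-4}{2}Q_gu$$ (the $Q^{(4)}$-curvature and the Paneitz operator), and put $d=\lfloor\frac{n-4}{2}\rfloor$, $\varsigma_n=2(n-4)(n-2)|\mathbb S^{n-1}|$. Write $f=O^{(4)}(|x|^s)$ if $f$ is $C^4$ and $|\nabla^if|=O(|x|^{s-i})$ for $i=0,\dots,4$. Assume that $\ker P_g=0$. Let $\bar\sigma\in M$, and suppose that the Green's function $G=G_g(\cdot,\bar\sigma)$ of $P_g$ with pole $\bar\sigma$ is positive on $M\setminus\{\bar\sigma\}$. Let $x$ be geodesic normal coordinates on a ball centered at $\bar\sigma$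 such that $\det(g_{ij})=1$ near $\bar\sigma$. Suppose that the Weyl tensor satisfies $\nabla_g^mW_g(\bar\sigma)=0$ for all integers $0\le m\le d-2$, and that, as $x\to0$, $$G(x)=\varsigma_n^{-1}|x|^{4-n}\Big[1+\sum_{k=d+1}^{n-4}\psi^{(k)}(x)\Big]+A+O^{(4)}(|x|),$$ where $A\in\mathbb R$ and $\psi^{(k)}$ is a homogeneous polynomial of degree $k$ with $\int_{\mathbb S^{n-1}}\psi^{(k)}=0$ and $\int_{\mathbb S^{n-1}}x_i\psi^{(k)}=0$ for all $i$. Let $\hat g=G^{4/(n-4)}g$ on $M\setminus\{\bar\sigma\}$. Then $Q_{\hat g}=0$, and, with the inverted coordinates $y=\varsigma_n^{-2/(n-4)}\,x/|x|^2$ as coordinates at infinity, $(M\setminus\{\bar\sigma\},\hat g)$ is an asymptotically flat manifold with one end and some decay rate $\tau>\frac{n-4}{2}$: the coordinates $y$ identify an open set with compact complement in $M\setminus\{\bar\sigma\}$ with the exterior of a closed ball in $\mathbb R^n$, and $\hat g_{ij}(y)-\delta_{ij}=O^{(4)}(|y|^{-\tau})$ as $|y|\to\infty$. Moreover, the fourth-order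 mass of $\hat g$ exists and is $$m(\hat g):=\lim_{r\to\infty}\int_{\partial B_r}(\hat g_{ii,jjk}-\hat g_{ij,ijk})(y)\frac{y_k}{|y|}\,dS=\frac{4(n-1)}{n-4}A,$$ where repeated indices are summed and commas denote partial derivatives in the coordinates $y$. -/

import Mathlib

open scoped Manifold ContDiff Topology

noncomputable section

namespace PaneitzMass

/-- Euclidean `n`-space. -/
abbrev Euc (n : ℕ) : Type := EuclideanSpace ℝ (Fin n)

/-! ### Riemannian geometry in coordinates

A metric in coordinates is a matrix-valued function `γ` with entries `γ x i j = g_ij(x)`. -/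

section Coordinates

variable {n : ℕ}

/-- The partial derivative `∂_i f`. -/
def pd (i : Fin n) (f : Euc n → ℝ) (x : Euc n) : ℝ :=
  fderiv ℝ f x (EuclideanSpace.single i 1)

/-- Christoffel symbols `Γ^k_ij = ½ g^{kl} (∂_i g_jl + ∂_j g_il - ∂_l g_ij)`. -/
def christoffel (γ : Euc n → Matrix (Fin n) (Fin n) ℝ) (k i j : Fin n) (x : Euc n) : ℝ :=
  (1 / 2) * ∑ l, (γ x)⁻¹ k l *
    (pd i (fun y => γ y j l) x + pd j (fun y => γ y i l) x - pd l (fun y => γ y i j) x)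

/-- `R_ijk^m`, where `R(∂_i, ∂_j) ∂_k = R_ijk^m ∂_m` and
`R(X, Y) Z = ∇_X ∇_Y Z - ∇_Y ∇_X Z - ∇_[X,Y] Z`. -/
def riemannUp (γ : Euc n → Matrix (Fin n) (Fin n) ℝ) (i j k m : Fin n) (x : Euc n) : ℝ :=
  pd i (christoffel γ m j k) x - pd j (christoffel γ m i k) x
    + ∑ p, (christoffel γ m i p x * christoffel γ p j k x
      - christoffel γ m j p x * christoffel γ p i k x)

/-- `R_ijkl = g(R(∂_i, ∂_j) ∂_k, ∂_l)`; on the unit sphere it is `g_il g_jk - g_ik g_jl`. -/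
def riemann (γ : Euc n → Matrix (Fin n) (Fin n) ℝ) (i j k l : Fin n) (x : Euc n) : ℝ :=
  ∑ m, riemannUp γ i j k m x * γ x m l

/-- The Ricci tensor `Ric_jk = R_ijk^i` (positive on the sphere). -/
def ricci (γ : Euc n → Matrix (Fin n) (Fin n) ℝ) (j k : Fin n) (x : Euc n) : ℝ :=
  ∑ i, riemannUp γ i j k i x

/-- The scalar curvature. -/
def scalarCurv (γ : Euc n → Matrix (Fin n) (Fin n) ℝ) (x : Euc n) : ℝ :=
  ∑ i, ∑ j, (γ x)⁻¹ i j * ricci γ i j x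

/-- The Schouten tensor `A = (Ric - R g / (2(n-1))) / (n-2)`. -/
def schouten (γ : Euc n → Matrix (Fin n) (Fin n) ℝ) (i j : Fin n) (x : Euc n) : ℝ :=
  (1 / ((n : ℝ) - 2)) * (ricci γ i j x - scalarCurv γ x / (2 * ((n : ℝ) - 1)) * γ x i j)

/-- The Weyl tensor `W = Rm - A ∧ g` (Kulkarni-Nomizu product), all indices down. -/
def weyl (γ : Euc n → Matrix (Fin n) (Fin n) ℝ) (I : Fin 4 → Fin n) (x : Euc n) : ℝ :=
  riemann γ (I 0) (I 1) (I 2) (I 3) x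
    - (schouten γ (I 0) (I 3) x * γ x (I 1) (I 2) + schouten γ (I 1) (I 2) x * γ x (I 0) (I 3)
      - schouten γ (I 0) (I 2) x * γ x (I 1) (I 3) - schouten γ (I 1) (I 3) x * γ x (I 0) (I 2))

/-- The covariant derivative of a covariant `r`-tensor; the new index comes first. -/
def covDeriv (γ : Euc n → Matrix (Fin n) (Fin n) ℝ) {r : ℕ}
    (T : (Fin r → Fin n) → Euc n → ℝ) (I : Fin (r + 1) → Fin n) (x : Euc n) : ℝ :=
  pd (I 0) (T (Fin.tail I)) x
    - ∑ s, ∑ k, christoffel γ k (I 0) (Fin.tail I s) x * T (Function.update (Fin.tail I) s k) x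

/-- The iterated covariant derivative `∇^m T`. -/
def covDerivIter (γ : Euc n → Matrix (Fin n) (Fin n) ℝ) {r : ℕ}
    (T : (Fin r → Fin n) → Euc n → ℝ) : (m : ℕ) → (Fin (r + m) → Fin n) → Euc n → ℝ
  | 0 => T
  | m + 1 => covDeriv γ (covDerivIter γ T m)

/-- The divergence `∂_k V^k + Γ^j_jk V^k` of a vector field. -/
def divergence (γ : Euc n → Matrix (Fin n) (Fin n) ℝ) (V : Fin n → Euc n → ℝ) (x : Euc n) : ℝ :=
  ∑ k, (pd k (V k) x + ∑ j, christoffel γ j j k x * V k x)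

/-- The Laplace-Beltrami operator `div ∇` (nonpositive eigenvalues). -/
def laplacian (γ : Euc n → Matrix (Fin n) (Fin n) ℝ) (u : Euc n → ℝ) (x : Euc n) : ℝ :=
  divergence γ (fun k y => ∑ l, (γ y)⁻¹ k l * pd l u y) x

/-- `div {T(∇u, ·)} = (g^{ik} g^{jl} T_ij u_l)_{;k}` for a symmetric 2-tensor `T`. -/
def divTensorGrad (γ : Euc n → Matrix (Fin n) (Fin n) ℝ) (T : Fin n → Fin n → Euc n → ℝ)
    (u : Euc n → ℝ) (x : Euc n) : ℝ :=
  divergence γ (fun k y => ∑ i, ∑ j, ∑ l, (γ y)⁻¹ i k * (γ y)⁻¹ j l * T i j y * pd l u y) x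

/-- `σ₁(A)`, the trace of the Schouten tensor. -/
def sigma1 (γ : Euc n → Matrix (Fin n) (Fin n) ℝ) (x : Euc n) : ℝ :=
  ∑ i, ∑ j, (γ x)⁻¹ i j * schouten γ i j x

/-- `|A|²`, the sum of the squares of the eigenvalues of the Schouten tensor. -/
def schoutenSq (γ : Euc n → Matrix (Fin n) (Fin n) ℝ) (x : Euc n) : ℝ :=
  ∑ i, ∑ j, ∑ k, ∑ l, (γ x)⁻¹ i k * (γ x)⁻¹ j l * schouten γ i j x * schouten γ k l x

/-- `σ₂(A)`, the second elementary symmetric function of the eigenvalues. -/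
def sigma2 (γ : Euc n → Matrix (Fin n) (Fin n) ℝ) (x : Euc n) : ℝ :=
  (1 / 2) * (sigma1 γ x ^ 2 - schoutenSq γ x)

/-- Branson's curvature `Q = -Δ σ₁(A) + 4 σ₂(A) + (n-4)/2 σ₁(A)²`. -/
def qCurv (γ : Euc n → Matrix (Fin n) (Fin n) ℝ) (x : Euc n) : ℝ :=
  -laplacian γ (sigma1 γ) x + 4 * sigma2 γ x + ((n : ℝ) - 4) / 2 * sigma1 γ x ^ 2

/-- The Paneitz operator
`P u = Δ² u + div {(4 A - (n-2) σ₁(A) g)(∇u, ·)} + (n-4)/2 Q u`. -/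
def paneitz (γ : Euc n → Matrix (Fin n) (Fin n) ℝ) (u : Euc n → ℝ) (x : Euc n) : ℝ :=
  laplacian γ (laplacian γ u) x
    + divTensorGrad γ
        (fun i j y => 4 * schouten γ i j y - ((n : ℝ) - 2) * sigma1 γ y * γ y i j) u x
    + ((n : ℝ) - 4) / 2 * qCurv γ x * u x

/-- `f = O^{(l)}(|x|^s)` along the filter `F`: `f` is `C^l` and `|∇^i f| = O(|x|^{s-i})` for
`i = 0, …, l`. -/
def IsBigODeriv (F : Filter (Euc n)) (l : ℕ) (s : ℝ) (f : Euc n → ℝ) : Prop :=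
  (∀ᶠ x in F, ContDiffAt ℝ l f x) ∧
    ∀ i ≤ l, (fun x => iteratedFDeriv ℝ i f x) =O[F] fun x => ‖x‖ ^ (s - (i : ℝ))

/-- The integral of `f` over the unit sphere with respect to surface measure. -/
def sphereIntegral (f : Euc n → ℝ) : ℝ :=
  ∫ θ : Metric.sphere (0 : Euc n) 1, f θ
    ∂(MeasureTheory.Measure.toSphere (MeasureTheory.volume : MeasureTheory.Measure (Euc n)))

/-- The flux `∫_{∂B_r} (g_{ii,jjk} - g_{ij,ijk})(y) y_k / |y| dS`, written over the unit sphere. -/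
def massFlux (γ : Euc n → Matrix (Fin n) (Fin n) ℝ) (r : ℝ) : ℝ :=
  r ^ (n - 1) * sphereIntegral (fun θ : Euc n => ∑ i, ∑ j, ∑ k,
    (pd k (pd j (pd j (fun y => γ y i i))) (r • θ)
      - pd k (pd j (pd i (fun y => γ y i j))) (r • θ)) * θ k)

/-- The limit defining the fourth-order mass exists and equals `m`. -/
def HasFourthOrderMass (γ : Euc n → Matrix (Fin n) (Fin n) ℝ) (m : ℝ) : Prop :=
  Filter.Tendsto (massFlux γ) Filter.atTop (𝓝 m)

/-- A smooth function given by a real polynomial in the coordinates. -/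
def polyFun (p : MvPolynomial (Fin n) ℝ) (x : Euc n) : ℝ :=
  MvPolynomial.eval (fun i => x i) p

end Coordinates

/-- The area of the unit sphere in Euclidean `n`-space. -/
def sphereArea (n : ℕ) : ℝ :=
  sphereIntegral (fun _ : Euc n => (1 : ℝ))

/-- `ς_n = 2 (n-4) (n-2) |S^{n-1}|`. -/
def varsigma (n : ℕ) : ℝ :=
  2 * ((n : ℝ) - 4) * ((n : ℝ) - 2) * sphereArea n

/-- `d = ⌊(n-4)/2⌋` (only used for `n ≥ 5`). -/
def dOrder (n : ℕ) : ℕ := (n - 4) / 2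

/-! ### Metrics, Green's functions and asymptotic flatness on manifolds -/

section Manifolds

variable {n : ℕ} {M : Type*} [TopologicalSpace M] [ChartedSpace (Euc n) M]

variable (n M) in
/-- A field of bilinear forms on the tangent spaces of `M`. -/
abbrev BilinField : Type _ :=
  (p : M) → TangentSpace (𝓡 n) p →L[ℝ] TangentSpace (𝓡 n) p →L[ℝ] ℝ

/-- The components `h_ij` of a field of bilinear forms in the coordinates given by the chart `e`. -/
def comps (h : BilinField n M) (e : OpenPartialHomeomorph M (Euc n)) (x : Euc n) :
    Matrix (Fin n) (Fin n) ℝ :=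
  Matrix.of fun i j =>
    h (e.symm x) (mfderiv 𝓘(ℝ, Euc n) (𝓡 n) e.symm x (EuclideanSpace.single i (1 : ℝ)))
      (mfderiv 𝓘(ℝ, Euc n) (𝓡 n) e.symm x (EuclideanSpace.single j (1 : ℝ)))

/-- `h` is a smooth Riemannian metric on the open set `U`. -/
structure IsRiemannianMetricOn (h : BilinField n M) (U : Set M) : Prop where
  symm : ∀ p ∈ U, ∀ v w, h p v w = h p w v
  pos : ∀ p ∈ U, ∀ v, v ≠ 0 → 0 < h p v v
  smooth : ∀ e ∈ IsManifold.maximalAtlas (𝓡 n) ∞ M, ∀ i j,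
    ContDiffOn ℝ ∞ (fun x => comps h e x i j) (e.target ∩ e.symm ⁻¹' U)

/-- `P_h u = 0` on `U`, in all coordinates. -/
def PaneitzZeroOn (h : BilinField n M) (u : M → ℝ) (U : Set M) : Prop :=
  ∀ e ∈ IsManifold.maximalAtlas (𝓡 n) ∞ M, ∀ x ∈ e.target, e.symm x ∈ U →
    paneitz (comps h e) (fun y => u (e.symm y)) x = 0

/-- The `Q`-curvature of `h` vanishes on `U`, in all coordinates. -/
def QCurvZeroOn (h : BilinField n M) (U : Set M) : Prop :=
  ∀ e ∈ IsManifold.maximalAtlas (𝓡 n) ∞ M, ∀ x ∈ e.target, e.symm x ∈ U →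
    qCurv (comps h e) x = 0

/-- `ker P_h = 0` on smooth functions (by elliptic regularity, every solution is smooth). -/
def PaneitzKerTrivial (h : BilinField n M) : Prop :=
  ∀ u : M → ℝ, ContMDiff (𝓡 n) 𝓘(ℝ, ℝ) ∞ u → PaneitzZeroOn h u Set.univ → ∀ p, u p = 0

/-- `G` is the Green's function of the Paneitz operator of `h` with pole `σ`: it is smooth off the
pole, locally integrable, and `P_h G = δ_σ` in the sense of distributions, that is
`∫_M G P_h φ dv_h = φ(σ)` for the test functions `φ`. By a partition of unity it suffices to test
with functions supported in one coordinate domain, where `dv_h = √(det h_ij) dx`. -/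
structure IsGreenFunction (h : BilinField n M) (σ : M) (G : M → ℝ) : Prop where
  smooth : ContMDiffOn (𝓡 n) 𝓘(ℝ, ℝ) ∞ G {σ}ᶜ
  integrable : ∀ e ∈ IsManifold.maximalAtlas (𝓡 n) ∞ M,
    MeasureTheory.LocallyIntegrableOn (fun x => G (e.symm x)) e.target
  eq_dirac : ∀ e ∈ IsManifold.maximalAtlas (𝓡 n) ∞ M, ∀ φ : M → ℝ,
    ContMDiff (𝓡 n) 𝓘(ℝ, ℝ) ∞ φ → HasCompactSupport φ → tsupport φ ⊆ e.source →
    ∫ x in e.target, G (e.symm x) * paneitz (comps h e) (fun y => φ (e.symm y)) x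
      * Real.sqrt (comps h e x).det = φ σ

/-- `e` is a geodesic normal coordinate system centred at `σ`, on a ball: the coordinate frame is
orthonormal at the centre, and the rays from the centre are geodesics
(`Γ^k_ij(x) x_i x_j = 0`). -/
structure IsNormalChart (h : BilinField n M) (σ : M)
    (e : OpenPartialHomeomorph M (Euc n)) : Prop where
  mem_atlas : e ∈ IsManifold.maximalAtlas (𝓡 n) ∞ M
  mem_source : σ ∈ e.source
  map_center : e σ = 0
  target_eq : ∃ ρ : ℝ, 0 < ρ ∧ e.target = Metric.ball 0 ρ
  orthonormal : comps h e 0 = 1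
  radial_geodesic : ∀ x ∈ e.target, ∀ k,
    ∑ i, ∑ j, christoffel (comps h e) k i j x * x i * x j = 0

/-- In the coordinates `e` centred at `σ`, `∇^m W(σ) = 0` for all integers `0 ≤ m ≤ d - 2`. -/
def WeylVanishes (h : BilinField n M) (e : OpenPartialHomeomorph M (Euc n)) : Prop :=
  ∀ m : ℕ, (m : ℤ) ≤ (dOrder n : ℤ) - 2 → ∀ I : Fin (4 + m) → Fin n,
    covDerivIter (comps h e) (weyl (comps h e)) m I 0 = 0

/-- The expansion
`f(x) = ς_n⁻¹ |x|^{4-n} (1 + ∑_{k=d+1}^{n-4} ψ^{(k)}(x)) + A + O^{(4)}(|x|)` as `x → 0`, where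
`ψ^{(k)}` is a homogeneous polynomial of degree `k` with
`∫_{S^{n-1}} ψ^{(k)} = 0` and `∫_{S^{n-1}} x_i ψ^{(k)} = 0`. -/
def HasGreenExpansion (f : Euc n → ℝ) (A : ℝ) : Prop :=
  ∃ ψ : ℕ → MvPolynomial (Fin n) ℝ,
    (∀ k ∈ Finset.Icc (dOrder n + 1) (n - 4), (ψ k).IsHomogeneous k ∧
      sphereIntegral (polyFun (ψ k)) = 0 ∧
      ∀ i, sphereIntegral (fun x => x i * polyFun (ψ k) x) = 0) ∧
    IsBigODeriv (𝓝[≠] 0) 4 1 (fun x => f x -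
      ((varsigma n)⁻¹ * ‖x‖ ^ (4 - (n : ℝ)) *
        (1 + ∑ k ∈ Finset.Icc (dOrder n + 1) (n - 4), polyFun (ψ k) x) + A))

/-- `h` makes the open subset `U` of `M` an asymptotically flat manifold with one end and decay
rate `τ`, with `y = e(p)` as coordinates at infinity: `e` identifies an open subset `M_∞` of `U`
with the exterior of a closed ball, the rest of `U` (also together with any bounded part of the
end) is compact, and `h_ij(y) - δ_ij = O^{(4)}(|y|^{-τ})` as `|y| → ∞`. -/
structure IsAsymptoticallyFlat (h : BilinField n M) (U : Set M)
    (e : OpenPartialHomeomorph M (Euc n)) (τ : ℝ) : Prop where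
  isOpen : IsOpen U
  metric : IsRiemannianMetricOn h U
  rate_pos : 0 < τ
  mem_atlas : e ∈ IsManifold.maximalAtlas (𝓡 n) ∞ M
  source_subset : e.source ⊆ U
  exterior : ∃ R : ℝ, 0 < R ∧ e.target = (Metric.closedBall 0 R)ᶜ ∧
    ∀ R' ≥ R, IsCompact (U \ e.symm '' (Metric.closedBall 0 R')ᶜ)
  decay : ∀ i j, IsBigODeriv (Bornology.cobounded (Euc n)) 4 (-τ)
    (fun y => comps h e y i j - (1 : Matrix (Fin n) (Fin n) ℝ) i j)

/-- The conformal metric `G^{4/(n-4)} g`. -/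
def conformalMetric (G : M → ℝ) (g : BilinField n M) : BilinField n M :=
  fun p => (G p ^ (4 / ((n : ℝ) - 4))) • g p

/-- `einf` is the inverted coordinate system `y = ς_n^{-2/(n-4)} x / |x|²` on the punctured
domain of the coordinates `x = e(p)` centred at `σ`. -/
def IsInvertedChart (e : OpenPartialHomeomorph M (Euc n)) (σ : M)
    (einf : OpenPartialHomeomorph M (Euc n)) : Prop :=
  einf.source = e.source \ {σ} ∧
    ∀ p ∈ e.source \ {σ},
      einf p = (varsigma n ^ (-2 / ((n : ℝ) - 4)) * (‖e p‖ ^ 2)⁻¹) • e p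

end Manifolds

end PaneitzMass

end

/-! The conclusion has three sources: conformal covariance, flatness of the metric at the pole, and
a flux computation at infinity.

Vanishing of Q. For ĝ = u^{4/(n-4)} g the Paneitz operator satisfies P_g u = (n-4)/2 · Q_ĝ
u^{(n+4)/(n-4)}. Off the pole the smooth function G solves P_g G = 0 weakly, hence classically
because P_g is formally self-adjoint; so Q_ĝ = 0. The covariance law `Formal.IsMetric.qc_conf` is a
purely algebraic consequence of the Leibniz rule, the contracted Bianchi identity and Bochner's
formula. It is proved over an arbitrary commutative real algebra with commuting derivations, where
no differentiability has to be checked, and then read in the algebra of smooth functions on an open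
set.

Flatness at the pole. In normal coordinates g_ij x_j = x_i (`IsNormalMetric.gauss`), and det g = 1
makes tr(g - δ) quadratic in g - δ (`IsNormalMetric.trace_vanishes`). The lowest Taylor part H of g
- δ is therefore symmetric, annihilates x and is trace-free. If the Weyl tensor vanishes in the
corresponding degree, the linearized curvature of H is a Kulkarni-Nomizu product B ∧ δ. Its Bianchi
identity is a Codazzi equation, so B is a multiple of the Hessian of f = B(x, x); tracing gives c f
= -|x|² Δf with c > 0, which forces f = 0, B = 0 and H = 0 (`eq_zero_of_linRiem_eq_knEuclid`).
Induction on the degree yields g - δ = O(|x|^{d+1}) (`IsNormalMetric.dev_vanishes`).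

Asymptotics. The derivative of the inversion is a scalar times a reflection in the radial direction,
and the reflection preserves g because g x = x. Hence ĝ_ij(y) = v^{4/(n-4)} g_ij(x) with v = 1 + ∑
ψ^{(k)}(x) + ς⁻¹ A |y|^{4-n} + O(|y|^{3-n}); the scale of the inversion is chosen to make the
leading constant 1. Both v - 1 and g(x) - δ are O(|y|^{-(d+1)}), and d + 1 > (n-4)/2.

Mass. Since 2(d+1) ≥ n - 3, everything quadratic in these quantities is O(|y|^{3-n}) and has no
flux. What is left is linear: a conformal part (1 + q u) δ with q = 4/(n-4), and h = g(x) - δ. The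
flux of a radial derivative of a divergence div X over a sphere depends only on the radial component
X·y (`sphereInt_radialDeriv_div`). For X = div h this component is -tr h, which is quadratic, so h
contributes nothing (`hasFlux_double_div`). For the conformal part the flux is (n-1) q times that of
Δu: the ψ^{(k)} drop out because they have mean zero on spheres, and Δ|y|^{4-n} has flux exactly ς_n
(`hasFlux_norm_rpow`), leaving 4(n-1)/(n-4) · A. -/

noncomputable section

namespace PaneitzMass

/-! ### Tensor calculus over a commutative ring with commuting derivations -/

namespace Formal

section Defs
variable {n : ℕ} {R : Type*} [CommRing R] [Algebra ℝ R] (D : Fin n → Derivation ℝ R R)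
  (g H : Fin n → Fin n → R)

/-- Christoffel symbols `Γ^k_ij`. -/
def chr (k i j : Fin n) : R :=
  algebraMap ℝ R (1 / 2) * ∑ l, H k l * (D i (g j l) + D j (g i l) - D l (g i j))

/-- The curvature `R_ijk^m`. -/
def riem (i j k m : Fin n) : R :=
  D i (chr D g H m j k) - D j (chr D g H m i k)
    + ∑ p, (chr D g H m i p * chr D g H p j k - chr D g H m j p * chr D g H p i k)

/-- The Ricci tensor. -/
def ric (j k : Fin n) : R := ∑ i, riem D g H i j k i

/-- The scalar curvature. -/
def scal : R := ∑ i, ∑ j, H i j * ric D g H i j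

/-- The Schouten tensor. -/
def sch (i j : Fin n) : R :=
  algebraMap ℝ R (1 / ((n : ℝ) - 2)) *
    (ric D g H i j - scal D g H * algebraMap ℝ R (1 / (2 * ((n : ℝ) - 1))) * g i j)

/-- The divergence of a vector field. -/
def dv (V : Fin n → R) : R := ∑ k, (D k (V k) + ∑ j, chr D g H j j k * V k)

/-- The gradient. -/
def grad (u : R) (k : Fin n) : R := ∑ l, H k l * D l u

/-- The Laplacian. -/
def lap (u : R) : R := dv D g H (grad D H u)

/-- The divergence of `T(∇u, ·)`. -/
def divTG (T : Fin n → Fin n → R) (u : R) : R :=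
  dv D g H fun k => ∑ i, ∑ j, ∑ l, H i k * H j l * T i j * D l u

/-- The trace of the Schouten tensor. -/
def sig1 : R := ∑ i, ∑ j, H i j * sch D g H i j

/-- The inner product of 2-tensors. -/
def ip (S T : Fin n → Fin n → R) : R :=
  ∑ i, ∑ j, ∑ k, ∑ l, H i k * H j l * S i j * T k l

/-- Branson's curvature. -/
def qc : R :=
  -lap D g H (sig1 D g H)
    + 4 * (algebraMap ℝ R (1 / 2) * (sig1 D g H ^ 2 - ip H (sch D g H) (sch D g H)))
    + algebraMap ℝ R (((n : ℝ) - 4) / 2) * sig1 D g H ^ 2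

/-- The Paneitz operator. -/
def pan (u : R) : R :=
  lap D g H (lap D g H u)
    + divTG D g H (fun i j => 4 * sch D g H i j
        - algebraMap ℝ R ((n : ℝ) - 2) * sig1 D g H * g i j) u
    + algebraMap ℝ R (((n : ℝ) - 4) / 2) * qc D g H * u

/-- The covariant derivative of a vector field. -/
def nabV (V : Fin n → R) (i k : Fin n) : R := D i (V k) + ∑ m, chr D g H k i m * V m

/-- The covariant derivative of a covector field. -/
def nabF (w : Fin n → R) (i j : Fin n) : R := D i (w j) - ∑ m, chr D g H m i j * w m

/-- The covariant derivative of a covariant 2-tensor field. -/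
def nabT (T : Fin n → Fin n → R) (i j k : Fin n) : R :=
  D i (T j k) - ∑ m, chr D g H m i j * T m k - ∑ m, chr D g H m i k * T j m

/-- The Hessian of a function. -/
def hess (u : R) (i j : Fin n) : R := nabF D g H (fun k => D k u) i j

/-- Commuting derivations, a symmetric form `g` and its inverse `H`. -/
structure IsMetric : Prop where
  comm : ∀ i j a, D i (D j a) = D j (D i a)
  g_symm : ∀ i j, g i j = g j i
  H_symm : ∀ i j, H i j = H j i
  Hg : ∀ i k, ∑ j, H i j * g j k = if i = k then 1 else 0

end Defs

section Lemmas
variable {n : ℕ} {R : Type*} [CommRing R] [Algebra ℝ R] {D : Fin n → Derivation ℝ R R}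
  {g H : Fin n → Fin n → R}

/-- `R` is not a field, so the constant 1/2 is the image of a real number, and divisions by two are
carried out through this relation. -/
lemma two_half : (2 : R) * algebraMap ℝ R (1 / 2) = 1 := by
  rw [← map_ofNat (algebraMap ℝ R) 2, ← map_mul]; norm_num

lemma der_mul (d : Derivation ℝ R R) (a b : R) : d (a * b) = d a * b + a * d b := by
  rw [d.leibniz]; simp only [smul_eq_mul]; ring

lemma der_C (d : Derivation ℝ R R) (r : ℝ) : d (algebraMap ℝ R r) = 0 := d.map_algebraMap r

lemma IsMetric.gH (h : IsMetric D g H) (i k : Fin n) : ∑ j, g i j * H j k = if i = k then 1 else 0 := by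
  rw [show (∑ j, g i j * H j k) = ∑ j, H k j * g j i from
    Finset.sum_congr rfl fun j _ => by rw [h.g_symm i j, h.H_symm j k]; ring, h.Hg]
  simp [eq_comm]

lemma IsMetric.g_lower (h : IsMetric D g H) (a : Fin n → R) (i : Fin n) :
    ∑ k, g i k * ∑ l, H k l * a l = a i := by
  simp_rw [Finset.mul_sum]
  rw [Finset.sum_comm]
  simp_rw [← mul_assoc, ← Finset.sum_mul, h.gH]
  simp

lemma IsMetric.chr_symm (h : IsMetric D g H) (k i j : Fin n) : chr D g H k i j = chr D g H k j i := by
  simp only [chr]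
  congr 1
  exact Finset.sum_congr rfl fun l _ => by rw [h.g_symm i j]; ring

lemma IsMetric.g_chr (h : IsMetric D g H) (l i j : Fin n) : ∑ m, g l m * chr D g H m i j =
    algebraMap ℝ R (1 / 2) * (D i (g j l) + D j (g i l) - D l (g i j)) := by
  simp only [chr]
  rw [show (∑ m, g l m * (algebraMap ℝ R (1 / 2) *
      ∑ p, H m p * (D i (g j p) + D j (g i p) - D p (g i j)))) =
    algebraMap ℝ R (1 / 2) * ∑ m, g l m * ∑ p, H m p * (D i (g j p) + D j (g i p) - D p (g i j))
    from by rw [Finset.mul_sum]; exact Finset.sum_congr rfl fun m _ => by ring]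
  rw [h.g_lower]

/-- Metric compatibility ∇g = 0: in the sum of the two lowered Christoffel symbols all derivatives
but one cancel. -/
lemma IsMetric.compat (h : IsMetric D g H) (i j l : Fin n) : D i (g j l) =
    ∑ m, chr D g H m i j * g m l + ∑ m, g j m * chr D g H m i l := by
  rw [show (∑ m, chr D g H m i j * g m l) = ∑ m, g l m * chr D g H m i j from
    Finset.sum_congr rfl fun m _ => by rw [h.g_symm m l]; ring, h.g_chr, h.g_chr,
    h.g_symm l j, h.g_symm i l]
  linear_combination (-D i (g j l)) * two_half (R := R)

/-- The Christoffel matrix `(Γ_i)^k_j`. -/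
def Gam (D : Fin n → Derivation ℝ R R) (g H : Fin n → Fin n → R) (i : Fin n) :
    Matrix (Fin n) (Fin n) R := Matrix.of fun k j => chr D g H k i j

/-- The curvature matrix `(R_ij)^m_k`. -/
def Rm (D : Fin n → Derivation ℝ R R) (g H : Fin n → Fin n → R) (i j : Fin n) :
    Matrix (Fin n) (Fin n) R := Matrix.of fun m k => riem D g H i j k m

/-- A derivation acts on matrices entrywise. -/
def DM (d : Derivation ℝ R R) (M : Matrix (Fin n) (Fin n) R) : Matrix (Fin n) (Fin n) R :=
  M.map d

lemma DM_mul (d : Derivation ℝ R R) (M N : Matrix (Fin n) (Fin n) R) :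
    DM d (M * N) = DM d M * N + M * DM d N := by
  ext i j
  simp only [DM, Matrix.map_apply, Matrix.mul_apply, Matrix.add_apply, map_sum, der_mul,
    Finset.sum_add_distrib]

lemma DM_add (d : Derivation ℝ R R) (M N : Matrix (Fin n) (Fin n) R) :
    DM d (M + N) = DM d M + DM d N := by
  ext i j; simp [DM]

lemma DM_sub (d : Derivation ℝ R R) (M N : Matrix (Fin n) (Fin n) R) :
    DM d (M - N) = DM d M - DM d N := by
  ext i j; simp [DM]

lemma DM_transpose (d : Derivation ℝ R R) (M : Matrix (Fin n) (Fin n) R) :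
    DM d M.transpose = (DM d M).transpose := by
  ext i j; simp [DM]

lemma IsMetric.DM_comm (h : IsMetric D g H) (i j : Fin n) (M : Matrix (Fin n) (Fin n) R) :
    DM (D i) (DM (D j) M) = DM (D j) (DM (D i) M) := by
  ext k l; simp [DM, h.comm i j]

lemma IsMetric.DM_g (h : IsMetric D g H) (i : Fin n) : DM (D i) (Matrix.of g) =
    (Gam D g H i).transpose * Matrix.of g + Matrix.of g * Gam D g H i := by
  ext j l
  simp only [DM, Matrix.map_apply, Matrix.of_apply, Matrix.add_apply, Matrix.mul_apply,
    Matrix.transpose_apply, Gam]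
  exact h.compat i j l

lemma IsMetric.Hg_mat (h : IsMetric D g H) :
    (Matrix.of H : Matrix (Fin n) (Fin n) R) * Matrix.of g = 1 := by
  ext i k; simp only [Matrix.mul_apply, Matrix.of_apply, h.Hg, Matrix.one_apply]

lemma IsMetric.gH_mat (h : IsMetric D g H) :
    (Matrix.of g : Matrix (Fin n) (Fin n) R) * Matrix.of H = 1 := by
  ext i k; simp only [Matrix.mul_apply, Matrix.of_apply, h.gH, Matrix.one_apply]

/-- Compatibility for the inverse metric, obtained by differentiating H g = 1 and multiplying by H
on the right. -/
lemma IsMetric.DM_H (h : IsMetric D g H) (i : Fin n) : DM (D i) (Matrix.of H) =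
    -(Gam D g H i * Matrix.of H) - Matrix.of H * (Gam D g H i).transpose := by
  have h1 := congrArg (DM (D i)) h.Hg_mat
  rw [DM_mul, h.DM_g] at h1
  have h0 : DM (D i) (1 : Matrix (Fin n) (Fin n) R) = 0 := by
    ext a b
    simp only [DM, Matrix.map_apply, Matrix.one_apply, Matrix.zero_apply]
    split_ifs <;> simp
  rw [h0] at h1
  have h2 := congrArg (· * (Matrix.of H : Matrix (Fin n) (Fin n) R)) h1
  simp only [add_mul, mul_add, zero_mul, Matrix.mul_assoc, h.gH_mat, Matrix.mul_one] at h2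
  rw [← Matrix.mul_assoc (Matrix.of H) (Matrix.of g), h.Hg_mat, Matrix.one_mul] at h2
  rw [← sub_eq_zero, ← h2]
  abel

lemma IsMetric.D_H (h : IsMetric D g H) (i j l : Fin n) : D i (H j l) =
    -(∑ m, chr D g H j i m * H m l) - ∑ m, H j m * chr D g H l i m := by
  have := congrFun (congrFun (h.DM_H i) j) l
  simpa only [DM, Matrix.map_apply, Matrix.of_apply, Matrix.sub_apply, Matrix.neg_apply,
    Matrix.mul_apply, Matrix.transpose_apply, Gam] using this

lemma Rm_eq (i j : Fin n) : Rm D g H i j = DM (D i) (Gam D g H j) - DM (D j) (Gam D g H i)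
    + (Gam D g H i * Gam D g H j - Gam D g H j * Gam D g H i) := by
  ext m k
  simp only [Rm, riem, DM, Gam, Matrix.of_apply, Matrix.add_apply, Matrix.sub_apply,
    Matrix.map_apply, Matrix.mul_apply, Finset.sum_sub_distrib]

/-- Expanding ∂_i ∂_j g = ∂_j ∂_i g twice through ∇g = 0 leaves exactly this relation: curvature is
skew in its last two indices because the derivations commute on `g`. -/
lemma IsMetric.Rm_antisymm (h : IsMetric D g H) (i j : Fin n) :
    Matrix.of g * Rm D g H i j + (Rm D g H i j).transpose * Matrix.of g = 0 := by
  have h1 := h.DM_comm i j (Matrix.of g)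
  simp only [h.DM_g, DM_add, DM_mul, DM_transpose, add_mul, mul_add, Matrix.mul_assoc] at h1
  rw [← sub_eq_zero] at h1
  rw [Rm_eq]
  simp only [Matrix.transpose_add, Matrix.transpose_sub, Matrix.transpose_mul, mul_add, add_mul,
    mul_sub, sub_mul, Matrix.mul_assoc]
  rw [← h1]
  abel

/-- The curvature `R_ij^{mk}` with the last index raised. -/
def RmH (D : Fin n → Derivation ℝ R R) (g H : Fin n → Fin n → R) (i j : Fin n) :
    Matrix (Fin n) (Fin n) R := Rm D g H i j * Matrix.of H

lemma IsMetric.H_transpose (h : IsMetric D g H) :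
    (Matrix.of H : Matrix (Fin n) (Fin n) R).transpose = Matrix.of H := by
  ext i j; exact h.H_symm j i

lemma IsMetric.RmH_transpose (h : IsMetric D g H) (i j : Fin n) :
    (RmH D g H i j).transpose = -RmH D g H i j := by
  have h1 := congrArg (fun M => Matrix.of H * M * Matrix.of H) (h.Rm_antisymm i j)
  simp only [mul_add, add_mul, mul_zero, zero_mul, Matrix.mul_assoc, h.gH_mat, mul_one] at h1
  rw [← Matrix.mul_assoc (Matrix.of H) (Matrix.of g), h.Hg_mat, Matrix.one_mul] at h1
  rw [RmH, Matrix.transpose_mul, h.H_transpose]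
  exact eq_neg_of_add_eq_zero_right h1

lemma IsMetric.RmH_antisymm (h : IsMetric D g H) (i j k l : Fin n) :
    RmH D g H i j k l = -RmH D g H i j l k := by
  have := congrFun (congrFun (h.RmH_transpose i j) l) k
  simpa using this

lemma Rm_swap (i j : Fin n) : Rm D g H i j = -Rm D g H j i := by
  rw [Rm_eq, Rm_eq]; abel

lemma RmH_swap (i j : Fin n) : RmH D g H i j = -RmH D g H j i := by
  rw [RmH, Rm_swap, neg_mul, RmH]

/-- The second Bianchi identity, with one index raised. -/
lemma IsMetric.bianchi (h : IsMetric D g H) (m i j : Fin n) :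
    (DM (D m) (RmH D g H i j) + Gam D g H m * RmH D g H i j
        + RmH D g H i j * (Gam D g H m).transpose)
      + (DM (D i) (RmH D g H j m) + Gam D g H i * RmH D g H j m
        + RmH D g H j m * (Gam D g H i).transpose)
      + (DM (D j) (RmH D g H m i) + Gam D g H j * RmH D g H m i
        + RmH D g H m i * (Gam D g H j).transpose) = 0 := by
  -- Raising an index commutes with ∇, so the corrections collapse to the commutator [Γ_m, R_ij].
  -- The cyclic sum then vanishes by the Jacobi identity for matrices and the commutation of the
  -- derivations.
  have key : ∀ m i j : Fin n, DM (D m) (RmH D g H i j) + Gam D g H m * RmH D g H i j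
        + RmH D g H i j * (Gam D g H m).transpose =
      (DM (D m) (Rm D g H i j) + Gam D g H m * Rm D g H i j
        - Rm D g H i j * Gam D g H m) * Matrix.of H := by
    intro m i j
    rw [RmH, DM_mul, h.DM_H]
    simp only [mul_sub, mul_neg, add_mul, sub_mul, Matrix.mul_assoc]
    abel
  rw [key, key, key, ← add_mul, ← add_mul]
  convert zero_mul _
  simp only [Rm_eq, DM_add, DM_sub, DM_mul, mul_add, add_mul, mul_sub, sub_mul]
  rw [h.DM_comm m i, h.DM_comm m j, h.DM_comm i j]
  simp only [Matrix.mul_assoc]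
  abel

/-- The mixed Ricci tensor. -/
def ricUp (D : Fin n → Derivation ℝ R R) (g H : Fin n → Fin n → R) (j k : Fin n) : R :=
  ∑ l, ric D g H j l * H l k

lemma RmH_apply (i j m k : Fin n) :
    RmH D g H i j m k = ∑ l, riem D g H i j l m * H l k := by
  simp only [RmH, Matrix.mul_apply, Rm, Matrix.of_apply]

lemma sum_RmH (j k : Fin n) : ∑ i, RmH D g H i j i k = ricUp D g H j k := by
  simp only [RmH_apply, ricUp, ric, Finset.sum_mul]
  exact Finset.sum_comm

lemma IsMetric.sum_RmH' (h : IsMetric D g H) (j k : Fin n) :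
    ∑ i, RmH D g H j i k i = ricUp D g H j k := by
  rw [← sum_RmH]
  refine Finset.sum_congr rfl fun i _ => ?_
  rw [h.RmH_antisymm, RmH_swap]; simp

lemma IsMetric.sum_ricUp (h : IsMetric D g H) : ∑ j, ricUp D g H j j = scal D g H := by
  simp only [ricUp, scal]
  refine Finset.sum_congr rfl fun j _ => Finset.sum_congr rfl fun l _ => ?_
  rw [h.H_symm]; ring

lemma sum_symm_antisymm {f : Fin n → Fin n → R} (hf : ∀ i j, f i j = -f j i) :
    ∑ i, ∑ j, f i j = 0 := by
  have h1 : ∑ i, ∑ j, f i j = -∑ i, ∑ j, f i j := by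
    conv_lhs => rw [Finset.sum_comm]
    simp only [← Finset.sum_neg_distrib]
    exact Finset.sum_congr rfl fun i _ => Finset.sum_congr rfl fun j _ => hf j i
  linear_combination algebraMap ℝ R (1 / 2) * h1
    - (∑ i, ∑ j, f i j) * two_half (R := R)

/-- The contracted second Bianchi identity. -/
lemma IsMetric.contracted_bianchi (h : IsMetric D g H) (j : Fin n) :
    2 * (∑ m, (D m (ricUp D g H j m) + ∑ p, chr D g H m m p * ricUp D g H j p
      - ∑ p, chr D g H p j m * ricUp D g H p m)) = D j (scal D g H) := by
  -- Double trace of the Bianchi identity. The first two cyclic terms give the divergence of Ricci,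
  -- the third gives -∂_j of the scalar curvature and the remaining Christoffel correction; a
  -- symmetric Γ against a skew curvature contributes nothing.
  have hb : ∑ i, ∑ m, ((DM (D m) (RmH D g H i j) + Gam D g H m * RmH D g H i j
        + RmH D g H i j * (Gam D g H m).transpose)
      + (DM (D i) (RmH D g H j m) + Gam D g H i * RmH D g H j m
        + RmH D g H j m * (Gam D g H i).transpose)
      + (DM (D j) (RmH D g H m i) + Gam D g H j * RmH D g H m i
        + RmH D g H m i * (Gam D g H j).transpose)) i m = 0 := by
    simp only [h.bianchi, Matrix.zero_apply, Finset.sum_const_zero]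
  simp only [Matrix.add_apply, DM, Matrix.map_apply, Matrix.mul_apply, Matrix.transpose_apply,
    Gam, Matrix.of_apply, Finset.sum_add_distrib] at hb
  have t1 : ∑ i, ∑ m, D m (RmH D g H i j i m) = ∑ m, D m (ricUp D g H j m) := by
    rw [Finset.sum_comm]; simp only [← map_sum, sum_RmH]
  have t2 : ∑ i, ∑ m, ∑ p, chr D g H i m p * RmH D g H i j p m = 0 := by
    rw [show (0 : R) = ∑ i : Fin n, 0 by simp]
    refine Finset.sum_congr rfl fun i _ => sum_symm_antisymm fun m p => ?_
    rw [h.chr_symm i p m, h.RmH_antisymm i j m p]; ring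
  have t3 : ∑ i, ∑ m, ∑ p, RmH D g H i j i p * chr D g H m m p =
      ∑ m, ∑ p, chr D g H m m p * ricUp D g H j p := by
    rw [Finset.sum_comm]
    refine Finset.sum_congr rfl fun m _ => ?_
    rw [Finset.sum_comm]
    refine Finset.sum_congr rfl fun p _ => ?_
    rw [← Finset.sum_mul, sum_RmH]; ring
  have t4 : ∑ i, ∑ m, D i (RmH D g H j m i m) = ∑ m, D m (ricUp D g H j m) := by
    simp only [← map_sum, h.sum_RmH']
  have t5 : ∑ i, ∑ m, ∑ p, chr D g H i i p * RmH D g H j m p m =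
      ∑ m, ∑ p, chr D g H m m p * ricUp D g H j p := by
    refine Finset.sum_congr rfl fun i _ => ?_
    rw [Finset.sum_comm]
    refine Finset.sum_congr rfl fun p _ => ?_
    rw [← Finset.mul_sum, h.sum_RmH']
  have t6 : ∑ i, ∑ m, ∑ p, RmH D g H j m i p * chr D g H m i p = 0 := by
    rw [Finset.sum_comm, show (0 : R) = ∑ i : Fin n, 0 by simp]
    refine Finset.sum_congr rfl fun i _ => sum_symm_antisymm fun m p => ?_
    rw [h.chr_symm i p m, h.RmH_antisymm _ _ m p]; ring
  have e7 : ∀ m p, ∑ i, RmH D g H m i i p = -ricUp D g H m p := by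
    intro m p
    rw [← sum_RmH, ← Finset.sum_neg_distrib]
    exact Finset.sum_congr rfl fun i _ => by rw [RmH_swap]; simp
  have e8 : ∀ i p, ∑ m, RmH D g H m i p m = -ricUp D g H i p := by
    intro i p
    rw [← h.sum_RmH', ← Finset.sum_neg_distrib]
    exact Finset.sum_congr rfl fun m _ => by rw [RmH_swap]; simp
  have t7 : ∑ i, ∑ m, D j (RmH D g H m i i m) = -D j (scal D g H) := by
    rw [Finset.sum_comm]
    simp only [← map_sum, e7, Finset.sum_neg_distrib, h.sum_ricUp, map_neg]
  have t8 : ∑ i, ∑ m, ∑ p, chr D g H i j p * RmH D g H m i p m =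
      -∑ m, ∑ p, chr D g H p j m * ricUp D g H p m := by
    simp only [← Finset.sum_neg_distrib]
    rw [Finset.sum_congr rfl fun i _ => Finset.sum_comm]
    rw [Finset.sum_comm]
    refine Finset.sum_congr rfl fun m _ => Finset.sum_congr rfl fun p _ => ?_
    rw [← Finset.mul_sum, e8]; ring
  have t9 : ∑ i, ∑ m, ∑ p, RmH D g H m i i p * chr D g H m j p =
      -∑ m, ∑ p, chr D g H p j m * ricUp D g H p m := by
    simp only [← Finset.sum_neg_distrib]
    rw [Finset.sum_comm, Finset.sum_congr rfl fun i _ => Finset.sum_comm, Finset.sum_comm]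
    refine Finset.sum_congr rfl fun m _ => Finset.sum_congr rfl fun p _ => ?_
    rw [← Finset.sum_mul, e7]; ring
  rw [t1, t2, t3, t4, t5, t6, t7, t8, t9] at hb
  simp only [Finset.sum_add_distrib, Finset.sum_sub_distrib]
  linear_combination hb

end Lemmas
end Formal

/-! ### Covariant derivatives, the Ricci identity and Bochner's formula. -/

namespace Formal
section Calculus
variable {n : ℕ} {R : Type*} [CommRing R] [Algebra ℝ R] {D : Fin n → Derivation ℝ R R}
  {g H : Fin n → Fin n → R}

/-- The one term of Ricci that is not visibly symmetric is ∂_j Γ^i_ik. Its antisymmetrization in j,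
k is the trace of the curvature matrix R_jk, which is zero because that matrix is skew with respect
to `g`. -/
lemma IsMetric.ric_symm (h : IsMetric D g H) (j k : Fin n) : ric D g H j k = ric D g H k j := by
  have h1 : ∑ i, Rm D g H j k i i = 0 := by
    have h2 := congrArg (fun M => Matrix.trace (Matrix.of H * M)) (h.Rm_antisymm j k)
    simp only [mul_add, Matrix.trace_add, mul_zero, Matrix.trace_zero] at h2
    rw [← Matrix.mul_assoc, h.Hg_mat, Matrix.one_mul, ← Matrix.mul_assoc, Matrix.trace_mul_comm,
      ← Matrix.mul_assoc, h.gH_mat, Matrix.one_mul, Matrix.trace_transpose] at h2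
    have h3 : Matrix.trace (Rm D g H j k) = 0 := by
      linear_combination algebraMap ℝ R (1 / 2) * h2
        - Matrix.trace (Rm D g H j k) * two_half (R := R)
    exact h3
  simp only [Rm, Matrix.of_apply, riem, Finset.sum_add_distrib, Finset.sum_sub_distrib] at h1
  rw [Finset.sum_comm (f := fun i p => chr D g H i j p * chr D g H p k i)] at h1
  rw [show (∑ y, ∑ x, chr D g H x j y * chr D g H y k x) =
    ∑ y, ∑ x, chr D g H y k x * chr D g H x j y from
    Finset.sum_congr rfl fun y _ => Finset.sum_congr rfl fun x _ => mul_comm _ _] at h1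
  simp only [ric, riem, Finset.sum_add_distrib, Finset.sum_sub_distrib]
  rw [Finset.sum_comm (f := fun i p => chr D g H i j p * chr D g H p i k)]
  have e1 : ∀ a b c, chr D g H a b c = chr D g H a c b := h.chr_symm
  have e2 : ∑ y, ∑ x, chr D g H x j y * chr D g H y x k =
      ∑ x, ∑ i, chr D g H x k i * chr D g H i x j :=
    Finset.sum_congr rfl fun y _ => Finset.sum_congr rfl fun x _ => by
      rw [e1 y x k, e1 x j y]; ring
  have e3 : ∀ x, D x (chr D g H x j k) = D x (chr D g H x k j) := fun x => by rw [e1]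
  have e4 : ∀ x p, chr D g H x x p * chr D g H p j k = chr D g H x x p * chr D g H p k j :=
    fun x p => by rw [e1 p]
  have e5 : ∀ x, D j (chr D g H x x k) = D j (chr D g H x k x) := fun x => by rw [e1 x x k]
  have e6 : ∀ x, D k (chr D g H x x j) = D k (chr D g H x j x) := fun x => by rw [e1 x x j]
  simp only [e2, e3, e4, e5, e6]
  linear_combination -h1

lemma dv_eq (V : Fin n → R) : dv D g H V = ∑ k, nabV D g H V k k := by
  simp only [dv, nabV, Finset.sum_add_distrib]
  rw [Finset.sum_comm]

/-- Covariant differentiation commutes with raising an index, by `D_H`; this reduces statements on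
gradients to statements on Hessians. -/
lemma IsMetric.nabV_raise (h : IsMetric D g H) (w : Fin n → R) (i k : Fin n) :
    nabV D g H (fun k => ∑ l, H k l * w l) i k = ∑ l, H k l * nabF D g H w i l := by
  simp only [nabV, nabF, map_sum, der_mul, h.D_H i k, mul_sub, Finset.sum_add_distrib,
    Finset.sum_sub_distrib, sub_mul, neg_mul, Finset.sum_mul, Finset.mul_sum, Finset.sum_neg_distrib]
  rw [Finset.sum_comm (f := fun m l => chr D g H k i m * (H m l * w l)),
    Finset.sum_comm (f := fun l m => H k l * (chr D g H m i l * w m))]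
  simp only [mul_assoc]
  ring

lemma der_pair (V w : Fin n → R) (i : Fin n) :
    D i (∑ j, V j * w j) = ∑ j, nabV D g H V i j * w j + ∑ j, V j * nabF D g H w i j := by
  simp only [nabV, nabF, map_sum, der_mul, mul_sub, Finset.sum_add_distrib,
    Finset.sum_sub_distrib, add_mul, Finset.sum_mul, Finset.mul_sum]
  rw [Finset.sum_comm (f := fun m l => chr D g H m i l * V l * w m)]
  simp only [mul_assoc, mul_left_comm (V _)]
  ring

lemma nabF_contract (T : Fin n → Fin n → R) (V : Fin n → R) (i j : Fin n) :
    nabF D g H (fun j => ∑ k, T j k * V k) i j =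
      ∑ k, nabT D g H T i j k * V k + ∑ k, T j k * nabV D g H V i k := by
  simp only [nabV, nabF, nabT, map_sum, der_mul, mul_add, Finset.sum_add_distrib,
    Finset.sum_sub_distrib, sub_mul, Finset.sum_mul, Finset.mul_sum]
  rw [Finset.sum_comm (f := fun k m => chr D g H m i k * T j m * V k),
    Finset.sum_comm (f := fun k m => chr D g H m i j * T m k * V k)]
  simp only [mul_assoc, mul_left_comm (T _ _)]
  ring

lemma IsMetric.hess_symm (h : IsMetric D g H) (u : R) (i j : Fin n) :
    hess D g H u i j = hess D g H u j i := by
  simp only [hess, nabF, h.comm i j, h.chr_symm _ i j]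

/-- The Ricci identity for covector fields. -/
lemma IsMetric.ricci_identity (h : IsMetric D g H) (w : Fin n → R) (i j k : Fin n) :
    nabT D g H (nabF D g H w) i j k - nabT D g H (nabF D g H w) j i k =
      -∑ m, riem D g H i j k m * w m := by
  simp only [nabF, nabT, riem, map_sum, map_sub, der_mul, mul_sub, sub_mul, add_mul,
    Finset.sum_add_distrib, Finset.sum_sub_distrib, Finset.sum_mul, Finset.mul_sum, h.comm i j,
    h.chr_symm _ i j]
  rw [Finset.sum_comm (f := fun x y => chr D g H x i k * (chr D g H y j x * w y)),
    Finset.sum_comm (f := fun x y => chr D g H x j k * (chr D g H y i x * w y))]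
  simp only [mul_comm (chr D g H _ i k), mul_comm (chr D g H _ j k), mul_assoc]
  simp only [mul_comm (w _)]
  ring

/-- The trace of a covariant 2-tensor. -/
def tr (H : Fin n → Fin n → R) (T : Fin n → Fin n → R) : R := ∑ i, ∑ k, H i k * T i k

lemma IsMetric.der_tr (h : IsMetric D g H) (T : Fin n → Fin n → R) (l : Fin n) :
    D l (tr H T) = ∑ i, ∑ k, H i k * nabT D g H T l i k := by
  simp only [tr, nabT, map_sum, der_mul, h.D_H l, mul_sub, sub_mul, Finset.sum_add_distrib,
    Finset.sum_sub_distrib, neg_mul, Finset.sum_mul, Finset.mul_sum, Finset.sum_neg_distrib]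
  have e1 : ∑ i, ∑ k, ∑ m, chr D g H i l m * H m k * T i k =
      ∑ i, ∑ k, ∑ m, H i k * (chr D g H m l i * T m k) := by
    rw [Finset.sum_congr rfl fun i _ => Finset.sum_comm, Finset.sum_comm,
      Finset.sum_congr rfl fun i _ => Finset.sum_comm]
    exact Finset.sum_congr rfl fun _ _ => Finset.sum_congr rfl fun _ _ =>
      Finset.sum_congr rfl fun _ _ => by ring
  have e2 : ∑ i, ∑ k, ∑ m, H i m * chr D g H k l m * T i k =
      ∑ i, ∑ k, ∑ m, H i k * (chr D g H m l k * T i m) := by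
    refine Finset.sum_congr rfl fun i _ => ?_
    rw [Finset.sum_comm]
    exact Finset.sum_congr rfl fun _ _ => Finset.sum_congr rfl fun _ _ => by ring
  rw [e1, e2]
  ring

lemma IsMetric.lap_eq (h : IsMetric D g H) (u : R) :
    lap D g H u = tr H (hess D g H u) := by
  have : grad D H u = fun k => ∑ l, H k l * (fun l => D l u) l := rfl
  simp only [lap, dv_eq, this, h.nabV_raise, tr, hess]

lemma IsMetric.riem_trace (h : IsMetric D g H) (l m : Fin n) :
    ∑ i, ∑ k, H i k * riem D g H i l k m = -ricUp D g H l m := by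
  rw [← h.sum_RmH', ← Finset.sum_neg_distrib]
  refine Finset.sum_congr rfl fun i _ => ?_
  rw [RmH_swap l i, Matrix.neg_apply, neg_neg, RmH_apply]
  exact Finset.sum_congr rfl fun k _ => by rw [h.H_symm i k, mul_comm]

/-- `⟨∇u, ∇v⟩`. -/
def gip (D : Fin n → Derivation ℝ R R) (H : Fin n → Fin n → R) (u v : R) : R :=
  ∑ k, grad D H u k * D k v

lemma IsMetric.gip_comm (h : IsMetric D g H) (u v : R) : gip D H u v = gip D H v u := by
  simp only [gip, grad, Finset.sum_mul]
  rw [Finset.sum_comm]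
  exact Finset.sum_congr rfl fun _ _ => Finset.sum_congr rfl fun _ _ => by
    rw [h.H_symm]; ring

lemma IsMetric.der_gip_self (h : IsMetric D g H) (u : R) (k : Fin n) :
    D k (gip D H u u) = 2 * ∑ l, hess D g H u k l * grad D H u l := by
  have hg : grad D H u = fun k => ∑ l, H k l * (fun l => D l u) l := rfl
  rw [gip, der_pair (g := g) (H := H)]
  have : ∑ j, nabV D g H (grad D H u) k j * D j u =
      ∑ j, grad D H u j * nabF D g H (fun k => D k u) k j := by
    rw [hg]
    simp only [h.nabV_raise, Finset.sum_mul]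
    rw [Finset.sum_comm]
    exact Finset.sum_congr rfl fun _ _ => Finset.sum_congr rfl fun _ _ => by
      rw [h.H_symm]; ring
  rw [this, two_mul]
  congr 1 <;> exact Finset.sum_congr rfl fun l _ => by rw [hess, mul_comm]

/-- Bochner's formula. -/
lemma IsMetric.bochner (h : IsMetric D g H) (u : R) :
    lap D g H (gip D H u u) = 2 * (ip H (hess D g H u) (hess D g H u)
      + gip D H u (lap D g H u)
      + ∑ l, ∑ m, ric D g H l m * grad D H u l * grad D H u m) := by
  have hg : grad D H u = fun k => ∑ l, H k l * (fun l => D l u) l := rfl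
  rw [h.lap_eq]
  have h1 : ∀ i k, hess D g H (gip D H u u) i k =
      2 * (∑ l, nabT D g H (hess D g H u) i k l * grad D H u l
        + ∑ l, hess D g H u k l * ∑ m, H l m * hess D g H u i m) := by
    intro i k
    have h2 : (fun k => D k (gip D H u u)) =
        fun k => ∑ l, (fun a b => 2 * hess D g H u a b) k l * grad D H u l := by
      funext k
      rw [h.der_gip_self, Finset.mul_sum]
      exact Finset.sum_congr rfl fun _ _ => by ring
    rw [hess, h2, nabF_contract, mul_add, Finset.mul_sum, Finset.mul_sum]
    congr 1
    · refine Finset.sum_congr rfl fun l _ => ?_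
      have h2 : D i (2 : R) = 0 := by
        have := (D i).map_natCast 2; simpa using this
      simp only [nabT, der_mul, h2, mul_left_comm _ (2 : R), ← Finset.mul_sum]
      ring
    · refine Finset.sum_congr rfl fun l _ => ?_
      have : nabV D g H (grad D H u) i l = ∑ m, H l m * hess D g H u i m := by
        rw [hg, h.nabV_raise]; rfl
      rw [this]; ring
  -- The Ricci identity moves the free index l of the third derivative to the outside, so that the
  -- trace over i, k can be taken under ∂_l; the price is one curvature term, whose trace is Ricci.
  have h3 : ∀ i k l, nabT D g H (hess D g H u) i k l =
      nabT D g H (hess D g H u) l i k - ∑ m, riem D g H i l k m * D m u := by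
    intro i k l
    have hs : ∀ a b c, nabT D g H (hess D g H u) a b c = nabT D g H (hess D g H u) a c b := by
      intro a b c
      have e : ∀ x y, hess D g H u x y = hess D g H u y x := h.hess_symm u
      simp only [nabT]
      rw [e b c, Finset.sum_congr rfl fun m _ => by rw [e m c],
        Finset.sum_congr (s₁ := Finset.univ) (f := fun m => chr D g H m a c * _) rfl
          fun m _ => by rw [e b m]]
      ring
    have := h.ricci_identity (fun k => D k u) i l k
    rw [hs i k l]
    have hh : hess D g H u = nabF D g H (fun k => D k u) := rfl
    rw [hh]
    linear_combination this
  have h4 : ∀ l, ∑ i, ∑ k, H i k * nabT D g H (hess D g H u) i k l =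
      D l (lap D g H u) + ∑ m, ric D g H l m * grad D H u m := by
    intro l
    rw [h.lap_eq, h.der_tr]
    rw [Finset.sum_congr rfl fun i _ => Finset.sum_congr rfl fun k _ => by rw [h3 i k l, mul_sub]]
    simp only [Finset.sum_sub_distrib]
    have : ∑ i, ∑ k, H i k * ∑ m, riem D g H i l k m * D m u =
        ∑ m, (∑ i, ∑ k, H i k * riem D g H i l k m) * D m u := by
      simp only [Finset.mul_sum, Finset.sum_mul]
      rw [Finset.sum_congr rfl fun i _ => Finset.sum_comm, Finset.sum_comm]
      simp only [mul_assoc]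
    rw [this]
    simp only [h.riem_trace, ricUp, grad, Finset.mul_sum, neg_mul, Finset.sum_neg_distrib,
      Finset.sum_mul]
    rw [Finset.sum_comm (f := fun m l_1 => ric D g H l l_1 * H l_1 m * D m u)]
    simp only [mul_assoc]
    ring
  simp only [tr, h1]
  have h5 : ∑ i, ∑ k, H i k * (2 * (∑ l, nabT D g H (hess D g H u) i k l * grad D H u l
        + ∑ l, hess D g H u k l * ∑ m, H l m * hess D g H u i m)) =
      2 * (∑ l, (∑ i, ∑ k, H i k * nabT D g H (hess D g H u) i k l) * grad D H u l
        + ∑ i, ∑ k, H i k * ∑ l, hess D g H u k l * ∑ m, H l m * hess D g H u i m) := by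
    simp only [mul_add, Finset.sum_add_distrib, Finset.mul_sum, Finset.sum_mul]
    congr 1
    · rw [Finset.sum_congr rfl fun i _ => Finset.sum_comm, Finset.sum_comm]
      exact Finset.sum_congr rfl fun _ _ => Finset.sum_congr rfl fun _ _ =>
        Finset.sum_congr rfl fun _ _ => by ring
    · exact Finset.sum_congr rfl fun _ _ => Finset.sum_congr rfl fun _ _ =>
        Finset.sum_congr rfl fun _ _ => Finset.sum_congr rfl fun _ _ => by ring
  rw [h5]
  simp only [h4]
  have h6 : ∑ i, ∑ k, H i k * ∑ l, hess D g H u k l * ∑ m, H l m * hess D g H u i m =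
      ip H (hess D g H u) (hess D g H u) := by
    simp only [ip, Finset.mul_sum]
    refine Finset.sum_congr rfl fun i _ => ?_
    rw [Finset.sum_congr rfl fun k _ => Finset.sum_comm, Finset.sum_comm]
    exact Finset.sum_congr rfl fun m _ => Finset.sum_congr rfl fun k _ =>
        Finset.sum_congr rfl fun l _ => by rw [h.H_symm l m]; ring
  rw [h6]
  have h7 : ∑ l, (D l (lap D g H u) + ∑ m, ric D g H l m * grad D H u m) * grad D H u l =
      gip D H u (lap D g H u) + ∑ l, ∑ m, ric D g H l m * grad D H u l * grad D H u m := by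
    simp only [add_mul, Finset.sum_add_distrib, gip, Finset.sum_mul]
    congr 1
    · exact Finset.sum_congr rfl fun _ _ => by ring
    · exact Finset.sum_congr rfl fun _ _ => Finset.sum_congr rfl fun _ _ => by ring
  rw [h7]
  ring

lemma dv_mul (f : R) (V : Fin n → R) :
    dv D g H (fun k => f * V k) = f * dv D g H V + ∑ k, V k * D k f := by
  simp only [dv, der_mul, Finset.mul_sum, mul_add, Finset.sum_add_distrib]
  simp only [mul_left_comm f, mul_comm (D _ f)]
  ring

lemma dv_sub (V W : Fin n → R) :
    dv D g H (fun k => V k - W k) = dv D g H V - dv D g H W := by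
  simp only [dv, map_sub, mul_sub, Finset.sum_sub_distrib, Finset.sum_add_distrib]
  ring

lemma dv_add (V W : Fin n → R) :
    dv D g H (fun k => V k + W k) = dv D g H V + dv D g H W := by
  simp only [dv, map_add, mul_add, Finset.sum_add_distrib]
  ring

lemma dv_C (r : ℝ) (V : Fin n → R) :
    dv D g H (fun k => algebraMap ℝ R r * V k) = algebraMap ℝ R r * dv D g H V := by
  rw [dv_mul]; simp

lemma lap_add (u v : R) : lap D g H (u + v) = lap D g H u + lap D g H v := by
  rw [lap, lap, lap, ← dv_add]
  congr 1; funext k; simp [grad, mul_add, Finset.sum_add_distrib]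

lemma lap_C (r : ℝ) (u : R) :
    lap D g H (algebraMap ℝ R r * u) = algebraMap ℝ R r * lap D g H u := by
  rw [lap, lap, ← dv_C]
  congr 1; funext k
  simp only [grad, der_mul, der_C, zero_mul, zero_add, Finset.mul_sum]
  exact Finset.sum_congr rfl fun _ _ => by ring

lemma IsMetric.lap_mul (h : IsMetric D g H) (u v : R) :
    lap D g H (u * v) = u * lap D g H v + 2 * gip D H u v + v * lap D g H u := by
  have : grad D H (u * v) = fun k => u * grad D H v k + v * grad D H u k := by
    funext k
    simp only [grad, der_mul, mul_add, Finset.mul_sum, Finset.sum_add_distrib]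
    rw [add_comm]
    congr 1 <;> exact Finset.sum_congr rfl fun _ _ => by ring
  rw [lap, this, dv_add, dv_mul, dv_mul, lap, lap]
  have e := h.gip_comm u v
  simp only [gip] at e ⊢
  linear_combination -e

/-- The divergence of the Ricci tensor applied to a gradient. -/
lemma IsMetric.divTG_ric (h : IsMetric D g H) (u : R) :
    2 * divTG D g H (ric D g H) u =
      gip D H u (scal D g H) + 2 * ip H (ric D g H) (hess D g H u) := by
  have hg : grad D H u = fun k => ∑ l, H k l * (fun l => D l u) l := rfl
  have h1 : (fun k => ∑ i, ∑ j, ∑ l, H i k * H j l * ric D g H i j * D l u) =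
      fun k => ∑ j, ricUp D g H j k * grad D H u j := by
    funext k
    simp only [ricUp, grad, Finset.mul_sum, Finset.sum_mul]
    rw [Finset.sum_comm]
    refine Finset.sum_congr rfl fun j _ => ?_
    rw [Finset.sum_comm]
    exact Finset.sum_congr rfl fun l _ => Finset.sum_congr rfl fun i _ => by
      rw [h.ric_symm j i]; ring
  -- Leibniz rule: the derivative falls either on Ricci, where the contracted Bianchi identity
  -- produces half of the differential of the scalar curvature, or on ∇u, where it produces the
  -- Hessian.
  have h2 : dv D g H (fun k => ∑ j, ricUp D g H j k * grad D H u j) =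
      ∑ j, (∑ m, (D m (ricUp D g H j m) + ∑ p, chr D g H m m p * ricUp D g H j p
        - ∑ p, chr D g H p j m * ricUp D g H p m)) * grad D H u j
      + ∑ k, ∑ j, ricUp D g H j k * nabV D g H (grad D H u) k j := by
    simp only [dv_eq, nabV, map_sum, der_mul, Finset.sum_mul, Finset.mul_sum, mul_add, add_mul,
      sub_mul, Finset.sum_add_distrib, Finset.sum_sub_distrib]
    have e1 : ∑ x, ∑ i, ∑ i_1, chr D g H x x i * (ricUp D g H i_1 i * grad D H u i_1) =
        ∑ x, ∑ x_1, ∑ i, chr D g H x_1 x_1 i * ricUp D g H x i * grad D H u x := by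
      rw [Finset.sum_congr rfl fun i _ => Finset.sum_comm, Finset.sum_comm]
      simp only [mul_assoc]
    have e2 : ∑ x, ∑ x_1, ∑ i, chr D g H i x x_1 * ricUp D g H i x_1 * grad D H u x =
        ∑ x, ∑ x_1, ∑ i, ricUp D g H x_1 x * (chr D g H x_1 x i * grad D H u i) := by
      rw [Finset.sum_comm]
      refine Finset.sum_congr rfl fun k _ => ?_
      rw [Finset.sum_comm]
      exact Finset.sum_congr rfl fun i _ => Finset.sum_congr rfl fun j _ => by
        rw [h.chr_symm i j k]; ring
    rw [e1, e2, Finset.sum_comm (f := fun x i => D x (ricUp D g H i x) * grad D H u i)]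
    ring
  rw [divTG, h1, h2, mul_add]
  congr 1
  · simp only [gip, Finset.mul_sum (a := (2 : R))]
    exact Finset.sum_congr rfl fun j _ => by
      rw [← h.contracted_bianchi j]; ring
  · congr 1
    have e3 : ∀ (a b : Fin n → Fin n → Fin n → R), ∑ k, ∑ j, (∑ l, a j l k) * ∑ m, b j m k =
        ∑ j, ∑ l, ∑ m, ∑ k, a j l k * b j m k := by
      intro a b
      simp only [Finset.sum_mul_sum]
      rw [Finset.sum_comm]
      refine Finset.sum_congr rfl fun j _ => ?_
      rw [Finset.sum_comm]
      exact Finset.sum_congr rfl fun l _ => Finset.sum_comm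
    simp only [hg, h.nabV_raise, ricUp]
    rw [e3 (fun j l k => ric D g H j l * H l k)
      (fun j m k => H j m * nabF D g H (fun l => D l u) k m), ip]
    exact Finset.sum_congr rfl fun j _ => Finset.sum_congr rfl fun l _ =>
      Finset.sum_congr rfl fun m _ => Finset.sum_congr rfl fun k _ => by
        rw [h.hess_symm u m k, hess]; ring

/-- The divergence of `(f g)(∇u, ·)`. -/
lemma IsMetric.divTG_metric (h : IsMetric D g H) (f u : R) :
    divTG D g H (fun i j => f * g i j) u = f * lap D g H u + gip D H u f := by
  have : (fun k => ∑ i, ∑ j, ∑ l, H i k * H j l * (f * g i j) * D l u) =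
      fun k => f * grad D H u k := by
    funext k
    simp only [grad, Finset.mul_sum]
    rw [Finset.sum_comm' (t' := Finset.univ) (s' := fun _ => Finset.univ) (by simp),
      Finset.sum_congr rfl fun i _ => Finset.sum_comm, Finset.sum_comm]
    refine Finset.sum_congr rfl fun l _ => ?_
    have e : ∀ j, ∑ i, H i k * H j l * (f * g i j) * D l u =
        (if k = j then 1 else 0) * (H j l * f * D l u) := by
      intro j
      rw [← h.Hg k j, Finset.sum_mul]
      exact Finset.sum_congr rfl fun i _ => by rw [h.H_symm i k]; ring
    simp only [e]
    simp; ring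
  rw [divTG, this, dv_mul]; rfl

lemma divTG_sub (S T : Fin n → Fin n → R) (u : R) :
    divTG D g H (fun i j => S i j - T i j) u = divTG D g H S u - divTG D g H T u := by
  rw [divTG, divTG, divTG, ← dv_sub]
  simp only [mul_sub, sub_mul, Finset.sum_sub_distrib]

lemma divTG_C (r : ℝ) (S : Fin n → Fin n → R) (u : R) :
    divTG D g H (fun i j => algebraMap ℝ R r * S i j) u = algebraMap ℝ R r * divTG D g H S u := by
  rw [divTG, divTG, ← dv_C]
  congr 1; funext k
  simp only [Finset.mul_sum]
  exact Finset.sum_congr rfl fun _ _ => Finset.sum_congr rfl fun _ _ =>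
    Finset.sum_congr rfl fun _ _ => by ring

end Calculus
end Formal

/-! ### Conformal change of curvature and covariance of the Paneitz operator. -/

namespace Formal
section Conformal
variable {n : ℕ} {R : Type*} [CommRing R] [Algebra ℝ R] {D : Fin n → Derivation ℝ R R}
  {g H : Fin n → Fin n → R}

/-- `E = e^{2w}` and `F = e^{-2w}`. -/
structure IsConf (D : Fin n → Derivation ℝ R R) (w E F : R) : Prop where
  inv : E * F = 1
  der : ∀ i, D i E = 2 * E * D i w

lemma IsMetric.conf (h : IsMetric D g H) {w E F : R} (c : IsConf D w E F) :
    IsMetric D (fun i j => E * g i j) (fun i j => F * H i j) where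
  comm := h.comm
  g_symm i j := by rw [h.g_symm]
  H_symm i j := by rw [h.H_symm]
  Hg i k := by
    rw [← h.Hg i k]
    exact Finset.sum_congr rfl fun j _ => by linear_combination H i j * g j k * c.inv

lemma IsMetric.sum_grad (h : IsMetric D g H) (u : R) (j : Fin n) :
    ∑ i, g j i * grad D H u i = D j u := h.g_lower _ j

lemma IsMetric.chr_conf (h : IsMetric D g H) {w E F : R} (c : IsConf D w E F) (k i j : Fin n) :
    chr D (fun i j => E * g i j) (fun i j => F * H i j) k i j = chr D g H k i j
      + ((if k = i then 1 else 0) * D j w + (if k = j then 1 else 0) * D i w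
        - g i j * grad D H w k) := by
  have e : ∀ l, F * H k l * (D i (E * g j l) + D j (E * g i l) - D l (E * g i j)) =
      H k l * (D i (g j l) + D j (g i l) - D l (g i j))
      + 2 * (H k l * g l j * D i w + H k l * g l i * D j w - g i j * (H k l * D l w)) := by
    intro l
    simp only [der_mul, c.der, h.g_symm l]
    linear_combination (H k l * (D i (g j l) + D j (g i l) - D l (g i j))
      + 2 * (H k l * g j l * D i w + H k l * g i l * D j w - g i j * (H k l * D l w))) * c.inv
  simp only [chr, e, Finset.sum_add_distrib, Finset.sum_sub_distrib, ← Finset.mul_sum,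
    ← Finset.sum_mul, h.Hg]
  simp only [grad]
  linear_combination ((if k = i then 1 else 0) * D j w + (if k = j then 1 else 0) * D i w
        - g i j * ∑ l, H k l * D l w) * two_half (R := R)

/-- The trace `Γ^i_ik` of the Christoffel symbols. -/
def chrTr (D : Fin n → Derivation ℝ R R) (g H : Fin n → Fin n → R) (k : Fin n) : R :=
  ∑ i, chr D g H i i k

lemma IsMetric.chrTr_conf (h : IsMetric D g H) {w E F : R} (c : IsConf D w E F) (k : Fin n) :
    chrTr D (fun i j => E * g i j) (fun i j => F * H i j) k = chrTr D g H k + n * D k w := by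
  simp only [chrTr, h.chr_conf c, Finset.sum_add_distrib, Finset.sum_sub_distrib]
  simp [h.g_symm _ k, h.sum_grad]

lemma ric_eq (j k : Fin n) : ric D g H j k = ∑ i, D i (chr D g H i j k) - D j (chrTr D g H k)
    + ∑ p, chrTr D g H p * chr D g H p j k
    - ∑ i, ∑ p, chr D g H i j p * chr D g H p i k := by
  simp only [ric, riem, chrTr, Finset.sum_add_distrib, Finset.sum_sub_distrib, map_sum,
    Finset.sum_mul]
  rw [Finset.sum_comm (f := fun i p => chr D g H i i p * chr D g H p j k)]
  ring

lemma lap_eq_chrTr (u : R) :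
    lap D g H u = ∑ i, D i (grad D H u i) + ∑ i, chrTr D g H i * grad D H u i := by
  simp only [lap, dv, chrTr, Finset.sum_add_distrib, Finset.sum_mul]

/-- The terms of `ric_eq` are expanded separately. The products of Γ with ∂w that are not tensorial
either cancel between `s1`, `s2` and `s3` or complete second derivatives of w to the Hessian and the
Laplacian. -/
lemma IsMetric.ric_conf (h : IsMetric D g H) {w E F : R} (c : IsConf D w E F) (j k : Fin n) :
    ric D (fun i j => E * g i j) (fun i j => F * H i j) j k = ric D g H j k
      - (n - 2) * hess D g H w j k - lap D g H w * g j k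
      + (n - 2) * (D j w * D k w - gip D H w w * g j k) := by
  have hgr : ∀ j, ∑ i, grad D H w i * g j i = D j w := fun j => by
    rw [← h.sum_grad w j]; exact Finset.sum_congr rfl fun _ _ => mul_comm _ _
  have hgr' : ∀ j, ∑ i, grad D H w i * g i j = D j w := fun j => by
    rw [← h.sum_grad w j]; exact Finset.sum_congr rfl fun i _ => by rw [h.g_symm i j, mul_comm]
  have s1 : ∑ i, D i (chr D (fun i j => E * g i j) (fun i j => F * H i j) i j k) =
      ∑ i, D i (chr D g H i j k) + 2 * D j (D k w)
        - g j k * ∑ i, D i (grad D H w i)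
        - ∑ i, grad D H w i * (∑ m, chr D g H m i j * g m k + ∑ m, g j m * chr D g H m i k) := by
    have e : ∀ i, D i (chr D (fun i j => E * g i j) (fun i j => F * H i j) i j k) =
        D i (chr D g H i j k) + (if i = j then 1 else 0) * D i (D k w)
        + (if i = k then 1 else 0) * D i (D j w) - g j k * D i (grad D H w i)
        - grad D H w i * D i (g j k) := by
      intro i
      have z : ∀ b : Prop, [Decidable b] → D i (if b then (1 : R) else 0) = 0 := by
        intro b _; split_ifs <;> simp
      rw [h.chr_conf c]
      simp only [map_add, map_sub, der_mul, z]
      ring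
    simp only [e, Finset.sum_add_distrib, Finset.sum_sub_distrib, ← h.compat, Finset.mul_sum]
    simp only [ite_mul, one_mul, zero_mul, Finset.sum_ite_eq', Finset.mem_univ, if_true]
    rw [h.comm k j]; ring
  have s2 : ∑ p, chrTr D (fun i j => E * g i j) (fun i j => F * H i j) p *
      chr D (fun i j => E * g i j) (fun i j => F * H i j) p j k =
      ∑ p, chrTr D g H p * chr D g H p j k + chrTr D g H j * D k w + chrTr D g H k * D j w
        - g j k * (∑ i, chrTr D g H i * grad D H w i)
        + n * ∑ p, D p w * chr D g H p j k + 2 * n * (D j w * D k w)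
        - n * g j k * gip D H w w := by
    have e : ∀ p, chrTr D (fun i j => E * g i j) (fun i j => F * H i j) p *
      chr D (fun i j => E * g i j) (fun i j => F * H i j) p j k =
        chrTr D g H p * chr D g H p j k + (if p = j then 1 else 0) * (chrTr D g H p * D k w)
        + (if p = k then 1 else 0) * (chrTr D g H p * D j w)
        - g j k * (chrTr D g H p * grad D H w p) + n * (D p w * chr D g H p j k)
        + (if p = j then 1 else 0) * (n * D p w * D k w)
        + (if p = k then 1 else 0) * (n * D p w * D j w)
        - n * g j k * (grad D H w p * D p w) := by
      intro p
      rw [h.chr_conf c, h.chrTr_conf c]; ring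
    simp only [e, Finset.sum_add_distrib, Finset.sum_sub_distrib, ← Finset.mul_sum]
    simp only [ite_mul, one_mul, zero_mul, Finset.sum_ite_eq', Finset.mem_univ, if_true, gip]
    ring
  have s3 : ∑ i, ∑ p, chr D (fun i j => E * g i j) (fun i j => F * H i j) i j p *
      chr D (fun i j => E * g i j) (fun i j => F * H i j) p i k =
      ∑ i, ∑ p, chr D g H i j p * chr D g H p i k
      + chrTr D g H j * D k w + chrTr D g H k * D j w
      + 2 * ∑ p, D p w * chr D g H p j k
      - ∑ i, grad D H w i * (∑ m, chr D g H m i j * g m k + ∑ m, g j m * chr D g H m i k)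
      + (n + 2) * (D j w * D k w) - 2 * g j k * gip D H w w := by
    have e : ∀ i p, chr D (fun i j => E * g i j) (fun i j => F * H i j) i j p *
      chr D (fun i j => E * g i j) (fun i j => F * H i j) p i k =
        chr D g H i j p * chr D g H p i k
        + (if p = i then 1 else 0) * (chr D g H i j p * D k w)
        + (if p = k then 1 else 0) * (chr D g H i j p * D i w)
        - chr D g H i p j * g i k * grad D H w p
        + (if i = j then 1 else 0) * (D p w * chr D g H p i k)
        + (if i = p then 1 else 0) * (D j w * chr D g H p i k)
        - grad D H w i * (g j p * chr D g H p i k)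
        + (if i = j then 1 else 0) * (if p = i then 1 else 0) * (D p w * D k w)
        + (if i = j then 1 else 0) * (if p = k then 1 else 0) * (D p w * D i w)
        - (if i = j then 1 else 0) * (D p w * g i k * grad D H w p)
        + (if i = p then 1 else 0) * (if p = i then 1 else 0) * (D j w * D k w)
        + (if i = p then 1 else 0) * (if p = k then 1 else 0) * (D j w * D i w)
        - (if i = p then 1 else 0) * (D j w * g i k * grad D H w p)
        - (if p = i then 1 else 0) * (g j p * grad D H w i * D k w)
        - (if p = k then 1 else 0) * (g j p * grad D H w i * D i w)
        + grad D H w i * g i k * (g j p * grad D H w p) := by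
      intro i p
      rw [h.chr_conf c, h.chr_conf c, h.chr_symm i j p]; ring
    simp only [e, Finset.sum_add_distrib, Finset.sum_sub_distrib]
    have f1 : ∑ i, ∑ p, chr D g H i p j * g i k * grad D H w p =
        ∑ i, grad D H w i * ∑ m, chr D g H m i j * g m k := by
      rw [Finset.sum_comm]; simp only [Finset.mul_sum]
      exact Finset.sum_congr rfl fun _ _ => Finset.sum_congr rfl fun _ _ => by ring
    have f2 : ∑ i, ∑ p, grad D H w i * g i k * (g j p * grad D H w p) = D k w * D j w := by
      rw [← Finset.sum_mul_sum, hgr', h.sum_grad]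
    rw [f1, f2]
    simp only [ite_mul, one_mul, zero_mul, Finset.sum_ite_eq', Finset.sum_ite_eq,
      Finset.mem_univ, if_true, Finset.sum_const, Finset.card_univ, Fintype.card_fin,
      nsmul_eq_mul, mul_add, Finset.sum_add_distrib, Finset.mul_sum]
    have q : ∀ f : Fin n → Fin n → R, (∑ x, ∑ y, if x = j then f x y else 0) = ∑ y, f j y := by
      intro f; rw [Finset.sum_comm]; simp
    simp only [q, Finset.sum_ite_eq', Finset.mem_univ, if_true]
    have a1 : ∑ x, chr D g H x j x * D k w = chrTr D g H j * D k w := by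
      rw [chrTr, Finset.sum_mul]; exact Finset.sum_congr rfl fun x _ => by rw [h.chr_symm]
    have a2 : ∑ x, chr D g H x j k * D x w = ∑ x, D x w * chr D g H x j k :=
      Finset.sum_congr rfl fun _ _ => mul_comm _ _
    have a4 : ∑ x, D j w * chr D g H x x k = chrTr D g H k * D j w := by
      rw [← Finset.mul_sum, chrTr, mul_comm]
    have a5 : ∑ x, D x w * g j k * grad D H w x = g j k * gip D H w w := by
      rw [gip, Finset.mul_sum]; exact Finset.sum_congr rfl fun _ _ => by ring
    have a6 : ∑ x, D j w * g x k * grad D H w x = D j w * D k w := by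
      rw [← hgr' k, Finset.mul_sum]; exact Finset.sum_congr rfl fun _ _ => by ring
    have a7 : ∑ x, g j x * grad D H w x * D k w = D j w * D k w := by
      rw [← Finset.sum_mul, h.sum_grad]
    have a8 : ∑ x, g j k * grad D H w x * D x w = g j k * gip D H w w := by
      rw [gip, Finset.mul_sum]; exact Finset.sum_congr rfl fun _ _ => by ring
    rw [a1, a2, a4, a5, a6, a7, a8]
    simp only [← Finset.mul_sum]
    ring
  rw [ric_eq, s1, s2, s3, h.chrTr_conf c, ric_eq, lap_eq_chrTr, hess, nabF]
  have : D j (n * D k w) = n * D j (D k w) := by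
    rw [der_mul, (D j).map_natCast]; ring
  simp only [map_add, this]
  have e : ∑ m, chr D g H m j k * D m w = ∑ p, D p w * chr D g H p j k :=
    Finset.sum_congr rfl fun _ _ => mul_comm _ _
  rw [e]
  ring

lemma tr_sub (S T : Fin n → Fin n → R) :
    tr H (fun i j => S i j - T i j) = tr H S - tr H T := by
  simp only [tr, mul_sub, Finset.sum_sub_distrib]

lemma tr_add (S T : Fin n → Fin n → R) :
    tr H (fun i j => S i j + T i j) = tr H S + tr H T := by
  simp only [tr, mul_add, Finset.sum_add_distrib]

lemma tr_mul (a : R) (T : Fin n → Fin n → R) : tr H (fun i j => a * T i j) = a * tr H T := by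
  simp only [tr, Finset.mul_sum]
  exact Finset.sum_congr rfl fun _ _ => Finset.sum_congr rfl fun _ _ => by ring

lemma IsMetric.tr_g (h : IsMetric D g H) : tr H g = n := by
  have : tr H g = ∑ i : Fin n, (1 : R) := by
    refine Finset.sum_congr rfl fun i _ => ?_
    rw [← (h.Hg i i).trans (if_pos rfl)]
    exact Finset.sum_congr rfl fun _ _ => by rw [h.g_symm]
  rw [this]; simp

lemma IsMetric.tr_dw (h : IsMetric D g H) (w : R) :
    tr H (fun i j => D i w * D j w) = gip D H w w := by
  rw [gip, tr, Finset.sum_comm]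
  simp only [grad, Finset.sum_mul]
  exact Finset.sum_congr rfl fun _ _ => Finset.sum_congr rfl fun _ _ => by rw [h.H_symm]; ring

lemma ip_sub_left (S S' T : Fin n → Fin n → R) :
    ip H (fun i j => S i j - S' i j) T = ip H S T - ip H S' T := by
  simp only [ip, mul_sub, sub_mul, Finset.sum_sub_distrib]

lemma ip_add_left (S S' T : Fin n → Fin n → R) :
    ip H (fun i j => S i j + S' i j) T = ip H S T + ip H S' T := by
  simp only [ip, mul_add, add_mul, Finset.sum_add_distrib]

lemma ip_mul_left (a : R) (S T : Fin n → Fin n → R) :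
    ip H (fun i j => a * S i j) T = a * ip H S T := by
  simp only [ip, Finset.mul_sum]
  exact Finset.sum_congr rfl fun _ _ => Finset.sum_congr rfl fun _ _ =>
    Finset.sum_congr rfl fun _ _ => Finset.sum_congr rfl fun _ _ => by ring

lemma IsMetric.ip_comm (h : IsMetric D g H) (S T : Fin n → Fin n → R) :
    ip H S T = ip H T S := by
  simp only [ip, ← Fintype.sum_prod_type']
  refine Fintype.sum_equiv ⟨fun p => (p.2.2.1, p.2.2.2, p.1, p.2.1),
    fun p => (p.2.2.1, p.2.2.2, p.1, p.2.1), fun _ => rfl, fun _ => rfl⟩ _ _ fun p => ?_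
  simp only [Equiv.coe_fn_mk]
  rw [h.H_symm p.1, h.H_symm p.2.1]; ring

lemma IsMetric.ip_g (h : IsMetric D g H) (T : Fin n → Fin n → R) : ip H T g = tr H T := by
  simp only [ip, tr]
  refine Finset.sum_congr rfl fun i _ => Finset.sum_congr rfl fun j _ => ?_
  have e : ∀ k, ∑ l, H i k * H j l * T i j * g k l =
      (if j = k then 1 else 0) * (H i k * T i j) := by
    intro k
    rw [← h.Hg j k, Finset.sum_mul]
    exact Finset.sum_congr rfl fun l _ => by rw [h.g_symm k l]; ring
  simp only [e]
  simp

lemma ip_dw (T : Fin n → Fin n → R) (w : R) :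
    ip H T (fun i j => D i w * D j w) = ∑ i, ∑ j, T i j * grad D H w i * grad D H w j := by
  simp only [ip, grad]
  refine Finset.sum_congr rfl fun i _ => Finset.sum_congr rfl fun j _ => ?_
  rw [mul_assoc, Finset.sum_mul_sum, Finset.mul_sum]
  refine Finset.sum_congr rfl fun k _ => ?_
  rw [Finset.mul_sum]
  exact Finset.sum_congr rfl fun l _ => by ring

lemma IsMetric.ip_dw_dw (h : IsMetric D g H) (w : R) :
    ip H (fun i j => D i w * D j w) (fun i j => D i w * D j w) = gip D H w w ^ 2 := by
  rw [ip_dw, gip, sq, Finset.sum_mul_sum]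
  exact Finset.sum_congr rfl fun _ _ => Finset.sum_congr rfl fun _ _ => by ring

lemma IsMetric.ip_hess_dw (h : IsMetric D g H) (w : R) :
    2 * ip H (hess D g H w) (fun i j => D i w * D j w) = gip D H w (gip D H w w) := by
  rw [ip_dw, gip]
  simp only [h.der_gip_self, Finset.mul_sum]
  exact Finset.sum_congr rfl fun _ _ => Finset.sum_congr rfl fun _ _ => by ring

lemma IsMetric.dv_conf (h : IsMetric D g H) {w E F : R} (c : IsConf D w E F) (V : Fin n → R) :
    dv D (fun i j => E * g i j) (fun i j => F * H i j) V =
      dv D g H V + n * ∑ k, V k * D k w := by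
  have e : ∀ (g' H' : Fin n → Fin n → R), dv D g' H' V =
      ∑ k, D k (V k) + ∑ k, chrTr D g' H' k * V k := by
    intro g' H'
    simp only [dv, chrTr, Finset.sum_mul, Finset.sum_add_distrib]
  rw [e, e]
  simp only [h.chrTr_conf c, add_mul, Finset.sum_add_distrib, Finset.mul_sum]
  rw [add_assoc]
  congr 2
  exact Finset.sum_congr rfl fun _ _ => by ring

lemma IsConf.der_inv {w E F : R} (c : IsConf D w E F) (i : Fin n) :
    D i F = -(2 * F * D i w) := by
  have h1 : D i (E * F) = 0 := by rw [c.inv]; simp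
  rw [der_mul, c.der] at h1
  linear_combination F * h1 - (D i F + 2 * F * D i w) * c.inv

lemma IsMetric.lap_conf (h : IsMetric D g H) {w E F : R} (c : IsConf D w E F) (u : R) :
    lap D (fun i j => E * g i j) (fun i j => F * H i j) u =
      F * (lap D g H u + (n - 2) * gip D H w u) := by
  have e : grad D (fun i j => F * H i j) u = fun k => F * grad D H u k := by
    funext k; simp only [grad, Finset.mul_sum, mul_assoc]
  rw [lap, h.dv_conf c, e, dv_mul, lap, h.gip_comm w u, gip]
  have e1 : ∑ k, grad D H u k * D k F = -(2 * F * ∑ i, grad D H u i * D i w) := by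
    rw [Finset.mul_sum, ← Finset.sum_neg_distrib]
    exact Finset.sum_congr rfl fun _ _ => by rw [c.der_inv]; ring
  have e2 : ∑ i, F * grad D H u i * D i w = F * ∑ i, grad D H u i * D i w := by
    rw [Finset.mul_sum]; exact Finset.sum_congr rfl fun _ _ => by ring
  rw [e1, e2]
  ring

lemma IsMetric.scal_conf (h : IsMetric D g H) {w E F : R} (c : IsConf D w E F) :
    scal D (fun i j => E * g i j) (fun i j => F * H i j) =
      F * (scal D g H - 2 * (n - 1) * lap D g H w - (n - 1) * (n - 2) * gip D H w w) := by
  have e : ∀ (g' H' : Fin n → Fin n → R), scal D g' H' = tr H' (ric D g' H') := fun _ _ => rfl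
  have e2 : tr (fun i j => F * H i j) (ric D (fun i j => E * g i j) (fun i j => F * H i j)) =
      F * tr H (fun j k => ric D g H j k
      - (n - 2) * hess D g H w j k - lap D g H w * g j k
      + (n - 2) * (D j w * D k w - gip D H w w * g j k)) := by
    simp only [tr, h.ric_conf c, Finset.mul_sum, mul_assoc]
  rw [e, e2, tr_add, tr_sub, tr_sub, tr_mul, tr_mul, tr_mul, tr_sub, tr_mul, h.tr_g, h.tr_dw,
    ← e, ← h.lap_eq]
  ring

lemma alpha_mul (hn : 5 ≤ n) :
    algebraMap ℝ R (1 / ((n : ℝ) - 2)) * ((n : R) - 2) = 1 := by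
  have h5 : (5 : ℝ) ≤ n := by exact_mod_cast hn
  rw [← map_natCast (algebraMap ℝ R) n, ← map_ofNat (algebraMap ℝ R) 2, ← map_sub, ← map_mul,
    one_div_mul_cancel (by linarith), map_one]

lemma beta_mul (hn : 5 ≤ n) :
    algebraMap ℝ R (1 / (2 * ((n : ℝ) - 1))) * (2 * ((n : R) - 1)) = 1 := by
  have h5 : (5 : ℝ) ≤ n := by exact_mod_cast hn
  rw [← map_natCast (algebraMap ℝ R) n, ← map_ofNat (algebraMap ℝ R) 2,
    ← map_one (algebraMap ℝ R), ← map_sub, ← map_mul,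
    ← map_mul, one_div_mul_cancel (by linarith)]

lemma IsMetric.sch_conf (hn : 5 ≤ n) (h : IsMetric D g H) {w E F : R} (c : IsConf D w E F)
    (i j : Fin n) :
    sch D (fun i j => E * g i j) (fun i j => F * H i j) i j = sch D g H i j
      - hess D g H w i j + D i w * D j w - algebraMap ℝ R (1 / 2) * gip D H w w * g i j := by
  rw [sch, sch, h.ric_conf c, h.scal_conf c]
  have ha := alpha_mul (R := R) hn
  have hb := beta_mul (R := R) hn
  have hh := two_half (R := R)
  -- The numerical constants become symbols, each with one defining relation; the coefficients in
  -- `linear_combination` say how often each relation is used.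
  generalize algebraMap ℝ R (1 / ((n : ℝ) - 2)) = α at *
  generalize algebraMap ℝ R (1 / (2 * ((n : ℝ) - 1))) = β at *
  generalize algebraMap ℝ R (1 / 2) = t at *
  set S := scal D g H - 2 * (n - 1) * lap D g H w - (n - 1) * (n - 2) * gip D H w w
  linear_combination (-hess D g H w i j + D i w * D j w - t * gip D H w w * g i j) * ha
    + α * g i j * (lap D g H w + (n - 2) * t * gip D H w w) * hb
    - α * β * S * g i j * c.inv
    + (α * (n - 2) * gip D H w w * g i j - α * β * (n - 1) * (n - 2) * gip D H w w * g i j) * hh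

lemma IsMetric.sig1_conf (hn : 5 ≤ n) (h : IsMetric D g H) {w E F : R} (c : IsConf D w E F) :
    sig1 D (fun i j => E * g i j) (fun i j => F * H i j) =
      F * (sig1 D g H - lap D g H w
        - algebraMap ℝ R (1 / 2) * (n - 2) * gip D H w w) := by
  have e : ∀ (g' H' : Fin n → Fin n → R), sig1 D g' H' = tr H' (sch D g' H') := fun _ _ => rfl
  have e2 : tr (fun i j => F * H i j) (sch D (fun i j => E * g i j) (fun i j => F * H i j)) =
      F * tr H (fun i j => sch D g H i j
      - hess D g H w i j + D i w * D j w - algebraMap ℝ R (1 / 2) * gip D H w w * g i j) := by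
    simp only [tr, h.sch_conf hn c, Finset.mul_sum, mul_assoc]
  rw [e, e2, tr_sub, tr_add, tr_sub, tr_mul, h.tr_g, h.tr_dw, ← e, ← h.lap_eq]
  linear_combination (-F * gip D H w w) * two_half (R := R)

/-- The Schouten tensor in terms of its trace. -/
lemma IsMetric.ric_eq_sch (hn : 5 ≤ n) (h : IsMetric D g H) (i j : Fin n) :
    ric D g H i j = (n - 2) * sch D g H i j + sig1 D g H * g i j := by
  have e : sig1 D g H = tr H (fun i j => algebraMap ℝ R (1 / ((n : ℝ) - 2)) *
    (ric D g H i j - scal D g H * algebraMap ℝ R (1 / (2 * ((n : ℝ) - 1))) * g i j)) := rfl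
  have e' : scal D g H = tr H (ric D g H) := rfl
  rw [e, tr_mul, tr_sub, tr_mul, h.tr_g, ← e', sch]
  have ha := alpha_mul (R := R) hn
  have hb := beta_mul (R := R) hn
  generalize algebraMap ℝ R (1 / ((n : ℝ) - 2)) = α at *
  generalize algebraMap ℝ R (1 / (2 * ((n : ℝ) - 1))) = β at *
  linear_combination (-ric D g H i j + scal D g H * β * g i j) * ha
    + (α * scal D g H * g i j) * hb
    - (scal D g H * β * g i j) * ha

lemma IsMetric.scal_eq_sig1 (hn : 5 ≤ n) (h : IsMetric D g H) :
    scal D g H = 2 * (n - 1) * sig1 D g H := by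
  have e' : scal D g H = tr H (fun i j => (n - 2) * sch D g H i j + sig1 D g H * g i j) := by
    simp only [← h.ric_eq_sch hn]; rfl
  have e : sig1 D g H = tr H (sch D g H) := rfl
  rw [e', tr_add, tr_mul, tr_mul, h.tr_g, ← e]
  ring

lemma gip_add (u v v' : R) :
    gip D H u (v + v') = gip D H u v + gip D H u v' := by
  simp only [gip, map_add, mul_add, Finset.sum_add_distrib]

lemma gip_mul (u f v : R) : gip D H u (f * v) = f * gip D H u v + v * gip D H u f := by
  simp only [gip, der_mul, mul_add, Finset.mul_sum, ← Finset.sum_add_distrib]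
  exact Finset.sum_congr rfl fun _ _ => by ring

lemma gip_C (u : R) (r : ℝ) : gip D H u (algebraMap ℝ R r) = 0 := by
  simp [gip]

lemma gip_sub (u v v' : R) : gip D H u (v - v') = gip D H u v - gip D H u v' := by
  simp only [gip, map_sub, mul_sub, Finset.sum_sub_distrib]

lemma lap_sub (u v : R) : lap D g H (u - v) = lap D g H u - lap D g H v := by
  have := lap_add (D := D) (g := g) (H := H) (u - v) v
  rw [sub_add_cancel] at this
  rw [this]; ring

lemma nat_eq : (n : R) = 2 * algebraMap ℝ R (((n : ℝ) - 4) / 2) + 4 := by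
  rw [← map_ofNat (algebraMap ℝ R) 2, ← map_ofNat (algebraMap ℝ R) 4, ← map_mul, ← map_add,
    ← map_natCast (algebraMap ℝ R) n]
  congr 1; ring

/-- In Schouten form the contracted Bianchi identity reads div A = dσ₁, which accounts for the first
term. -/
lemma IsMetric.divTG_sch (hn : 5 ≤ n) (h : IsMetric D g H) (u : R) :
    divTG D g H (sch D g H) u = gip D H u (sig1 D g H) + ip H (sch D g H) (hess D g H u) := by
  have e : sch D g H = fun i j => algebraMap ℝ R (1 / ((n : ℝ) - 2)) *
    (ric D g H i j - scal D g H * algebraMap ℝ R (1 / (2 * ((n : ℝ) - 1))) * g i j) := rfl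
  have hr := h.divTG_ric u
  have hs : gip D H u (scal D g H) = 2 * (n - 1) * gip D H u (sig1 D g H) := by
    rw [h.scal_eq_sig1 hn, show (2 * ((n : R) - 1)) = algebraMap ℝ R (2 * ((n : ℝ) - 1)) by
        rw [map_mul, map_sub, map_one, map_natCast, map_ofNat],
      gip_mul, gip_C]
    ring
  rw [e, divTG_C, divTG_sub, h.divTG_metric, ip_mul_left, ip_sub_left, ip_mul_left, h.ip_comm g,
    h.ip_g, ← h.lap_eq, mul_comm (scal D g H), gip_mul, gip_C, hs]
  rw [hs] at hr
  have ha := alpha_mul (R := R) hn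
  have hb := beta_mul (R := R) hn
  have hh := two_half (R := R)
  generalize algebraMap ℝ R (1 / ((n : ℝ) - 2)) = α at *
  generalize algebraMap ℝ R (1 / (2 * ((n : ℝ) - 1))) = β at *
  generalize algebraMap ℝ R (1 / 2) = t at *
  generalize gip D H u (sig1 D g H) = G at *
  linear_combination (α * t) * hr - α * (divTG D g H (ric D g H) u
    - ip H (ric D g H) (hess D g H u)) * hh + G * ha - α * G * hb + α * (n - 1) * G * hh

/-- The conformal covariance of the Paneitz operator and the `Q`-curvature: for
`u = e^{(n-4)w/2}`, `P_g u = (n-4)/2 · Q_{e^{2w}g} e^{4w} u`. -/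
theorem IsMetric.qc_conf (hn : 5 ≤ n) (h : IsMetric D g H) {w E F u : R} (c : IsConf D w E F)
    (hu : ∀ i, D i u = algebraMap ℝ R (((n : ℝ) - 4) / 2) * u * D i w) :
    pan D g H u = algebraMap ℝ R (((n : ℝ) - 4) / 2) *
      (qc D (fun i j => E * g i j) (fun i j => F * H i j) * E ^ 2 * u) := by
  have hc := h.conf c
  have hn2 : algebraMap ℝ R ((n : ℝ) - 2) = (n : R) - 2 := by
    rw [map_sub, map_natCast, map_ofNat]
  have hna := nat_eq (R := R) (n := n)
  have hh := two_half (R := R)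
  -- After division by (n-4)/2 · u, the coefficients of Δ|∇w|² on the two sides differ by one.
  -- Bochner's formula exchanges this difference for |∇²w|², which otherwise occurs only in the
  -- conformal |A|².
  have hboch := h.bochner w
  have hip4 : ∑ i, ∑ j, sch D g H i j * grad D H w i * grad D H w j =
    ip H (sch D g H) (fun i j => D i w * D j w) := (ip_dw _ _).symm
  have hric : ∑ l, ∑ m, ric D g H l m * grad D H w l * grad D H w m =
      (n - 2) * ip H (sch D g H) (fun i j => D i w * D j w) + sig1 D g H * gip D H w w := by
    rw [← ip_dw, show ric D g H = fun i j => (n - 2) * sch D g H i j + sig1 D g H * g i j from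
      funext fun i => funext fun j => h.ric_eq_sch hn i j, ip_add_left, ip_mul_left, ip_mul_left,
      h.ip_comm g, h.ip_g, h.tr_dw]
  rw [hric] at hboch
  -- the gradient of `u` and of `F`
  have hgu : ∀ v, gip D H u v = algebraMap ℝ R (((n : ℝ) - 4) / 2) * u * gip D H w v := by
    intro v
    rw [h.gip_comm, h.gip_comm w, gip, gip, Finset.mul_sum]
    exact Finset.sum_congr rfl fun _ _ => by rw [hu]; ring
  have hgF : ∀ v, gip D H F v = -2 * F * gip D H w v := by
    intro v
    rw [h.gip_comm, h.gip_comm w, gip, gip, Finset.mul_sum]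
    exact Finset.sum_congr rfl fun _ _ => by rw [c.der_inv]; ring
  have hlapF : lap D g H F = F * (-2 * lap D g H w + 4 * gip D H w w) := by
    have e : grad D H F = fun k => (-2 * F) * grad D H w k := by
      funext k; simp only [grad, c.der_inv, Finset.mul_sum]
      exact Finset.sum_congr rfl fun _ _ => by ring
    have e2 : ∑ k, grad D H w k * D k (-2 * F) = 4 * F * gip D H w w := by
      rw [gip, Finset.mul_sum]
      refine Finset.sum_congr rfl fun k _ => ?_
      have : D k (-2 * F) = -2 * D k F := by
        have h2 : D k (-2 : R) = 0 := by
          have := (D k).map_intCast (-2); simpa using this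
        rw [der_mul, h2]; ring
      rw [this, c.der_inv]; ring
    rw [lap, e, dv_mul, e2, lap]; ring
  have hlapu : lap D g H u = u * (algebraMap ℝ R (((n : ℝ) - 4) / 2) * lap D g H w
      + algebraMap ℝ R (((n : ℝ) - 4) / 2) ^ 2 * gip D H w w) := by
    have e : grad D H u = fun k => (algebraMap ℝ R (((n : ℝ) - 4) / 2) * u) * grad D H w k := by
      funext k; simp only [grad, hu, Finset.mul_sum]
      exact Finset.sum_congr rfl fun _ _ => by ring
    have e2 : ∑ k, grad D H w k * D k (algebraMap ℝ R (((n : ℝ) - 4) / 2) * u) =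
        algebraMap ℝ R (((n : ℝ) - 4) / 2) ^ 2 * u * gip D H w w := by
      rw [gip, Finset.mul_sum]
      exact Finset.sum_congr rfl fun k _ => by rw [der_mul, der_C, hu]; ring
    rw [lap, e, dv_mul, e2, lap]; ring
  have hhess : hess D g H u = fun i j => algebraMap ℝ R (((n : ℝ) - 4) / 2) * u *
      (hess D g H w i j + algebraMap ℝ R (((n : ℝ) - 4) / 2) * (D i w * D j w)) := by
    funext i j
    simp only [hess, nabF, hu, der_mul, der_C, mul_sub, mul_add]
    have : ∑ m, chr D g H m i j * (algebraMap ℝ R (((n : ℝ) - 4) / 2) * u * D m w) =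
        algebraMap ℝ R (((n : ℝ) - 4) / 2) * u * ∑ m, chr D g H m i j * D m w := by
      rw [Finset.mul_sum]; exact Finset.sum_congr rfl fun _ _ => by ring
    rw [this]; ring
  have hAu : ip H (sch D g H) (hess D g H u) = algebraMap ℝ R (((n : ℝ) - 4) / 2) * u *
      (ip H (sch D g H) (hess D g H w) + algebraMap ℝ R (((n : ℝ) - 4) / 2) *
        ip H (sch D g H) (fun i j => D i w * D j w)) := by
    rw [hhess, h.ip_comm, ip_mul_left, ip_add_left, ip_mul_left, h.ip_comm (hess D g H w),
      h.ip_comm (fun i j => D i w * D j w)]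
  have hdiv : divTG D g H (fun i j => 4 * sch D g H i j
        - algebraMap ℝ R ((n : ℝ) - 2) * sig1 D g H * g i j) u =
      4 * (gip D H u (sig1 D g H) + ip H (sch D g H) (hess D g H u))
      - (n - 2) * (sig1 D g H * lap D g H u + gip D H u (sig1 D g H)) := by
    rw [divTG_sub (fun i j => 4 * sch D g H i j), h.divTG_metric, gip_mul, gip_C, ← h.divTG_sch hn,
      ← map_ofNat (algebraMap ℝ R) 4, divTG_C, hn2]
    ring
  -- the Schouten tensor of the conformal metric
  set a := algebraMap ℝ R (((n : ℝ) - 4) / 2) with ha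
  have hsig : sig1 D (fun i j => E * g i j) (fun i j => F * H i j) =
      F * (sig1 D g H - lap D g H w - (a + 1) * gip D H w w) := by
    rw [h.sig1_conf hn c]
    linear_combination (-F * algebraMap ℝ R (1 / 2) * gip D H w w) * hna
      - F * (a + 1) * gip D H w w * hh
  have hsq : 2 * ip (fun i j => F * H i j) (sch D (fun i j => E * g i j) (fun i j => F * H i j))
      (sch D (fun i j => E * g i j) (fun i j => F * H i j)) = F ^ 2 *
      (2 * ip H (sch D g H) (sch D g H) + 2 * ip H (hess D g H w) (hess D g H w)
        + (a + 2) * gip D H w w ^ 2 - 4 * ip H (sch D g H) (hess D g H w)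
        + 4 * ip H (sch D g H) (fun i j => D i w * D j w)
        - 2 * gip D H w w * sig1 D g H - 2 * gip D H w (gip D H w w)
        + 2 * gip D H w w * lap D g H w) := by
    have e : ∀ T, ip (fun i j => F * H i j) T T = F ^ 2 * ip H T T := by
      intro T
      simp only [ip, Finset.mul_sum]
      exact Finset.sum_congr rfl fun _ _ => Finset.sum_congr rfl fun _ _ =>
        Finset.sum_congr rfl fun _ _ => Finset.sum_congr rfl fun _ _ => by ring
    have e2 : sch D (fun i j => E * g i j) (fun i j => F * H i j) = fun i j => sch D g H i j
      - hess D g H w i j + D i w * D j w - algebraMap ℝ R (1 / 2) * gip D H w w * g i j :=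
      funext fun i => funext fun j => h.sch_conf hn c i j
    have e3 : ∀ T, ip H (sch D (fun i j => E * g i j) (fun i j => F * H i j)) T =
        ip H (sch D g H) T - ip H (hess D g H w) T + ip H (fun i j => D i w * D j w) T
        - algebraMap ℝ R (1 / 2) * gip D H w w * tr H T := by
      intro T
      rw [e2, ip_sub_left, ip_add_left, ip_sub_left, ip_mul_left, h.ip_comm g, h.ip_g]
    have e4 : tr H (sch D g H) = sig1 D g H := rfl
    rw [e, e3, h.ip_comm (sch D g H), h.ip_comm (hess D g H w),
      h.ip_comm (fun i j => D i w * D j w), e3, e3, e3,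
      show tr H (sch D (fun i j => E * g i j) (fun i j => F * H i j)) = sig1 D g H
        - lap D g H w + gip D H w w - algebraMap ℝ R (1 / 2) * gip D H w w * n from by
        rw [e2, tr_sub, tr_add, tr_sub, tr_mul, h.tr_g, h.tr_dw, e4, ← h.lap_eq],
      e4, h.tr_dw, ← h.lap_eq, h.ip_dw_dw, h.ip_comm (hess D g H w) (sch D g H),
      h.ip_comm (fun i j => D i w * D j w), h.ip_comm (fun i j => D i w * D j w)]
    have e5 := h.ip_hess_dw w
    generalize algebraMap ℝ R (1 / 2) = t at *
    linear_combination F ^ 2 * (-2 * e5 + (-2 * gip D H w w * sig1 D g H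
      + 2 * gip D H w w * lap D g H w - 2 * gip D H w w ^ 2
      + (a + 2) * (2 * t + 1) * gip D H w w ^ 2) * hh + 2 * t ^ 2 * gip D H w w ^ 2 * hna)
  have hlap : lap D (fun i j => E * g i j) (fun i j => F * H i j)
      (sig1 D (fun i j => E * g i j) (fun i j => F * H i j)) =
      F ^ 2 * (lap D g H (sig1 D g H) - lap D g H (lap D g H w)
        - (a + 1) * lap D g H (gip D H w w)
        + (n - 6) * (gip D H w (sig1 D g H) - gip D H w (lap D g H w)
          - (a + 1) * gip D H w (gip D H w w))
        + (sig1 D g H - lap D g H w - (a + 1) * gip D H w w) *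
          (-2 * lap D g H w + 4 * gip D H w w - 2 * (n - 2) * gip D H w w)) := by
    have ha1 : a + 1 = algebraMap ℝ R (((n : ℝ) - 4) / 2 + 1) := by rw [map_add, map_one]
    rw [h.lap_conf c, hsig, h.lap_mul, hgF, hlapF, gip_mul, h.gip_comm w F, hgF, ha1, lap_sub,
      lap_sub, lap_C, gip_sub, gip_sub, gip_mul, gip_C]
    ring
  have hplap : lap D g H (lap D g H u) = u * (a * lap D g H (lap D g H w)
      + a ^ 2 * lap D g H (gip D H w w) + 2 * a * (a * gip D H w (lap D g H w)
      + a ^ 2 * gip D H w (gip D H w w)) + (a * lap D g H w + a ^ 2 * gip D H w w) ^ 2) := by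
    have ha2 : a ^ 2 = algebraMap ℝ R ((((n : ℝ) - 4) / 2) ^ 2) := by rw [map_pow]
    conv_lhs => rw [hlapu]
    rw [h.lap_mul, hgu, hlapu, gip_add, lap_add, gip_mul, ha2, gip_mul, gip_C, lap_C, ha, lap_C,
      gip_C]
    ring
  -- The weight: Q carries F², cancelled by E² through E F = 1. Isolating this step keeps powers of
  -- E and F out of the last computation.
  have hQ : ∀ X S I Z : R, 2 * I = F ^ 2 * Z →
      (-(F ^ 2 * X) + 4 * (algebraMap ℝ R (1 / 2) * ((F * S) ^ 2 - I)) + a * (F * S) ^ 2) * E ^ 2 =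
        -X + 2 * S ^ 2 - Z + a * S ^ 2 := by
    intro X S I Z hI
    generalize algebraMap ℝ R (1 / 2) = t at *
    linear_combination (-2 * t * E ^ 2) * hI
      + (2 * F ^ 2 * S ^ 2 * E ^ 2 - F ^ 2 * Z * E ^ 2) * hh
      + (E * F + 1) * (-X + 2 * S ^ 2 - Z + a * S ^ 2) * c.inv
  rw [pan, hplap, hdiv, qc, qc, hlap, hsig, ← ha, hQ _ _ _ _ hsq, hgu, hAu, hlapu, hboch]
  generalize algebraMap ℝ R (1 / 2) = t at *
  clear_value a
  rw [hna]
  linear_combination 2 * a * u * (sig1 D g H ^ 2 - ip H (sch D g H) (sch D g H)) * hh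

end Conformal
end Formal

/-! ### Partial derivatives -/

section PartialDerivatives
variable {n : ℕ}

lemma pd_congr {i : Fin n} {f g : Euc n → ℝ} {x : Euc n} (h : f =ᶠ[𝓝 x] g) :
    pd i f x = pd i g x := by rw [pd, pd, h.fderiv_eq]

lemma pd_eventuallyEq {i : Fin n} {f g : Euc n → ℝ} {x : Euc n} (h : f =ᶠ[𝓝 x] g) :
    pd i f =ᶠ[𝓝 x] pd i g := h.eventuallyEq_nhds.mono fun _ hy => pd_congr hy

lemma pd_congr_on {U : Set (Euc n)} (hU : IsOpen U) {f g : Euc n → ℝ} (h : ∀ x ∈ U, f x = g x)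
    {i : Fin n} {x : Euc n} (hx : x ∈ U) : pd i f x = pd i g x :=
  pd_congr (Filter.eventually_of_mem (hU.mem_nhds hx) h)

lemma pd_add {i : Fin n} {f g : Euc n → ℝ} {x : Euc n} (hf : DifferentiableAt ℝ f x)
    (hg : DifferentiableAt ℝ g x) : pd i (fun y => f y + g y) x = pd i f x + pd i g x := by
  simp only [pd]; rw [fderiv_fun_add hf hg]; rfl

lemma pd_sub {i : Fin n} {f g : Euc n → ℝ} {x : Euc n} (hf : DifferentiableAt ℝ f x)
    (hg : DifferentiableAt ℝ g x) : pd i (fun y => f y - g y) x = pd i f x - pd i g x := by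
  simp only [pd]; rw [fderiv_fun_sub hf hg]; rfl

lemma pd_mul {i : Fin n} {f g : Euc n → ℝ} {x : Euc n} (hf : DifferentiableAt ℝ f x)
    (hg : DifferentiableAt ℝ g x) :
    pd i (fun y => f y * g y) x = pd i f x * g x + f x * pd i g x := by
  simp only [pd]; rw [fderiv_fun_mul hf hg]; simp; ring

lemma pd_const (i : Fin n) (c : ℝ) (x : Euc n) : pd i (fun _ => c) x = 0 := by
  simp [pd]

lemma pd_const_mul {i : Fin n} (c : ℝ) {f : Euc n → ℝ} {x : Euc n}
    (hf : DifferentiableAt ℝ f x) : pd i (fun y => c * f y) x = c * pd i f x := by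
  rw [pd_mul (differentiableAt_const c) hf, pd_const]; ring

lemma pd_sum {ι : Type*} {i : Fin n} {s : Finset ι} {f : ι → Euc n → ℝ} {x : Euc n}
    (hf : ∀ a ∈ s, DifferentiableAt ℝ (f a) x) :
    pd i (fun y => ∑ a ∈ s, f a y) x = ∑ a ∈ s, pd i (f a) x := by
  simp only [pd]; rw [fderiv_fun_sum hf]; simp

lemma pd_comp {i : Fin n} {φ : ℝ → ℝ} {φ' : ℝ} {f : Euc n → ℝ} {x : Euc n}
    (hφ : HasDerivAt φ φ' (f x)) (hf : DifferentiableAt ℝ f x) :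
    pd i (fun y => φ (f y)) x = φ' * pd i f x := by
  have := hφ.comp_hasFDerivAt x hf.hasFDerivAt
  simp only [pd]
  rw [show (fun y => φ (f y)) = φ ∘ f from rfl, this.fderiv]; simp

lemma pd_coord (i j : Fin n) (x : Euc n) : pd i (fun y => y j) x = if i = j then 1 else 0 := by
  have : (fun y : Euc n => y j) = (EuclideanSpace.proj j : Euc n →L[ℝ] ℝ) := by
    ext y; simp
  rw [pd, this, ContinuousLinearMap.fderiv]
  simp [eq_comm]

lemma pd_comm {f : Euc n → ℝ} {x : Euc n} (hf : ContDiffAt ℝ 2 f x) (i j : Fin n) :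
    pd i (pd j f) x = pd j (pd i f) x := by
  have h1 : DifferentiableAt ℝ (fderiv ℝ f) x :=
    (hf.fderiv_right (m := 1) (by norm_num)).differentiableAt (by norm_num)
  have e : ∀ a b : Fin n, pd a (pd b f) x =
      fderiv ℝ (fderiv ℝ f) x (EuclideanSpace.single a 1) (EuclideanSpace.single b 1) := by
    intro a b
    simp only [pd]
    have := (h1.hasFDerivAt.clm_apply (hasFDerivAt_const (EuclideanSpace.single b (1 : ℝ)) x))
    have h3 : (fun x => fderiv ℝ f x (EuclideanSpace.single b 1)) = pd b f := rfl
    show fderiv ℝ (fun x => fderiv ℝ f x (EuclideanSpace.single b 1)) x _ = _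
    rw [this.fderiv]
    simp
  rw [e, e]
  exact (hf.isSymmSndFDerivAt (by simp)).eq _ _

lemma ContDiffAt.pd {m k : WithTop ℕ∞} {f : Euc n → ℝ} {x : Euc n} (hf : ContDiffAt ℝ k f x)
    (hk : m + 1 ≤ k) (i : Fin n) : ContDiffAt ℝ m (pd i f) x :=
  (hf.fderiv_right hk).clm_apply contDiffAt_const

lemma ContDiffOn.pd {U : Set (Euc n)} (hU : IsOpen U) {f : Euc n → ℝ}
    (hf : ContDiffOn ℝ ∞ f U) (i : Fin n) : ContDiffOn ℝ ∞ (pd i f) U := fun x hx =>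
  (ContDiffAt.pd (hf.contDiffAt (hU.mem_nhds hx)) (by simp) i).contDiffWithinAt

lemma ContDiffOn.diffAt {U : Set (Euc n)} (hU : IsOpen U) {f : Euc n → ℝ}
    (hf : ContDiffOn ℝ ∞ f U) {x : Euc n} (hx : x ∈ U) : DifferentiableAt ℝ f x :=
  (hf.contDiffAt (hU.mem_nhds hx)).differentiableAt (by simp)

end PartialDerivatives

/-! ### The ring of smooth functions on an open set -/

section SmoothRing
variable {n : ℕ} {U : Set (Euc n)}

/-- Extension of a function on `U` by zero. -/
def extZero (F : U → ℝ) (x : Euc n) : ℝ := open Classical in if h : x ∈ U then F ⟨x, h⟩ else 0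

lemma extZero_apply (F : U → ℝ) (x : U) : extZero F x = F x := by
  simp [extZero]

lemma extZero_of_mem (F : U → ℝ) {x : Euc n} (hx : x ∈ U) : extZero F x = F ⟨x, hx⟩ := by
  simp [extZero, hx]

variable (U) in
/-- The ring of smooth functions on `U`. -/
def SmoothRing : Subalgebra ℝ (U → ℝ) where
  carrier := {F | ContDiffOn ℝ ∞ (extZero F) U}
  mul_mem' {F G} hF hG := (ContDiffOn.mul hF hG).congr fun x hx => by
    simp [extZero_of_mem _ hx]
  add_mem' {F G} hF hG := (ContDiffOn.add hF hG).congr fun x hx => by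
    simp [extZero_of_mem _ hx]
  algebraMap_mem' r := (contDiffOn_const (c := r)).congr fun x hx => by
    simp [extZero_of_mem _ hx]

/-- The restriction of a smooth function. -/
def toSmooth (f : Euc n → ℝ) (hf : ContDiffOn ℝ ∞ f U) : SmoothRing U :=
  ⟨fun x => f x, hf.congr fun x hx => by simp [extZero_of_mem _ hx]⟩

lemma SmoothRing.diffAt (hU : IsOpen U) (F : SmoothRing U) {x : Euc n} (hx : x ∈ U) :
    DifferentiableAt ℝ (extZero (F : U → ℝ)) x := ContDiffOn.diffAt hU F.2 hx

/-- Evaluation at a point. -/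
def ev (F : SmoothRing U) (x : U) : ℝ := F.1 x

/-- The partial derivative as a derivation of the ring of smooth functions. -/
def smoothDer (hU : IsOpen U) (i : Fin n) : Derivation ℝ (SmoothRing U) (SmoothRing U) :=
  Derivation.mk'
    { toFun := fun F => toSmooth (pd i (extZero (F : U → ℝ))) (ContDiffOn.pd hU F.2 i)
      map_add' := fun F G => by
        ext x
        show pd i _ x.1 = pd i _ x.1 + pd i _ x.1
        rw [← pd_add (SmoothRing.diffAt hU F x.2) (SmoothRing.diffAt hU G x.2)]
        exact pd_congr_on hU (fun y hy => by simp [extZero_of_mem _ hy]) x.2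
      map_smul' := fun r F => by
        ext x
        show pd i _ x.1 = r * pd i _ x.1
        rw [← pd_const_mul r (SmoothRing.diffAt hU F x.2)]
        exact pd_congr_on hU (fun y hy => by simp [extZero_of_mem _ hy]) x.2 }
    fun F G => by
      ext x
      show pd i _ x.1 = F.1 x * pd i _ x.1 + G.1 x * pd i _ x.1
      rw [show pd i (extZero ((F * G : SmoothRing U) : U → ℝ)) x.1 =
        pd i (fun y => extZero (F : U → ℝ) y * extZero (G : U → ℝ) y) x.1 from
          pd_congr_on hU (fun y hy => by simp [extZero_of_mem _ hy]) x.2,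
        pd_mul (SmoothRing.diffAt hU F x.2) (SmoothRing.diffAt hU G x.2), extZero_apply, extZero_apply]
      ring

/-- Partial derivatives depend only on germs, so any function that agrees with `F` on the open set
may be used in place of its extension by zero. -/
lemma smoothDer_apply (hU : IsOpen U) (i : Fin n) (F : SmoothRing U) {f : Euc n → ℝ}
    (hf : ∀ x : U, f x = ev (F) x) (x : U) :
    pd i f x = ev (smoothDer hU i F) x :=
  pd_congr_on hU (fun y hy => (hf ⟨y, hy⟩).trans (extZero_of_mem _ hy).symm) x.2

lemma smoothDer_comm (hU : IsOpen U) (i j : Fin n) (F : SmoothRing U) :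
    smoothDer hU i (smoothDer hU j F) = smoothDer hU j (smoothDer hU i F) := by
  ext x
  change ev _ x = ev _ x
  rw [← smoothDer_apply hU i _ (f := pd j (extZero (F : U → ℝ))) (fun _ => rfl),
    ← smoothDer_apply hU j _ (f := pd i (extZero (F : U → ℝ))) (fun _ => rfl)]
  exact pd_comm ((F.2.contDiffAt (hU.mem_nhds x.2)).of_le (by norm_cast)) i j

end SmoothRing

/-! ### Coordinate expressions in the ring of smooth functions -/

/-- `γ` is a smooth nondegenerate symmetric matrix-valued function on the open set `U`. -/
structure IsCoordMetric {n : ℕ} (γ : Euc n → Matrix (Fin n) (Fin n) ℝ) (U : Set (Euc n)) :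
    Prop where
  isOpen : IsOpen U
  smooth : ∀ i j, ContDiffOn ℝ ∞ (fun x => γ x i j) U
  symm : ∀ x ∈ U, ∀ i j, γ x i j = γ x j i
  det_ne : ∀ x ∈ U, (γ x).det ≠ 0

section Transfer
variable {n : ℕ} {U : Set (Euc n)} {γ : Euc n → Matrix (Fin n) (Fin n) ℝ}

lemma contDiffOn_det (h : ∀ i j, ContDiffOn ℝ ∞ (fun x => γ x i j) U) :
    ContDiffOn ℝ ∞ (fun x => (γ x).det) U := by
  simp only [Matrix.det_apply]
  exact ContDiffOn.sum fun σ _ => (contDiffOn_prod fun i _ => h _ _).const_smul _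

lemma IsCoordMetric.smooth_inv (h : IsCoordMetric γ U) (i j : Fin n) :
    ContDiffOn ℝ ∞ (fun x => (γ x)⁻¹ i j) U := by
  have e : ∀ x, (γ x)⁻¹ i j = ((γ x).det)⁻¹ * ((γ x).updateRow j (Pi.single i 1)).det := by
    intro x
    rw [Matrix.inv_def, Matrix.smul_apply, Matrix.adjugate_apply, Ring.inverse_eq_inv', smul_eq_mul]
  simp only [e]
  refine ((contDiffOn_det h.smooth).inv h.det_ne).mul (contDiffOn_det fun a b => ?_)
  simp only [Matrix.updateRow_apply]
  split_ifs
  · exact contDiffOn_const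
  · exact h.smooth a b

/-- The metric as a matrix over the ring of smooth functions. -/
def IsCoordMetric.G (h : IsCoordMetric γ U) (i j : Fin n) : SmoothRing U :=
  toSmooth (fun x => γ x i j) (h.smooth i j)

/-- The inverse metric as a matrix over the ring of smooth functions. -/
def IsCoordMetric.I (h : IsCoordMetric γ U) (i j : Fin n) : SmoothRing U :=
  toSmooth (fun x => (γ x)⁻¹ i j) (h.smooth_inv i j)

/-- The partial derivatives as derivations of the ring of smooth functions. -/
abbrev IsCoordMetric.D (h : IsCoordMetric γ U) (i : Fin n) :
    Derivation ℝ (SmoothRing U) (SmoothRing U) := smoothDer h.isOpen i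

lemma toSmooth_apply (f : Euc n → ℝ) (hf : ContDiffOn ℝ ∞ f U) (x : U) :
    ev (toSmooth f hf) x = f x := rfl

lemma coe_sum {ι : Type*} (s : Finset ι) (F : ι → SmoothRing U) (x : U) :
    ev (∑ a ∈ s, F a) x = ∑ a ∈ s, ev (F a) x := by
  rw [ev, AddSubmonoidClass.coe_finsetSum, Finset.sum_apply]; rfl

lemma coe_C (r : ℝ) (x : U) : ev (algebraMap ℝ (SmoothRing U) r) x = r := rfl

lemma coe_mul' (F G : SmoothRing U) (x : U) :
    ev (F * G) x = ev (F) x * ev (G) x := rfl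

lemma coe_add' (F G : SmoothRing U) (x : U) :
    ev (F + G) x = ev (F) x + ev (G) x := rfl

lemma coe_sub' (F G : SmoothRing U) (x : U) :
    ev (F - G) x = ev (F) x - ev (G) x := rfl

lemma coe_neg' (F : SmoothRing U) (x : U) :
    ev (-F) x = -ev (F) x := rfl

lemma coe_pow' (F : SmoothRing U) (k : ℕ) (x : U) :
    ev (F ^ k) x = ev (F) x ^ k := rfl

lemma coe_ofNat' (k : ℕ) [k.AtLeastTwo] (x : U) :
    ev (OfNat.ofNat k) x = OfNat.ofNat k := rfl

lemma IsCoordMetric.isMetric (h : IsCoordMetric γ U) : Formal.IsMetric h.D h.G h.I where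
  comm := smoothDer_comm h.isOpen
  g_symm i j := by ext x; exact h.symm x x.2 i j
  H_symm i j := by
    ext x
    have : (γ x).transpose = γ x := by ext i j; exact h.symm x x.2 j i
    show (γ x)⁻¹ i j = (γ x)⁻¹ j i
    conv_rhs => rw [← this, ← Matrix.transpose_nonsing_inv]
    rfl
  Hg i k := by
    ext x
    change ev _ x = ev _ x
    rw [coe_sum]
    have : ((γ x)⁻¹ * γ x) i k = (1 : Matrix (Fin n) (Fin n) ℝ) i k := by
      rw [Matrix.nonsing_inv_mul _ (isUnit_iff_ne_zero.mpr (h.det_ne x x.2))]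
    rw [Matrix.mul_apply, Matrix.one_apply] at this
    show ∑ j, (γ x)⁻¹ i j * γ x j k = _
    rw [this]
    split_ifs <;> rfl

variable (h : IsCoordMetric γ U) (x : U)

/-- From here to `paneitz_eq`, a dictionary: each coordinate expression is the value of its formal
counterpart in the ring of smooth functions, so the formal identities hold pointwise. -/
lemma IsCoordMetric.christoffel_eq (h : IsCoordMetric γ U) (k i j : Fin n) (x : U) :
    christoffel γ k i j x = ev (Formal.chr h.D h.G h.I k i j) x := by
  have e : ∀ a b c, pd a (fun y => γ y b c) x = ev (h.D a (h.G b c)) x := fun a b c =>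
    smoothDer_apply h.isOpen a _ (fun _ => rfl) x
  simp only [christoffel, Formal.chr, coe_mul', coe_C, coe_sum, coe_add', coe_sub', e]
  rfl

lemma IsCoordMetric.riemannUp_eq (h : IsCoordMetric γ U) (i j k m : Fin n) (x : U) :
    riemannUp γ i j k m x = ev (Formal.riem h.D h.G h.I i j k m) x := by
  simp only [riemannUp, Formal.riem, coe_mul', coe_sum, coe_add', coe_sub',
    ← h.christoffel_eq, ← smoothDer_apply h.isOpen _ _ (h.christoffel_eq _ _ _)]

lemma IsCoordMetric.ricci_eq (h : IsCoordMetric γ U) (j k : Fin n) (x : U) :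
    ricci γ j k x = ev (Formal.ric h.D h.G h.I j k) x := by
  simp only [ricci, Formal.ric, coe_sum, ← h.riemannUp_eq]

lemma IsCoordMetric.scalarCurv_eq (h : IsCoordMetric γ U) (x : U) :
    scalarCurv γ x = ev (Formal.scal h.D h.G h.I) x := by
  simp only [scalarCurv, Formal.scal, coe_sum, coe_mul', ← h.ricci_eq]; rfl

lemma IsCoordMetric.schouten_eq (h : IsCoordMetric γ U) (i j : Fin n) (x : U) :
    schouten γ i j x = ev (Formal.sch h.D h.G h.I i j) x := by
  simp only [schouten, Formal.sch, coe_sub', coe_mul', coe_C, ← h.ricci_eq, ← h.scalarCurv_eq,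
    IsCoordMetric.G, toSmooth_apply]
  ring

lemma IsCoordMetric.divergence_eq (h : IsCoordMetric γ U) {V : Fin n → Euc n → ℝ}
    {V' : Fin n → SmoothRing U} (hV : ∀ k, ∀ x : U, V k x = ev (V' k) x) (x : U) :
    divergence γ V x = ev (Formal.dv h.D h.G h.I V') x := by
  simp only [divergence, Formal.dv, coe_sum, coe_add', coe_mul', ← h.christoffel_eq, ← hV,
    ← smoothDer_apply h.isOpen _ _ (hV _)]

lemma IsCoordMetric.laplacian_eq (h : IsCoordMetric γ U) {u : Euc n → ℝ}
    {u' : SmoothRing U} (hu : ∀ x : U, u x = ev (u') x) (x : U) :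
    laplacian γ u x = ev (Formal.lap h.D h.G h.I u') x := by
  refine h.divergence_eq (fun k x => ?_) x
  simp only [Formal.grad, coe_sum, coe_mul', ← smoothDer_apply h.isOpen _ _ hu,
    IsCoordMetric.I, toSmooth_apply]

lemma IsCoordMetric.divTensorGrad_eq (h : IsCoordMetric γ U) {T : Fin n → Fin n → Euc n → ℝ}
    {T' : Fin n → Fin n → SmoothRing U} (hT : ∀ i j, ∀ x : U, T i j x = ev (T' i j) x)
    {u : Euc n → ℝ} {u' : SmoothRing U} (hu : ∀ x : U, u x = ev (u') x) (x : U) :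
    divTensorGrad γ T u x = ev (Formal.divTG h.D h.G h.I T' u') x := by
  refine h.divergence_eq (fun k x => ?_) x
  simp only [coe_sum, coe_mul', ← smoothDer_apply h.isOpen _ _ hu, ← hT,
    IsCoordMetric.I, toSmooth_apply]

lemma IsCoordMetric.sigma1_eq (h : IsCoordMetric γ U) (x : U) :
    sigma1 γ x = ev (Formal.sig1 h.D h.G h.I) x := by
  simp only [sigma1, Formal.sig1, coe_sum, coe_mul', ← h.schouten_eq]; rfl

lemma IsCoordMetric.qCurv_eq (h : IsCoordMetric γ U) (x : U) :
    qCurv γ x = ev (Formal.qc h.D h.G h.I) x := by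
  simp only [qCurv, Formal.qc, coe_neg', coe_add', coe_mul', coe_pow', coe_C, coe_sub', sigma2,
    schoutenSq, Formal.ip, coe_sum, ← h.schouten_eq, ← h.sigma1_eq,
    ← h.laplacian_eq h.sigma1_eq]
  rfl

lemma IsCoordMetric.paneitz_eq (h : IsCoordMetric γ U) {u : Euc n → ℝ}
    {u' : SmoothRing U} (hu : ∀ x : U, u x = ev (u') x) (x : U) :
    paneitz γ u x = ev (Formal.pan h.D h.G h.I u') x := by
  have hT : ∀ i j, ∀ x : U, 4 * schouten γ i j x - ((n : ℝ) - 2) * sigma1 γ x * γ x i j =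
      ev (4 * Formal.sch h.D h.G h.I i j - algebraMap ℝ (SmoothRing U) ((n : ℝ) - 2) *
        Formal.sig1 h.D h.G h.I * h.G i j) x := by
    intro i j x
    simp only [coe_sub', coe_mul', coe_C, ← h.schouten_eq, ← h.sigma1_eq]
    rfl
  simp only [paneitz, Formal.pan, coe_add', coe_mul', coe_C, ← h.qCurv_eq, ← hu,
    ← h.laplacian_eq (h.laplacian_eq hu), ← h.divTensorGrad_eq
      (T := fun i j y => 4 * schouten γ i j y - ((n : ℝ) - 2) * sigma1 γ y * γ y i j) hT hu]

/-- If `P_γ u = 0` at a point then the `Q`-curvature of `u^{4/(n-4)} γ` vanishes there. -/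
theorem IsCoordMetric.qCurv_conformal_eq_zero (hn : 5 ≤ n) (h : IsCoordMetric γ U)
    {u : Euc n → ℝ} (hu : ContDiffOn ℝ ∞ u U) (hpos : ∀ x ∈ U, 0 < u x) {x : Euc n} (hx : x ∈ U)
    (hP : paneitz γ u x = 0) :
    qCurv (fun y => (u y ^ (4 / ((n : ℝ) - 4))) • γ y) x = 0 := by
  have h5 : (5 : ℝ) ≤ n := by exact_mod_cast hn
  have h4 : (n : ℝ) - 4 ≠ 0 := by linarith
  have hpow : ∀ q : ℝ, ContDiffOn ℝ ∞ (fun y => u y ^ q) U := fun q =>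
    hu.rpow_const_of_ne fun y hy => (hpos y hy).ne'
  set q := 4 / ((n : ℝ) - 4) with hq
  have h' : IsCoordMetric (fun y => (u y ^ q) • γ y) U :=
    { isOpen := h.isOpen
      smooth := fun i j => (hpow q).mul (h.smooth i j)
      symm := fun y hy i j => by simp [h.symm y hy i j]
      det_ne := fun y hy => by
        rw [Matrix.det_smul]
        exact mul_ne_zero (pow_ne_zero _ (Real.rpow_pos_of_pos (hpos y hy) _).ne') (h.det_ne y hy) }
  -- This is w with e^{2w} = u^{4/(n-4)}, equivalently u = e^{(n-4)w/2}, as `qc_conf` requires.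
  have hlog : ContDiffOn ℝ ∞ (fun y => 2 / ((n : ℝ) - 4) * Real.log (u y)) U :=
    contDiffOn_const.mul (hu.log fun y hy => (hpos y hy).ne')
  have hud : ∀ y ∈ U, DifferentiableAt ℝ u y := fun y hy => ContDiffOn.diffAt h.isOpen hu hy
  have hpdlog : ∀ i, ∀ y ∈ U, pd i (fun y => 2 / ((n : ℝ) - 4) * Real.log (u y)) y =
      2 / ((n : ℝ) - 4) * ((u y)⁻¹ * pd i u y) := by
    intro i y hy
    rw [pd_const_mul _ ((hud y hy).log (hpos y hy).ne'),
      pd_comp (Real.hasDerivAt_log (hpos y hy).ne') (hud y hy)]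
  have c : Formal.IsConf h.D (toSmooth _ hlog) (toSmooth _ (hpow q)) (toSmooth _ (hpow (-q))) :=
    { inv := by
        ext y
        show u y ^ q * u y ^ (-q) = 1
        rw [← Real.rpow_add (hpos y y.2), add_neg_cancel, Real.rpow_zero]
      der := fun i => by
        ext y
        change ev _ y = ev _ y
        rw [coe_mul', coe_mul', ← smoothDer_apply h.isOpen i _ (toSmooth_apply _ _ · |>.symm),
          ← smoothDer_apply h.isOpen i _ (toSmooth_apply _ _ · |>.symm), coe_ofNat', toSmooth_apply]
        rw [hpdlog i y y.2, pd_comp (Real.hasDerivAt_rpow_const (Or.inl (hpos y y.2).ne'))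
          (hud y y.2), Real.rpow_sub_one (hpos y y.2).ne', hq]
        field_simp
        ring }
  have key := h.isMetric.qc_conf hn c (u := toSmooth u hu) (fun i => by
    ext y
    change ev _ y = ev _ y
    rw [coe_mul', coe_mul', ← smoothDer_apply h.isOpen i _ (toSmooth_apply _ _ · |>.symm),
          ← smoothDer_apply h.isOpen i _ (toSmooth_apply _ _ · |>.symm), coe_C, toSmooth_apply, hpdlog i y y.2]
    have := (hpos y y.2).ne'
    field_simp)
  have e1 : (fun i j => toSmooth _ (hpow q) * h.G i j) = h'.G := by
    funext i j; ext y; rfl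
  have e2 : (fun i j => toSmooth _ (hpow (-q)) * h.I i j) = h'.I := by
    funext i j; ext y
    show u y ^ (-q) * (γ y)⁻¹ i j = ((u y ^ q) • γ y)⁻¹ i j
    have hne : u y ^ q ≠ 0 := (Real.rpow_pos_of_pos (hpos y y.2) _).ne'
    have : ((u y ^ q) • γ y)⁻¹ = (u y ^ q)⁻¹ • (γ y)⁻¹ := by
      refine Matrix.inv_eq_right_inv ?_
      rw [Matrix.smul_mul, Matrix.mul_smul, smul_smul, mul_inv_cancel₀ hne, one_smul,
        Matrix.mul_nonsing_inv _ (isUnit_iff_ne_zero.mpr (h.det_ne y y.2))]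
    rw [this, Real.rpow_neg (hpos y y.2).le]; rfl
  rw [e1, e2] at key
  have k2 := congrArg (fun F => ev F ⟨x, hx⟩) key
  beta_reduce at k2
  have k3 := h.paneitz_eq (u := u) (u' := toSmooth u hu) (fun _ => rfl) ⟨x, hx⟩
  rw [← k3, hP] at k2
  have k4 := h'.qCurv_eq ⟨x, hx⟩
  change qCurv (fun y => (u y ^ q) • γ y) x = _ at k4
  change 0 = ((n : ℝ) - 4) / 2 * (ev (Formal.qc h'.D h'.G h'.I) ⟨x, hx⟩ * (u x ^ q) ^ 2 * u x)
    at k2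
  rw [← k4] at k2
  -- All the factors multiplying Q in the covariance law are nonzero, so Q itself must vanish.
  have hne : u x ^ q ≠ 0 := (Real.rpow_pos_of_pos (hpos x hx) _).ne'
  have := hpos x hx
  simp only [zero_eq_mul, mul_eq_zero, div_eq_zero_iff, h4, this.ne'] at k2
  simpa [hne] using k2

end Transfer

/-! ### Jacobi's formula and the trace of the Christoffel symbols. -/

namespace Formal
section Jacobi
variable {n : ℕ} {R : Type*} [CommRing R] [Algebra ℝ R] {D : Fin n → Derivation ℝ R R}
  {g H : Fin n → Fin n → R}

lemma der_prod {ι : Type*} [DecidableEq ι] (d : Derivation ℝ R R) (s : Finset ι) (f : ι → R) :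
    d (∏ i ∈ s, f i) = ∑ i ∈ s, d (f i) * ∏ j ∈ s.erase i, f j := by
  induction s using Finset.induction_on with
  | empty => simp
  | insert a s ha ih =>
    rw [Finset.prod_insert ha, der_mul, ih, Finset.sum_insert ha, Finset.erase_insert ha,
      Finset.mul_sum]
    congr 1
    refine Finset.sum_congr rfl fun i hi => ?_
    rw [Finset.erase_insert_of_ne (fun h => ha (by rw [h]; exact hi)),
      Finset.prod_insert (fun h => ha (Finset.mem_of_mem_erase h))]
    ring

/-- Jacobi's formula. -/
lemma der_det (d : Derivation ℝ R R) (M : Matrix (Fin n) (Fin n) R) :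
    d M.det = ∑ i, ∑ l, M.adjugate i l * d (M l i) := by
  have h1 : ∀ i, ∑ l, M.adjugate i l * d (M l i) = (M.updateCol i fun l => d (M l i)).det := by
    intro i
    rw [← Matrix.cramer_apply, Matrix.cramer_eq_adjugate_mulVec]; rfl
  simp only [h1, Matrix.det_apply, map_sum]
  rw [Finset.sum_comm]
  refine Finset.sum_congr rfl fun σ _ => ?_
  rw [Units.smul_def, map_zsmul, der_prod, Finset.smul_sum]
  refine Finset.sum_congr rfl fun i _ => ?_
  rw [Units.smul_def]
  congr 1
  rw [← Finset.mul_prod_erase _ _ (Finset.mem_univ i), Matrix.updateCol_self]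
  congr 1
  refine Finset.prod_congr rfl fun j hj => ?_
  rw [Matrix.updateCol_ne (Finset.ne_of_mem_erase hj)]

/-- Two of the three derivative terms in Γ^i_ik exchange under the symmetry of H and cancel. -/
lemma IsMetric.chrTr_eq (h : IsMetric D g H) (k : Fin n) :
    2 * chrTr D g H k = ∑ i, ∑ l, H i l * D k (g l i) := by
  have e : chrTr D g H k = algebraMap ℝ R (1 / 2) * (∑ i, ∑ l, H i l * D i (g k l)
      + ∑ i, ∑ l, H i l * D k (g l i) - ∑ i, ∑ l, H i l * D l (g k i)) := by
    simp only [chrTr, chr, ← Finset.mul_sum, mul_add, mul_sub, Finset.sum_add_distrib,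
      Finset.sum_sub_distrib, h.g_symm _ k]
    have : ∀ i l, g i l = g l i := h.g_symm
    rw [Finset.sum_congr (s₁ := Finset.univ) (f := fun i => ∑ l, H i l * D k (g i l)) rfl fun i _ =>
      Finset.sum_congr rfl fun l _ => by rw [this i l]]
  have e2 : ∑ i, ∑ l, H i l * D l (g k i) = ∑ i, ∑ l, H i l * D i (g k l) := by
    rw [Finset.sum_comm]
    exact Finset.sum_congr rfl fun _ _ => Finset.sum_congr rfl fun _ _ => by rw [h.H_symm]
  rw [e, e2]
  linear_combination (∑ i, ∑ l, H i l * D k (g l i)) * two_half (R := R)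

lemma IsMetric.der_det_metric (h : IsMetric D g H) (k : Fin n) :
    D k (Matrix.of g).det = 2 * (Matrix.of g).det * chrTr D g H k := by
  have e : (Matrix.of g).adjugate = (Matrix.of g).det • Matrix.of H := by
    calc (Matrix.of g).adjugate = (Matrix.of g).adjugate * (Matrix.of g * Matrix.of H) := by
          rw [h.gH_mat, mul_one]
      _ = _ := by rw [← Matrix.mul_assoc, Matrix.adjugate_mul, Matrix.smul_mul, one_mul]
  rw [der_det, e, mul_comm (2 : R), mul_assoc, h.chrTr_eq, Finset.mul_sum]
  refine Finset.sum_congr rfl fun i _ => ?_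
  rw [Finset.mul_sum]
  exact Finset.sum_congr rfl fun l _ => by
    simp only [Matrix.smul_apply, Matrix.of_apply, smul_eq_mul]; ring

end Jacobi
end Formal

/-! ### The Riemannian density and weak solutions. -/

section Density
variable {n : ℕ} {U : Set (Euc n)} {γ : Euc n → Matrix (Fin n) (Fin n) ℝ}

lemma contDiffOn_of_eq_ev {f : Euc n → ℝ} {F : SmoothRing U} (h : ∀ x : U, f x = ev F x) :
    ContDiffOn ℝ ∞ f U :=
  F.2.congr fun x hx => (h ⟨x, hx⟩).trans (extZero_of_mem _ hx).symm

lemma IsCoordMetric.pd_det (h : IsCoordMetric γ U) {x : Euc n} (hx : x ∈ U) (k : Fin n) :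
    pd k (fun y => (γ y).det) x = 2 * (γ x).det * ∑ j, christoffel γ j j k x := by
  have hd : ∀ y : U, (γ y).det = ev (Matrix.of h.G).det y := by
    intro y
    have := RingHom.map_det ((Pi.evalRingHom (fun _ : U => ℝ) y).comp
      (SmoothRing U).val.toRingHom) (Matrix.of h.G)
    exact this.symm
  have := smoothDer_apply (f := fun y => (γ y).det) h.isOpen k _ hd ⟨x, hx⟩
  rw [h.isMetric.der_det_metric] at this
  rw [this]
  simp only [coe_mul', Formal.chrTr, coe_sum, ← h.christoffel_eq, ← hd]
  rfl

/-- The Riemannian density `√(det γ)`. -/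
def density (γ : Euc n → Matrix (Fin n) (Fin n) ℝ) (x : Euc n) : ℝ := Real.sqrt (γ x).det

lemma IsCoordMetric.density_smooth (h : IsCoordMetric γ U) (hdet : ∀ x ∈ U, 0 < (γ x).det) :
    ContDiffOn ℝ ∞ (density γ) U :=
  (contDiffOn_det h.smooth).sqrt fun x hx => (hdet x hx).ne'

lemma IsCoordMetric.pd_density (h : IsCoordMetric γ U) (hdet : ∀ x ∈ U, 0 < (γ x).det)
    {x : Euc n} (hx : x ∈ U) (k : Fin n) :
    pd k (density γ) x = density γ x * ∑ j, christoffel γ j j k x := by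
  have h1 : pd k (density γ) x = 1 / (2 * Real.sqrt (γ x).det) * pd k (fun y => (γ y).det) x :=
    pd_comp (Real.hasDerivAt_sqrt (hdet x hx).ne')
      (ContDiffOn.diffAt h.isOpen (contDiffOn_det h.smooth) hx)
  rw [h1, h.pd_det hx, density]
  have h2 : Real.sqrt (γ x).det ≠ 0 := (Real.sqrt_pos.mpr (hdet x hx)).ne'
  have h3 := Real.mul_self_sqrt (hdet x hx).le
  field_simp
  rw [sq, h3]

/-! ### Integration by parts -/

lemma integral_pd_eq_zero {F : Euc n → ℝ} (hF : ContDiff ℝ 1 F) (hc : HasCompactSupport F)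
    (k : Fin n) : ∫ x, pd k F x = 0 := by
  have hpd : Continuous (pd k F) := (hF.continuous_fderiv (by norm_num)).clm_apply continuous_const
  have hpc : HasCompactSupport (pd k F) := hc.fderiv_apply (𝕜 := ℝ) _
  have := integral_mul_fderiv_eq_neg_fderiv_mul_of_integrable (𝕜 := ℝ)
    (μ := MeasureTheory.volume)
    (f := fun _ : Euc n => (1 : ℝ)) (g := F) (v := EuclideanSpace.single k 1)
    (by simp) (by simp only [one_mul]; exact hpd.integrable_of_hasCompactSupport hpc)
    (by simpa using hF.continuous.integrable_of_hasCompactSupport hc)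
    (fun x _ => differentiableAt_const _) (fun x _ => hF.differentiable (by norm_num) x)
  simpa [pd] using this

lemma pd_eq_zero_of_notMem {K : Set (Euc n)} (hK : IsClosed K) {f : Euc n → ℝ}
    (hf : ∀ x ∉ K, f x = 0) (k : Fin n) : ∀ x ∉ K, pd k f x = 0 := fun x hx => by
  rw [pd_congr_on hK.isOpen_compl (g := fun _ => 0) (fun y hy => hf y hy) hx, pd_const]

lemma contDiff_of_supported (hU : IsOpen U) {K : Set (Euc n)} (hK : IsClosed K) (hKU : K ⊆ U)
    {f : Euc n → ℝ} (hf : ContDiffOn ℝ ∞ f U) (h0 : ∀ x ∉ K, f x = 0) : ContDiff ℝ ∞ f := by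
  rw [contDiff_iff_contDiffAt]
  intro x
  by_cases hx : x ∈ U
  · exact hf.contDiffAt (hU.mem_nhds hx)
  · refine (contDiffAt_const (c := (0 : ℝ))).congr_of_eventuallyEq ?_
    filter_upwards [hK.isOpen_compl.mem_nhds (fun h => hx (hKU h))] with y hy using h0 y hy

lemma hasCompactSupport_of_supported {K : Set (Euc n)} (hK : IsCompact K) {f : Euc n → ℝ}
    (h0 : ∀ x ∉ K, f x = 0) : HasCompactSupport f := HasCompactSupport.intro hK h0

lemma divergence_eq_zero_of_notMem {K : Set (Euc n)} (hK : IsClosed K)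
    {V : Fin n → Euc n → ℝ} (hV : ∀ k, ∀ x ∉ K, V k x = 0) : ∀ x ∉ K, divergence γ V x = 0 := by
  intro x hx
  simp [divergence, pd_eq_zero_of_notMem hK (hV _) _ x hx, hV _ x hx]

/-- The divergence theorem for `ψ V` with compact support. -/
lemma IsCoordMetric.integral_div (h : IsCoordMetric γ U) (hdet : ∀ x ∈ U, 0 < (γ x).det)
    {K : Set (Euc n)} (hK : IsCompact K) (hKU : K ⊆ U) {ψ : Euc n → ℝ} {V : Fin n → Euc n → ℝ}
    (hψ : ContDiffOn ℝ ∞ ψ U) (hV : ∀ k, ContDiffOn ℝ ∞ (V k) U)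
    (h0 : (∀ x ∉ K, ψ x = 0) ∨ ∀ k, ∀ x ∉ K, V k x = 0) :
    MeasureTheory.Integrable (fun x => (ψ x * divergence γ V x + ∑ k, V k x * pd k ψ x)
      * density γ x) ∧
    ∫ x, (ψ x * divergence γ V x + ∑ k, V k x * pd k ψ x) * density γ x = 0 := by
  have hρ := h.density_smooth hdet
  have hF0 : ∀ k, ∀ x ∉ K, ψ x * V k x * density γ x = 0 := by
    intro k x hx
    rcases h0 with h0 | h0
    · rw [h0 x hx]; ring
    · rw [h0 k x hx]; ring
  have hF : ∀ k, ContDiff ℝ ∞ fun x => ψ x * V k x * density γ x := fun k =>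
    contDiff_of_supported h.isOpen hK.isClosed hKU ((hψ.mul (hV k)).mul hρ) (hF0 k)
  have hFc : ∀ k, HasCompactSupport fun x => ψ x * V k x * density γ x := fun k =>
    hasCompactSupport_of_supported hK (hF0 k)
  -- By `pd_density`, √det · div V is the Euclidean divergence of √det · V; the integrand is a sum
  -- of partial derivatives of compactly supported functions.
  have e : (fun x => (ψ x * divergence γ V x + ∑ k, V k x * pd k ψ x) * density γ x) =
      fun x => ∑ k, pd k (fun x => ψ x * V k x * density γ x) x := by
    funext x
    by_cases hx : x ∈ U
    · have d1 := ContDiffOn.diffAt h.isOpen hψ hx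
      have d2 := fun k => ContDiffOn.diffAt h.isOpen (hV k) hx
      have d3 := ContDiffOn.diffAt h.isOpen hρ hx
      rw [divergence, Finset.mul_sum, ← Finset.sum_add_distrib, Finset.sum_mul]
      refine Finset.sum_congr rfl fun k _ => ?_
      rw [pd_mul (f := fun x => ψ x * V k x) (d1.mul (d2 k)) d3, pd_mul d1 (d2 k), h.pd_density hdet hx, ← Finset.sum_mul]
      ring
    · have hxK : x ∉ K := fun hh => hx (hKU hh)
      have : ∀ k, pd k (fun x => ψ x * V k x * density γ x) x = 0 := fun k =>
        pd_eq_zero_of_notMem hK.isClosed (hF0 k) k x hxK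
      simp only [this, Finset.sum_const_zero]
      rcases h0 with h0 | h0
      · simp [h0 x hxK, pd_eq_zero_of_notMem hK.isClosed h0 _ x hxK]
      · simp [h0 _ x hxK, divergence_eq_zero_of_notMem hK.isClosed h0 x hxK]
  have hint : ∀ k, MeasureTheory.Integrable (pd k fun x => ψ x * V k x * density γ x) := by
    intro k
    refine Continuous.integrable_of_hasCompactSupport ?_ ?_
    · exact ((hF k).continuous_fderiv (by simp)).clm_apply continuous_const
    · exact (hFc k).fderiv_apply (𝕜 := ℝ) _
  rw [e]
  refine ⟨MeasureTheory.integrable_finsetSum _ fun k _ => hint k, ?_⟩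
  rw [MeasureTheory.integral_finsetSum _ fun k _ => hint k]
  exact Finset.sum_eq_zero fun k _ => integral_pd_eq_zero ((hF k).of_le (by simp)) (hFc k) k

/-- The gradient vector field. -/
def gradient (γ : Euc n → Matrix (Fin n) (Fin n) ℝ) (u : Euc n → ℝ) (k : Fin n) (y : Euc n) : ℝ :=
  ∑ l, (γ y)⁻¹ k l * pd l u y

/-- The vector field `T(∇u, ·)`. -/
def tensorGrad (γ : Euc n → Matrix (Fin n) (Fin n) ℝ) (T : Fin n → Fin n → Euc n → ℝ)
    (u : Euc n → ℝ) (k : Fin n) (y : Euc n) : ℝ :=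
  ∑ i, ∑ j, ∑ l, (γ y)⁻¹ i k * (γ y)⁻¹ j l * T i j y * pd l u y

lemma IsCoordMetric.gradient_smooth (h : IsCoordMetric γ U) {u : Euc n → ℝ}
    (hu : ContDiffOn ℝ ∞ u U) (k : Fin n) : ContDiffOn ℝ ∞ (gradient γ u k) U :=
  ContDiffOn.sum fun l _ => (h.smooth_inv k l).mul (ContDiffOn.pd h.isOpen hu l)

lemma IsCoordMetric.tensorGrad_smooth (h : IsCoordMetric γ U) {u : Euc n → ℝ}
    {T : Fin n → Fin n → Euc n → ℝ} (hT : ∀ i j, ContDiffOn ℝ ∞ (T i j) U)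
    (hu : ContDiffOn ℝ ∞ u U) (k : Fin n) : ContDiffOn ℝ ∞ (tensorGrad γ T u k) U :=
  ContDiffOn.sum fun i _ => ContDiffOn.sum fun j _ => ContDiffOn.sum fun l _ =>
    (((h.smooth_inv i k).mul (h.smooth_inv j l)).mul (hT i j)).mul (ContDiffOn.pd h.isOpen hu l)

lemma IsCoordMetric.inv_symm (h : IsCoordMetric γ U) {x : Euc n} (hx : x ∈ U) (i j : Fin n) :
    (γ x)⁻¹ i j = (γ x)⁻¹ j i := congrArg (fun F => ev F ⟨x, hx⟩) (h.isMetric.H_symm i j)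

lemma IsCoordMetric.laplacian_smooth (h : IsCoordMetric γ U) {u : Euc n → ℝ}
    (hu : ContDiffOn ℝ ∞ u U) : ContDiffOn ℝ ∞ (laplacian γ u) U :=
  contDiffOn_of_eq_ev (h.laplacian_eq (u' := toSmooth u hu) fun _ => rfl)

lemma IsCoordMetric.paneitz_smooth (h : IsCoordMetric γ U) {u : Euc n → ℝ}
    (hu : ContDiffOn ℝ ∞ u U) : ContDiffOn ℝ ∞ (paneitz γ u) U :=
  contDiffOn_of_eq_ev (h.paneitz_eq (u' := toSmooth u hu) fun _ => rfl)

lemma IsCoordMetric.gradient_pair (h : IsCoordMetric γ U) {x : Euc n} (hx : x ∈ U)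
    (u v : Euc n → ℝ) :
    ∑ k, gradient γ u k x * pd k v x = ∑ k, gradient γ v k x * pd k u x := by
  simp only [gradient, Finset.sum_mul]
  rw [Finset.sum_comm]
  exact Finset.sum_congr rfl fun i _ => Finset.sum_congr rfl fun j _ => by
    rw [h.inv_symm hx]; ring

lemma tensorGrad_pair {T : Fin n → Fin n → Euc n → ℝ} {x : Euc n}
    (hT : ∀ i j, T i j x = T j i x) (u v : Euc n → ℝ) :
    ∑ k, tensorGrad γ T u k x * pd k v x = ∑ k, tensorGrad γ T v k x * pd k u x := by
  simp only [tensorGrad, Finset.sum_mul]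
  simp only [← Fintype.sum_prod_type']
  refine Fintype.sum_equiv ⟨fun p => (p.2.2.2, p.2.2.1, p.2.1, p.1),
    fun p => (p.2.2.2, p.2.2.1, p.2.1, p.1), fun _ => rfl, fun _ => rfl⟩ _ _ fun p => ?_
  simp only [Equiv.coe_fn_mk]
  rw [hT p.2.1]; ring

/-- The 2-tensor `4A - (n-2) σ₁(A) g` in the Paneitz operator. -/
def paneitzTensor (γ : Euc n → Matrix (Fin n) (Fin n) ℝ) (i j : Fin n) (y : Euc n) : ℝ :=
  4 * schouten γ i j y - ((n : ℝ) - 2) * sigma1 γ y * γ y i j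

lemma IsCoordMetric.paneitzTensor_smooth (h : IsCoordMetric γ U) (i j : Fin n) :
    ContDiffOn ℝ ∞ (paneitzTensor γ i j) U :=
  (contDiffOn_const.mul (contDiffOn_of_eq_ev (h.schouten_eq i j))).sub
    ((contDiffOn_const.mul (contDiffOn_of_eq_ev h.sigma1_eq)).mul (h.smooth i j))

lemma IsCoordMetric.paneitzTensor_symm (h : IsCoordMetric γ U) {x : Euc n} (hx : x ∈ U)
    (i j : Fin n) : paneitzTensor γ i j x = paneitzTensor γ j i x := by
  have h1 : ricci γ i j x = ricci γ j i x := by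
    rw [h.ricci_eq i j ⟨x, hx⟩, h.ricci_eq j i ⟨x, hx⟩, h.isMetric.ric_symm]
  simp only [paneitzTensor, schouten, h1, h.symm x hx i j]

lemma paneitz_expand (u : Euc n → ℝ) (x : Euc n) :
    paneitz γ u x = divergence γ (gradient γ (laplacian γ u)) x
      + divergence γ (tensorGrad γ (paneitzTensor γ) u) x
      + ((n : ℝ) - 4) / 2 * qCurv γ x * u x := rfl

/-- Bookkeeping for `paneitz_eq_zero_of_weak`, where six applications of the divergence theorem
account for the difference of the two integrands. -/
lemma integral_eq_zero_of_null_terms {b₁ b₂ b₃ b₄ b₅ b₆ f F : Euc n → ℝ}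
    (h₁ : MeasureTheory.Integrable b₁ ∧ ∫ x, b₁ x = 0)
    (h₂ : MeasureTheory.Integrable b₂ ∧ ∫ x, b₂ x = 0)
    (h₃ : MeasureTheory.Integrable b₃ ∧ ∫ x, b₃ x = 0)
    (h₄ : MeasureTheory.Integrable b₄ ∧ ∫ x, b₄ x = 0)
    (h₅ : MeasureTheory.Integrable b₅ ∧ ∫ x, b₅ x = 0)
    (h₆ : MeasureTheory.Integrable b₆ ∧ ∫ x, b₆ x = 0)
    (hf : MeasureTheory.Integrable f)
    (e : ∀ x, F x = f x + (b₁ x - b₂ x + b₃ x - b₄ x + b₅ x - b₆ x))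
    (hF : ∫ x, F x = 0) : ∫ x, f x = 0 := by
  have e' : F = f + (b₁ - b₂ + b₃ - b₄ + b₅ - b₆) := funext e
  rw [e', MeasureTheory.integral_add' hf
      (((((h₁.1.sub h₂.1).add h₃.1).sub h₄.1).add h₅.1).sub h₆.1),
    MeasureTheory.integral_sub' ((((h₁.1.sub h₂.1).add h₃.1).sub h₄.1).add h₅.1) h₆.1,
    MeasureTheory.integral_add' (((h₁.1.sub h₂.1).add h₃.1).sub h₄.1) h₅.1,
    MeasureTheory.integral_sub' ((h₁.1.sub h₂.1).add h₃.1) h₄.1,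
    MeasureTheory.integral_add' (h₁.1.sub h₂.1) h₃.1,
    MeasureTheory.integral_sub' h₁.1 h₂.1, h₁.2, h₂.2, h₃.2, h₄.2, h₅.2, h₆.2] at hF
  simpa using hF

/-- A weak solution of `P u = 0` that is smooth is a classical solution. -/
theorem IsCoordMetric.paneitz_eq_zero_of_weak (h : IsCoordMetric γ U)
    (hdet : ∀ x ∈ U, 0 < (γ x).det) {u : Euc n → ℝ} (hu : ContDiffOn ℝ ∞ u U)
    (hw : ∀ φ : Euc n → ℝ, ContDiff ℝ ∞ φ → HasCompactSupport φ → tsupport φ ⊆ U →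
      ∫ x, u x * paneitz γ φ x * density γ x = 0) :
    ∀ x ∈ U, paneitz γ u x = 0 := by
  have hρ := h.density_smooth hdet
  have hPu := h.paneitz_smooth hu
  -- Formal self-adjointness of P: all derivatives are moved from φ to u.
  have key : ∀ φ : Euc n → ℝ, ContDiff ℝ ∞ φ → HasCompactSupport φ → tsupport φ ⊆ U →
      ∫ x, φ x • (paneitz γ u x * density γ x) = 0 := by
    intro φ hφ hc hs
    have hK : IsCompact (tsupport φ) := hc
    have hφ0 : ∀ x ∉ tsupport φ, φ x = 0 := fun x hx => image_eq_zero_of_notMem_tsupport hx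
    have hφU : ContDiffOn ℝ ∞ φ U := hφ.contDiffOn
    have hpd0 := pd_eq_zero_of_notMem hK.isClosed hφ0
    have hg0 : ∀ k, ∀ x ∉ tsupport φ, gradient γ φ k x = 0 := fun k x hx => by
      simp [gradient, hpd0 _ x hx]
    have hl0 : ∀ x ∉ tsupport φ, laplacian γ φ x = 0 := divergence_eq_zero_of_notMem hK.isClosed hg0
    have hlg0 : ∀ k, ∀ x ∉ tsupport φ, gradient γ (laplacian γ φ) k x = 0 := fun k x hx => by
      simp [gradient, pd_eq_zero_of_notMem hK.isClosed hl0 _ x hx]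
    have ht0 : ∀ k, ∀ x ∉ tsupport φ, tensorGrad γ (paneitzTensor γ) φ k x = 0 := fun k x hx => by
      simp [tensorGrad, hpd0 _ x hx]
    -- The identities are used in differences in which the first-order products cancel by symmetry:
    -- `b1 - b2` replaces u Δ²φ by Δu Δφ, `b3 - b4` replaces this by φ Δ²u, and `b5 - b6` transfers
    -- the second-order term.
    have b1 := h.integral_div hdet hK hs hu (h.gradient_smooth (h.laplacian_smooth hφU)) (Or.inr hlg0)
    have b2 := h.integral_div hdet hK hs (h.laplacian_smooth hφU) (h.gradient_smooth hu) (Or.inl hl0)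
    have b3 := h.integral_div hdet hK hs (h.laplacian_smooth hu) (h.gradient_smooth hφU) (Or.inr hg0)
    have b4 := h.integral_div hdet hK hs hφU (h.gradient_smooth (h.laplacian_smooth hu)) (Or.inl hφ0)
    have b5 := h.integral_div hdet hK hs hu (h.tensorGrad_smooth h.paneitzTensor_smooth hφU)
      (Or.inr ht0)
    have b6 := h.integral_div hdet hK hs hφU (h.tensorGrad_smooth h.paneitzTensor_smooth hu)
      (Or.inl hφ0)
    have hi : MeasureTheory.Integrable fun x => φ x * (paneitz γ u x * density γ x) := by
      have h0 : ∀ x ∉ tsupport φ, φ x * (paneitz γ u x * density γ x) = 0 := fun x hx => by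
        rw [hφ0 x hx, zero_mul]
      exact (contDiff_of_supported h.isOpen hK.isClosed hs (hφU.mul (hPu.mul hρ))
        h0).continuous.integrable_of_hasCompactSupport (hasCompactSupport_of_supported hK h0)
    refine integral_eq_zero_of_null_terms b1 b2 b3 b4 b5 b6 hi (fun x => ?_) (hw φ hφ hc hs)
    by_cases hx : x ∈ U
    · rw [h.gradient_pair hx (laplacian γ φ) u, h.gradient_pair hx φ (laplacian γ u),
        tensorGrad_pair (h.paneitzTensor_symm hx) φ u, paneitz_expand, paneitz_expand]
      have e1 : laplacian γ φ x = divergence γ (gradient γ φ) x := rfl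
      have e2 : laplacian γ u x = divergence γ (gradient γ u) x := rfl
      rw [← e1, ← e2]
      ring
    · have hxK : x ∉ tsupport φ := fun hh => hx (hs hh)
      rw [paneitz_expand]
      simp [hφ0 x hxK, hg0 _ x hxK, hl0 x hxK, hlg0 _ x hxK, ht0 _ x hxK, hpd0 _ x hxK,
        pd_eq_zero_of_notMem hK.isClosed hl0 _ x hxK,
        divergence_eq_zero_of_notMem hK.isClosed hg0 x hxK,
        divergence_eq_zero_of_notMem hK.isClosed hlg0 x hxK,
        divergence_eq_zero_of_notMem hK.isClosed ht0 x hxK]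
  have hcont : ContinuousOn (fun x => paneitz γ u x * density γ x) U :=
    (hPu.mul hρ).continuousOn
  -- The fundamental lemma of the calculus of variations gives the equation almost everywhere,
  -- continuity gives it everywhere, and the positive density is divided out.
  have hae := h.isOpen.ae_eq_zero_of_integral_contDiff_smul_eq_zero
    (μ := (MeasureTheory.volume : MeasureTheory.Measure (Euc n)))
    (hcont.locallyIntegrableOn h.isOpen.measurableSet) key
  have hae2 : (fun x => paneitz γ u x * density γ x) =ᵐ[MeasureTheory.volume.restrict U]
      fun _ => (0 : ℝ) := (MeasureTheory.ae_restrict_iff' h.isOpen.measurableSet).mpr hae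
  have heq := MeasureTheory.Measure.eqOn_open_of_ae_eq hae2 h.isOpen hcont continuousOn_const
  intro x hx
  have := heq hx
  simp only [mul_eq_zero] at this
  exact this.resolve_right (Real.sqrt_pos.mpr (hdet x hx)).ne'

end Density

/-! ### Smoothness and positivity of the components of a metric in a chart. -/

section ManifoldComponents

variable {n : ℕ} {M : Type*} [TopologicalSpace M] [ChartedSpace (Euc n) M]
  [IsManifold (𝓡 n) ∞ M]

open Bundle in
/-- The coordinate vector field `∂_i` of a chart is a smooth map into the tangent bundle. -/
theorem contMDiffOn_coordField {e : OpenPartialHomeomorph M (Euc n)}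
    (he : e ∈ IsManifold.maximalAtlas (𝓡 n) ∞ M) (v : Euc n) :
    ContMDiffOn 𝓘(ℝ, Euc n) ((𝓡 n).prod 𝓘(ℝ, Euc n)) ∞
      (fun x => (⟨e.symm x, mfderiv 𝓘(ℝ, Euc n) (𝓡 n) e.symm x v⟩ :
        TotalSpace (Euc n) (TangentSpace (𝓡 n) : M → Type _))) e.target := by
  have hs := contMDiffOn_symm_of_mem_maximalAtlas he
  have hu : UniqueMDiffOn 𝓘(ℝ, Euc n) e.target := e.open_target.uniqueMDiffOn
  have h1 := hs.contMDiffOn_tangentMapWithin (m := ∞) le_rfl hu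
  have h2 : ContMDiffOn 𝓘(ℝ, Euc n) (𝓘(ℝ, Euc n).prod 𝓘(ℝ, Euc n)) ∞
      (fun x => (⟨x, v⟩ : TotalSpace (Euc n) (TangentSpace 𝓘(ℝ, Euc n) : Euc n → Type _)))
      e.target := by
    have := (contMDiffOn_vectorSpace_iff_contDiffOn (𝕜 := ℝ) (n := ∞) (s := e.target)
      (V := fun x : Euc n => (v : TangentSpace 𝓘(ℝ, Euc n) x))).2 contDiffOn_const
    exact this
  have h3 := h1.comp h2 (fun x hx => hx)
  refine h3.congr fun x hx => ?_
  simp only [Function.comp, tangentMapWithin]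
  rw [mfderivWithin_of_isOpen e.open_target hx]

theorem contDiffOn_comps (g : Bundle.ContMDiffRiemannianMetric (𝓡 n) ∞ (Euc n)
      (fun p : M => TangentSpace (𝓡 n) p)) {e : OpenPartialHomeomorph M (Euc n)}
    (he : e ∈ IsManifold.maximalAtlas (𝓡 n) ∞ M) (i j : Fin n) :
    ContDiffOn ℝ ∞ (fun x => comps g.inner e x i j) e.target := by
  rw [← contMDiffOn_iff_contDiffOn]
  intro x hx
  have hs := contMDiffOn_symm_of_mem_maximalAtlas he
  have : ContMDiffWithinAt 𝓘(ℝ, Euc n) ((𝓡 n).prod 𝓘(ℝ)) ∞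
      (fun x => Bundle.TotalSpace.mk' ℝ (E := Bundle.Trivial M ℝ) (e.symm x)
        (comps g.inner e x i j)) e.target x := by
    apply ContMDiffWithinAt.clm_bundle_apply₂ (𝕜 := ℝ) (F₁ := Euc n) (F₂ := Euc n) (F₃ := ℝ)
      (E₃ := Bundle.Trivial M ℝ) (E₁ := fun p : M => TangentSpace (𝓡 n) p) (E₂ := fun p : M => TangentSpace (𝓡 n) p)
      (b := fun x => e.symm x)
      (v := fun x => mfderiv 𝓘(ℝ, Euc n) (𝓡 n) e.symm x (EuclideanSpace.single i (1 : ℝ)))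
      (w := fun x => mfderiv 𝓘(ℝ, Euc n) (𝓡 n) e.symm x (EuclideanSpace.single j (1 : ℝ)))
      (ψ := fun x => g.inner (e.symm x))
    · exact ContMDiffAt.comp_contMDiffWithinAt x g.contMDiff.contMDiffAt (hs x hx)
    · exact contMDiffOn_coordField he _ x hx
    · exact contMDiffOn_coordField he _ x hx
  simp only [Bundle.contMDiffWithinAt_totalSpace] at this
  exact this.2

theorem mfderiv_symm_injective {e : OpenPartialHomeomorph M (Euc n)}
    (he : e ∈ IsManifold.maximalAtlas (𝓡 n) ∞ M) {x : Euc n} (hx : x ∈ e.target) :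
    Function.Injective (mfderiv 𝓘(ℝ, Euc n) (𝓡 n) e.symm x) := by
  have hmd : e.MDifferentiable (𝓡 n) 𝓘(ℝ, Euc n) :=
    ⟨(contMDiffOn_of_mem_maximalAtlas he).mdifferentiableOn (by simp),
      (contMDiffOn_symm_of_mem_maximalAtlas he).mdifferentiableOn (by simp)⟩
  have h := hmd.comp_symm_deriv hx
  intro v w hvw
  have hv := congrArg (fun L : Euc n →L[ℝ] Euc n => L v) h
  have hw := congrArg (fun L : Euc n →L[ℝ] Euc n => L w) h
  have e1 : (mfderiv (𝓡 n) 𝓘(ℝ, Euc n) e (e.symm x)) (mfderiv 𝓘(ℝ, Euc n) (𝓡 n) e.symm x v) = v := hv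
  have e2 : (mfderiv (𝓡 n) 𝓘(ℝ, Euc n) e (e.symm x)) (mfderiv 𝓘(ℝ, Euc n) (𝓡 n) e.symm x w) = w := hw
  rw [← e1, ← e2, hvw]

theorem bilin_basis {E : Type*} [AddCommGroup E] [Module ℝ E] [TopologicalSpace E]
    [IsTopologicalAddGroup E] [ContinuousConstSMul ℝ E] (B : E →L[ℝ] E →L[ℝ] ℝ)
    (L : Euc n →L[ℝ] E) (v w : Euc n) :
    B (L v) (L w) = ∑ i, ∑ j, v i * w j *
      B (L (EuclideanSpace.single i 1)) (L (EuclideanSpace.single j 1)) := by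
  have key : ∀ v : Euc n, v = ∑ i, v i • EuclideanSpace.single i (1 : ℝ) := by
    intro v
    ext k
    simp [Finset.sum_apply, Pi.single_apply]
  conv_lhs => rw [key v, key w]
  simp only [map_sum, map_smul, sum_apply, smul_apply, smul_eq_mul]
  rw [Finset.sum_comm]
  simp only [mul_assoc, Finset.mul_sum]
  exact Finset.sum_congr rfl fun i _ => Finset.sum_congr rfl fun j _ => by ring

/-- A bilinear field evaluated on vectors given by their coordinate components. -/
theorem comps_bilin (h : BilinField n M) (e : OpenPartialHomeomorph M (Euc n)) (x : Euc n)
    (v w : Euc n) :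
    h (e.symm x) (mfderiv 𝓘(ℝ, Euc n) (𝓡 n) e.symm x v)
      (mfderiv 𝓘(ℝ, Euc n) (𝓡 n) e.symm x w) = ∑ i, ∑ j, v i * w j * comps h e x i j :=
  bilin_basis (h (e.symm x)) (mfderiv 𝓘(ℝ, Euc n) (𝓡 n) e.symm x) v w

theorem comps_posDef {h : BilinField n M} {U : Set M}
    (hsymm : ∀ p ∈ U, ∀ v w, h p v w = h p w v)
    (hpos : ∀ p ∈ U, ∀ v, v ≠ 0 → 0 < h p v v)
    {e : OpenPartialHomeomorph M (Euc n)}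
    (he : e ∈ IsManifold.maximalAtlas (𝓡 n) ∞ M) {x : Euc n} (hx : x ∈ e.target)
    (hxU : e.symm x ∈ U) : (comps h e x).PosDef := by
  refine Matrix.PosDef.of_dotProduct_mulVec_pos ?_ ?_
  · ext i j
    simp only [Matrix.conjTranspose_apply, star_trivial]
    exact hsymm _ hxU _ _
  · intro v hv
    have hv' : (WithLp.toLp 2 v : Euc n) ≠ 0 := by
      intro h0
      apply hv
      ext i
      exact congrArg (fun w : Euc n => w i) h0
    have := hpos _ hxU (mfderiv 𝓘(ℝ, Euc n) (𝓡 n) e.symm x (WithLp.toLp 2 v : Euc n)) (by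
      intro h0
      apply hv'
      apply mfderiv_symm_injective he hx
      exact h0.trans (map_zero (mfderiv 𝓘(ℝ, Euc n) (𝓡 n) e.symm x)).symm)
    have hb := comps_bilin h e x (WithLp.toLp 2 v : Euc n) (WithLp.toLp 2 v : Euc n)
    rw [hb] at this
    refine this.trans_eq ?_
    simp only [dotProduct, Matrix.mulVec, star_trivial, Finset.mul_sum]
    refine Finset.sum_congr rfl fun i _ => Finset.sum_congr rfl fun j _ => ?_
    ring

end ManifoldComponents

/-! ### Locality of the differential operators. -/

section Congruence
variable {n : ℕ} {γ : Euc n → Matrix (Fin n) (Fin n) ℝ}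

theorem divergence_congr_on {U : Set (Euc n)} (hU : IsOpen U) {V W : Fin n → Euc n → ℝ}
    (h : ∀ k, ∀ x ∈ U, V k x = W k x) {x : Euc n} (hx : x ∈ U) :
    divergence γ V x = divergence γ W x := by
  simp only [divergence]
  refine Finset.sum_congr rfl fun k _ => ?_
  rw [pd_congr_on hU (h k) hx, h k x hx]

theorem laplacian_congr_on {U : Set (Euc n)} (hU : IsOpen U) {u w : Euc n → ℝ}
    (h : ∀ x ∈ U, u x = w x) {x : Euc n} (hx : x ∈ U) :
    laplacian γ u x = laplacian γ w x := by
  refine divergence_congr_on hU (fun k y hy => ?_) hx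
  exact Finset.sum_congr rfl fun l _ => by rw [pd_congr_on hU h hy]

theorem paneitz_congr_on {U : Set (Euc n)} (hU : IsOpen U) {u w : Euc n → ℝ}
    (h : ∀ x ∈ U, u x = w x) {x : Euc n} (hx : x ∈ U) :
    paneitz γ u x = paneitz γ w x := by
  simp only [paneitz, divTensorGrad]
  rw [laplacian_congr_on hU (fun y hy => laplacian_congr_on hU h hy) hx, h x hx]
  congr 2
  refine divergence_congr_on hU (fun k y hy => ?_) hx
  exact Finset.sum_congr rfl fun i _ => Finset.sum_congr rfl fun j _ =>
    Finset.sum_congr rfl fun l _ => by rw [pd_congr_on hU h hy]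

theorem paneitz_zero (x : Euc n) : paneitz γ (fun _ => 0) x = 0 := by
  have h1 : ∀ i, pd i (fun _ : Euc n => (0 : ℝ)) = fun _ => 0 :=
    fun i => funext fun x => pd_const i 0 x
  have h2 : laplacian γ (fun _ => 0) = fun _ => 0 := by
    funext y
    simp [laplacian, divergence, h1]
  simp only [paneitz, h2]
  simp [divTensorGrad, divergence, h1, h2]

theorem paneitz_eq_zero_of_notMem {φ : Euc n → ℝ} {x : Euc n} (hx : x ∉ tsupport φ) :
    paneitz γ φ x = 0 := by
  rw [← paneitz_zero (γ := γ) x]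
  exact paneitz_congr_on (isClosed_tsupport φ).isOpen_compl
    (fun y hy => image_eq_zero_of_notMem_tsupport hy) hx

end Congruence

/-! ### The Green's function off its pole and the vanishing of Q. -/

section GreenFunction
variable {n : ℕ} {M : Type*} [TopologicalSpace M] [T2Space M] [ChartedSpace (Euc n) M]
  [IsManifold (𝓡 n) ∞ M]

theorem isOpen_chart_punctured (e : OpenPartialHomeomorph M (Euc n)) (σ : M) :
    IsOpen (e.target ∩ e.symm ⁻¹' {σ}ᶜ) :=
  e.symm.isOpen_inter_preimage isOpen_compl_singleton

theorem isCoordMetric_comps (g : Bundle.ContMDiffRiemannianMetric (𝓡 n) ∞ (Euc n)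
      (fun p : M => TangentSpace (𝓡 n) p)) {e : OpenPartialHomeomorph M (Euc n)}
    (he : e ∈ IsManifold.maximalAtlas (𝓡 n) ∞ M) : IsCoordMetric (comps g.inner e) e.target where
  isOpen := e.open_target
  smooth := contDiffOn_comps g he
  symm := fun _ _ _ _ => g.symm _ _ _
  det_ne := fun x hx => (comps_posDef (U := Set.univ) (fun p _ => g.symm p) (fun p _ => g.pos p)
    he hx (Set.mem_univ _)).det_pos.ne'

theorem det_comps_pos (g : Bundle.ContMDiffRiemannianMetric (𝓡 n) ∞ (Euc n)
      (fun p : M => TangentSpace (𝓡 n) p)) {e : OpenPartialHomeomorph M (Euc n)}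
    (he : e ∈ IsManifold.maximalAtlas (𝓡 n) ∞ M) {x : Euc n} (hx : x ∈ e.target) :
    0 < (comps g.inner e x).det :=
  (comps_posDef (U := Set.univ) (fun p _ => g.symm p) (fun p _ => g.pos p)
    he hx (Set.mem_univ _)).det_pos

theorem IsCoordMetric.mono {γ : Euc n → Matrix (Fin n) (Fin n) ℝ} {U V : Set (Euc n)}
    (h : IsCoordMetric γ U) (hV : IsOpen V) (hVU : V ⊆ U) : IsCoordMetric γ V where
  isOpen := hV
  smooth := fun i j => (h.smooth i j).mono hVU
  symm := fun x hx => h.symm x (hVU hx)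
  det_ne := fun x hx => h.det_ne x (hVU hx)

theorem contDiffOn_comp_symm {G : M → ℝ} {U : Set M} (hG : ContMDiffOn (𝓡 n) 𝓘(ℝ, ℝ) ∞ G U)
    {e : OpenPartialHomeomorph M (Euc n)} (he : e ∈ IsManifold.maximalAtlas (𝓡 n) ∞ M) :
    ContDiffOn ℝ ∞ (fun x => G (e.symm x)) (e.target ∩ e.symm ⁻¹' U) := by
  rw [← contMDiffOn_iff_contDiffOn]
  exact hG.comp ((contMDiffOn_symm_of_mem_maximalAtlas he).mono Set.inter_subset_left)
    fun x hx => hx.2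

/-- A test function on the target of a chart, transplanted to the manifold. -/
def transplant (e : OpenPartialHomeomorph M (Euc n)) (φ : Euc n → ℝ) : M → ℝ :=
  e.source.indicator (φ ∘ e)

theorem transplant_symm (e : OpenPartialHomeomorph M (Euc n)) (φ : Euc n → ℝ) {x : Euc n}
    (hx : x ∈ e.target) : transplant e φ (e.symm x) = φ x := by
  simp [transplant, Set.indicator_of_mem (e.map_target hx), e.right_inv hx]

theorem transplant_eq_zero (e : OpenPartialHomeomorph M (Euc n)) {φ : Euc n → ℝ} {p : M}
    (hp : p ∉ e.symm '' tsupport φ) : transplant e φ p = 0 := by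
  by_cases hs : p ∈ e.source
  · rw [transplant, Set.indicator_of_mem hs]
    exact image_eq_zero_of_notMem_tsupport (f := φ) fun h => hp ⟨e p, h, e.left_inv hs⟩
  · exact Set.indicator_of_notMem hs _

theorem isCompact_image_tsupport {e : OpenPartialHomeomorph M (Euc n)} {φ : Euc n → ℝ}
    (hc : HasCompactSupport φ) (hs : tsupport φ ⊆ e.target) :
    IsCompact (e.symm '' tsupport φ) :=
  hc.isCompact.image_of_continuousOn (e.continuousOn_symm.mono hs)

/-- Hausdorffness enters here: the compact image of the support is closed in `M`, so it contains the
closure of the nonvanishing set. Smoothness of the extension by zero rests on the same fact. -/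
theorem tsupport_transplant {e : OpenPartialHomeomorph M (Euc n)} {φ : Euc n → ℝ}
    (hc : HasCompactSupport φ) (hs : tsupport φ ⊆ e.target) :
    tsupport (transplant e φ) ⊆ e.symm '' tsupport φ := by
  refine closure_minimal (fun p hp => ?_) (isCompact_image_tsupport hc hs).isClosed
  by_contra h
  exact hp (transplant_eq_zero e h)

theorem contMDiff_transplant {e : OpenPartialHomeomorph M (Euc n)}
    (he : e ∈ IsManifold.maximalAtlas (𝓡 n) ∞ M) {φ : Euc n → ℝ} (hφ : ContDiff ℝ ∞ φ)
    (hc : HasCompactSupport φ) (hs : tsupport φ ⊆ e.target) :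
    ContMDiff (𝓡 n) 𝓘(ℝ, ℝ) ∞ (transplant e φ) := by
  intro p
  by_cases hp : p ∈ e.source
  · have h1 : ContMDiffAt (𝓡 n) 𝓘(ℝ, ℝ) ∞ (φ ∘ e) p :=
      hφ.contMDiff.contMDiffAt.comp p
        ((contMDiffOn_of_mem_maximalAtlas he).contMDiffAt (e.open_source.mem_nhds hp))
    refine h1.congr_of_eventuallyEq ?_
    filter_upwards [e.open_source.mem_nhds hp] with q hq
    exact Set.indicator_of_mem hq _
  · have hK := (isCompact_image_tsupport hc hs).isClosed.isOpen_compl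
    have hpK : p ∈ (e.symm '' tsupport φ)ᶜ := by
      rintro ⟨x, hx, rfl⟩
      exact hp (e.map_target (hs hx))
    refine (contMDiffAt_const (c := (0 : ℝ))).congr_of_eventuallyEq ?_
    filter_upwards [hK.mem_nhds hpK] with q hq
    exact transplant_eq_zero e hq

/-- Off its pole, the Green's function is a classical solution of the Paneitz equation. -/
theorem IsGreenFunction.paneitz_eq_zero {g : Bundle.ContMDiffRiemannianMetric (𝓡 n) ∞ (Euc n)
      (fun p : M => TangentSpace (𝓡 n) p)} {σ : M} {G : M → ℝ}
    (hG : IsGreenFunction g.inner σ G) {e : OpenPartialHomeomorph M (Euc n)}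
    (he : e ∈ IsManifold.maximalAtlas (𝓡 n) ∞ M) :
    ∀ x ∈ e.target ∩ e.symm ⁻¹' {σ}ᶜ,
      paneitz (comps g.inner e) (fun y => G (e.symm y)) x = 0 := by
  refine ((isCoordMetric_comps g he).mono (isOpen_chart_punctured e σ)
    Set.inter_subset_left).paneitz_eq_zero_of_weak (fun x hx => det_comps_pos g he hx.1)
    (contDiffOn_comp_symm hG.smooth he) fun φ hφ hc hs => ?_
  have hs' : tsupport φ ⊆ e.target := hs.trans Set.inter_subset_left
  have hK := tsupport_transplant hc hs'
  have h := hG.eq_dirac e he (transplant e φ) (contMDiff_transplant he hφ hc hs')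
    (HasCompactSupport.of_support_subset_isCompact (isCompact_image_tsupport hc hs')
      ((subset_tsupport _).trans hK))
    (hK.trans (by rintro _ ⟨x, hx, rfl⟩; exact e.map_target (hs' hx)))
  -- The support avoids the pole, so the Dirac mass tests to zero.
  rw [transplant_eq_zero e (by rintro ⟨x, hx, hxσ⟩; exact (hs hx).2 hxσ)] at h
  rw [← h, ← MeasureTheory.setIntegral_eq_integral_of_forall_compl_eq_zero (s := e.target)]
  · refine MeasureTheory.setIntegral_congr_fun e.open_target.measurableSet fun x hx => ?_
    simp only [density]
    rw [paneitz_congr_on e.open_target (fun y hy => transplant_symm e φ hy) hx]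
  · intro x hx
    rw [paneitz_eq_zero_of_notMem (fun h => hx (hs' h))]
    ring

theorem comps_conformalMetric (G : M → ℝ) (h : BilinField n M)
    (e : OpenPartialHomeomorph M (Euc n)) :
    comps (conformalMetric G h) e =
      fun x => (G (e.symm x) ^ (4 / ((n : ℝ) - 4))) • comps h e x := rfl

theorem qCurvZeroOn_conformal (hn : 5 ≤ n)
    {g : Bundle.ContMDiffRiemannianMetric (𝓡 n) ∞ (Euc n)
      (fun p : M => TangentSpace (𝓡 n) p)} {σ : M} {G : M → ℝ}
    (hG : IsGreenFunction g.inner σ G) (hpos : ∀ p, p ≠ σ → 0 < G p) :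
    QCurvZeroOn (conformalMetric G g.inner) {σ}ᶜ := by
  intro e he x hx hxσ
  rw [comps_conformalMetric]
  exact ((isCoordMetric_comps g he).mono (isOpen_chart_punctured e σ)
    Set.inter_subset_left).qCurv_conformal_eq_zero hn (contDiffOn_comp_symm hG.smooth he)
    (fun y hy => hpos _ hy.2) ⟨hx, hxσ⟩ (hG.paneitz_eq_zero he x ⟨hx, hxσ⟩)

theorem isRiemannianMetricOn_conformal
    {g : Bundle.ContMDiffRiemannianMetric (𝓡 n) ∞ (Euc n)
      (fun p : M => TangentSpace (𝓡 n) p)} {σ : M} {G : M → ℝ}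
    (hG : ContMDiffOn (𝓡 n) 𝓘(ℝ, ℝ) ∞ G {σ}ᶜ) (hpos : ∀ p, p ≠ σ → 0 < G p) :
    IsRiemannianMetricOn (conformalMetric G g.inner) {σ}ᶜ where
  symm := fun p _ v w => by
    change (G p ^ (4 / ((n : ℝ) - 4))) * g.inner p v w = (G p ^ (4 / ((n : ℝ) - 4))) * g.inner p w v
    rw [g.symm]
  pos := fun p hp v hv => mul_pos (Real.rpow_pos_of_pos (hpos p hp) _) (g.pos p v hv)
  smooth := fun e he i j => by
    have h1 := contDiffOn_comp_symm hG he
    have h2 := (contDiffOn_comps g he i j).mono (Set.inter_subset_left (t := e.symm ⁻¹' {σ}ᶜ))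
    exact (h1.rpow_const_of_ne (fun x hx => (hpos _ hx.2).ne')).mul h2

end GreenFunction

set_option linter.unusedSectionVars false

/-! ### The inversion and its Jacobian. -/

section Inversion
variable {n : ℕ}

/-- The inversion `y ↦ s y / |y|²`. -/
def inversion (s : ℝ) (y : Euc n) : Euc n := (s * (‖y‖ ^ 2)⁻¹) • y

theorem norm_inversion {s : ℝ} (hs : 0 < s) (y : Euc n) : ‖inversion s y‖ = s * ‖y‖⁻¹ := by
  rw [inversion, norm_smul, Real.norm_of_nonneg (by positivity)]
  rcases eq_or_ne ‖y‖ 0 with h | h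
  · simp [h]
  · field_simp

theorem inversion_ne_zero {s : ℝ} (hs : 0 < s) {y : Euc n} (hy : y ≠ 0) : inversion s y ≠ 0 := by
  have : 0 < ‖y‖ := norm_pos_iff.2 hy
  rw [← norm_pos_iff, norm_inversion hs]
  positivity

theorem inversion_inversion {s : ℝ} (hs : 0 < s) {y : Euc n} (hy : y ≠ 0) :
    inversion s (inversion s y) = y := by
  have : 0 < ‖y‖ := norm_pos_iff.2 hy
  conv_lhs => rw [inversion, norm_inversion hs, inversion, smul_smul]
  convert one_smul ℝ y
  field_simp

theorem contDiffOn_inversion (s : ℝ) : ContDiffOn ℝ ∞ (inversion (n := n) s) {0}ᶜ := by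
  refine ContDiffOn.smul (contDiffOn_const.mul (ContDiffOn.inv
    (f := fun y : Euc n => ‖y‖ ^ 2) ?_ ?_)) contDiffOn_id
  · exact (contDiff_norm_sq ℝ).contDiffOn
  · intro x hx
    have : 0 < ‖x‖ := norm_pos_iff.2 hx
    positivity

/-- The inversion as a partial homeomorphism of the punctured space. -/
def inversionHomeomorph (s : ℝ) (hs : 0 < s) : OpenPartialHomeomorph (Euc n) (Euc n) where
  toFun := inversion s
  invFun := inversion s
  source := {0}ᶜ
  target := {0}ᶜ
  map_source' := fun _ hx => inversion_ne_zero hs hx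
  map_target' := fun _ hx => inversion_ne_zero hs hx
  left_inv' := fun _ hx => inversion_inversion hs hx
  right_inv' := fun _ hx => inversion_inversion hs hx
  open_source := isOpen_compl_singleton
  open_target := isOpen_compl_singleton
  continuousOn_toFun := (contDiffOn_inversion s).continuousOn
  continuousOn_invFun := (contDiffOn_inversion s).continuousOn

/-- The derivative is the conformal factor s/|y|² times the reflection I - 2 y yᵗ/|y|² in the
hyperplane orthogonal to y. -/
theorem hasFDerivAt_inversion_apply {s : ℝ} {y : Euc n} (hy : y ≠ 0) (i a : Fin n) :
    fderiv ℝ (inversion s) y (EuclideanSpace.single i 1) a =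
      s * (‖y‖ ^ 2)⁻¹ * ((if a = i then 1 else 0) - 2 * (y a * y i) * (‖y‖ ^ 2)⁻¹) := by
  have hy' : ‖y‖ ^ 2 ≠ 0 := by
    have : 0 < ‖y‖ := norm_pos_iff.2 hy
    positivity
  have h1 : HasFDerivAt (fun y : Euc n => ‖y‖ ^ 2) (2 • innerSL ℝ y) y :=
    (hasStrictFDerivAt_norm_sq y).hasFDerivAt
  have h2 : HasFDerivAt (fun y : Euc n => s * (‖y‖ ^ 2)⁻¹)
      (s • ((-((‖y‖ ^ 2) ^ 2)⁻¹) • (2 • innerSL ℝ y))) y :=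
    ((hasDerivAt_inv hy').comp_hasFDerivAt y h1).const_mul s
  have h3 := h2.smul (hasFDerivAt_id y)
  have h4 : fderiv ℝ (inversion s) y = _ := h3.fderiv
  rw [h4]
  have h5 : inner ℝ y (EuclideanSpace.single i (1 : ℝ)) = y i := by
    simp [EuclideanSpace.inner_single_right]
  simp [h5, Pi.single_apply]
  split_ifs <;> field_simp <;> ring

theorem sphereArea_pos (hn : 1 ≤ n) : 0 < sphereArea n := by
  haveI : Nonempty (Fin n) := ⟨⟨0, hn⟩⟩
  rw [sphereArea, sphereIntegral, MeasureTheory.integral_const]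
  simp only [smul_eq_mul, mul_one, MeasureTheory.Measure.real,
    MeasureTheory.Measure.toSphere_apply_univ]
  rw [ENNReal.toReal_mul]
  refine mul_pos ?_ (ENNReal.toReal_pos ?_ ?_)
  · simpa using Nat.pos_of_ne_zero (by omega)
  · exact (Metric.measure_ball_pos _ _ one_pos).ne'
  · exact MeasureTheory.measure_ball_lt_top.ne

theorem varsigma_pos (hn : 5 ≤ n) : 0 < varsigma n := by
  have h1 : (5 : ℝ) ≤ n := by exact_mod_cast hn
  have := sphereArea_pos (n := n) (by omega)
  rw [varsigma]
  have h2 : 0 < (n : ℝ) - 4 := by linarith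
  have h3 : 0 < (n : ℝ) - 2 := by linarith
  positivity

/-- The inversion acts on a metric with `γ x = x` at the image point by rescaling. -/
theorem sum_inversion_metric {s : ℝ} {y : Euc n} (hy : y ≠ 0) (γ : Fin n → Fin n → ℝ)
    (hsymm : ∀ i j, γ i j = γ j i) (hrad : ∀ i, ∑ j, γ i j * y j = y i) (i j : Fin n) :
    ∑ a, ∑ b, fderiv ℝ (inversion s) y (EuclideanSpace.single i 1) a *
      fderiv ℝ (inversion s) y (EuclideanSpace.single j 1) b * γ a b =
      (s * (‖y‖ ^ 2)⁻¹) ^ 2 * γ i j := by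
  have hy' : ‖y‖ ^ 2 ≠ 0 := by
    have : 0 < ‖y‖ := norm_pos_iff.2 hy
    positivity
  obtain ⟨J, hJ⟩ : ∃ J : Fin n → Fin n → ℝ, ∀ i a,
      fderiv ℝ (inversion s) y (EuclideanSpace.single i 1) a = J i a := ⟨_, fun _ _ => rfl⟩
  have hJf : ∀ i a, J i a =
      s * (‖y‖ ^ 2)⁻¹ * ((if a = i then 1 else 0) - 2 * (y a * y i) * (‖y‖ ^ 2)⁻¹) :=
    fun i a => by rw [← hJ, hasFDerivAt_inversion_apply hy]
  simp only [hJ]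
  have hnorm : ∑ a, y a * y a = ‖y‖ ^ 2 := by
    rw [EuclideanSpace.norm_sq_eq]
    exact Finset.sum_congr rfl fun a _ => by rw [Real.norm_eq_abs, sq_abs, sq]
  -- Since γ y = y and γ is symmetric, γ commutes with the reflection, whose square is the identity;
  -- only the squared conformal factor survives.
  have hb : ∀ a, ∑ b, J j b * γ a b =
      s * (‖y‖ ^ 2)⁻¹ * (γ a j - 2 * y j * (‖y‖ ^ 2)⁻¹ * y a) := by
    intro a
    rw [← hrad a, Finset.mul_sum]
    simp only [hJf]
    rw [mul_sub, Finset.mul_sum]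
    have : γ a j = ∑ b, (if b = j then 1 else 0) * γ a b := by simp
    rw [this, Finset.mul_sum, ← Finset.sum_sub_distrib]
    exact Finset.sum_congr rfl fun b _ => by ring
  simp only [mul_assoc, ← Finset.mul_sum]
  simp only [hb]
  simp only [hJf]
  have e1 : ∀ a, s * (‖y‖ ^ 2)⁻¹ * ((if a = i then 1 else 0) - 2 * (y a * y i) * (‖y‖ ^ 2)⁻¹) *
      (s * (‖y‖ ^ 2)⁻¹ * (γ a j - 2 * y j * (‖y‖ ^ 2)⁻¹ * y a)) =
      (s * (‖y‖ ^ 2)⁻¹) ^ 2 * ((if a = i then 1 else 0) * γ a j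
        - 2 * y j * (‖y‖ ^ 2)⁻¹ * ((if a = i then 1 else 0) * y a)
        - 2 * y i * (‖y‖ ^ 2)⁻¹ * (γ j a * y a)
        + 4 * y i * y j * ((‖y‖ ^ 2)⁻¹) ^ 2 * (y a * y a)) := by
    intro a
    rw [hsymm a j]
    ring
  simp only [e1, ← Finset.mul_sum, Finset.sum_add_distrib, Finset.sum_sub_distrib, hrad, hnorm]
  simp only [ite_mul, one_mul, zero_mul, Finset.sum_ite_eq', Finset.mem_univ, if_true]
  field_simp
  ring

end Inversion

/-! ### The chart at infinity. -/

section InvertedChart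
variable {n : ℕ} {M : Type*} [TopologicalSpace M] [ChartedSpace (Euc n) M]
  [IsManifold (𝓡 n) ∞ M]

/-- The inverted chart. -/
def invertedChart (e : OpenPartialHomeomorph M (Euc n)) (s : ℝ) (hs : 0 < s) :
    OpenPartialHomeomorph M (Euc n) := e.trans (inversionHomeomorph s hs)

variable {e : OpenPartialHomeomorph M (Euc n)} {σ : M} {s : ℝ} (hs : 0 < s)

theorem invertedChart_source (hσ : σ ∈ e.source) (h0 : e σ = 0) :
    (invertedChart e s hs).source = e.source \ {σ} := by
  ext p
  simp only [invertedChart, OpenPartialHomeomorph.trans_source, inversionHomeomorph,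
    Set.mem_inter_iff, Set.mem_preimage, Set.mem_compl_iff, Set.mem_singleton_iff, Set.mem_sdiff]
  refine and_congr_right fun hp => not_congr ⟨fun h => ?_, fun h => by rw [h, h0]⟩
  exact e.injOn hp hσ (h.trans h0.symm)

theorem invertedChart_symm_apply (y : Euc n) :
    (invertedChart e s hs).symm y = e.symm (inversion s y) := rfl

theorem invertedChart_target {ρ : ℝ} (hρ : 0 < ρ) (ht : e.target = Metric.ball 0 ρ) :
    (invertedChart e s hs).target = (Metric.closedBall 0 (s / ρ))ᶜ := by
  ext y
  have h1 : y ∈ (invertedChart e s hs).target ↔ y ≠ 0 ∧ inversion s y ∈ e.target := by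
    simp only [invertedChart, OpenPartialHomeomorph.trans_target]
    rfl
  rw [h1, ht, mem_ball_zero_iff, norm_inversion hs]
  simp only [Set.mem_compl_iff, mem_closedBall_zero_iff, not_le]
  constructor
  · rintro ⟨hy, h⟩
    have : 0 < ‖y‖ := norm_pos_iff.2 hy
    rw [div_lt_iff₀ hρ]
    rw [← div_eq_mul_inv, div_lt_iff₀ this] at h
    linarith
  · intro h
    have : 0 < ‖y‖ := lt_trans (by positivity) h
    refine ⟨norm_pos_iff.1 this, ?_⟩
    rw [← div_eq_mul_inv, div_lt_iff₀ this]
    rw [div_lt_iff₀ hρ] at h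
    linarith

theorem invertedChart_mem (he : e ∈ IsManifold.maximalAtlas (𝓡 n) ∞ M) :
    invertedChart e s hs ∈ IsManifold.maximalAtlas (𝓡 n) ∞ M := by
  apply OpenPartialHomeomorph.mem_maximalAtlas_of_contMDiffOn
  · have h1 := contMDiffOn_of_mem_maximalAtlas he
    have h2 := (contDiffOn_inversion (n := n) s).contMDiffOn
    exact h2.comp (h1.mono fun p hp => hp.1) fun p hp => hp.2
  · have h1 := contMDiffOn_symm_of_mem_maximalAtlas he
    have h2 := (contDiffOn_inversion (n := n) s).contMDiffOn
    exact h1.comp (h2.mono fun p hp => hp.1) fun p hp => hp.2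

/-- Adding the pole to the image of the exterior of radius R gives the chart image of the ball of
radius s/R, an open set; its complement is closed in the compact manifold. -/
theorem isCompact_compl_invertedChart [CompactSpace M] [T2Space M] (hσ : σ ∈ e.source)
    (h0 : e σ = 0) {ρ R : ℝ} (hρ : 0 < ρ) (ht : e.target = Metric.ball 0 ρ) (hR : s / ρ ≤ R) :
    IsCompact ({σ}ᶜ \ (invertedChart e s hs).symm '' (Metric.closedBall 0 R)ᶜ) := by
  have hR0 : 0 < R := lt_of_lt_of_le (by positivity) hR
  have hsub : Metric.ball (0 : Euc n) (s / R) ⊆ e.target := by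
    rw [ht]
    apply Metric.ball_subset_ball
    rw [div_le_iff₀ hR0]
    rwa [div_le_iff₀ hρ, mul_comm] at hR
  have hset : {σ}ᶜ \ (invertedChart e s hs).symm '' (Metric.closedBall 0 R)ᶜ
      = (e.symm '' Metric.ball 0 (s / R))ᶜ := by
    ext p
    simp only [Set.mem_sdiff, Set.mem_compl_iff, Set.mem_singleton_iff, Set.mem_image,
      mem_closedBall_zero_iff, mem_ball_zero_iff, invertedChart_symm_apply]
    rw [← not_or]
    refine not_congr ⟨?_, ?_⟩
    · rintro (rfl | ⟨y, hy, rfl⟩)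
      · exact ⟨0, by simpa using by positivity, by rw [← h0, e.left_inv hσ]⟩
      · have hy0 : 0 < ‖y‖ := lt_trans hR0 (not_le.1 hy)
        refine ⟨_, ?_, rfl⟩
        rw [norm_inversion hs, ← div_eq_mul_inv]
        exact div_lt_div_of_pos_left hs hR0 (not_le.1 hy)
    · rintro ⟨x, hx, rfl⟩
      rcases eq_or_ne x 0 with rfl | hx0
      · left
        rw [← h0, e.left_inv hσ]
      · right
        have : 0 < ‖x‖ := norm_pos_iff.2 hx0
        refine ⟨inversion s x, ?_, by rw [inversion_inversion hs hx0]⟩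
        rw [norm_inversion hs, not_le, ← div_eq_mul_inv, lt_div_iff₀ this]
        rw [lt_div_iff₀ hR0] at hx
        linarith
  rw [hset]
  exact (e.isOpen_image_symm_of_subset_target Metric.isOpen_ball hsub).isClosed_compl.isCompact

/-- The chain rule for the inverse chart, combined with bilinearity. -/
theorem comps_invertedChart (he : e ∈ IsManifold.maximalAtlas (𝓡 n) ∞ M) (h : BilinField n M)
    {y : Euc n} (hy : y ≠ 0) (ht : inversion s y ∈ e.target) (i j : Fin n) :
    comps h (invertedChart e s hs) y i j =
      ∑ a, ∑ b, fderiv ℝ (inversion s) y (EuclideanSpace.single i 1) a *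
        fderiv ℝ (inversion s) y (EuclideanSpace.single j 1) b * comps h e (inversion s y) a b := by
  have hd : ∀ v, mfderiv 𝓘(ℝ, Euc n) (𝓡 n) (invertedChart e s hs).symm y v =
      mfderiv 𝓘(ℝ, Euc n) (𝓡 n) e.symm (inversion s y) (fderiv ℝ (inversion s) y v) := by
    intro v
    have h1 : MDifferentiableAt 𝓘(ℝ, Euc n) (𝓡 n) e.symm (inversion s y) :=
      ((contMDiffOn_symm_of_mem_maximalAtlas he).contMDiffAt
        (e.open_target.mem_nhds ht)).mdifferentiableAt (by simp)
    have h2 : MDifferentiableAt 𝓘(ℝ, Euc n) 𝓘(ℝ, Euc n) (inversion s) y :=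
      (((contDiffOn_inversion (n := n) s).contDiffAt
        (isOpen_compl_singleton.mem_nhds hy)).differentiableAt (by simp)).mdifferentiableAt
    have h3 := mfderiv_comp y h1 h2
    rw [mfderiv_eq_fderiv] at h3
    exact congrArg (fun L => L v) h3
  rw [← comps_bilin]
  exact congrArg₂ (fun v w => h (e.symm (inversion s y)) v w) (hd _) (hd _)

end InvertedChart

/-! ### Order of vanishing and homogeneous Taylor parts at the origin. -/

section TaylorParts
variable {n : ℕ}

theorem eventually_diffAt {f : Euc n → ℝ} {x : Euc n} (hf : ContDiffAt ℝ ∞ f x) :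
    ∀ᶠ y in 𝓝 x, DifferentiableAt ℝ f y :=
  ((hf.of_le (m := 1) (by simp)).eventually (by simp)).mono fun _ h =>
    h.differentiableAt (by simp)

theorem pd_smoothAt {f : Euc n → ℝ} {x : Euc n} (hf : ContDiffAt ℝ ∞ f x) (i : Fin n) :
    ContDiffAt ℝ ∞ (pd i f) x := ContDiffAt.pd hf (by simp) i

theorem pd_add_ev {f g : Euc n → ℝ} {x : Euc n} (hf : ContDiffAt ℝ ∞ f x)
    (hg : ContDiffAt ℝ ∞ g x) (i : Fin n) :
    pd i (fun y => f y + g y) =ᶠ[𝓝 x] fun y => pd i f y + pd i g y := by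
  filter_upwards [eventually_diffAt hf, eventually_diffAt hg] with y h1 h2 using pd_add h1 h2

theorem pd_mul_ev {f g : Euc n → ℝ} {x : Euc n} (hf : ContDiffAt ℝ ∞ f x)
    (hg : ContDiffAt ℝ ∞ g x) (i : Fin n) :
    pd i (fun y => f y * g y) =ᶠ[𝓝 x] fun y => pd i f y * g y + f y * pd i g y := by
  filter_upwards [eventually_diffAt hf, eventually_diffAt hg] with y h1 h2 using pd_mul h1 h2

theorem pd_const_mul_ev {f : Euc n → ℝ} {x : Euc n} (hf : ContDiffAt ℝ ∞ f x) (c : ℝ) (i : Fin n) :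
    pd i (fun y => c * f y) =ᶠ[𝓝 x] fun y => c * pd i f y := by
  filter_upwards [eventually_diffAt hf] with y h1 using pd_const_mul c h1

theorem pd_comm_ev {f : Euc n → ℝ} {x : Euc n} (hf : ContDiffAt ℝ ∞ f x) (i j : Fin n) :
    pd i (pd j f) =ᶠ[𝓝 x] pd j (pd i f) := by
  filter_upwards [(hf.of_le (m := 2) (WithTop.coe_le_coe.2 le_top)).eventually (by simp)] with y h1
    using pd_comm h1 i j

theorem smooth_coord (j : Fin n) : ContDiff ℝ ∞ (fun y : Euc n => y j) :=
  (EuclideanSpace.proj j : Euc n →L[ℝ] ℝ).contDiff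

/-- `f` is smooth at the origin and vanishes there to order `k`. -/
def VanishesTo : ℕ → (Euc n → ℝ) → Prop
  | 0, f => ContDiffAt ℝ ∞ f 0
  | k + 1, f => ContDiffAt ℝ ∞ f 0 ∧ f 0 = 0 ∧ ∀ i, VanishesTo k (pd i f)

/-- The degree `k` part of the Taylor expansion at the origin. -/
def taylorPart : ℕ → (Euc n → ℝ) → MvPolynomial (Fin n) ℝ
  | 0, f => MvPolynomial.C (f 0)
  | k + 1, f => MvPolynomial.C ((k + 1 : ℝ)⁻¹) * ∑ i, MvPolynomial.X i * taylorPart k (pd i f)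

theorem VanishesTo.smooth {k : ℕ} {f : Euc n → ℝ} (h : VanishesTo k f) : ContDiffAt ℝ ∞ f 0 := by
  cases k with
  | zero => exact h
  | succ k => exact h.1

theorem VanishesTo.congr {k : ℕ} {f g : Euc n → ℝ} (h : VanishesTo k f) (hfg : g =ᶠ[𝓝 0] f) :
    VanishesTo k g := by
  induction k generalizing f g with
  | zero => exact ContDiffAt.congr_of_eventuallyEq (show ContDiffAt ℝ ∞ f 0 from h) hfg
  | succ k ih =>
    exact ⟨h.1.congr_of_eventuallyEq hfg, hfg.eq_of_nhds.trans h.2.1, fun i =>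
      ih (h.2.2 i) (pd_eventuallyEq hfg)⟩

theorem VanishesTo.of_succ {k : ℕ} {f : Euc n → ℝ} (h : VanishesTo (k + 1) f) :
    VanishesTo k f := by
  induction k generalizing f with
  | zero => exact h.1
  | succ k ih => exact ⟨h.1, h.2.1, fun i => ih (h.2.2 i)⟩

theorem VanishesTo.mono {k l : ℕ} {f : Euc n → ℝ} (h : VanishesTo k f) (hl : l ≤ k) :
    VanishesTo l f := by
  induction k with
  | zero => rwa [Nat.le_zero.1 hl]
  | succ k ih =>
    rcases hl.eq_or_lt with rfl | hl
    · exact h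
    · exact ih h.of_succ (Nat.lt_succ_iff.1 hl)

theorem VanishesTo.pd {k : ℕ} {f : Euc n → ℝ} (h : VanishesTo k f) (i : Fin n) :
    VanishesTo (k - 1) (pd i f) := by
  cases k with
  | zero => exact pd_smoothAt h i
  | succ k => exact h.2.2 i

theorem VanishesTo.add {k : ℕ} {f g : Euc n → ℝ} (hf : VanishesTo k f) (hg : VanishesTo k g) :
    VanishesTo k (fun x => f x + g x) := by
  induction k generalizing f g with
  | zero => exact ContDiffAt.add (show ContDiffAt ℝ ∞ f 0 from hf) hg
  | succ k ih =>
    refine ⟨hf.1.add hg.1, by simp [hf.2.1, hg.2.1], fun i => ?_⟩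
    exact (ih (hf.2.2 i) (hg.2.2 i)).congr (pd_add_ev hf.1 hg.1 i)

theorem vanishesTo_zero (k : ℕ) : VanishesTo k (fun _ : Euc n => (0 : ℝ)) := by
  induction k with
  | zero => exact contDiffAt_const
  | succ k ih =>
    refine ⟨contDiffAt_const, rfl, fun i => ih.congr (Filter.Eventually.of_forall fun x => ?_)⟩
    exact pd_const i 0 x

theorem VanishesTo.sum {ι : Type*} {k : ℕ} {s : Finset ι} {f : ι → Euc n → ℝ}
    (h : ∀ a ∈ s, VanishesTo k (f a)) : VanishesTo k (fun x => ∑ a ∈ s, f a x) := by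
  classical
  induction s using Finset.induction_on with
  | empty => simpa using vanishesTo_zero k
  | insert a s ha ih =>
    simp only [Finset.sum_insert ha]
    exact (h a (by simp)).add (ih fun b hb => h b (by simp [hb]))

/-- Induction on the total order. Each Leibniz term lowers the order of one factor by one; a
differentiated factor of order zero merely stays smooth, and the other factor then has order to
spare. -/
theorem VanishesTo.mul {k l : ℕ} {f g : Euc n → ℝ} (hf : VanishesTo k f) (hg : VanishesTo l g) :
    VanishesTo (k + l) (fun x => f x * g x) := by
  obtain ⟨m, hm⟩ : ∃ m, m = k + l := ⟨_, rfl⟩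
  rw [← hm]
  induction m generalizing k l f g with
  | zero => exact hf.smooth.mul hg.smooth
  | succ m ih =>
    refine ⟨hf.smooth.mul hg.smooth, ?_, fun i => ?_⟩
    · rcases k with _ | k
      · obtain rfl : l = m + 1 := by omega
        simp [hg.2.1]
      · simp [hf.2.1]
    · refine VanishesTo.congr ?_ (pd_mul_ev hf.smooth hg.smooth i)
      refine VanishesTo.add ?_ ?_
      · rcases k with _ | k
        · exact ih (k := 0) (l := m) (pd_smoothAt hf.smooth i)
            (VanishesTo.mono hg (by omega)) (by omega)
        · exact ih (hf.2.2 i) hg (by omega)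
      · rcases l with _ | l
        · exact ih (k := m) (l := 0) (VanishesTo.mono hf (by omega))
            (pd_smoothAt hg.smooth i) (by omega)
        · exact ih hf (hg.2.2 i) (by omega)

theorem VanishesTo.const_mul {k : ℕ} {f : Euc n → ℝ} (c : ℝ) (hf : VanishesTo k f) :
    VanishesTo k (fun x => c * f x) := by
  simpa using VanishesTo.mul (k := 0) (f := fun _ => c)
    (show ContDiffAt ℝ ∞ (fun _ => c) (0 : Euc n) from contDiffAt_const) hf

theorem VanishesTo.smooth_mul {k : ℕ} {f g : Euc n → ℝ} (hf : ContDiffAt ℝ ∞ f 0)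
    (hg : VanishesTo k g) : VanishesTo k (fun x => f x * g x) := by
  simpa using VanishesTo.mul (k := 0) hf hg

theorem VanishesTo.sub {k : ℕ} {f g : Euc n → ℝ} (hf : VanishesTo k f) (hg : VanishesTo k g) :
    VanishesTo k (fun x => f x - g x) := by
  simpa [sub_eq_add_neg] using hf.add (hg.const_mul (-1))

theorem taylorPart_congr {k : ℕ} {f g : Euc n → ℝ} (h : f =ᶠ[𝓝 0] g) :
    taylorPart k f = taylorPart k g := by
  induction k generalizing f g with
  | zero => simp [taylorPart, h.eq_of_nhds]
  | succ k ih =>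
    simp only [taylorPart]
    rw [Finset.sum_congr rfl fun i _ => by rw [ih (pd_eventuallyEq h)]]

theorem taylorPart_add {k : ℕ} {f g : Euc n → ℝ} (hf : ContDiffAt ℝ ∞ f 0)
    (hg : ContDiffAt ℝ ∞ g 0) :
    taylorPart k (fun x => f x + g x) = taylorPart k f + taylorPart k g := by
  induction k generalizing f g with
  | zero => simp [taylorPart]
  | succ k ih =>
    simp only [taylorPart]
    rw [← mul_add, ← Finset.sum_add_distrib]
    congr 1
    refine Finset.sum_congr rfl fun i _ => ?_
    rw [taylorPart_congr (pd_add_ev hf hg i), ih (pd_smoothAt hf i) (pd_smoothAt hg i), mul_add]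

theorem taylorPart_const_mul {k : ℕ} (c : ℝ) {f : Euc n → ℝ} (hf : ContDiffAt ℝ ∞ f 0) :
    taylorPart k (fun x => c * f x) = MvPolynomial.C c * taylorPart k f := by
  induction k generalizing f with
  | zero => simp [taylorPart]
  | succ k ih =>
    simp only [taylorPart]
    rw [mul_left_comm]
    congr 1
    rw [Finset.mul_sum]
    refine Finset.sum_congr rfl fun i _ => ?_
    rw [taylorPart_congr (pd_const_mul_ev hf c i), ih (pd_smoothAt hf i)]
    ring

theorem taylorPart_sub {k : ℕ} {f g : Euc n → ℝ} (hf : ContDiffAt ℝ ∞ f 0)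
    (hg : ContDiffAt ℝ ∞ g 0) :
    taylorPart k (fun x => f x - g x) = taylorPart k f - taylorPart k g := by
  have h := taylorPart_add (k := k) hf (contDiffAt_const.mul hg : ContDiffAt ℝ ∞ (fun x => -1 * g x) 0)
  rw [taylorPart_const_mul _ hg] at h
  simpa [sub_eq_add_neg] using h

theorem VanishesTo.taylorPart_eq_zero {k : ℕ} {f : Euc n → ℝ} (h : VanishesTo (k + 1) f) :
    taylorPart k f = 0 := by
  induction k generalizing f with
  | zero => simp [taylorPart, h.2.1]
  | succ k ih =>
    simp only [taylorPart]
    simp [ih (h.2.2 _)]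

theorem taylorPart_sum {ι : Type*} {k : ℕ} {s : Finset ι} {f : ι → Euc n → ℝ}
    (h : ∀ a ∈ s, ContDiffAt ℝ ∞ (f a) 0) :
    taylorPart k (fun x => ∑ a ∈ s, f a x) = ∑ a ∈ s, taylorPart k (f a) := by
  classical
  induction s using Finset.induction_on with
  | empty => simp [(vanishesTo_zero (n := n) (k + 1)).taylorPart_eq_zero]
  | insert a s ha ih =>
    simp only [Finset.sum_insert ha]
    rw [taylorPart_add (h a (by simp)) (VanishesTo.sum (k := 0) fun b hb => h b (by simp [hb])),
      ih fun b hb => h b (by simp [hb])]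

/-- `taylorPart` is defined through Euler's identity (k+1) p = ∑ x_i ∂_i p. Commuting mixed partials
make this recursion consistent with differentiation, so the parts are genuine Taylor polynomials. -/
theorem pderiv_taylorPart {k : ℕ} {f : Euc n → ℝ} (hf : ContDiffAt ℝ ∞ f 0) (j : Fin n) :
    MvPolynomial.pderiv j (taylorPart (k + 1) f) = taylorPart k (pd j f) := by
  induction k generalizing f with
  | zero => simp [taylorPart, MvPolynomial.pderiv_X, Pi.single_apply]
  | succ k ih =>
    rw [taylorPart, MvPolynomial.pderiv_C_mul, map_sum]
    have h1 : ∀ i, MvPolynomial.pderiv j (MvPolynomial.X i * taylorPart (k + 1) (pd i f)) =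
        (if i = j then taylorPart (k + 1) (pd j f) else 0) +
          MvPolynomial.X i * taylorPart k (pd i (pd j f)) := by
      intro i
      rw [Derivation.leibniz, ih (pd_smoothAt hf i), taylorPart_congr (pd_comm_ev hf j i),
        MvPolynomial.pderiv_X, add_comm]
      rcases eq_or_ne i j with rfl | hij
      · simp
      · simp [hij]
    simp only [h1, Finset.sum_add_distrib, Finset.sum_ite_eq', Finset.mem_univ, if_true]
    have h2 : ∑ i, MvPolynomial.X i * taylorPart k (pd i (pd j f)) =
        MvPolynomial.C (k + 1 : ℝ) * taylorPart (k + 1) (pd j f) := by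
      rw [taylorPart, ← mul_assoc, ← MvPolynomial.C_mul, mul_inv_cancel₀ (by positivity),
        MvPolynomial.C_1, one_mul]
    rw [h2]
    have : (MvPolynomial.C ((((k + 1 : ℕ) : ℝ) + 1)⁻¹) : MvPolynomial (Fin n) ℝ) *
        MvPolynomial.C ((k : ℝ) + 1 + 1) = 1 := by
      rw [← MvPolynomial.C_mul]
      push_cast
      rw [inv_mul_cancel₀ (by positivity), MvPolynomial.C_1]
    have h3 : (MvPolynomial.C ((k : ℝ) + 1 + 1) : MvPolynomial (Fin n) ℝ) =
        1 + MvPolynomial.C ((k : ℝ) + 1) := by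
      simp only [MvPolynomial.C_add, MvPolynomial.C_1]; ring
    rw [h3] at this
    linear_combination (taylorPart (k + 1) (pd j f)) * this

theorem taylorPart_isHomogeneous (k : ℕ) (f : Euc n → ℝ) : (taylorPart k f).IsHomogeneous k := by
  induction k generalizing f with
  | zero => exact MvPolynomial.isHomogeneous_C _ _
  | succ k ih =>
    have : (∑ i, MvPolynomial.X i * taylorPart k (pd i f)).IsHomogeneous (k + 1) := by
      refine MvPolynomial.IsHomogeneous.sum _ _ _ fun i _ => ?_
      rw [add_comm k 1]
      exact (MvPolynomial.isHomogeneous_X ℝ i).mul (ih _)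
    simpa [taylorPart] using (MvPolynomial.isHomogeneous_C (Fin n) ((k + 1 : ℝ)⁻¹)).mul this

/-- The lever of the flatness induction: killing one homogeneous part raises the order by one. The
hypothesis passes to the partial derivatives by `pderiv_taylorPart`. -/
theorem vanishesTo_succ {k : ℕ} {f : Euc n → ℝ} (h : VanishesTo k f) (h0 : taylorPart k f = 0) :
    VanishesTo (k + 1) f := by
  induction k generalizing f with
  | zero =>
    exact ⟨h, by simpa [taylorPart] using h0, fun i => pd_smoothAt h i⟩
  | succ k ih =>
    refine ⟨h.1, h.2.1, fun i => ih (h.2.2 i) ?_⟩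
    rw [← pderiv_taylorPart h.1, h0, map_zero]

/-- This turns the relation (g - δ) x = 0 into one relation for each homogeneous part of g - δ. -/
theorem taylorPart_coord_mul {k : ℕ} {f : Euc n → ℝ} (hf : ContDiffAt ℝ ∞ f 0) (j : Fin n) :
    taylorPart (k + 1) (fun x => x j * f x) = MvPolynomial.X j * taylorPart k f := by
  induction k generalizing f with
  | zero =>
    have h1 : ∀ i, pd i (fun x : Euc n => x j * f x) 0 = if i = j then f 0 else 0 := by
      intro i
      rw [pd_mul ((smooth_coord j).contDiffAt.differentiableAt (by simp))
        (hf.differentiableAt (by simp)), pd_coord]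
      simp
    simp [taylorPart, h1, apply_ite MvPolynomial.C]
  | succ k ih =>
    rw [taylorPart]
    have h1 : ∀ i, taylorPart (k + 1) (pd i (fun x : Euc n => x j * f x)) =
        (if i = j then taylorPart (k + 1) f else 0) +
          MvPolynomial.X j * taylorPart k (pd i f) := by
      intro i
      rw [taylorPart_congr (pd_mul_ev (smooth_coord j).contDiffAt hf i)]
      rw [taylorPart_add (ContDiffAt.mul (pd_smoothAt (smooth_coord j).contDiffAt i) hf)
        ((smooth_coord j).contDiffAt.mul (pd_smoothAt hf i)), ih (pd_smoothAt hf i)]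
      congr 1
      have : (fun x : Euc n => pd i (fun y : Euc n => y j) x * f x) =
          fun x => (if i = j then 1 else 0) * f x := by
        funext x; rw [pd_coord]
      rw [this, taylorPart_const_mul _ hf]
      split_ifs <;> simp
    have h2 : ∑ i, MvPolynomial.X i * taylorPart k (pd i f) =
        MvPolynomial.C (k + 1 : ℝ) * taylorPart (k + 1) f := by
      rw [taylorPart, ← mul_assoc, ← MvPolynomial.C_mul, mul_inv_cancel₀ (by positivity),
        MvPolynomial.C_1, one_mul]
    have h4 : ∑ i, MvPolynomial.X i * ((if i = j then taylorPart (k + 1) f else 0) +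
          MvPolynomial.X j * taylorPart k (pd i f)) = MvPolynomial.X j * taylorPart (k + 1) f +
        MvPolynomial.X j * (MvPolynomial.C (k + 1 : ℝ) * taylorPart (k + 1) f) := by
      rw [← h2, Finset.mul_sum]
      simp only [mul_add, Finset.sum_add_distrib, mul_ite, mul_zero, Finset.sum_ite_eq',
        Finset.mem_univ, if_true]
      congr 1
      exact Finset.sum_congr rfl fun i _ => by ring
    simp only [h1]
    rw [h4]
    have : (MvPolynomial.C ((((k + 1 : ℕ) : ℝ) + 1)⁻¹) : MvPolynomial (Fin n) ℝ) *
        MvPolynomial.C ((k : ℝ) + 1 + 1) = 1 := by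
      rw [← MvPolynomial.C_mul]
      push_cast
      rw [inv_mul_cancel₀ (by positivity), MvPolynomial.C_1]
    have h3 : (MvPolynomial.C ((k : ℝ) + 1 + 1) : MvPolynomial (Fin n) ℝ) =
        1 + MvPolynomial.C ((k : ℝ) + 1) := by
      simp only [MvPolynomial.C_add, MvPolynomial.C_1]; ring
    rw [h3] at this
    linear_combination (MvPolynomial.X j * taylorPart (k + 1) f) * this

end TaylorParts

/-! ### Linearized curvature of polynomial tensors: no Weyl part forces vanishing. -/

section LinearizedCurvature
open MvPolynomial
variable {n : ℕ}

local notation "Poly" => MvPolynomial (Fin n) ℝ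

/-- Second derivatives of a polynomial commute. -/
theorem pderiv_comm (i j : Fin n) (p : Poly) : pderiv i (pderiv j p) = pderiv j (pderiv i p) := by
  have h : ⁅(pderiv i : Derivation ℝ Poly Poly), (pderiv j : Derivation ℝ Poly Poly)⁆ = 0 := by
    refine MvPolynomial.derivation_ext fun k => ?_
    rw [Derivation.commutator_apply]
    simp [pderiv_X, Pi.single_apply, apply_ite]
  have h2 := congrArg (fun D : Derivation ℝ Poly Poly => D p) h
  simp only [Derivation.commutator_apply, Derivation.zero_apply] at h2
  exact sub_eq_zero.1 h2

/-- Twice the linearized Riemann tensor of a symmetric form. -/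
def linRiem (H : Fin n → Fin n → Poly) (i j k l : Fin n) : Poly :=
  pderiv i (pderiv k (H j l)) - pderiv j (pderiv k (H i l))
    - pderiv i (pderiv l (H j k)) + pderiv j (pderiv l (H i k))

theorem linRiem_bianchi (H : Fin n → Fin n → Poly) (m i j k l : Fin n) :
    pderiv m (linRiem H i j k l) + pderiv i (linRiem H j m k l)
      + pderiv j (linRiem H m i k l) = 0 := by
  simp only [linRiem, map_add, map_sub]
  rw [pderiv_comm i m (pderiv k (H j l)), pderiv_comm j m (pderiv k (H i l)),
    pderiv_comm i m (pderiv l (H j k)), pderiv_comm j m (pderiv l (H i k)),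
    pderiv_comm j i (pderiv k (H m l)), pderiv_comm j i (pderiv l (H m k))]
  ring

theorem euler {k : ℕ} {p : Poly} (hp : p.IsHomogeneous k) :
    ∑ i, X i * pderiv i p = C (k : ℝ) * p := by
  rw [hp.sum_X_mul_pderiv]
  simp [nsmul_eq_mul]

theorem pderiv_X_mul (i j : Fin n) (p : Poly) :
    pderiv i (X j * p) = (if i = j then p else 0) + X j * pderiv i p := by
  rw [Derivation.leibniz, pderiv_X, add_comm]
  rcases eq_or_ne i j with rfl | hij
  · simp
  · simp [hij, Ne.symm hij]

/-- Radial contraction of the linearized curvature of a form annihilating the radial vector. -/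
theorem linRiem_radial {k : ℕ} {H : Fin n → Fin n → Poly} (hsymm : ∀ i j, H i j = H j i)
    (hhom : ∀ i j, (H i j).IsHomogeneous (k + 2)) (hrad : ∀ i, ∑ j, X j * H i j = 0)
    (i l : Fin n) :
    ∑ j, ∑ m, X j * X m * linRiem H i j m l = - C ((k + 2 : ℝ) * (k + 3)) * H i l := by
  -- Derivatives of H x = 0 evaluate contractions of x with an index of H, and Euler's identity
  -- evaluates x_m ∂_m. The four terms of `linRiem` contribute -(k+1), -(k+1)(k+2), -2 and -(k+1),
  -- whose sum is -(k+2)(k+3).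
  have hd : ∀ i a, ∑ j, X j * pderiv a (H i j) = -H i a := by
    intro i a
    have h := congrArg (pderiv a) (hrad i)
    rw [map_sum, map_zero] at h
    simp only [pderiv_X_mul, Finset.sum_add_distrib, Finset.sum_ite_eq, Finset.mem_univ,
      if_true] at h
    linear_combination h
  have hE1 : ∀ (p : Poly) (r : ℕ), p.IsHomogeneous (r + 1) → ∀ a,
      ∑ m, X m * pderiv m (pderiv a p) = C (r : ℝ) * pderiv a p := by
    intro p r hp a
    exact euler (by simpa using hp.pderiv (i := a))
  have hdd : ∀ a b, ∑ j, ∑ m, X j * X m * pderiv a (pderiv b (H j m)) = C 2 * H a b := by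
    intro a b
    have h1 : ∀ j, ∑ m, X m * pderiv a (pderiv b (H j m)) = -pderiv a (H j b) - pderiv b (H j a) := by
      intro j
      have h := congrArg (pderiv a) (hd j b)
      rw [map_sum, map_neg] at h
      simp only [pderiv_X_mul, Finset.sum_add_distrib, Finset.sum_ite_eq, Finset.mem_univ,
        if_true] at h
      linear_combination h
    simp only [mul_assoc, ← Finset.mul_sum, h1]
    have e1 : ∀ j, X j * (-pderiv a (H j b) - pderiv b (H j a)) =
        -(X j * pderiv a (H b j)) - X j * pderiv b (H a j) := by
      intro j; rw [hsymm j b, hsymm j a]; ring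
    simp only [e1, Finset.sum_sub_distrib, Finset.sum_neg_distrib, hd]
    rw [hsymm b a]
    have : (C 2 : Poly) = 2 := rfl
    rw [this]; ring
  have t1 : ∀ b c, ∑ j, ∑ m, X j * X m * pderiv b (pderiv m (H j c)) =
      -C ((k : ℝ) + 1) * H b c := by
    intro b c
    have h1 : ∀ j, ∑ m, X j * X m * pderiv b (pderiv m (H j c)) =
        C ((k : ℝ) + 1) * (X j * pderiv b (H c j)) := by
      intro j
      have := hE1 (H j c) (k + 1) (hhom j c) b
      simp only [mul_assoc, ← Finset.mul_sum]
      rw [Finset.sum_congr rfl fun m _ => by rw [pderiv_comm b m], this, hsymm j c]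
      push_cast
      ring
    simp only [h1, ← Finset.mul_sum, hd]
    rw [hsymm b c]; ring
  have t2 : ∑ j, ∑ m, X j * X m * pderiv j (pderiv m (H i l)) =
      C (((k : ℝ) + 1) * (k + 2)) * H i l := by
    rw [Finset.sum_comm]
    have h1 : ∀ m, ∑ j, X j * X m * pderiv j (pderiv m (H i l)) =
        C ((k : ℝ) + 1) * (X m * pderiv m (H i l)) := by
      intro m
      have := hE1 (H i l) (k + 1) (hhom i l) m
      have e : ∀ j, X j * X m * pderiv j (pderiv m (H i l)) =
        X m * (X j * pderiv j (pderiv m (H i l))) := fun j => by ring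
      simp only [e, ← Finset.mul_sum]
      rw [this]
      push_cast
      ring
    simp only [h1, ← Finset.mul_sum]
    rw [euler (hhom i l), C_mul]
    push_cast
    ring
  have t3 : ∑ j, ∑ m, X j * X m * pderiv j (pderiv l (H i m)) = -C ((k : ℝ) + 1) * H i l := by
    rw [Finset.sum_comm]
    have e : ∀ m j, X j * X m * pderiv j (pderiv l (H i m)) =
        X m * X j * pderiv l (pderiv j (H m i)) := by
      intro m j
      rw [pderiv_comm, hsymm i m]; ring
    simp only [e]
    rw [t1, hsymm l i]
  simp only [linRiem, mul_add, mul_sub, Finset.sum_add_distrib, Finset.sum_sub_distrib]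
  rw [t1, t2, hdd, t3]
  have c2 : (C 2 : Poly) = 2 := rfl
  simp only [C_mul, C_add, C_1, c2]
  have c3 : (C 3 : Poly) = 3 := rfl
  rw [c3]
  ring

theorem pderiv_pderiv_sq_mul (i j : Fin n) (p : Poly) :
    pderiv i (pderiv i (X j * X j * p)) = (if i = j then 2 * p + 4 * (X j * pderiv j p) else 0) +
      X j * X j * pderiv i (pderiv i p) := by
  simp only [mul_assoc, pderiv_X_mul, map_add, apply_ite (pderiv i), map_zero]
  rcases eq_or_ne i j with rfl | hij
  · simp; ring
  · simp [hij]

theorem laplacian_normSq_mul {k : ℕ} {p : Poly} (hp : p.IsHomogeneous k) :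
    ∑ i, pderiv i (pderiv i ((∑ j, X j * X j) * p)) =
      C (2 * (n : ℝ) + 4 * k) * p + (∑ j, X j * X j) * ∑ i, pderiv i (pderiv i p) := by
  simp only [Finset.sum_mul, map_sum, pderiv_pderiv_sq_mul, Finset.sum_add_distrib,
    Finset.sum_ite_eq, Finset.mem_univ, if_true, Finset.mul_sum]
  have h4 : ∑ x, (4 : Poly) * (X x * pderiv x p) = 4 * (C (k : ℝ) * p) := by
    rw [← Finset.mul_sum, euler hp]
  rw [h4, Finset.sum_comm (f := fun i j => X j * X j * pderiv i (pderiv i p))]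
  have c2 : (C 2 : Poly) = 2 := rfl
  have c4 : (C 4 : Poly) = 4 := rfl
  have cn : (C (n : ℝ) : Poly) = (n : Poly) := by simp
  simp only [C_add, C_mul, c2, c4, cn, Finset.sum_const, Finset.card_univ, Fintype.card_fin,
    nsmul_eq_mul]
  rw [Finset.sum_comm]
  ring

/-- A homogeneous polynomial with `c f = -|x|² Δ f`, `c > 0`, vanishes. -/
theorem eq_zero_of_laplacian {k : ℕ} {p : Poly} (hp : p.IsHomogeneous k) {c : ℝ} (hc : 0 < c)
    (h : C c * p = -((∑ j, X j * X j) * ∑ i, pderiv i (pderiv i p))) : p = 0 := by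
  induction k using Nat.strong_induction_on generalizing p c with
  | _ k ih =>
    have hcu : ∀ q : Poly, ∀ {c : ℝ}, 0 < c → C c * q = 0 → q = 0 := by
      intro q c hc hq
      rcases mul_eq_zero.1 hq with h0 | h0
      · exact absurd (C_eq_zero.1 h0) hc.ne'
      · exact h0
    set g : Poly := ∑ i, pderiv i (pderiv i p) with hg
    have hgh : g.IsHomogeneous (k - 1 - 1) :=
      MvPolynomial.IsHomogeneous.sum _ _ _ fun i _ => (hp.pderiv (i := i)).pderiv
    -- Descent in the degree: below degree two Δp vanishes outright; otherwise the Laplacian of the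
    -- relation is a relation of the same form for Δp, with a larger constant. Once Δp = 0 the
    -- original relation gives c p = 0.
    have hg0 : g = 0 := by
      rcases Nat.lt_or_ge k 2 with hk | hk
      · have h1 : ∀ i, pderiv i (pderiv i p) = 0 := by
          intro i
          have h0 : (pderiv i p).IsHomogeneous 0 := by
            have : k - 1 = 0 := by omega
            simpa [this] using hp.pderiv (i := i)
          obtain ⟨a, ha⟩ : ∃ a, pderiv i p = C a := ⟨_, (totalDegree_eq_zero_iff_eq_C.1
            (Nat.le_zero.1 h0.totalDegree_le))⟩
          rw [ha, pderiv_C]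
        simp [hg, h1]
      · refine ih (k - 1 - 1) (by omega) hgh (c := c + (2 * n + 4 * (k - 1 - 1 : ℕ))) (by positivity) ?_
        have h2 := laplacian_normSq_mul hgh
        have h3 : (∑ j : Fin n, X j * X j) * g = - (C c * p) := by rw [h, neg_neg]
        rw [h3] at h2
        have h4 : ∑ i, pderiv i (pderiv i (-(C c * p))) = -(C c * g) := by
          rw [hg, Finset.mul_sum, ← Finset.sum_neg_distrib]
          exact Finset.sum_congr rfl fun i _ => by simp [pderiv_C_mul]
        rw [h4] at h2
        rw [C_add]
        linear_combination (-1 : Poly) * h2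
    rw [hg0, mul_zero, neg_zero] at h
    exact hcu p hc h

/-- The Kulkarni-Nomizu product of `B` with the Euclidean metric. -/
def knEuclid (B : Fin n → Fin n → Poly) (i j k l : Fin n) : Poly :=
  (if j = k then B i l else 0) + (if i = l then B j k else 0)
    - (if j = l then B i k else 0) - (if i = k then B j l else 0)

/-- The dimension condition of the algebraic argument: next to any three indices there must be room
for a fourth. -/
theorem exists_fresh (hn : 4 ≤ n) (a b c : Fin n) : ∃ j, j ≠ a ∧ j ≠ b ∧ j ≠ c := by
  by_contra! h
  have h1 : (Finset.univ : Finset (Fin n)) ⊆ {a, b, c} := by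
    intro j _
    by_contra hj
    simp only [Finset.mem_insert, Finset.mem_singleton, not_or] at hj
    exact hj.2.2 (h j hj.1 hj.2.1)
  have h2 := Finset.card_le_card h1
  have h3 := Finset.card_le_three (a := a) (b := b) (c := c)
  simp only [Finset.card_univ, Fintype.card_fin] at h2
  omega

/-- With a fourth index j contracted against δ, the cyclic identity isolates the Codazzi equation
for distinct indices. On the diagonal it only gives c(m,i) + c(m,j) = 0 for the defects c(m,i) = ∂_m
B_ii - ∂_i B_mi; three such relations among i, j, r force each defect to vanish. -/
theorem knEuclid_codazzi (hn : 4 ≤ n) {B : Fin n → Fin n → Poly} (hB : ∀ i j, B i j = B j i)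
    (h : ∀ m i j k l, pderiv m (knEuclid B i j k l) + pderiv i (knEuclid B j m k l)
      + pderiv j (knEuclid B m i k l) = 0) (m i l : Fin n) :
    pderiv m (B i l) = pderiv i (B m l) := by
  have hoff : ∀ m i l, i ≠ l → m ≠ l → pderiv m (B i l) = pderiv i (B m l) := by
    intro m i l hil hml
    obtain ⟨j, hjm, hji, hjl⟩ := exists_fresh hn m i l
    have := h m i j j l
    simp [knEuclid, hjl, hjm.symm, hji.symm, hil, hml] at this
    linear_combination this
  have hpair : ∀ m i j, m ≠ i → j ≠ m → j ≠ i →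
      pderiv m (B i i) - pderiv i (B m i) + (pderiv m (B j j) - pderiv j (B m j)) = 0 := by
    intro m i j hmi hjm hji
    have := h m i j j i
    simp [knEuclid, hji, hjm.symm, hji.symm, hmi] at this
    linear_combination this
  have hdiag : ∀ m i, m ≠ i → pderiv m (B i i) = pderiv i (B m i) := by
    intro m i hmi
    obtain ⟨j, hjm, hji, -⟩ := exists_fresh hn m i i
    obtain ⟨r, hrm, hri, hrj⟩ := exists_fresh hn m i j
    have h1 := hpair m i j hmi hjm hji
    have h2 := hpair m i r hmi hrm hri
    have h3 := hpair m j r hjm.symm hrm hrj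
    have h4 : (2 : Poly) * (pderiv m (B i i) - pderiv i (B m i)) = 0 := by
      linear_combination h1 + h2 - h3
    rcases mul_eq_zero.1 h4 with h5 | h5
    · exact absurd h5 two_ne_zero
    · exact sub_eq_zero.1 h5
  rcases eq_or_ne m i with rfl | hmi
  · rfl
  rcases eq_or_ne i l with rfl | hil
  · exact hdiag m i hmi
  rcases eq_or_ne m l with rfl | hml
  · exact (hdiag i m hmi.symm).symm
  · exact hoff m i l hil hml

theorem sum_radial_knEuclid (B : Fin n → Fin n → Poly) (i : Fin n) :
    ∑ j, ∑ m, X j * X m * knEuclid B i j m i =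
      (∑ j, X j * X j) * B i i + (∑ j, ∑ m, X j * X m * B j m)
        - X i * ∑ m, X m * B i m - X i * ∑ j, X j * B j i := by
  simp only [knEuclid, mul_add, mul_sub, mul_ite, mul_zero, Finset.sum_add_distrib,
    Finset.sum_sub_distrib, Finset.sum_ite_eq, Finset.sum_ite_eq', Finset.mem_univ, if_true,
    Finset.sum_mul, Finset.mul_sum]
  have e1 : ∑ x : Fin n, ∑ y, (if x = i then X x * X y * B i y else 0) =
      ∑ y, X i * (X y * B i y) := by
    rw [Finset.sum_comm]
    simp [mul_assoc]
  rw [e1]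
  simp only [mul_assoc]
  congr 1
  exact Finset.sum_congr rfl fun j _ => by ring

/-- If the linearized curvature of a homogeneous trace-free form annihilating the radial vector
has no Weyl part, the form vanishes. -/
theorem eq_zero_of_linRiem_eq_knEuclid (hn : 4 ≤ n) {k : ℕ} {H B : Fin n → Fin n → Poly}
    (hsymm : ∀ i j, H i j = H j i) (hhom : ∀ i j, (H i j).IsHomogeneous (k + 2))
    (hrad : ∀ i, ∑ j, X j * H i j = 0) (htr : ∑ i, H i i = 0)
    (hB : ∀ i j, B i j = B j i) (hBhom : ∀ i j, (B i j).IsHomogeneous k)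
    (h : ∀ i j m l, linRiem H i j m l = knEuclid B i j m l) (i j : Fin n) : H i j = 0 := by
  have hcod := knEuclid_codazzi hn hB (fun m i j k l => by
    simp only [← h]; exact linRiem_bianchi H m i j k l)
  -- The potential: by the Codazzi equation and Euler's identity, two differentiations of f return
  -- (k+1)(k+2) B.
  set f : Poly := ∑ i, ∑ j, X i * X j * B i j with hf
  have hfl : ∀ l, pderiv l f = C ((k : ℝ) + 2) * ∑ j, X j * B l j := by
    intro l
    have e1 : ∀ i, pderiv l (∑ j, X i * X j * B i j) = (if l = i then ∑ j, X j * B l j else 0)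
        + X i * B l i + X i * ∑ j, X j * pderiv l (B i j) := by
      intro i
      simp only [mul_assoc, ← Finset.mul_sum, pderiv_X_mul, map_sum, Finset.sum_add_distrib,
        Finset.sum_ite_eq, Finset.mem_univ, if_true]
      rw [hB l i]
      split_ifs with h1
      · subst h1; ring
      · ring
    have e2 : ∑ i, X i * ∑ j, X j * pderiv l (B i j) = C (k : ℝ) * ∑ j, X j * B l j := by
      simp only [Finset.mul_sum]
      rw [Finset.sum_comm]
      refine Finset.sum_congr rfl fun j _ => ?_
      have : ∀ i, X i * (X j * pderiv l (B i j)) = X j * (X i * pderiv i (B l j)) := by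
        intro i; rw [hcod l i j]; ring
      simp only [this, ← Finset.mul_sum]
      rw [euler (hBhom l j)]; ring
    rw [hf, map_sum]
    simp only [e1, Finset.sum_add_distrib, Finset.sum_ite_eq, Finset.mem_univ, if_true, e2]
    have c2 : (C 2 : Poly) = 2 := rfl
    rw [C_add, c2]
    ring
  have hfml : ∀ m l, pderiv m (pderiv l f) = C (((k : ℝ) + 2) * (k + 1)) * B m l := by
    intro m l
    rw [hfl, pderiv_C_mul, map_sum]
    have e1 : ∑ j, pderiv m (X j * B l j) = B l m + C (k : ℝ) * B m l := by
      simp only [pderiv_X_mul, Finset.sum_add_distrib, Finset.sum_ite_eq, Finset.mem_univ, if_true]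
      have : ∀ j, X j * pderiv m (B l j) = X j * pderiv j (B m l) := by
        intro j; rw [hB l j, hcod m j l]
      simp only [this]
      rw [euler (hBhom m l)]
    rw [e1, hB l m]
    simp only [C_mul, C_add, C_1]
    ring
  have hfhom : f.IsHomogeneous (2 + k) :=
    MvPolynomial.IsHomogeneous.sum _ _ _ fun i _ => MvPolynomial.IsHomogeneous.sum _ _ _ fun j _ =>
      ((isHomogeneous_X ℝ i).mul (isHomogeneous_X ℝ j)).mul (hBhom i j)
  -- Trace of the radial contraction: the H side is zero because H is trace-free, and the
  -- Kulkarni-Nomizu side is |x|² tr B + (n-2) f.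
  have htrace : C ((n : ℝ) - 2) * f = -((∑ j, X j * X j) * ∑ i, B i i) := by
    have h1 : ∑ i, ∑ j, ∑ m, X j * X m * linRiem H i j m i = 0 := by
      simp only [linRiem_radial hsymm hhom hrad, ← Finset.mul_sum, htr, mul_zero]
    simp only [h, sum_radial_knEuclid] at h1
    rw [Finset.sum_sub_distrib, Finset.sum_sub_distrib, Finset.sum_add_distrib,
      ← Finset.mul_sum] at h1
    have e1 : ∑ i, X i * ∑ m, X m * B i m = f := by
      rw [hf]
      exact Finset.sum_congr rfl fun i _ => by
        rw [Finset.mul_sum]; exact Finset.sum_congr rfl fun j _ => by ring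
    have e2 : ∑ i, X i * ∑ m, X m * B m i = f := by
      rw [← e1]
      exact Finset.sum_congr rfl fun i _ => by
        congr 1; exact Finset.sum_congr rfl fun j _ => by rw [hB j i]
    rw [e1, e2, ← hf, Finset.sum_const, Finset.card_univ, Fintype.card_fin, nsmul_eq_mul] at h1
    have cn : (C (n : ℝ) : Poly) = (n : Poly) := by simp
    have c2 : (C 2 : Poly) = 2 := rfl
    rw [C_sub, cn, c2]
    linear_combination h1
  have hn' : (4 : ℝ) ≤ n := by exact_mod_cast hn
  have hf0 : f = 0 := by
    -- As tr B is a positive multiple of Δf, the trace relation has the form c f = -|x|² Δf.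
    refine eq_zero_of_laplacian hfhom
      (c := ((n : ℝ) - 2) * (((k : ℝ) + 2) * (k + 1))) ?_ ?_
    · have : (0 : ℝ) < (n : ℝ) - 2 := by linarith
      positivity
    · simp only [hfml, ← Finset.mul_sum]
      rw [C_mul]
      linear_combination (C (((k : ℝ) + 2) * (k + 1))) * htrace
  have hB0 : ∀ m l, B m l = 0 := by
    intro m l
    have := hfml m l
    rw [hf0, map_zero, map_zero] at this
    rcases mul_eq_zero.1 this.symm with h0 | h0
    · exact absurd (C_eq_zero.1 h0) (by positivity)
    · exact h0
  -- With B = 0 the linearized curvature is zero, and its radial contraction is a nonzero multiple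
  -- of H.
  have h1 := linRiem_radial hsymm hhom hrad i j
  simp only [h, knEuclid, hB0] at h1
  simp only [ite_self, add_zero, sub_zero, mul_zero, Finset.sum_const_zero] at h1
  rcases mul_eq_zero.1 h1.symm with h0 | h0
  · exact absurd (C_eq_zero.1 (neg_eq_zero.1 h0)) (by positivity)
  · exact h0

end LinearizedCurvature

/-! ### The Gauss lemma in normal coordinates. -/

section GaussLemma
open scoped Matrix
variable {n : ℕ}

theorem fderiv_eq_sum_pd (f : Euc n → ℝ) (y x : Euc n) :
    fderiv ℝ f y x = ∑ i, x i * pd i f y := by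
  have key : x = ∑ i, x i • EuclideanSpace.single i (1 : ℝ) := by
    ext k
    simp [Finset.sum_apply, Pi.single_apply]
  conv_lhs => rw [key]
  simp [pd, map_sum, map_smul]

/-- Mean value theorem along the segment from the origin to `x`. -/
theorem eq_of_radial_pd_eq_zero {f : Euc n → ℝ} {ρ : ℝ}
    (hf : ∀ y ∈ Metric.ball (0 : Euc n) ρ, DifferentiableAt ℝ f y) {x : Euc n}
    (hx : x ∈ Metric.ball (0 : Euc n) ρ)
    (h : ∀ t : ℝ, 0 < t → t < 1 → ∑ i, x i * pd i f (t • x) = 0) : f x = f 0 := by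
  have hmem : ∀ t : ℝ, 0 ≤ t → t ≤ 1 → t • x ∈ Metric.ball (0 : Euc n) ρ := by
    intro t h0 h1
    rw [mem_ball_zero_iff] at hx ⊢
    rw [norm_smul, Real.norm_of_nonneg h0]
    exact lt_of_le_of_lt (mul_le_of_le_one_left (norm_nonneg _) h1) hx
  have hd : ∀ t : ℝ, 0 ≤ t → t ≤ 1 →
      HasDerivAt (fun t : ℝ => f (t • x)) (∑ i, x i * pd i f (t • x)) t := by
    intro t h0 h1
    have e1 : HasDerivAt (fun t : ℝ => t • x) x t := by
      simpa using (hasDerivAt_id t).smul_const x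
    have := (hf _ (hmem t h0 h1)).hasFDerivAt.comp_hasDerivAt t e1
    rwa [fderiv_eq_sum_pd] at this
  obtain ⟨c, hc, hc'⟩ := exists_hasDerivAt_eq_slope (fun t : ℝ => f (t • x)) _ (zero_lt_one)
    (fun t ht => (hd t ht.1 ht.2).continuousAt.continuousWithinAt)
    (fun t ht => hd t ht.1.le ht.2.le)
  rw [h c hc.1 hc.2] at hc'
  simp at hc'
  linarith

/-- A metric on a ball in geodesic normal coordinates with unit determinant. -/
structure IsNormalMetric (γ : Euc n → Matrix (Fin n) (Fin n) ℝ) (ρ : ℝ) : Prop where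
  pos : 0 < ρ
  metric : IsCoordMetric γ (Metric.ball 0 ρ)
  center : γ 0 = 1
  geodesic : ∀ x ∈ Metric.ball (0 : Euc n) ρ, ∀ k,
    ∑ i, ∑ j, christoffel γ k i j x * x i * x j = 0
  det_eq : ∀ x ∈ Metric.ball (0 : Euc n) ρ, (γ x).det = 1

variable {γ : Euc n → Matrix (Fin n) (Fin n) ℝ} {ρ : ℝ}

/-- The inverse metric in the geodesic equation is removed by applying the invertible matrix γ. -/
theorem IsNormalMetric.lowered_geodesic (h : IsNormalMetric γ ρ) {x : Euc n}
    (hx : x ∈ Metric.ball (0 : Euc n) ρ) (l : Fin n) :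
    2 * ∑ i, ∑ j, pd i (fun y => γ y j l) x * x i * x j =
      ∑ i, ∑ j, pd l (fun y => γ y i j) x * x i * x j := by
  set Z : Fin n → ℝ := fun l => ∑ i, ∑ j,
    (pd i (fun y => γ y j l) x + pd j (fun y => γ y i l) x - pd l (fun y => γ y i j) x) * x i * x j
    with hZ
  have h1 : (γ x)⁻¹ *ᵥ Z = 0 := by
    funext k
    have h2 := h.geodesic x hx k
    have h3 : ∑ i, ∑ j, christoffel γ k i j x * x i * x j = (1 / 2) * ∑ l, (γ x)⁻¹ k l * Z l := by
      simp only [christoffel, hZ, Finset.mul_sum, Finset.sum_mul]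
      refine (Finset.sum_congr rfl fun i _ => Finset.sum_comm).trans (Finset.sum_comm.trans ?_)
      refine Finset.sum_congr rfl fun l _ => Finset.sum_congr rfl fun i _ =>
        Finset.sum_congr rfl fun j _ => ?_
      ring
    rw [h3] at h2
    simpa [Matrix.mulVec, dotProduct] using h2
  have h2 : Z = 0 := by
    have := congrArg (fun v => γ x *ᵥ v) h1
    simpa [Matrix.mulVec_mulVec, Matrix.mul_nonsing_inv _ (isUnit_iff_ne_zero.2
      (h.metric.det_ne x hx))] using this
  have h3 : Z l = 0 := congrFun h2 l
  have h4 : Z l = 2 * (∑ i, ∑ j, pd i (fun y => γ y j l) x * x i * x j) -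
      ∑ i, ∑ j, pd l (fun y => γ y i j) x * x i * x j := by
    simp only [hZ, add_mul, sub_mul, Finset.sum_add_distrib, Finset.sum_sub_distrib]
    rw [Finset.sum_comm (f := fun i j => pd j (fun y => γ y i l) x * x i * x j), two_mul]
    congr 2
    exact Finset.sum_congr rfl fun i _ => Finset.sum_congr rfl fun j _ => by ring
  linarith

theorem IsNormalMetric.diffAt (h : IsNormalMetric γ ρ) {x : Euc n}
    (hx : x ∈ Metric.ball (0 : Euc n) ρ) (i j : Fin n) :
    DifferentiableAt ℝ (fun y => γ y i j) x :=
  ContDiffOn.diffAt h.metric.isOpen (h.metric.smooth i j) hx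

theorem diffAt_coord (j : Fin n) (x : Euc n) : DifferentiableAt ℝ (fun y : Euc n => y j) x :=
  (smooth_coord j).contDiffAt.differentiableAt (by simp)

/-- Rays have constant speed. With x frozen, let S be the radial derivative of γ(x, x) along the
ray; contracting the lowered geodesic equation with x gives 2S = S, so S = 0. -/
theorem IsNormalMetric.radial_quadratic (h : IsNormalMetric γ ρ) {x : Euc n}
    (hx : x ∈ Metric.ball (0 : Euc n) ρ) :
    ∑ i, ∑ j, γ x i j * x i * x j = ∑ i, x i * x i := by
  have hdiff : ∀ y ∈ Metric.ball (0 : Euc n) ρ, ∀ i j,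
      DifferentiableAt ℝ (fun y => γ y i j * (x i * x j)) y := fun y hy i j =>
    (h.diffAt hy i j).mul_const _
  have key := eq_of_radial_pd_eq_zero (f := fun y => ∑ i, ∑ j, γ y i j * (x i * x j))
    (fun y hy => DifferentiableAt.fun_sum fun i _ => DifferentiableAt.fun_sum fun j _ =>
      hdiff y hy i j) hx (by
    intro t h0 h1
    have hy : t • x ∈ Metric.ball (0 : Euc n) ρ := by
      rw [mem_ball_zero_iff] at hx ⊢
      rw [norm_smul, Real.norm_of_nonneg h0.le]
      exact lt_of_le_of_lt (mul_le_of_le_one_left (norm_nonneg _) h1.le) hx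
    have e1 : ∀ k, pd k (fun y => ∑ i, ∑ j, γ y i j * (x i * x j)) (t • x) =
        ∑ i, ∑ j, pd k (fun y => γ y i j) (t • x) * (x i * x j) := by
      intro k
      rw [pd_sum fun i _ => DifferentiableAt.fun_sum fun j _ => hdiff _ hy i j]
      refine Finset.sum_congr rfl fun i _ => ?_
      rw [pd_sum fun j _ => hdiff _ hy i j]
      refine Finset.sum_congr rfl fun j _ => ?_
      rw [pd_mul (h.diffAt hy i j) (differentiableAt_const _), pd_const]
      ring
    simp only [e1]
    set D : Fin n → Fin n → Fin n → ℝ := fun k i j => pd k (fun y => γ y i j) (t • x) with hD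
    have h2 : ∀ l, 2 * ∑ i, ∑ j, D i j l * x i * x j = ∑ i, ∑ j, D l i j * x i * x j := by
      intro l
      have := h.lowered_geodesic hy l
      simp only [PiLp.smul_apply, smul_eq_mul] at this
      have e2 : ∀ E : Fin n → Fin n → ℝ, ∑ i, ∑ j, E i j * (t * x i) * (t * x j) =
          t ^ 2 * ∑ i, ∑ j, E i j * x i * x j := by
        intro E
        simp only [Finset.mul_sum]
        exact Finset.sum_congr rfl fun i _ => Finset.sum_congr rfl fun j _ => by ring
      rw [e2 (fun i j => D i j l), e2 (fun i j => D l i j)] at this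
      have ht : t ^ 2 ≠ 0 := by positivity
      apply mul_left_cancel₀ ht
      linarith
    have h3 : ∑ l, x l * (2 * ∑ i, ∑ j, D i j l * x i * x j) =
        2 * ∑ k, x k * ∑ i, ∑ j, D k i j * (x i * x j) := by
      simp only [Finset.mul_sum]
      rw [Finset.sum_comm]
      refine Finset.sum_congr rfl fun i _ => ?_
      rw [Finset.sum_comm]
      exact Finset.sum_congr rfl fun j _ => Finset.sum_congr rfl fun k _ => by ring
    simp only [h2] at h3
    have h4 : ∑ l, x l * ∑ i, ∑ j, D l i j * x i * x j =
        ∑ k, x k * ∑ i, ∑ j, D k i j * (x i * x j) := by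
      simp only [mul_assoc]
    linarith)
  simp only [h.center, ← mul_assoc] at key
  rw [key]
  simp [Matrix.one_apply]

/-- The Gauss lemma: `g_ij x_j = x_i`. -/
theorem IsNormalMetric.gauss (h : IsNormalMetric γ ρ) {x : Euc n}
    (hx : x ∈ Metric.ball (0 : Euc n) ρ) (l : Fin n) :
    ∑ j, γ x l j * x j = x l := by
  have hq : ∀ y ∈ Metric.ball (0 : Euc n) ρ, ∀ k, pd k (fun y => ∑ j, γ y l j * y j) y =
      ∑ j, pd k (fun y => γ y l j) y * y j + γ y l k := by
    intro y hy k
    rw [pd_sum fun j _ => (h.diffAt hy l j).fun_mul (diffAt_coord j y)]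
    simp only [pd_mul (h.diffAt hy l _) (diffAt_coord _ y), pd_coord, Finset.sum_add_distrib]
    simp
  -- The ∂_l derivative of the constant-speed relation γ(y, y) = |y|².
  have hF : ∀ y ∈ Metric.ball (0 : Euc n) ρ, ∀ l,
      ∑ i, ∑ j, pd l (fun y => γ y i j) y * y i * y j + 2 * ∑ j, γ y l j * y j = 2 * y l := by
    intro y hy l
    have e1 := pd_congr_on h.metric.isOpen (fun z hz => h.radial_quadratic hz) (i := l) hy
    have d1 : ∀ i j, DifferentiableAt ℝ (fun y : Euc n => γ y i j * y i * y j) y := fun i j =>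
      ((h.diffAt hy i j).fun_mul (diffAt_coord i y)).fun_mul (diffAt_coord j y)
    rw [pd_sum fun i _ => DifferentiableAt.fun_sum fun j _ => d1 i j,
      pd_sum fun i _ => (diffAt_coord i y).fun_mul (diffAt_coord i y)] at e1
    simp only [pd_sum fun j _ => d1 _ j, pd_mul (diffAt_coord _ y) (diffAt_coord _ y),
      pd_mul ((h.diffAt hy _ _).fun_mul (diffAt_coord _ y)) (diffAt_coord _ y),
      pd_mul (h.diffAt hy _ _) (diffAt_coord _ y), pd_coord, add_mul, mul_ite, ite_mul, mul_one,
      one_mul, mul_zero, zero_mul, Finset.sum_add_distrib, Finset.sum_ite_eq, Finset.mem_univ,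
      if_true] at e1
    have e2 : ∑ i, ∑ j, (if l = i then γ y i j * y j else 0) = ∑ j, γ y l j * y j := by
      rw [Finset.sum_comm]; simp
    have e3 : ∑ i, γ y i l * y i = ∑ j, γ y l j * y j :=
      Finset.sum_congr rfl fun i _ => by rw [h.metric.symm y hy]
    rw [e2, e3] at e1
    linarith
  have key := eq_of_radial_pd_eq_zero (f := fun y => ∑ j, γ y l j * y j - y l)
    (fun y hy => (DifferentiableAt.fun_sum fun j _ => (h.diffAt hy l j).fun_mul
      (diffAt_coord j y)).sub (diffAt_coord l y)) hx (by
    intro t h0 h1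
    have hy : t • x ∈ Metric.ball (0 : Euc n) ρ := by
      rw [mem_ball_zero_iff] at hx ⊢
      rw [norm_smul, Real.norm_of_nonneg h0.le]
      exact lt_of_le_of_lt (mul_le_of_le_one_left (norm_nonneg _) h1.le) hx
    obtain ⟨y, hyx⟩ : ∃ y, y = t • x := ⟨_, rfl⟩
    rw [← hyx] at hy ⊢
    -- The radial derivative of γ y - y is the geodesic term plus γ y - y itself. The geodesic
    -- equation makes the former half of (∂_l γ)(y, y), which `hF` evaluates as minus the latter.
    have hz : ∑ i, y i * pd i (fun y => ∑ j, γ y l j * y j - y l) y = 0 := by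
      have e1 : ∀ i, pd i (fun y : Euc n => ∑ j, γ y l j * y j - y l) y =
          ∑ j, pd i (fun y => γ y l j) y * y j + γ y l i - if i = l then 1 else 0 := by
        intro i
        rw [pd_sub (DifferentiableAt.fun_sum fun j _ => (h.diffAt hy l j).fun_mul
          (diffAt_coord j y)) (diffAt_coord l y), hq y hy, pd_coord]
      simp only [e1, mul_add, mul_sub, Finset.sum_add_distrib, Finset.sum_sub_distrib, mul_ite,
        mul_one, mul_zero, Finset.sum_ite_eq', Finset.mem_univ, if_true]
      have e2 : ∑ i, y i * ∑ j, pd i (fun y => γ y l j) y * y j =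
          ∑ i, ∑ j, pd i (fun y => γ y j l) y * y i * y j := by
        refine Finset.sum_congr rfl fun i _ => ?_
        rw [Finset.mul_sum]
        refine Finset.sum_congr rfl fun j _ => ?_
        rw [pd_congr_on h.metric.isOpen (fun z hz => h.metric.symm z hz l j) hy]
        ring
      have e3 : ∑ i, y i * γ y l i = ∑ j, γ y l j * y j :=
        Finset.sum_congr rfl fun i _ => mul_comm _ _
      rw [e2, e3]
      have := h.lowered_geodesic hy l
      have := hF y hy l
      linarith
    rw [hyx] at hz ⊢
    simp only [PiLp.smul_apply, smul_eq_mul, mul_assoc, ← Finset.mul_sum] at hz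
    exact (mul_eq_zero.1 hz).resolve_left h0.ne')
  simp at key
  linarith

end GaussLemma

/-! ### From vanishing covariant derivatives to vanishing Taylor coefficients. -/

section CovariantVanishing
variable {n : ℕ} {γ : Euc n → Matrix (Fin n) (Fin n) ℝ}

theorem covDeriv_smooth (hΓ : ∀ k i j, ContDiffAt ℝ ∞ (christoffel γ k i j) 0) {r : ℕ}
    {T : (Fin r → Fin n) → Euc n → ℝ} (hT : ∀ I, ContDiffAt ℝ ∞ (T I) 0) (I : Fin (r + 1) → Fin n) :
    ContDiffAt ℝ ∞ (covDeriv γ T I) 0 := by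
  refine VanishesTo.sub (k := 0) (pd_smoothAt (hT _) _) ?_
  refine VanishesTo.sum fun s _ => VanishesTo.sum fun k _ => ?_
  exact (hΓ _ _ _).mul (hT _)

theorem covDerivIter_smooth (hΓ : ∀ k i j, ContDiffAt ℝ ∞ (christoffel γ k i j) 0) {r : ℕ}
    {T : (Fin r → Fin n) → Euc n → ℝ} (hT : ∀ I, ContDiffAt ℝ ∞ (T I) 0) (m : ℕ)
    (I : Fin (r + m) → Fin n) : ContDiffAt ℝ ∞ (covDerivIter γ T m I) 0 := by
  induction m with
  | zero => exact hT I
  | succ m ih => exact covDeriv_smooth hΓ ih I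

/-- A tensor whose covariant derivatives of order at most `p` vanish at the origin vanishes there
to order `p + 1`. -/
theorem vanishesTo_of_covDerivIter (hΓ : ∀ k i j, ContDiffAt ℝ ∞ (christoffel γ k i j) 0) {r : ℕ}
    {T : (Fin r → Fin n) → Euc n → ℝ} (hT : ∀ I, ContDiffAt ℝ ∞ (T I) 0) {p : ℕ}
    (h : ∀ m ≤ p, ∀ I, covDerivIter γ T m I 0 = 0) (I : Fin r → Fin n) :
    VanishesTo (p + 1) (T I) := by
  -- Strengthened claim for the induction: every ∇^m T vanishes to order j + 1 as long as m + j ≤ p.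
  -- A partial derivative of ∇^m T is ∇^{m+1} T plus Γ times ∇^m T, and both terms are covered by
  -- the case j.
  have key : ∀ j m, m + j ≤ p → ∀ I, VanishesTo (j + 1) (covDerivIter γ T m I) := by
    intro j
    induction j with
    | zero =>
      intro m hm I
      exact ⟨covDerivIter_smooth hΓ hT m I, h m hm I, fun i =>
        pd_smoothAt (covDerivIter_smooth hΓ hT m I) i⟩
    | succ j ih =>
      intro m hm I
      refine ⟨covDerivIter_smooth hΓ hT m I, h m (by omega) I, fun i => ?_⟩
      have h1 := ih (m + 1) (by omega) (Fin.cons i I : Fin (r + m + 1) → Fin n)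
      have h2 : VanishesTo (j + 1) (fun x => ∑ s, ∑ k, christoffel γ k i (I s) x *
          covDerivIter γ T m (Function.update I s k) x) :=
        VanishesTo.sum fun s _ => VanishesTo.sum fun k _ =>
          VanishesTo.smooth_mul (hΓ _ _ _) (ih m (by omega) _)
      refine (h1.add h2).congr (Filter.Eventually.of_forall fun x => ?_)
      simp only [covDerivIter, covDeriv, Fin.tail_cons, Fin.cons_zero]
      exact (sub_add_cancel _ _).symm
  exact key p 0 (by omega) I

end CovariantVanishing

/-! ### Vanishing of the Weyl tensor forces flatness of the metric. -/

section Flatness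
variable {n : ℕ} {γ : Euc n → Matrix (Fin n) (Fin n) ℝ} {ρ : ℝ}

/-- The deviation of a metric from the Euclidean one. -/
def metricDev (γ : Euc n → Matrix (Fin n) (Fin n) ℝ) (i j : Fin n) (x : Euc n) : ℝ :=
  γ x i j - if i = j then 1 else 0

/-- Leading-order rule: a factor with value c at the origin acts on the lowest Taylor part as the
constant c. It lets γ and its inverse be replaced by δ in leading terms. -/
theorem taylorPart_mul_of_sub_vanishes {k : ℕ} {f g : Euc n → ℝ} (hf : VanishesTo k f) {c : ℝ}
    (hg : VanishesTo 1 (fun x => g x - c)) :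
    taylorPart k (fun x => f x * g x) = MvPolynomial.C c * taylorPart k f := by
  have e : (fun x => f x * g x) = fun x => c * f x + f x * (g x - c) := by
    funext x; ring
  rw [e, taylorPart_add (hf.const_mul c).smooth (hf.mul hg).smooth, taylorPart_const_mul c hf.smooth,
    (hf.mul hg).taylorPart_eq_zero, add_zero]

theorem VanishesTo.mul_of_sub_vanishes {k : ℕ} {f g : Euc n → ℝ} (hf : VanishesTo k f) {c : ℝ}
    (hg : VanishesTo 1 (fun x => g x - c)) : VanishesTo k (fun x => f x * g x) := by
  have e : (fun x => f x * g x) = fun x => c * f x + f x * (g x - c) := by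
    funext x; ring
  rw [e]
  exact (hf.const_mul c).add (hf.mul hg).of_succ

namespace IsNormalMetric

theorem ball_nhds (h : IsNormalMetric γ ρ) : Metric.ball (0 : Euc n) ρ ∈ 𝓝 0 :=
  Metric.ball_mem_nhds _ h.pos

theorem smooth_metric (h : IsNormalMetric γ ρ) (i j : Fin n) :
    ContDiffAt ℝ ∞ (fun x => γ x i j) 0 := (h.metric.smooth i j).contDiffAt h.ball_nhds

theorem smooth_inv (h : IsNormalMetric γ ρ) (i j : Fin n) :
    ContDiffAt ℝ ∞ (fun x => (γ x)⁻¹ i j) 0 := (h.metric.smooth_inv i j).contDiffAt h.ball_nhds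

theorem smooth_dev (h : IsNormalMetric γ ρ) (i j : Fin n) : ContDiffAt ℝ ∞ (metricDev γ i j) 0 :=
  (h.smooth_metric i j).sub contDiffAt_const

theorem smooth_christoffel (h : IsNormalMetric γ ρ) (k i j : Fin n) :
    ContDiffAt ℝ ∞ (christoffel γ k i j) 0 :=
  (contDiffOn_of_eq_ev (h.metric.christoffel_eq k i j)).contDiffAt h.ball_nhds

theorem smooth_schouten (h : IsNormalMetric γ ρ) (i j : Fin n) :
    ContDiffAt ℝ ∞ (schouten γ i j) 0 :=
  (contDiffOn_of_eq_ev (h.metric.schouten_eq i j)).contDiffAt h.ball_nhds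

theorem smooth_riemannUp (h : IsNormalMetric γ ρ) (i j k m : Fin n) :
    ContDiffAt ℝ ∞ (riemannUp γ i j k m) 0 :=
  (contDiffOn_of_eq_ev (h.metric.riemannUp_eq i j k m)).contDiffAt h.ball_nhds

theorem smooth_riemann (h : IsNormalMetric γ ρ) (i j k m : Fin n) :
    ContDiffAt ℝ ∞ (riemann γ i j k m) 0 :=
  VanishesTo.sum (k := 0) fun _ _ => (h.smooth_riemannUp _ _ _ _).mul (h.smooth_metric _ _)

theorem smooth_weyl (h : IsNormalMetric γ ρ) (I : Fin 4 → Fin n) :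
    ContDiffAt ℝ ∞ (weyl γ I) 0 := by
  have h1 : ∀ i j k l, ContDiffAt ℝ ∞ (fun x => schouten γ i j x * γ x k l) 0 := fun i j k l =>
    (h.smooth_schouten i j).mul (h.smooth_metric k l)
  exact (h.smooth_riemann _ _ _ _).sub ((((h1 _ _ _ _).add (h1 _ _ _ _)).sub (h1 _ _ _ _)).sub
    (h1 _ _ _ _))

theorem dev_symm (h : IsNormalMetric γ ρ) (i j : Fin n) :
    metricDev γ i j =ᶠ[𝓝 0] metricDev γ j i := by
  filter_upwards [h.ball_nhds] with x hx
  simp only [metricDev, h.metric.symm x hx i j, eq_comm]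

theorem pd_dev (h : IsNormalMetric γ ρ) (a i j : Fin n) :
    pd a (fun x => γ x i j) =ᶠ[𝓝 0] pd a (metricDev γ i j) := by
  filter_upwards [h.ball_nhds] with x hx
  have : metricDev γ i j = fun x => γ x i j - (fun _ => if i = j then (1 : ℝ) else 0) x := rfl
  rw [this, pd_sub (h.diffAt hx i j) (differentiableAt_const _), pd_const, sub_zero]

/-- γ⁻¹ - 1 = -γ⁻¹ (γ - 1), so the inverse is as flat as the metric. -/
theorem inv_dev (h : IsNormalMetric γ ρ) {k : ℕ} (hk : ∀ i j, VanishesTo k (metricDev γ i j))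
    (i j : Fin n) : VanishesTo k (fun x => (γ x)⁻¹ i j - if i = j then 1 else 0) := by
  have h1 : VanishesTo k (fun x => -1 * ∑ l, (γ x)⁻¹ i l * metricDev γ l j x) :=
    (VanishesTo.sum fun l _ => VanishesTo.smooth_mul (h.smooth_inv i l) (hk l j)).const_mul (-1)
  refine h1.congr ?_
  filter_upwards [h.ball_nhds] with x hx
  have h2 := congrFun (congrFun (Matrix.nonsing_inv_mul (γ x)
    (isUnit_iff_ne_zero.2 (h.metric.det_ne x hx))) i) j
  rw [Matrix.mul_apply, Matrix.one_apply] at h2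
  simp only [metricDev, mul_sub, Finset.sum_sub_distrib, h2]
  split_ifs with hij
  · simp [hij]; ring
  · simp

theorem dev_one (h : IsNormalMetric γ ρ) (i j : Fin n) : VanishesTo 1 (metricDev γ i j) :=
  ⟨h.smooth_dev i j, by simp [metricDev, h.center, Matrix.one_apply], fun a =>
    pd_smoothAt (h.smooth_dev i j) a⟩

theorem inv_dev_one (h : IsNormalMetric γ ρ) (i j : Fin n) :
    VanishesTo 1 (fun x => (γ x)⁻¹ i j - if i = j then 1 else 0) :=
  h.inv_dev h.dev_one i j

theorem christoffel_vanishes (h : IsNormalMetric γ ρ) {k : ℕ}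
    (hk : ∀ i j, VanishesTo (k + 1) (metricDev γ i j)) (m i j : Fin n) :
    VanishesTo k (christoffel γ m i j) ∧ taylorPart k (christoffel γ m i j) =
      MvPolynomial.C (1 / 2) * (MvPolynomial.pderiv i (taylorPart (k + 1) (metricDev γ j m))
        + MvPolynomial.pderiv j (taylorPart (k + 1) (metricDev γ i m))
        - MvPolynomial.pderiv m (taylorPart (k + 1) (metricDev γ i j))) := by
  set Z : Fin n → Euc n → ℝ := fun l x => pd i (fun y => γ y j l) x + pd j (fun y => γ y i l) x
    - pd l (fun y => γ y i j) x with hZ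
  have hv : ∀ a i j, VanishesTo k (pd a (fun y => γ y i j)) := fun a i j =>
    ((hk i j).2.2 a).congr (h.pd_dev a i j)
  have ht : ∀ a i j, taylorPart k (pd a (fun y => γ y i j)) =
      MvPolynomial.pderiv a (taylorPart (k + 1) (metricDev γ i j)) := fun a i j => by
    rw [pderiv_taylorPart (h.smooth_dev i j), taylorPart_congr (h.pd_dev a i j)]
  have hZv : ∀ l, VanishesTo k (Z l) := fun l => ((hv _ _ _).add (hv _ _ _)).sub (hv _ _ _)
  have hZt : ∀ l, taylorPart k (Z l) =
      MvPolynomial.pderiv i (taylorPart (k + 1) (metricDev γ j l))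
        + MvPolynomial.pderiv j (taylorPart (k + 1) (metricDev γ i l))
        - MvPolynomial.pderiv l (taylorPart (k + 1) (metricDev γ i j)) := fun l => by
    simp only [hZ]
    rw [taylorPart_sub ((hv _ _ _).smooth.add (hv _ _ _).smooth) (hv _ _ _).smooth,
      taylorPart_add (hv _ _ _).smooth (hv _ _ _).smooth, ht, ht, ht]
  have e : christoffel γ m i j = fun x => (1 / 2) * ∑ l, Z l x * (γ x)⁻¹ m l := by
    funext x
    simp only [christoffel, hZ]
    exact congrArg _ (Finset.sum_congr rfl fun l _ => mul_comm _ _)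
  have hs : ∀ l ∈ Finset.univ, VanishesTo k (fun x => Z l x * (γ x)⁻¹ m l) := fun l _ =>
    (hZv l).mul_of_sub_vanishes (h.inv_dev_one m l)
  rw [e]
  refine ⟨(VanishesTo.sum hs).const_mul _, ?_⟩
  rw [taylorPart_const_mul _ (VanishesTo.sum hs).smooth, taylorPart_sum fun l hl => (hs l hl).smooth,
    ← hZt m]
  simp only [taylorPart_mul_of_sub_vanishes (hZv _) (h.inv_dev_one m _)]
  congr 1
  rw [Finset.sum_eq_single m]
  · simp
  · intro b _ hb; simp [hb.symm]
  · simp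

/-- The Christoffel symbols vanish to order k + 1, so their products vanish to order 2k + 2 and
cannot reach degree k; the leading part of the curvature is linear in the metric. -/
theorem riemannUp_vanishes (h : IsNormalMetric γ ρ) {k : ℕ}
    (hk : ∀ i j, VanishesTo (k + 2) (metricDev γ i j)) (i j m l : Fin n) :
    VanishesTo k (riemannUp γ i j m l) ∧ taylorPart k (riemannUp γ i j m l) =
      MvPolynomial.C (1 / 2) * linRiem (fun i j => taylorPart (k + 2) (metricDev γ i j)) i j m l := by
  have hc := fun a b c => h.christoffel_vanishes hk a b c
  have hp : ∀ a b c, VanishesTo (k + 1) (christoffel γ a b c) := fun a b c => (hc a b c).1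
  have hq : VanishesTo (k + 1) (fun x => ∑ p, (christoffel γ l i p x * christoffel γ p j m x
      - christoffel γ l j p x * christoffel γ p i m x)) :=
    VanishesTo.sum fun p _ => VanishesTo.sub (((hp _ _ _).mul (hp _ _ _)).mono (by omega))
      (((hp _ _ _).mul (hp _ _ _)).mono (by omega))
  have h1 : VanishesTo k (fun x => pd i (christoffel γ l j m) x - pd j (christoffel γ l i m) x) :=
    ((hp l j m).2.2 i).sub ((hp l i m).2.2 j)
  refine ⟨h1.add hq.of_succ, ?_⟩
  have e : riemannUp γ i j m l = fun x =>
      (pd i (christoffel γ l j m) x - pd j (christoffel γ l i m) x) +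
      ∑ p, (christoffel γ l i p x * christoffel γ p j m x
      - christoffel γ l j p x * christoffel γ p i m x) := rfl
  rw [e, taylorPart_add h1.smooth hq.smooth, hq.taylorPart_eq_zero, add_zero,
    taylorPart_sub ((hp l j m).2.2 i).smooth ((hp l i m).2.2 j).smooth,
    ← pderiv_taylorPart (hp l j m).smooth, ← pderiv_taylorPart (hp l i m).smooth,
    (hc l j m).2, (hc l i m).2, linRiem]
  simp only [MvPolynomial.pderiv_C_mul, map_add, map_sub]
  have e1 : taylorPart (k + 2) (metricDev γ j i) = taylorPart (k + 2) (metricDev γ i j) :=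
    taylorPart_congr (h.dev_symm j i)
  rw [pderiv_comm j i (taylorPart (k + 1 + 1) (metricDev γ m l))]
  ring

theorem riemann_vanishes (h : IsNormalMetric γ ρ) {k : ℕ}
    (hk : ∀ i j, VanishesTo (k + 2) (metricDev γ i j)) (i j m l : Fin n) :
    taylorPart k (riemann γ i j m l) =
      MvPolynomial.C (1 / 2) * linRiem (fun i j => taylorPart (k + 2) (metricDev γ i j)) i j m l := by
  have hr := fun l => (h.riemannUp_vanishes hk i j m l).1
  have e : riemann γ i j m l = fun x => ∑ p, riemannUp γ i j m p x * γ x p l := rfl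
  rw [e, taylorPart_sum fun p _ => ((hr p).mul_of_sub_vanishes (h.dev_one p l)).smooth]
  simp only [taylorPart_mul_of_sub_vanishes (hr _) (h.dev_one _ l)]
  rw [← (h.riemannUp_vanishes hk i j m l).2, Finset.sum_eq_single l]
  · simp
  · intro b _ hb; simp [hb]
  · simp

theorem schouten_vanishes (h : IsNormalMetric γ ρ) {k : ℕ}
    (hk : ∀ i j, VanishesTo (k + 2) (metricDev γ i j)) (i j : Fin n) :
    VanishesTo k (schouten γ i j) := by
  have hr : ∀ i j, VanishesTo k (ricci γ i j) := fun i j =>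
    VanishesTo.sum fun p _ => (h.riemannUp_vanishes hk p i j p).1
  have hs : VanishesTo k (scalarCurv γ) := VanishesTo.sum fun i _ => VanishesTo.sum fun j _ =>
    VanishesTo.smooth_mul (h.smooth_inv i j) (hr i j)
  have h1 := ((hr i j).sub ((VanishesTo.smooth_mul (h.smooth_metric i j) hs).const_mul
    (2 * ((n : ℝ) - 1))⁻¹)).const_mul (1 / ((n : ℝ) - 2))
  refine h1.congr (Filter.Eventually.of_forall fun x => ?_)
  simp only [schouten]
  ring

theorem schouten_symm (h : IsNormalMetric γ ρ) (i j : Fin n) :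
    schouten γ i j =ᶠ[𝓝 0] schouten γ j i := by
  filter_upwards [h.ball_nhds] with x hx
  have h1 : ricci γ i j x = ricci γ j i x := by
    rw [h.metric.ricci_eq i j ⟨x, hx⟩, h.metric.ricci_eq j i ⟨x, hx⟩, h.metric.isMetric.ric_symm]
  simp only [schouten, h1, h.metric.symm x hx i j]

theorem taylorPart_weyl (h : IsNormalMetric γ ρ) {k : ℕ}
    (hk : ∀ i j, VanishesTo (k + 2) (metricDev γ i j)) (i j m l : Fin n) :
    taylorPart k (weyl γ ![i, j, m, l]) =
      MvPolynomial.C (1 / 2) * linRiem (fun i j => taylorPart (k + 2) (metricDev γ i j)) i j m l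
        - knEuclid (fun i j => taylorPart k (schouten γ i j)) i j m l := by
  have hs := h.schouten_vanishes hk
  have hv : ∀ a b c d, ContDiffAt ℝ ∞ (fun x => schouten γ a b x * γ x c d) 0 := fun a b c d =>
    (h.smooth_schouten a b).mul (h.smooth_metric c d)
  have ht : ∀ a b c d, taylorPart k (fun x => schouten γ a b x * γ x c d) =
      if c = d then taylorPart k (schouten γ a b) else 0 := fun a b c d => by
    rw [taylorPart_mul_of_sub_vanishes (hs a b) (h.dev_one c d)]
    split_ifs <;> simp
  have e : weyl γ ![i, j, m, l] = fun x => riemann γ i j m l x -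
      (((schouten γ i l x * γ x j m + schouten γ j m x * γ x i l) -
        schouten γ i m x * γ x j l) - schouten γ j l x * γ x i m) := rfl
  rw [e, taylorPart_sub (h.smooth_riemann i j m l) ((((hv _ _ _ _).add (hv _ _ _ _)).sub
    (hv _ _ _ _)).sub (hv _ _ _ _)), taylorPart_sub (((hv _ _ _ _).add (hv _ _ _ _)).sub
    (hv _ _ _ _)) (hv _ _ _ _), taylorPart_sub ((hv _ _ _ _).add (hv _ _ _ _)) (hv _ _ _ _),
    taylorPart_add (hv _ _ _ _) (hv _ _ _ _), ht, ht, ht, ht, h.riemann_vanishes hk]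
  rfl

/-- The derivative of log det γ, which is constant. -/
theorem pd_trace (h : IsNormalMetric γ ρ) {x : Euc n} (hx : x ∈ Metric.ball (0 : Euc n) ρ)
    (k : Fin n) : ∑ i, ∑ l, (γ x)⁻¹ i l * pd k (fun y => γ y l i) x = 0 := by
  have h1 := h.metric.pd_det hx k
  have h2 : pd k (fun y => (γ y).det) x = 0 := by
    rw [pd_congr_on h.metric.isOpen h.det_eq hx, pd_const]
  rw [h2, h.det_eq x hx] at h1
  have h3 := congrArg (fun F => ev F ⟨x, hx⟩) (h.metric.isMetric.chrTr_eq k)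
  have h4 : ev (2 * Formal.chrTr h.metric.D h.metric.G h.metric.I k) ⟨x, hx⟩ =
      2 * ∑ j, christoffel γ j j k x := by
    rw [coe_mul', Formal.chrTr, coe_sum]
    simp only [← h.metric.christoffel_eq]
    rfl
  have h5 : ev (∑ i, ∑ l, h.metric.I i l * h.metric.D k (h.metric.G l i)) ⟨x, hx⟩ =
      ∑ i, ∑ l, (γ x)⁻¹ i l * pd k (fun y => γ y l i) x := by
    have e : ∀ a b c, pd a (fun y => γ y b c) x = ev (h.metric.D a (h.metric.G b c)) ⟨x, hx⟩ :=
      fun a b c => smoothDer_apply h.metric.isOpen a _ (fun _ => rfl) ⟨x, hx⟩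
    simp only [coe_sum, coe_mul', e]
    rfl
  rw [← h5, ← h3, h4]
  linarith

/-- Unit determinant gives tr(γ⁻¹ ∂γ) = 0, hence ∂ tr(γ - 1) = -tr((γ⁻¹ - 1) ∂γ), a product of
factors of orders k + 1 and k. The doubled order serves twice: for trace-freeness in the induction
and for the flux at infinity. -/
theorem trace_vanishes (h : IsNormalMetric γ ρ) {k : ℕ}
    (hk : ∀ i j, VanishesTo (k + 1) (metricDev γ i j)) :
    VanishesTo (2 * (k + 1)) (fun x => ∑ i, metricDev γ i i x) := by
  have hsm : ContDiffAt ℝ ∞ (fun x => ∑ i, metricDev γ i i x) 0 :=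
    VanishesTo.sum (k := 0) fun i _ => h.smooth_dev i i
  refine ⟨hsm, Finset.sum_eq_zero fun i _ => (hk i i).2.1, fun a => ?_⟩
  have h1 : VanishesTo (k + 1 + k) (fun x => -1 * ∑ i, ∑ l,
      ((γ x)⁻¹ i l - if i = l then 1 else 0) * pd a (metricDev γ l i) x) :=
    (VanishesTo.sum fun i _ => VanishesTo.sum fun l _ =>
      (h.inv_dev hk i l).mul ((hk l i).2.2 a)).const_mul _
  have h2 : 2 * k + 1 = k + 1 + k := by omega
  refine VanishesTo.congr (show VanishesTo (2 * k + 1) _ from h2 ▸ h1) ?_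
  have hd : ∀ᶠ x in 𝓝 (0 : Euc n), ∀ l i, pd a (fun y => γ y l i) x = pd a (metricDev γ l i) x :=
    Filter.eventually_all.2 fun l => Filter.eventually_all.2 fun i => h.pd_dev a l i
  filter_upwards [h.ball_nhds, hd] with x hx hx2
  have h3 := h.pd_trace hx a
  have h4 : ∀ i, DifferentiableAt ℝ (metricDev γ i i) x := fun i =>
    (h.diffAt hx i i).sub_const _
  rw [pd_sum fun i _ => h4 i]
  simp only [hx2] at h3
  simp only [sub_mul, Finset.sum_sub_distrib, h3]
  simp

theorem radial_dev (h : IsNormalMetric γ ρ) (i : Fin n) :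
    (fun x : Euc n => ∑ j, x j * metricDev γ i j x) =ᶠ[𝓝 0] fun _ => 0 := by
  filter_upwards [h.ball_nhds] with x hx
  have := h.gauss hx i
  have e : ∑ j, x j * metricDev γ i j x = ∑ j, γ x i j * x j - x i := by
    simp only [metricDev, mul_sub, Finset.sum_sub_distrib, mul_ite, mul_one, mul_zero,
      Finset.sum_ite_eq, Finset.mem_univ, if_true]
    congr 1
    exact Finset.sum_congr rfl fun j _ => mul_comm _ _
  rw [e, this, sub_self]

theorem taylorPart_radial (h : IsNormalMetric γ ρ) (k : ℕ) (i : Fin n) :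
    ∑ j, MvPolynomial.X j * taylorPart k (metricDev γ i j) = 0 := by
  have h1 := taylorPart_congr (k := k + 1) (h.radial_dev i)
  rw [taylorPart_sum fun j _ => (smooth_coord j).contDiffAt.mul (h.smooth_dev i j),
    (vanishesTo_zero (k + 2)).taylorPart_eq_zero] at h1
  simpa only [taylorPart_coord_mul (h.smooth_dev i _)] using h1

/-- The first derivatives b_aij at the origin are symmetric in i, j, and by the Gauss relation skew
under exchange of a with either; such an array is zero. This starts the induction, since curvature
sees the metric only from degree two on. -/
theorem dev_two (h : IsNormalMetric γ ρ) (i j : Fin n) : VanishesTo 2 (metricDev γ i j) := by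
  set b : Fin n → Fin n → Fin n → ℝ := fun a i j => pd a (metricDev γ i j) 0 with hb
  have hp : ∀ a i j, MvPolynomial.pderiv a (taylorPart 1 (metricDev γ i j)) =
      MvPolynomial.C (b a i j) := fun a i j => by
    rw [pderiv_taylorPart (h.smooth_dev i j)]; rfl
  have h1 : ∀ i a c, b c i a + b a i c = 0 := by
    intro i a c
    have h2 := congrArg (MvPolynomial.pderiv a) (h.taylorPart_radial 1 i)
    simp only [map_sum, pderiv_X_mul, hp, map_zero, Finset.sum_add_distrib,
      Finset.sum_ite_eq, Finset.mem_univ, if_true] at h2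
    have h3 := congrArg (MvPolynomial.pderiv c) h2
    rw [map_add, map_sum, map_zero, hp] at h3
    simp only [pderiv_X_mul, MvPolynomial.pderiv_C, mul_zero, add_zero,
      Finset.sum_ite_eq, Finset.mem_univ, if_true, ← MvPolynomial.C_add] at h3
    exact MvPolynomial.C_eq_zero.1 h3
  have h2 : ∀ a i j, b a i j = b a j i := fun a i j =>
    (pd_eventuallyEq (h.dev_symm i j)).eq_of_nhds
  have h3 : ∀ a i j, b a i j = 0 := by
    intro a i j
    have e1 := h1 i j a
    have e2 := h1 j a i
    have e3 := h1 a i j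
    have e4 := h2 j i a
    have e5 := h2 i j a
    have e6 := h2 a i j
    linarith
  refine vanishesTo_succ (h.dev_one i j) ?_
  rw [taylorPart]
  simp only [taylorPart]
  have : ∀ a, pd a (metricDev γ i j) 0 = 0 := fun a => h3 a i j
  simp [this]

/-- In conformal normal coordinates, the vanishing of the Weyl tensor to order `d - 2` forces the
metric to be flat to order `d`. -/
theorem dev_vanishes (h : IsNormalMetric γ ρ) (hn : 4 ≤ n) {d : ℕ}
    (hw : ∀ m : ℕ, (m : ℤ) ≤ (d : ℤ) - 2 → ∀ I : Fin (4 + m) → Fin n,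
      covDerivIter γ (weyl γ) m I 0 = 0) (i j : Fin n) :
    VanishesTo (d + 1) (metricDev γ i j) := by
  have hW : ∀ k, k + 2 ≤ d → ∀ I, taylorPart k (weyl γ I) = 0 := by
    intro k hk I
    have := vanishesTo_of_covDerivIter h.smooth_christoffel h.smooth_weyl (p := d - 2)
      (fun m hm I => hw m (by omega) I) I
    exact (this.mono (l := k + 1) (by omega)).taylorPart_eq_zero
  have key : ∀ k, k ≤ d → ∀ i j, VanishesTo (k + 1) (metricDev γ i j) := by
    intro k
    induction k with
    | zero => intro _ i j; exact h.dev_one i j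
    | succ k ih =>
      intro hk
      rcases k with _ | k
      · exact h.dev_two
      · have hv := ih (by omega)
        have htr := h.trace_vanishes hv
        intro i j
        refine vanishesTo_succ (hv i j) ?_
        -- The part of degree k + 2 is controlled by the Weyl part of degree k. The factor 2 in B is
        -- there because `linRiem` is twice the linearized curvature.
        refine eq_zero_of_linRiem_eq_knEuclid hn (k := k)
          (H := fun i j => taylorPart (k + 2) (metricDev γ i j))
          (B := fun i j => MvPolynomial.C 2 * taylorPart k (schouten γ i j))
          (fun i j => taylorPart_congr (h.dev_symm i j))
          (fun i j => taylorPart_isHomogeneous _ _) (h.taylorPart_radial _) ?_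
          (fun i j => by rw [taylorPart_congr (h.schouten_symm i j)])
          (fun i j => by
            simpa using (MvPolynomial.isHomogeneous_C (Fin n) (2 : ℝ)).mul
              (taylorPart_isHomogeneous k (schouten γ i j))) ?_ i j
        · rw [← taylorPart_sum fun i _ => h.smooth_dev i i]
          -- The trace vanishes to order 2(k + 2) ≥ k + 3, so it has no part of degree k + 2.
          exact (htr.mono (l := k + 3) (by omega)).taylorPart_eq_zero
        · intro i j m l
          have h1 := h.taylorPart_weyl hv i j m l
          rw [hW k (by omega)] at h1
          have e : knEuclid (fun i j => MvPolynomial.C 2 * taylorPart k (schouten γ i j)) i j m l =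
              MvPolynomial.C 2 * knEuclid (fun i j => taylorPart k (schouten γ i j)) i j m l := by
            simp only [knEuclid, mul_add, mul_sub, mul_ite, mul_zero]
          have h2 : (MvPolynomial.C 2 : MvPolynomial (Fin n) ℝ) * MvPolynomial.C (1 / 2) = 1 := by
            rw [← MvPolynomial.C_mul]; norm_num
          rw [e]
          linear_combination (-linRiem (fun i j => taylorPart (k + 2) (metricDev γ i j)) i j m l)
            * h2 - (MvPolynomial.C 2 : MvPolynomial (Fin n) ℝ) * h1
  exact key d le_rfl i j

end IsNormalMetric

end Flatness

/-! ### Calculus of decay rates with derivatives. -/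

section SymbolCalculus
open Filter Asymptotics
variable {n : ℕ} {F : Filter (Euc n)}

/-- A filter of punctured neighbourhoods of an end, with a basis of open sets avoiding `0`. -/
structure IsEndFilter (F : Filter (Euc n)) : Prop where
  ne_zero : ∀ᶠ x in F, x ≠ 0
  eventually_nhds : ∀ p : Euc n → Prop, (∀ᶠ x in F, p x) → ∀ᶠ x in F, ∀ᶠ y in 𝓝 x, p y

theorem isEndFilter_nhdsNE : IsEndFilter (𝓝[≠] (0 : Euc n)) where
  ne_zero := eventually_mem_nhdsWithin
  eventually_nhds := by
    intro p hp
    obtain ⟨U, hU, h0, hs⟩ := mem_nhdsWithin.1 hp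
    have hopen : IsOpen (U ∩ {0}ᶜ) := hU.inter isOpen_compl_singleton
    refine mem_nhdsWithin.2 ⟨U, hU, h0, fun x hx => ?_⟩
    filter_upwards [hopen.mem_nhds hx] with y hy using hs hy

theorem isEndFilter_cobounded : IsEndFilter (Bornology.cobounded (Euc n)) where
  ne_zero := by
    rw [(Metric.hasBasis_cobounded_compl_closedBall (0 : Euc n)).eventually_iff]
    refine ⟨0, trivial, fun x hx => ?_⟩
    rintro rfl
    simp at hx
  eventually_nhds := by
    intro p hp
    rw [(Metric.hasBasis_cobounded_compl_closedBall (0 : Euc n)).eventually_iff] at hp ⊢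
    obtain ⟨R, -, hR⟩ := hp
    refine ⟨R, trivial, fun x hx => ?_⟩
    filter_upwards [Metric.isClosed_closedBall.isOpen_compl.mem_nhds hx] with y hy using hR hy

theorem isBigODeriv_zero_iff {s : ℝ} {f : Euc n → ℝ} : IsBigODeriv F 0 s f ↔
    (∀ᶠ x in F, ContDiffAt ℝ 0 f x) ∧ f =O[F] fun x => ‖x‖ ^ s := by
  refine and_congr Iff.rfl ⟨fun h => ?_, fun h i hi => ?_⟩
  · have := h 0 le_rfl
    rw [← isBigO_norm_left] at this ⊢
    simpa using this
  · obtain rfl : i = 0 := Nat.le_zero.1 hi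
    rw [← isBigO_norm_left] at h ⊢
    simpa using h

theorem IsBigODeriv.isBigO {l : ℕ} {s : ℝ} {f : Euc n → ℝ} (h : IsBigODeriv F l s f) :
    f =O[F] fun x => ‖x‖ ^ s := by
  have := h.2 0 (Nat.zero_le l)
  rw [← isBigO_norm_left] at this ⊢
  simpa using this

theorem IsBigODeriv.of_succ {l : ℕ} {s : ℝ} {f : Euc n → ℝ} (h : IsBigODeriv F (l + 1) s f) :
    IsBigODeriv F l s f :=
  ⟨h.1.mono fun _ hx => hx.of_le (by exact_mod_cast Nat.le_succ l), fun i hi =>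
    h.2 i (hi.trans (Nat.le_succ l))⟩

theorem IsBigODeriv.pd {l : ℕ} {s : ℝ} {f : Euc n → ℝ} (h : IsBigODeriv F (l + 1) s f)
    (j : Fin n) : IsBigODeriv F l (s - 1) (pd j f) := by
  refine ⟨h.1.mono fun x hx => ContDiffAt.pd hx (by push_cast; rfl) j, fun i hi => ?_⟩
  have h1 := h.2 (i + 1) (by omega)
  have e : s - ((i + 1 : ℕ) : ℝ) = s - 1 - i := by push_cast; ring
  rw [e] at h1
  refine IsBigO.trans ?_ h1
  set L : (Euc n →L[ℝ] ℝ) →L[ℝ] ℝ :=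
    ContinuousLinearMap.apply ℝ ℝ (EuclideanSpace.single j (1 : ℝ)) with hL
  refine IsBigO.of_bound ‖L‖ ?_
  filter_upwards [h.1] with x hx
  have h2 : ContDiffAt ℝ l (fderiv ℝ f) x := hx.fderiv_right (by push_cast; rfl)
  have h3 := L.norm_iteratedFDeriv_comp_left h2 (n := i) (by exact_mod_cast hi)
  rw [norm_iteratedFDeriv_fderiv] at h3
  exact h3

theorem fderiv_eq_sum (f : Euc n → ℝ) :
    fderiv ℝ f = fun x => ∑ j, (ContinuousLinearMap.toSpanSingleton ℝ
      (EuclideanSpace.proj j : Euc n →L[ℝ] ℝ)) (pd j f x) := by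
  funext x
  ext v
  rw [fderiv_eq_sum_pd]
  simp [mul_comm]

/-- The induction principle for the whole calculus: order l + 1 amounts to the size of f together
with order l for its partial derivatives at the rate lowered by one. -/
theorem isBigODeriv_succ {l : ℕ} {s : ℝ} {f : Euc n → ℝ}
    (hc : ∀ᶠ x in F, ContDiffAt ℝ (l + 1 : ℕ) f x) (h0 : f =O[F] fun x => ‖x‖ ^ s)
    (h : ∀ j, IsBigODeriv F l (s - 1) (PaneitzMass.pd j f)) : IsBigODeriv F (l + 1) s f := by
  refine ⟨hc, fun i hi => ?_⟩
  rcases i with _ | i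
  · rw [← isBigO_norm_left] at h0 ⊢
    simpa using h0
  · have e : s - ((i + 1 : ℕ) : ℝ) = s - 1 - i := by push_cast; ring
    rw [e, ← isBigO_norm_left]
    simp only [← norm_iteratedFDeriv_fderiv]
    rw [isBigO_norm_left]
    set L : Fin n → ℝ →L[ℝ] (Euc n →L[ℝ] ℝ) := fun j => ContinuousLinearMap.toSpanSingleton ℝ
      (EuclideanSpace.proj j : Euc n →L[ℝ] ℝ) with hL
    have h1 : ∀ j, (fun x => iteratedFDeriv ℝ i (L j ∘ PaneitzMass.pd j f) x) =O[F]
        fun x => ‖x‖ ^ (s - 1 - i) := by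
      intro j
      refine IsBigO.trans (IsBigO.of_bound ‖L j‖ ?_) ((h j).2 i (by omega))
      filter_upwards [(h j).1] with x hx
      exact (L j).norm_iteratedFDeriv_comp_left hx (by exact_mod_cast Nat.le_of_succ_le_succ hi)
    have h2 : (fun x => ∑ j, iteratedFDeriv ℝ i (L j ∘ PaneitzMass.pd j f) x) =O[F]
        fun x => ‖x‖ ^ (s - 1 - i) := IsBigO.fun_sum fun j _ => h1 j
    refine h2.congr' ?_ EventuallyEq.rfl
    have h3 : ∀ᶠ x in F, ∀ j, ContDiffAt ℝ l (PaneitzMass.pd j f) x :=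
      eventually_all.2 fun j => (h j).1
    filter_upwards [h3] with x hx
    rw [fderiv_eq_sum f, iteratedFDeriv_fun_sum_apply]
    · rfl
    · intro j _
      exact ((L j).contDiff.contDiffAt.comp x (hx j)).of_le
        (by exact_mod_cast Nat.le_of_succ_le_succ hi)

theorem IsBigODeriv.congr (hF : IsEndFilter F) {l : ℕ} {s : ℝ} {f g : Euc n → ℝ}
    (h : IsBigODeriv F l s f) (hfg : g =ᶠ[F] f) : IsBigODeriv F l s g := by
  have hn := hF.eventually_nhds _ hfg
  refine ⟨?_, fun i hi => (h.2 i hi).congr' ?_ EventuallyEq.rfl⟩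
  · filter_upwards [h.1, hn] with x h1 h2 using h1.congr_of_eventuallyEq h2
  · filter_upwards [hn] with x hx
    exact (Filter.EventuallyEq.iteratedFDeriv ℝ (show g =ᶠ[𝓝 x] f from hx) i).eq_of_nhds.symm

theorem IsBigODeriv.mono_order {l m : ℕ} {s : ℝ} {f : Euc n → ℝ} (h : IsBigODeriv F l s f)
    (hm : m ≤ l) : IsBigODeriv F m s f :=
  ⟨h.1.mono fun _ hx => hx.of_le (by exact_mod_cast hm), fun i hi => h.2 i (hi.trans hm)⟩

/-- Stating the comparison of rates as boundedness of |x|^{s-t} covers both ends: it means s ≥ t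
near the origin and s ≤ t near infinity. -/
theorem IsBigODeriv.mono_rate (hF : IsEndFilter F) {l : ℕ} {s t : ℝ} {f : Euc n → ℝ}
    (h : IsBigODeriv F l s f) (hst : (fun x : Euc n => ‖x‖ ^ (s - t)) =O[F] fun _ => (1 : ℝ)) :
    IsBigODeriv F l t f := by
  refine ⟨h.1, fun i hi => (h.2 i hi).trans ?_⟩
  have h1 : (fun x : Euc n => ‖x‖ ^ (s - t) * ‖x‖ ^ (t - i)) =O[F]
      fun x => 1 * ‖x‖ ^ (t - (i : ℝ)) := hst.mul (isBigO_refl _ _)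
  refine (h1.congr' ?_ ?_)
  · filter_upwards [hF.ne_zero] with x hx
    rw [← Real.rpow_add (norm_pos_iff.2 hx)]
    congr 1; ring
  · exact Eventually.of_forall fun x => one_mul _

theorem norm_rpow_isBigO_nhdsNE {s : ℝ} (hs : 0 ≤ s) :
    (fun x : Euc n => ‖x‖ ^ s) =O[𝓝[≠] 0] fun _ => (1 : ℝ) := by
  refine IsBigO.of_bound 1 ?_
  filter_upwards [nhdsWithin_le_nhds (Metric.ball_mem_nhds (0 : Euc n) one_pos)] with x hx
  rw [mem_ball_zero_iff] at hx
  rw [Real.norm_of_nonneg (by positivity)]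
  simpa using Real.rpow_le_one (norm_nonneg x) hx.le hs

theorem norm_rpow_isBigO_cobounded {s : ℝ} (hs : s ≤ 0) :
    (fun x : Euc n => ‖x‖ ^ s) =O[Bornology.cobounded (Euc n)] fun _ => (1 : ℝ) := by
  refine IsBigO.of_bound 1 ?_
  filter_upwards [tendsto_norm_cobounded_atTop.eventually_ge_atTop (1 : ℝ)] with x hx
  rw [Real.norm_of_nonneg (by positivity)]
  simpa using Real.rpow_le_one_of_one_le_of_nonpos hx hs

theorem IsBigODeriv.add (hF : IsEndFilter F) {l : ℕ} {s : ℝ} {f g : Euc n → ℝ}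
    (hf : IsBigODeriv F l s f) (hg : IsBigODeriv F l s g) :
    IsBigODeriv F l s (fun x => f x + g x) := by
  induction l generalizing s f g with
  | zero =>
    rw [isBigODeriv_zero_iff] at hf hg ⊢
    exact ⟨by filter_upwards [hf.1, hg.1] with x h1 h2 using h1.add h2, hf.2.add hg.2⟩
  | succ l ih =>
    refine isBigODeriv_succ (by filter_upwards [hf.1, hg.1] with x h1 h2 using h1.add h2)
      (hf.isBigO.add hg.isBigO) fun j => (ih (hf.pd j) (hg.pd j)).congr hF ?_
    filter_upwards [hf.1, hg.1] with x h1 h2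
    exact pd_add (h1.differentiableAt (by simp)) (h2.differentiableAt (by simp))

theorem IsBigODeriv.mul (hF : IsEndFilter F) {l : ℕ} {s t : ℝ} {f g : Euc n → ℝ}
    (hf : IsBigODeriv F l s f) (hg : IsBigODeriv F l t g) :
    IsBigODeriv F l (s + t) (fun x => f x * g x) := by
  have hO : ∀ {s t : ℝ} {f g : Euc n → ℝ}, (f =O[F] fun x => ‖x‖ ^ s) → (g =O[F] fun x => ‖x‖ ^ t) →
      (fun x => f x * g x) =O[F] fun x => ‖x‖ ^ (s + t) := by
    intro s t f g h1 h2
    refine (h1.mul h2).congr' EventuallyEq.rfl ?_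
    filter_upwards [hF.ne_zero] with x hx
    rw [← Real.rpow_add (norm_pos_iff.2 hx)]
  induction l generalizing s t f g with
  | zero =>
    rw [isBigODeriv_zero_iff] at hf hg ⊢
    exact ⟨by filter_upwards [hf.1, hg.1] with x h1 h2 using h1.mul h2, hO hf.2 hg.2⟩
  | succ l ih =>
    refine isBigODeriv_succ (by filter_upwards [hf.1, hg.1] with x h1 h2 using h1.mul h2)
      (hO hf.isBigO hg.isBigO) fun j => ?_
    have h1 := ih (hf.pd j) hg.of_succ
    have h2 := ih hf.of_succ (hg.pd j)
    rw [show s - 1 + t = s + t - 1 by ring] at h1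
    rw [show s + (t - 1) = s + t - 1 by ring] at h2
    refine (h1.add hF h2).congr hF ?_
    filter_upwards [hf.1, hg.1] with x h1 h2
    exact pd_mul (h1.differentiableAt (by simp)) (h2.differentiableAt (by simp))

theorem isBigODeriv_zero_fun (hF : IsEndFilter F) (l : ℕ) (s : ℝ) :
    IsBigODeriv F l s (fun _ => (0 : ℝ)) := by
  induction l generalizing s with
  | zero => exact isBigODeriv_zero_iff.2 ⟨Eventually.of_forall fun _ => contDiffAt_const, isBigO_zero _ _⟩
  | succ l ih =>
    refine isBigODeriv_succ (Eventually.of_forall fun _ => contDiffAt_const) (isBigO_zero _ _)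
      fun j => (ih (s - 1)).congr hF (Eventually.of_forall fun x => pd_const j 0 x)

theorem isBigODeriv_const (hF : IsEndFilter F) (l : ℕ) (c : ℝ) :
    IsBigODeriv F l 0 (fun _ => c) := by
  have h0 : (fun _ => c) =O[F] fun x : Euc n => ‖x‖ ^ (0 : ℝ) := by
    simp only [Real.rpow_zero]
    exact isBigO_const_const c one_ne_zero F
  cases l with
  | zero => exact isBigODeriv_zero_iff.2 ⟨Eventually.of_forall fun _ => contDiffAt_const, h0⟩
  | succ l =>
    exact isBigODeriv_succ (Eventually.of_forall fun _ => contDiffAt_const) h0 fun j =>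
      (isBigODeriv_zero_fun hF l _).congr hF (Eventually.of_forall fun x => pd_const j c x)

theorem IsBigODeriv.const_mul (hF : IsEndFilter F) {l : ℕ} {s : ℝ} {f : Euc n → ℝ} (c : ℝ)
    (hf : IsBigODeriv F l s f) : IsBigODeriv F l s (fun x => c * f x) := by
  simpa using (isBigODeriv_const hF l c).mul hF hf

theorem IsBigODeriv.sub (hF : IsEndFilter F) {l : ℕ} {s : ℝ} {f g : Euc n → ℝ}
    (hf : IsBigODeriv F l s f) (hg : IsBigODeriv F l s g) :
    IsBigODeriv F l s (fun x => f x - g x) := by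
  simpa [sub_eq_add_neg] using hf.add hF (hg.const_mul hF (-1))

theorem IsBigODeriv.sum (hF : IsEndFilter F) {ι : Type*} {S : Finset ι} {l : ℕ} {s : ℝ}
    {f : ι → Euc n → ℝ} (h : ∀ a ∈ S, IsBigODeriv F l s (f a)) :
    IsBigODeriv F l s (fun x => ∑ a ∈ S, f a x) := by
  classical
  induction S using Finset.induction_on with
  | empty => simpa using isBigODeriv_zero_fun hF l s
  | insert a S ha ih =>
    simp only [Finset.sum_insert ha]
    exact (h a (by simp)).add hF (ih fun b hb => h b (by simp [hb]))

theorem isBigODeriv_coord (hF : IsEndFilter F) (l : ℕ) (i : Fin n) :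
    IsBigODeriv F l 1 (fun x => x i) := by
  have h0 : (fun x : Euc n => x i) =O[F] fun x => ‖x‖ ^ (1 : ℝ) := by
    refine IsBigO.of_bound 1 (Eventually.of_forall fun x => ?_)
    simpa using EuclideanSpace.norm_eq x ▸ PiLp.norm_apply_le x i
  cases l with
  | zero =>
    exact isBigODeriv_zero_iff.2
      ⟨Eventually.of_forall fun _ => (smooth_coord i).contDiffAt.of_le (by simp), h0⟩
  | succ l =>
    refine isBigODeriv_succ (Eventually.of_forall fun _ => (smooth_coord i).contDiffAt.of_le
      (by exact_mod_cast le_top)) h0 fun j => ?_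
    rw [show (1 : ℝ) - 1 = 0 by ring]
    exact (isBigODeriv_const hF l _).congr hF (Eventually.of_forall fun x => pd_coord j i x)

theorem hasFDerivAt_norm_rpow {x : Euc n} (hx : x ≠ 0) (q : ℝ) (i : Fin n) :
    pd i (fun y : Euc n => ‖y‖ ^ q) x = q * (x i * ‖x‖ ^ (q - 2)) := by
  have hp : 0 < ‖x‖ := norm_pos_iff.2 hx
  have h1 : HasFDerivAt (fun y : Euc n => ‖y‖ ^ 2) (2 • innerSL ℝ x) x :=
    (hasStrictFDerivAt_norm_sq x).hasFDerivAt
  have h3 : pd i (fun y : Euc n => ‖y‖ ^ 2) x = 2 * x i := by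
    rw [pd, h1.fderiv]
    simp [EuclideanSpace.inner_single_right]
  have e : (fun y : Euc n => ‖y‖ ^ q) = fun y => (‖y‖ ^ 2) ^ (q / 2) := by
    funext y
    rw [← Real.rpow_natCast, ← Real.rpow_mul (norm_nonneg _)]
    congr 1; push_cast; ring
  rw [e, pd_comp (φ := fun t => t ^ (q / 2)) (Real.hasDerivAt_rpow_const (Or.inl (by positivity)))
    h1.differentiableAt, h3]
  rw [← Real.rpow_natCast, ← Real.rpow_mul (norm_nonneg _)]
  rw [show ((2 : ℕ) : ℝ) * (q / 2 - 1) = q - 2 by push_cast; ring]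
  ring

theorem contDiffAt_norm_rpow {x : Euc n} (hx : x ≠ 0) (q : ℝ) {m : WithTop ℕ∞} :
    ContDiffAt ℝ m (fun y : Euc n => ‖y‖ ^ q) x :=
  (contDiffAt_norm ℝ hx).rpow_const_of_ne (norm_ne_zero_iff.2 hx)

theorem isBigODeriv_norm_rpow (hF : IsEndFilter F) (l : ℕ) (q : ℝ) :
    IsBigODeriv F l q (fun x => ‖x‖ ^ q) := by
  induction l generalizing q with
  | zero =>
    exact isBigODeriv_zero_iff.2
      ⟨hF.ne_zero.mono fun x hx => contDiffAt_norm_rpow hx q, isBigO_refl _ _⟩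
  | succ l ih =>
    refine isBigODeriv_succ (hF.ne_zero.mono fun x hx => contDiffAt_norm_rpow hx q)
      (isBigO_refl _ _) fun j => ?_
    have h1 := ((isBigODeriv_coord hF l j).mul hF (ih (q - 2))).const_mul hF q
    rw [show 1 + (q - 2) = q - 1 by ring] at h1
    exact h1.congr hF (hF.ne_zero.mono fun x hx => hasFDerivAt_norm_rpow hx q j)

end SymbolCalculus

/-! ### Real powers of functions tending to one. -/

section Powers
open Filter Asymptotics
variable {n : ℕ} {F : Filter (Euc n)}

theorem pd_rpow {v : Euc n → ℝ} {x : Euc n} (hx : DifferentiableAt ℝ v x) (h0 : v x ≠ 0) (q : ℝ)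
    (i : Fin n) : pd i (fun y => v y ^ q) x = q * v x ^ (q - 1) * pd i v x :=
  pd_comp (φ := fun t => t ^ q) (Real.hasDerivAt_rpow_const (Or.inl h0)) hx

theorem pd_sub_const {v : Euc n → ℝ} (c : ℝ) (i : Fin n) :
    pd i (fun y => v y - c) = pd i v := by
  funext x
  simp [pd, fderiv_sub_const]

theorem rpow_sub_one_isBigO (q : ℝ) :
    (fun t : ℝ => t ^ q - 1) =O[𝓝 1] fun t => t - 1 := by
  have h := (Real.hasDerivAt_rpow_const (x := 1) (p := q) (Or.inl one_ne_zero)).isBigO_sub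
  simpa using h

/-- Mean value inequality on the segment from 1 to t: the derivative q (s^{q-1} - 1) of the
remainder is itself O(|t - 1|) there. -/
theorem rpow_sub_linear_isBigO (q : ℝ) :
    (fun t : ℝ => t ^ q - 1 - q * (t - 1)) =O[𝓝 1] fun t => (t - 1) * (t - 1) := by
  obtain ⟨C, hC⟩ := (rpow_sub_one_isBigO (q - 1)).bound
  obtain ⟨ε, hε, hball⟩ := Metric.eventually_nhds_iff_ball.1
    (hC.and (lt_mem_nhds (show (0 : ℝ) < 1 by norm_num)))
  refine IsBigO.of_bound (|q| * C) ?_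
  filter_upwards [Metric.ball_mem_nhds (1 : ℝ) hε] with t ht
  have hd : ∀ y ∈ Set.uIcc 1 t, HasDerivWithinAt (fun t : ℝ => t ^ q - 1 - q * (t - 1))
      (q * (y ^ (q - 1) - 1)) (Set.uIcc 1 t) y := by
    intro y hy
    have hyb : y ∈ Metric.ball (1 : ℝ) ε := by
      rw [Metric.mem_ball, Real.dist_eq] at ht ⊢
      exact lt_of_le_of_lt (Set.abs_sub_left_of_mem_uIcc hy) ht
    have h1 := ((Real.hasDerivAt_rpow_const (x := y) (p := q) (Or.inl (hball y hyb).2.ne')).sub_const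
      1).sub (((hasDerivAt_id y).sub_const 1).const_mul q)
    refine (h1.congr_deriv ?_).hasDerivWithinAt
    ring
  have hb : ∀ y ∈ Set.uIcc 1 t, ‖q * (y ^ (q - 1) - 1)‖ ≤ |q| * C * |t - 1| := by
    intro y hy
    have hle := Set.abs_sub_left_of_mem_uIcc hy
    have hyb : y ∈ Metric.ball (1 : ℝ) ε := by
      rw [Metric.mem_ball, Real.dist_eq] at ht ⊢
      exact lt_of_le_of_lt hle ht
    have h1 := (hball y hyb).1
    have h2 := (hball t ht).1
    rw [norm_mul, mul_assoc]
    refine mul_le_mul_of_nonneg_left (h1.trans ?_) (abs_nonneg q)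
    rw [Real.norm_eq_abs]
    rcases le_or_gt 0 C with hC0 | hC0
    · exact mul_le_mul_of_nonneg_left hle hC0
    -- The constant from the bound carries no sign; a negative one is possible only if t = 1.
    · have e1 : |t - 1| = 0 := by
        by_contra hne
        have h3 : 0 < |t - 1| := lt_of_le_of_ne (abs_nonneg _) (Ne.symm hne)
        have h4 := (norm_nonneg _).trans h2
        rw [Real.norm_eq_abs] at h4
        nlinarith
      have e2 : |y - 1| = 0 := le_antisymm (hle.trans e1.le) (abs_nonneg _)
      rw [e1, e2]
  have h3 := (convex_uIcc (1 : ℝ) t).norm_image_sub_le_of_norm_hasDerivWithin_le hd hb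
    Set.left_mem_uIcc Set.right_mem_uIcc
  simp only [Real.one_rpow, sub_self, mul_zero, sub_zero] at h3
  rw [norm_mul, Real.norm_eq_abs (t - 1), ← mul_assoc]
  simpa [Real.norm_eq_abs] using h3

variable {b : ℝ} {l : ℕ} {v : Euc n → ℝ}

theorem isBigODeriv_rpow (hF : IsEndFilter F) (hb : (fun x : Euc n => ‖x‖ ^ b) =O[F] fun _ => (1 : ℝ))
    (hv1 : Tendsto v F (𝓝 1)) (hv : IsBigODeriv F l b (fun x => v x - 1)) (q : ℝ) :
    IsBigODeriv F l 0 (fun x => v x ^ q) := by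
  have hpos : ∀ᶠ x in F, 0 < v x := hv1.eventually (lt_mem_nhds one_pos)
  have h0 : ∀ q : ℝ, (fun x => v x ^ q) =O[F] fun x => ‖x‖ ^ (0 : ℝ) := by
    intro q
    simp only [Real.rpow_zero]
    have : Tendsto (fun x => v x ^ q) F (𝓝 (1 ^ q)) := hv1.rpow_const (Or.inl one_ne_zero)
    exact this.isBigO_one ℝ
  have hc : ∀ {l : ℕ}, IsBigODeriv F l b (fun x => v x - 1) → ∀ q : ℝ,
      ∀ᶠ x in F, ContDiffAt ℝ l (fun x => v x ^ q) x := by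
    intro l hv q
    filter_upwards [hv.1, hpos] with x h1 h2
    have h3 : ContDiffAt ℝ l v x := by simpa using h1.add (contDiffAt_const (c := (1 : ℝ)))
    exact h3.rpow_const_of_ne h2.ne'
  induction l generalizing q with
  | zero => exact isBigODeriv_zero_iff.2 ⟨hc hv q, h0 q⟩
  | succ l ih =>
    refine isBigODeriv_succ (hc hv q) (h0 q) fun j => ?_
    have h1 := ((ih hv.of_succ (q - 1)).mul hF (hv.pd j)).const_mul hF q
    refine (h1.mono_rate hF (t := 0 - 1) (by simpa using hb)).congr hF ?_
    filter_upwards [hv.1, hpos] with x h1 h2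
    have h3 : DifferentiableAt ℝ v x := by
      simpa using (h1.differentiableAt (by simp)).add (differentiableAt_const (1 : ℝ))
    rw [pd_rpow h3 h2.ne', pd_sub_const]
    ring

theorem isBigODeriv_rpow_sub_one (hF : IsEndFilter F)
    (hb : (fun x : Euc n => ‖x‖ ^ b) =O[F] fun _ => (1 : ℝ))
    (hv1 : Tendsto v F (𝓝 1)) (hv : IsBigODeriv F l b (fun x => v x - 1)) (q : ℝ) :
    IsBigODeriv F l b (fun x => v x ^ q - 1) := by
  have hpos : ∀ᶠ x in F, 0 < v x := hv1.eventually (lt_mem_nhds one_pos)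
  have hc : ∀ᶠ x in F, ContDiffAt ℝ l (fun x => v x ^ q - 1) x :=
    (isBigODeriv_rpow hF hb hv1 hv q).1.mono fun x hx => hx.sub contDiffAt_const
  have h0 : (fun x => v x ^ q - 1) =O[F] fun x => ‖x‖ ^ b :=
    ((rpow_sub_one_isBigO q).comp_tendsto hv1).trans hv.isBigO
  cases l with
  | zero => exact isBigODeriv_zero_iff.2 ⟨hc, h0⟩
  | succ l =>
    refine isBigODeriv_succ hc h0 fun j => ?_
    have h1 := ((isBigODeriv_rpow hF hb hv1 hv.of_succ (q - 1)).mul hF (hv.pd j)).const_mul hF q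
    rw [zero_add] at h1
    refine h1.congr hF ?_
    filter_upwards [hv.1, hpos] with x h1 h2
    have h3 : DifferentiableAt ℝ v x := by
      simpa using (h1.differentiableAt (by simp)).add (differentiableAt_const (1 : ℝ))
    rw [pd_sub_const, pd_rpow h3 h2.ne', pd_sub_const]
    ring

/-- Linearization of the conformal factor with quadratic error. It is applied with b = -(d+1), where
the rate 2b is at most 3 - n. -/
theorem isBigODeriv_rpow_sub_linear (hF : IsEndFilter F)
    (hb : (fun x : Euc n => ‖x‖ ^ b) =O[F] fun _ => (1 : ℝ))
    (hv1 : Tendsto v F (𝓝 1)) (hv : IsBigODeriv F l b (fun x => v x - 1)) (q : ℝ) :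
    IsBigODeriv F l (b + b) (fun x => v x ^ q - 1 - q * (v x - 1)) := by
  have hpos : ∀ᶠ x in F, 0 < v x := hv1.eventually (lt_mem_nhds one_pos)
  have hv' : ∀ᶠ x in F, ContDiffAt ℝ l v x := hv.1.mono fun x h1 => by
    simpa using h1.add (contDiffAt_const (c := (1 : ℝ)))
  have hc : ∀ᶠ x in F, ContDiffAt ℝ l (fun x => v x ^ q - 1 - q * (v x - 1)) x := by
    filter_upwards [(isBigODeriv_rpow_sub_one hF hb hv1 hv q).1, hv.1] with x h1 h2
    exact h1.sub (contDiffAt_const.mul h2)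
  have h0 : (fun x => v x ^ q - 1 - q * (v x - 1)) =O[F] fun x => ‖x‖ ^ (b + b) := by
    refine (((rpow_sub_linear_isBigO q).comp_tendsto hv1).trans (hv.isBigO.mul hv.isBigO)).congr'
      EventuallyEq.rfl ?_
    filter_upwards [hF.ne_zero] with x hx
    rw [← Real.rpow_add (norm_pos_iff.2 hx)]
  cases l with
  | zero => exact isBigODeriv_zero_iff.2 ⟨hc, h0⟩
  | succ l =>
    refine isBigODeriv_succ hc h0 fun j => ?_
    have h1 := ((isBigODeriv_rpow_sub_one hF hb hv1 hv.of_succ (q - 1)).mul hF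
      (hv.pd j)).const_mul hF q
    rw [show b + (b - 1) = b + b - 1 by ring] at h1
    refine h1.congr hF ?_
    filter_upwards [hv', hpos] with x h1 h2
    have h3 : DifferentiableAt ℝ v x := h1.differentiableAt (by simp)
    have h4 : DifferentiableAt ℝ (fun y => v y ^ q) x := h3.rpow_const (Or.inl h2.ne')
    rw [pd_sub (h4.sub_const 1) ((h3.sub_const 1).const_mul q), pd_sub_const,
      pd_const_mul q (h3.sub_const 1), pd_sub_const, pd_rpow h3 h2.ne']
    ring

end Powers

/-! ### Decay rates under inversion. -/

section InversionSymbols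
open Filter Asymptotics
variable {n : ℕ} {s : ℝ}

theorem tendsto_inversion (hs : 0 < s) :
    Tendsto (inversion (n := n) s) (Bornology.cobounded (Euc n)) (𝓝[≠] 0) := by
  refine tendsto_nhdsWithin_iff.2 ⟨?_, ?_⟩
  · rw [tendsto_zero_iff_norm_tendsto_zero]
    simp only [norm_inversion hs]
    have := (tendsto_inv_atTop_zero.comp (tendsto_norm_cobounded_atTop (E := Euc n))).const_mul s
    simpa using this
  · exact isEndFilter_cobounded.ne_zero.mono fun y hy => inversion_ne_zero hs hy

theorem contDiffAt_inversion {y : Euc n} (hy : y ≠ 0) : ContDiffAt ℝ ∞ (inversion s) y :=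
  (contDiffOn_inversion s).contDiffAt (isOpen_compl_singleton.mem_nhds hy)

/-- The Jacobian of the inversion. -/
def inversionJac (s : ℝ) (a i : Fin n) (y : Euc n) : ℝ :=
  fderiv ℝ (inversion s) y (EuclideanSpace.single i 1) a

theorem pd_comp_inversion {f : Euc n → ℝ} {y : Euc n} (hy : y ≠ 0)
    (hf : DifferentiableAt ℝ f (inversion s y)) (i : Fin n) :
    pd i (fun y => f (inversion s y)) y = ∑ a, inversionJac s a i y * pd a f (inversion s y) := by
  have h1 := hf.hasFDerivAt.comp y ((contDiffAt_inversion (s := s) hy).differentiableAt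
    (by simp)).hasFDerivAt
  rw [pd, show (fun y => f (inversion s y)) = f ∘ inversion s from rfl, h1.fderiv]
  exact fderiv_eq_sum_pd f _ _

theorem isBigODeriv_inversionJac (l : ℕ) (a i : Fin n) :
    IsBigODeriv (Bornology.cobounded (Euc n)) l (-2) (inversionJac s a i) := by
  have hF := isEndFilter_cobounded (n := n)
  have h2 := isBigODeriv_norm_rpow hF l (-2)
  have h3 := ((((isBigODeriv_coord hF l a).mul hF (isBigODeriv_coord hF l i)).mul hF
    h2).const_mul hF (-2)).mono_rate hF (t := 0) (by
      rw [show (1 + 1 + -2 - 0 : ℝ) = 0 by norm_num]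
      simpa using isBigO_refl (fun _ : Euc n => (1 : ℝ)) _)
  have h4 := ((h2.mul hF ((isBigODeriv_const hF l (if a = i then (1 : ℝ) else 0)).add hF
    h3)).const_mul hF s)
  rw [add_zero] at h4
  refine h4.congr hF ?_
  filter_upwards [hF.ne_zero] with y hy
  rw [inversionJac, hasFDerivAt_inversion_apply hy]
  have : ‖y‖ ^ (-2 : ℝ) = (‖y‖ ^ 2)⁻¹ := by
    rw [Real.rpow_neg (norm_nonneg _)]; norm_cast
  rw [this]
  ring

/-- The inversion turns decay rates at the origin into decay rates at infinity. -/
theorem IsBigODeriv.comp_inversion (hs : 0 < s) {l : ℕ} {a : ℝ} {f : Euc n → ℝ}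
    (hf : IsBigODeriv (𝓝[≠] 0) l a f) :
    IsBigODeriv (Bornology.cobounded (Euc n)) l (-a) (fun y => f (inversion s y)) := by
  have hF := isEndFilter_cobounded (n := n)
  have ht := tendsto_inversion (n := n) hs
  have hO : ∀ {a : ℝ} {f : Euc n → ℝ}, (f =O[𝓝[≠] 0] fun x => ‖x‖ ^ a) →
      (fun y => f (inversion s y)) =O[Bornology.cobounded (Euc n)] fun y => ‖y‖ ^ (-a) := by
    intro a f h
    refine (h.comp_tendsto ht).trans ?_
    refine IsBigO.of_bound (s ^ a) (Eventually.of_forall fun y => ?_)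
    simp only [Function.comp, norm_inversion hs]
    rw [Real.mul_rpow hs.le (by positivity), Real.inv_rpow (norm_nonneg _), Real.rpow_neg
      (norm_nonneg _), norm_mul, Real.norm_of_nonneg (Real.rpow_nonneg hs.le _)]
  have hc : ∀ {l : ℕ} {f : Euc n → ℝ}, (∀ᶠ x in 𝓝[≠] 0, ContDiffAt ℝ l f x) →
      ∀ᶠ y in Bornology.cobounded (Euc n), ContDiffAt ℝ l (fun y => f (inversion s y)) y := by
    intro l f h
    filter_upwards [ht.eventually h, hF.ne_zero] with y h1 h2
    exact ContDiffAt.comp y h1 ((contDiffAt_inversion h2).of_le (by exact_mod_cast le_top))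
  induction l generalizing a f with
  | zero =>
    rw [isBigODeriv_zero_iff] at hf ⊢
    exact ⟨hc (l := 0) hf.1, hO hf.2⟩
  | succ l ih =>
    refine isBigODeriv_succ (hc hf.1) (hO hf.isBigO) fun j => ?_
    have h1 : IsBigODeriv (Bornology.cobounded (Euc n)) l (-2 + -(a - 1))
        (fun y => ∑ b, inversionJac s b j y * PaneitzMass.pd b f (inversion s y)) :=
      IsBigODeriv.sum hF fun b _ => (isBigODeriv_inversionJac l b j).mul hF (ih (hf.pd b))
    rw [show -2 + -(a - 1) = -a - 1 by ring] at h1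
    refine h1.congr hF ?_
    filter_upwards [ht.eventually hf.1, hF.ne_zero] with y h1 h2
    exact pd_comp_inversion h2 (h1.differentiableAt (by simp)) j

/-- Induction on the order: the gradient is O(|x|^k), and the mean value inequality on the closed
ball of radius |x| gains one power. -/
theorem VanishesTo.isBigO {k : ℕ} {f : Euc n → ℝ} (h : VanishesTo k f) :
    f =O[𝓝 0] fun x => ‖x‖ ^ k := by
  induction k generalizing f with
  | zero =>
    simpa using ((show ContDiffAt ℝ ∞ f 0 from h).continuousAt.norm.isBoundedUnder_le.isBigO_one ℝ)
  | succ k ih =>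
    have h1 : ∀ i, PaneitzMass.pd i f =O[𝓝 0] fun x => ‖x‖ ^ k := fun i => ih (h.2.2 i)
    have h2 : (fun x => fderiv ℝ f x) =O[𝓝 0] fun x => ‖x‖ ^ k := by
      rw [fderiv_eq_sum]
      refine IsBigO.fun_sum fun j _ => ?_
      exact (ContinuousLinearMap.isBigO_comp _ _ _).trans (h1 j)
    obtain ⟨C, hC0, hC⟩ := h2.exists_nonneg
    obtain ⟨ε, hε, hball⟩ := Metric.eventually_nhds_iff_ball.1
      (hC.bound.and (eventually_diffAt h.1))
    refine IsBigO.of_bound C ?_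
    filter_upwards [Metric.ball_mem_nhds (0 : Euc n) hε] with x hx
    have hsub : ∀ y ∈ Metric.closedBall (0 : Euc n) ‖x‖, y ∈ Metric.ball (0 : Euc n) ε := by
      intro y hy
      rw [mem_closedBall_zero_iff] at hy
      rw [mem_ball_zero_iff] at hx ⊢
      exact lt_of_le_of_lt hy hx
    have h3 := (convex_closedBall (0 : Euc n) ‖x‖).norm_image_sub_le_of_norm_fderiv_le (𝕜 := ℝ)
      (f := f) (C := C * ‖x‖ ^ k) (fun y hy => (hball y (hsub y hy)).2) (fun y hy => by
        refine (hball y (hsub y hy)).1.trans ?_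
        rw [mem_closedBall_zero_iff] at hy
        rw [norm_pow, norm_norm]
        gcongr) (x := 0) (y := x) (by simp) (by simp)
    rw [h.2.1] at h3
    simp only [sub_zero] at h3
    rw [norm_pow, norm_norm, pow_succ, ← mul_assoc]
    exact h3

theorem VanishesTo.isBigODeriv {k : ℕ} {f : Euc n → ℝ} (h : VanishesTo k f) (l : ℕ) :
    IsBigODeriv (𝓝[≠] 0) l k f := by
  have hc : ∀ {l : ℕ}, ∀ᶠ x in 𝓝[≠] (0 : Euc n), ContDiffAt ℝ l f x := fun {l} =>
    nhdsWithin_le_nhds ((h.smooth.of_le (m := l) (by exact_mod_cast le_top)).eventually (by simp))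
  have h0 : f =O[𝓝[≠] 0] fun x => ‖x‖ ^ (k : ℝ) := by
    simpa only [Real.rpow_natCast] using h.isBigO.mono nhdsWithin_le_nhds
  induction l generalizing k f with
  | zero => exact isBigODeriv_zero_iff.2 ⟨hc (l := 0), h0⟩
  | succ l ih =>
    refine isBigODeriv_succ hc h0 fun j => ?_
    have hv := h.pd j
    have h1 := ih hv (fun {l} => nhdsWithin_le_nhds ((hv.smooth.of_le (m := l)
      (by exact_mod_cast le_top)).eventually (by simp))) (by
        simpa only [Real.rpow_natCast] using hv.isBigO.mono nhdsWithin_le_nhds)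
    -- The truncated `k - 1` is harmless: for k = 0 it gives rate 0, which is better than the rate
    -- -1 required.
    refine h1.mono_rate isEndFilter_nhdsNE (norm_rpow_isBigO_nhdsNE ?_)
    rcases k with _ | k
    · simp
    · simp

end InversionSymbols

/-! ### Integration by parts on spheres. -/

section SphereIntegrals
open MeasureTheory
variable {n : ℕ}

/-- The integral of `f` over the sphere of radius `r`, normalized by the unit sphere measure. -/
def sphereInt (r : ℝ) (f : Euc n → ℝ) : ℝ := sphereIntegral (fun θ => f (r • θ))

theorem norm_smul_sphere {r : ℝ} (hr : 0 < r) (θ : Metric.sphere (0 : Euc n) 1) :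
    ‖r • (θ : Euc n)‖ = r := by
  rw [norm_smul, Real.norm_of_nonneg hr.le, norm_eq_of_mem_sphere, mul_one]

theorem sphereInt_congr {r : ℝ} (hr : 0 < r) {f g : Euc n → ℝ} (h : ∀ y, ‖y‖ = r → f y = g y) :
    sphereInt r f = sphereInt r g :=
  integral_congr_ae (Filter.Eventually.of_forall fun θ => h _ (norm_smul_sphere hr θ))

theorem integrable_sphere {r : ℝ} (hr : 0 < r) {f : Euc n → ℝ}
    (hf : ∀ y, ‖y‖ = r → ContinuousAt f y) :
    Integrable (fun θ : Metric.sphere (0 : Euc n) 1 => f (r • (θ : Euc n)))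
      (Measure.toSphere (volume : Measure (Euc n))) := by
  have hc : Continuous (fun θ : Metric.sphere (0 : Euc n) 1 => f (r • (θ : Euc n))) := by
    rw [continuous_iff_continuousAt]
    intro θ
    exact ContinuousAt.comp (f := fun θ : Metric.sphere (0 : Euc n) 1 => r • (θ : Euc n))
      (hf _ (norm_smul_sphere hr θ)) (by fun_prop)
  exact hc.integrable_of_hasCompactSupport (HasCompactSupport.of_compactSpace _)

theorem sphereInt_add {r : ℝ} (hr : 0 < r) {f g : Euc n → ℝ}
    (hf : ∀ y, ‖y‖ = r → ContinuousAt f y) (hg : ∀ y, ‖y‖ = r → ContinuousAt g y) :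
    sphereInt r (fun y => f y + g y) = sphereInt r f + sphereInt r g :=
  integral_add (integrable_sphere hr hf) (integrable_sphere hr hg)

theorem sphereInt_const_mul (r c : ℝ) (f : Euc n → ℝ) :
    sphereInt r (fun y => c * f y) = c * sphereInt r f := integral_const_mul _ _

theorem sphereInt_sum {ι : Type*} {S : Finset ι} {r : ℝ} (hr : 0 < r) {f : ι → Euc n → ℝ}
    (hf : ∀ a ∈ S, ∀ y, ‖y‖ = r → ContinuousAt (f a) y) :
    sphereInt r (fun y => ∑ a ∈ S, f a y) = ∑ a ∈ S, sphereInt r (f a) :=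
  integral_finsetSum _ fun a ha => integrable_sphere hr (hf a ha)

theorem abs_sphereInt_le {r C : ℝ} (hr : 0 < r) {f : Euc n → ℝ}
    (h : ∀ y, ‖y‖ = r → |f y| ≤ C) : |sphereInt r f| ≤ C * sphereArea n := by
  have h1 := norm_integral_le_of_norm_le_const (μ := Measure.toSphere (volume : Measure (Euc n)))
    (f := fun θ : Metric.sphere (0 : Euc n) 1 => f (r • (θ : Euc n))) (C := C)
    (Filter.Eventually.of_forall fun θ => h _ (norm_smul_sphere hr θ))
  have h2 : sphereArea n = (Measure.toSphere (volume : Measure (Euc n))).real Set.univ := by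
    simp [sphereArea, sphereIntegral]
  rw [h2]
  exact h1

/-- Polar coordinates for a product of an angular and a radial function; this transfers Euclidean
integration by parts to spheres. -/
theorem integral_polar (hn : 1 ≤ n) (φ : Euc n → ℝ) (χ : ℝ → ℝ) :
    ∫ y : Euc n, φ (‖y‖⁻¹ • y) * χ ‖y‖ = sphereIntegral φ *
      ∫ t : Set.Ioi (0 : ℝ), χ t ∂(Measure.volumeIoiPow (Module.finrank ℝ (Euc n) - 1)) := by
  haveI : Nonempty (Fin n) := ⟨⟨0, hn⟩⟩
  calc ∫ y : Euc n, φ (‖y‖⁻¹ • y) * χ ‖y‖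
      = ∫ x : ({(0)}ᶜ : Set (Euc n)), φ (‖x.1‖⁻¹ • x.1) * χ ‖x.1‖
          ∂(Measure.comap Subtype.val volume) := by
        rw [integral_subtype_comap (measurableSet_singleton _).compl
          fun x : Euc n => φ (‖x‖⁻¹ • x) * χ ‖x‖, restrict_compl_singleton]
    _ = ∫ x : Metric.sphere (0 : Euc n) 1 × Set.Ioi (0 : ℝ), φ x.1 * χ x.2 ∂(Measure.toSphere (volume : Measure (Euc n))).prod
          (Measure.volumeIoiPow (Module.finrank ℝ (Euc n) - 1)) :=
        by simpa using
          (volume : Measure (Euc n)).measurePreserving_homeomorphUnitSphereProd.integral_comp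
            (Homeomorph.measurableEmbedding _)
            (fun x : Metric.sphere (0 : Euc n) 1 × Set.Ioi (0 : ℝ) => φ x.1 * χ x.2)
    _ = _ := integral_prod_mul (fun θ : Metric.sphere (0 : Euc n) 1 => φ θ)
        (fun t : Set.Ioi (0 : ℝ) => χ t)

/-- A smooth radial cutoff, supported in `1 < t < 3`. -/
def radialBump : ContDiffBump (2 : ℝ) := ⟨1 / 2, 1, by norm_num, by norm_num⟩

theorem radialBump_eq_zero {t : ℝ} (ht : t ≤ 1 ∨ 3 ≤ t) : radialBump t = 0 := by
  refine radialBump.zero_of_le_dist ?_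
  rw [Real.dist_eq]
  change 1 ≤ |t - 2|
  rcases ht with h | h
  · rw [abs_of_nonpos (by linarith)]; linarith
  · rw [abs_of_nonneg (by linarith)]; linarith

theorem contDiff_radialBump {F : Euc n → ℝ} {m : WithTop ℕ∞} (hm : m ≤ ∞)
    (hF : ∀ y ≠ 0, ContDiffAt ℝ m F y) :
    ContDiff ℝ m (fun y => F y * radialBump ‖y‖) := by
  rw [contDiff_iff_contDiffAt]
  intro y
  rcases eq_or_ne y 0 with rfl | hy
  · refine (contDiffAt_const (c := (0 : ℝ))).congr_of_eventuallyEq ?_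
    filter_upwards [Metric.ball_mem_nhds (0 : Euc n) one_pos] with z hz
    rw [radialBump_eq_zero (Or.inl (mem_ball_zero_iff.1 hz).le), mul_zero]
  · refine (hF y hy).mul (ContDiffAt.comp (g := radialBump) (f := fun y : Euc n => ‖y‖) y ?_
      (contDiffAt_norm ℝ hy))
    exact radialBump.contDiff.contDiffAt.of_le hm

theorem hasCompactSupport_radialBump (F : Euc n → ℝ) :
    HasCompactSupport (fun y => F y * radialBump ‖y‖) := by
  refine HasCompactSupport.intro (isCompact_closedBall (0 : Euc n) 3) fun y hy => ?_
  rw [mem_closedBall_zero_iff, not_le] at hy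
  rw [radialBump_eq_zero (Or.inr hy.le), mul_zero]

/-- The radial factor of the volume integral is nonzero because the cutoff is nonnegative and not
identically zero. -/
theorem sphereIntegral_eq_zero_of_integral (hn : 1 ≤ n) {φ : Euc n → ℝ}
    (h : ∫ y : Euc n, φ (‖y‖⁻¹ • y) * radialBump ‖y‖ = 0) : sphereIntegral φ = 0 := by
  rw [integral_polar hn] at h
  refine (mul_eq_zero.1 h).resolve_right fun h0 => ?_
  have h1 := integral_polar hn (fun _ => 1) radialBump
  rw [h0, mul_zero] at h1
  have hcd := contDiff_radialBump (n := n) (m := 0) (F := fun _ => 1) (by simp)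
    fun y _ => contDiffAt_const
  have h2 := hcd.continuous.integral_pos_of_hasCompactSupport_nonneg_nonzero (μ := volume)
    (hasCompactSupport_radialBump _) (fun y => by simpa using radialBump.nonneg)
    (x := (EuclideanSpace.single (⟨0, hn⟩ : Fin n) (2 : ℝ))) (by
      have : radialBump ‖(EuclideanSpace.single (⟨0, hn⟩ : Fin n) (2 : ℝ))‖ = 1 := by
        refine radialBump.one_of_mem_closedBall ?_
        simp [radialBump]
      rw [this]; norm_num)
  linarith

theorem norm_rpow_one_pd {y : Euc n} (hy : y ≠ 0) (i : Fin n) :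
    pd i (fun z : Euc n => ‖z‖) y = y i * ‖y‖⁻¹ := by
  have h := hasFDerivAt_norm_rpow hy 1 i
  simp only [Real.rpow_one] at h
  rw [h, show (1 : ℝ) - 2 = -1 by norm_num, Real.rpow_neg_one, one_mul]

theorem pd_comp_radial {f : Euc n → ℝ} {r : ℝ} {y : Euc n} (hy : y ≠ 0)
    (hf : DifferentiableAt ℝ f ((r * ‖y‖ ^ (-1 : ℝ)) • y)) (j : Fin n) :
    pd j (fun z => f ((r * ‖z‖ ^ (-1 : ℝ)) • z)) y =
      (r * ‖y‖ ^ (-1 : ℝ)) * pd j f ((r * ‖y‖ ^ (-1 : ℝ)) • y)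
      - y j * (r * ‖y‖ ^ (-3 : ℝ) * fderiv ℝ f ((r * ‖y‖ ^ (-1 : ℝ)) • y) y) := by
  have hc : DifferentiableAt ℝ (fun z : Euc n => r * ‖z‖ ^ (-1 : ℝ)) y :=
    ((contDiffAt_norm_rpow hy (-1) (m := 1)).differentiableAt (by simp)).const_mul r
  have h1 := hc.hasFDerivAt.smul (hasFDerivAt_id y)
  have h2 : HasFDerivAt (fun z => f ((r * ‖z‖ ^ (-1 : ℝ)) • z)) _ y :=
    HasFDerivAt.comp (f := fun z : Euc n => (r * ‖z‖ ^ (-1 : ℝ)) • z) y hf.hasFDerivAt h1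
  have h3 : fderiv ℝ (fun z : Euc n => r * ‖z‖ ^ (-1 : ℝ)) y (EuclideanSpace.single j 1) =
      -(r * (y j * ‖y‖ ^ (-3 : ℝ))) := by
    have := pd_const_mul (i := j) r ((contDiffAt_norm_rpow hy (-1) (m := 1)).differentiableAt (by simp))
    rw [hasFDerivAt_norm_rpow hy, show (-1 : ℝ) - 2 = -3 by norm_num] at this
    rw [show fderiv ℝ (fun z : Euc n => r * ‖z‖ ^ (-1 : ℝ)) y (EuclideanSpace.single j 1) = _ from this]
    ring
  rw [pd, h2.fderiv]
  simp only [ContinuousLinearMap.comp_apply, add_apply,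
    smul_apply, ContinuousLinearMap.smulRight_apply, h3, map_add, map_smul,
    smul_eq_mul, id]
  simp only [ContinuousLinearMap.id_apply, pd]
  ring

/-- The generators of rotations integrate to zero over spheres. -/
theorem sphereInt_rotation {r : ℝ} (hr : 0 < r) {f : Euc n → ℝ}
    (hf : ∀ y, ‖y‖ = r → ContDiffAt ℝ 1 f y) (i j : Fin n) :
    sphereInt r (fun y => y i * pd j f y - y j * pd i f y) = 0 := by
  have hn : 1 ≤ n := Nat.one_le_iff_ne_zero.2 fun h => by subst h; exact i.elim0
  refine sphereIntegral_eq_zero_of_integral hn ?_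
  -- Extension of f from the sphere to a function constant along rays. The rotation field y_i ∂_j -
  -- y_j ∂_i kills radial functions and is divergence-free, so applied to the extension times a
  -- radial cutoff it integrates to zero.
  set g : Euc n → ℝ := fun z => f ((r * ‖z‖ ^ (-1 : ℝ)) • z) with hg
  have hnorm : ∀ y : Euc n, y ≠ 0 → ‖(r * ‖y‖ ^ (-1 : ℝ)) • y‖ = r := by
    intro y hy
    have : ‖y‖ ≠ 0 := norm_ne_zero_iff.2 hy
    rw [norm_smul, Real.norm_of_nonneg (by positivity), Real.rpow_neg_one]
    field_simp
  have hgc : ∀ y ≠ 0, ContDiffAt ℝ 1 g y := fun y hy =>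
    ContDiffAt.comp y (hf _ (hnorm y hy))
      ((contDiffAt_const.mul (contDiffAt_norm_rpow hy _)).smul contDiffAt_id)
  set F : Euc n → ℝ := fun y => g y * radialBump ‖y‖ with hF
  have hFc : ContDiff ℝ 1 F := contDiff_radialBump (by exact_mod_cast le_top) hgc
  have hFs : HasCompactSupport F := hasCompactSupport_radialBump g
  have hcoord : ∀ k : Fin n, ContDiff ℝ 1 (fun y : Euc n => y k * F y) := fun k =>
    ((smooth_coord k).of_le (by exact_mod_cast le_top)).mul hFc
  have hsupp : ∀ k : Fin n, HasCompactSupport (fun y : Euc n => y k * F y) := fun k => hFs.mul_left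
  have hI : ∀ k l : Fin n, Integrable (pd l (fun y : Euc n => y k * F y)) := fun k l =>
    (((hcoord k).continuous_fderiv (by norm_num)).clm_apply
      continuous_const).integrable_of_hasCompactSupport ((hsupp k).fderiv_apply (𝕜 := ℝ) _)
  have h0 : ∫ y, (pd j (fun y : Euc n => y i * F y) y - pd i (fun y : Euc n => y j * F y) y) = 0 := by
    rw [integral_sub (hI i j) (hI j i), integral_pd_eq_zero (hcoord i) (hsupp i),
      integral_pd_eq_zero (hcoord j) (hsupp j), sub_zero]
  rw [← h0]
  congr 1
  funext y
  have hFd : DifferentiableAt ℝ F y := hFc.differentiable (by norm_num) y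
  rw [pd_mul (diffAt_coord i y) hFd, pd_mul (diffAt_coord j y) hFd, pd_coord, pd_coord]
  have e0 : (if j = i then (1 : ℝ) else 0) = if i = j then 1 else 0 := by simp only [eq_comm]
  rw [e0]
  rcases eq_or_ne y 0 with rfl | hy
  · have : radialBump ‖(0 : Euc n)‖ = 0 := radialBump_eq_zero (by simp)
    rw [this]
    simp
  · have hp : ‖y‖ ≠ 0 := norm_ne_zero_iff.2 hy
    have hχ : DifferentiableAt ℝ (fun z : Euc n => radialBump ‖z‖) y :=
      ((radialBump.contDiff (n := 1)).contDiffAt.comp y (contDiffAt_norm ℝ hy)).differentiableAt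
        (by simp)
    have hχ' : ∀ k, pd k (fun z : Euc n => radialBump ‖z‖) y =
        deriv radialBump ‖y‖ * (y k * ‖y‖⁻¹) := fun k => by
      rw [← norm_rpow_one_pd hy k]
      exact pd_comp (((radialBump.contDiff (n := 1)).differentiable (by norm_num) _).hasDerivAt)
        ((contDiffAt_norm ℝ hy (n := 1)).differentiableAt (by simp))
    have hFk : ∀ k, pd k F y = pd k g y * radialBump ‖y‖ + g y * pd k (fun z : Euc n => radialBump ‖z‖) y :=
      fun k => pd_mul ((hgc y hy).differentiableAt (by simp)) hχ
    have hgk := fun k => pd_comp_radial (r := r) hy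
      ((hf _ (hnorm y hy)).differentiableAt (by simp)) k
    rw [hFk, hFk, hχ', hχ', hg, hgk, hgk]
    have e1 : r • ‖y‖⁻¹ • y = (r * ‖y‖ ^ (-1 : ℝ)) • y := by rw [smul_smul, Real.rpow_neg_one]
    rw [e1]
    simp only [PiLp.smul_apply, smul_eq_mul]
    ring

/-- The radial derivative `x · ∇ f`. -/
def radialDeriv (f : Euc n → ℝ) (x : Euc n) : ℝ := ∑ k, x k * pd k f x

theorem pd_continuousAt {m : WithTop ℕ∞} (hm : 1 ≤ m) {f : Euc n → ℝ} {y : Euc n} (hf : ContDiffAt ℝ m f y) (i : Fin n) :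
    ContinuousAt (pd i f) y := (ContDiffAt.pd (m := 0) hf (by simpa using hm) i).continuousAt

theorem sum_sq_eq (y : Euc n) : ∑ a, y a * y a = ‖y‖ ^ 2 := by
  rw [EuclideanSpace.norm_sq_eq]
  exact Finset.sum_congr rfl fun a _ => by rw [Real.norm_eq_abs, sq_abs, sq]

theorem continuousAt_coord (i : Fin n) (y : Euc n) : ContinuousAt (fun y : Euc n => y i) y :=
  (smooth_coord i).continuous.continuousAt

/-- Integration by parts on the sphere of radius `r`. -/
theorem sphereInt_div {r : ℝ} (hr : 0 < r) {Y : Fin n → Euc n → ℝ}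
    (hY : ∀ i y, ‖y‖ = r → ContDiffAt ℝ 1 (Y i) y) :
    r ^ 2 * sphereInt r (fun y => ∑ i, pd i (Y i) y) =
      sphereInt r (fun y => ((n : ℝ) - 1) * (∑ i, Y i y * y i)
        + ∑ i, ∑ j, y i * y j * pd i (Y j) y) := by
  have hf : ∀ i j y, ‖y‖ = r → ContDiffAt ℝ 1 (fun y => y i * Y j y) y := fun i j y hy =>
    ((smooth_coord i).contDiffAt.of_le (by exact_mod_cast le_top)).mul (hY j y hy)
  -- The rotation generators are applied to y_i Y_j and summed over all i, j: r² div Y appears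
  -- together with the terms of the right-hand side, with opposite sign.
  have h1 : sphereInt r (fun y => ∑ i, ∑ j,
      (y i * pd j (fun y => y i * Y j y) y - y j * pd i (fun y => y i * Y j y) y)) = 0 := by
    have hc : ∀ i j y, ‖y‖ = r → ContinuousAt (fun y : Euc n =>
        y i * pd j (fun y => y i * Y j y) y - y j * pd i (fun y => y i * Y j y) y) y :=
      fun i j y hy => ((continuousAt_coord i y).mul (pd_continuousAt le_rfl (hf i j y hy) j)).sub
        ((continuousAt_coord j y).mul (pd_continuousAt le_rfl (hf i j y hy) i))
    rw [sphereInt_sum hr fun i _ y hy => tendsto_finsetSum _ fun j _ => hc i j y hy]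
    refine Finset.sum_eq_zero fun i _ => ?_
    rw [sphereInt_sum hr fun j _ y hy => hc i j y hy]
    exact Finset.sum_eq_zero fun j _ => sphereInt_rotation hr (hf i j) i j
  have h2 : ∀ y : Euc n, ‖y‖ = r → ∑ i, ∑ j,
      (y i * pd j (fun y => y i * Y j y) y - y j * pd i (fun y => y i * Y j y) y) =
      r ^ 2 * (∑ i, pd i (Y i) y) + -1 * (((n : ℝ) - 1) * (∑ i, Y i y * y i)
        + ∑ i, ∑ j, y i * y j * pd i (Y j) y) := by
    intro y hy
    have hd : ∀ j, DifferentiableAt ℝ (Y j) y := fun j => (hY j y hy).differentiableAt (by simp)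
    have e1 : ∀ i j, y i * pd j (fun y => y i * Y j y) y - y j * pd i (fun y => y i * Y j y) y =
        (if j = i then y i * Y j y else 0) + y i * y i * pd j (Y j) y - Y j y * y j
          - y i * y j * pd i (Y j) y := by
      intro i j
      rw [pd_mul (diffAt_coord i y) (hd j), pd_mul (diffAt_coord i y) (hd j), pd_coord, pd_coord]
      split_ifs <;> simp_all <;> ring
    simp only [e1, Finset.sum_add_distrib, Finset.sum_sub_distrib, Finset.sum_ite_eq',
      Finset.mem_univ, if_true, ← Finset.mul_sum, ← Finset.sum_mul, sum_sq_eq, hy]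
    rw [Finset.sum_const, Finset.card_univ, Fintype.card_fin, nsmul_eq_mul]
    rw [Finset.sum_congr rfl fun i _ => mul_comm (y i) (Y i y)]
    ring
  rw [sphereInt_congr hr h2, sphereInt_add hr, sphereInt_const_mul, sphereInt_const_mul] at h1
  · linarith
  · intro y hy
    exact continuousAt_const.mul (tendsto_finsetSum _ fun i _ => pd_continuousAt le_rfl (hY i y hy) i)
  · intro y hy
    refine continuousAt_const.mul ((continuousAt_const.mul (tendsto_finsetSum _ fun i _ =>
      (hY i y hy).continuousAt.mul (continuousAt_coord i y))).add
      (tendsto_finsetSum _ fun i _ => tendsto_finsetSum _ fun j _ => ?_))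
    exact ((continuousAt_coord i y).mul (continuousAt_coord j y)).mul
      (pd_continuousAt le_rfl (hY j y hy) i)

/-- The integral over a sphere of the radial derivative of a divergence is determined by the
radial component of the vector field. -/
theorem sphereInt_radialDeriv_div {r : ℝ} (hr : 0 < r) {X : Fin n → Euc n → ℝ} {Z : Euc n → ℝ}
    (hX : ∀ i y, ‖y‖ = r → ContDiffAt ℝ 2 (X i) y)
    (hZ : ∀ y, ‖y‖ = r → Z =ᶠ[𝓝 y] fun y => radialDeriv (fun y => ∑ i, X i y * y i) y
      - 2 * ∑ i, X i y * y i) :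
    r ^ 2 * sphereInt r (radialDeriv (fun y => ∑ i, pd i (X i) y)) =
      sphereInt r (fun y => ((n : ℝ) - 2) * Z y + radialDeriv Z y) := by
  -- Chosen so that div Y is the radial derivative of div X, the term -X cancelling the commutator
  -- of ∂_i with y·∇; its radial component Y·y is Z.
  set Y : Fin n → Euc n → ℝ := fun i y => radialDeriv (X i) y - X i y with hYdef
  have hY : ∀ i y, ‖y‖ = r → ContDiffAt ℝ 1 (Y i) y := by
    intro i y hy
    refine ContDiffAt.sub (ContDiffAt.sum fun k _ => ?_) ((hX i y hy).of_le (by norm_num))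
    exact ((smooth_coord k).contDiffAt.of_le (by exact_mod_cast le_top)).mul
      (ContDiffAt.pd (hX i y hy) (by norm_num) k)
  have hp : ∀ i j y, ‖y‖ = r → DifferentiableAt ℝ (pd i (X j)) y := fun i j y hy =>
    (ContDiffAt.pd (m := 1) (hX j y hy) (by norm_num) i).differentiableAt (by norm_num)
  have hXd : ∀ i y, ‖y‖ = r → ∀ᶠ z in 𝓝 y, DifferentiableAt ℝ (X i) z := fun i y hy =>
    ((hX i y hy).eventually (by simp)).mono fun z hz => hz.differentiableAt (by norm_num)
  have hZY : ∀ y, ‖y‖ = r → Z =ᶠ[𝓝 y] fun y => ∑ i, Y i y * y i := by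
    intro y hy
    filter_upwards [hZ y hy, Filter.eventually_all.2 fun i => hXd i y hy] with z h1 h2
    rw [h1]
    simp only [radialDeriv, hYdef]
    have e1 : ∀ k, pd k (fun y => ∑ i, X i y * y i) z = ∑ i, pd k (X i) z * z i + X k z := by
      intro k
      rw [pd_sum fun i _ => (h2 i).fun_mul (diffAt_coord i z)]
      simp only [pd_mul (h2 _) (diffAt_coord _ z), pd_coord, Finset.sum_add_distrib, mul_ite,
        mul_one, mul_zero, Finset.sum_ite_eq, Finset.mem_univ, if_true]
    simp only [e1, sub_mul, mul_add, Finset.sum_add_distrib, Finset.sum_sub_distrib]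
    have e2 : ∑ k, z k * ∑ i, pd k (X i) z * z i = ∑ i, (∑ k, z k * pd k (X i) z) * z i := by
      simp only [Finset.mul_sum, Finset.sum_mul]
      rw [Finset.sum_comm]
      exact Finset.sum_congr rfl fun i _ => Finset.sum_congr rfl fun k _ => by ring
    rw [e2, Finset.sum_congr rfl fun i _ => mul_comm (z i) (X i z)]
    ring
  have h1 : sphereInt r (radialDeriv (fun y => ∑ i, pd i (X i) y)) =
      sphereInt r (fun y => ∑ i, pd i (Y i) y) := by
    refine sphereInt_congr hr fun y hy => ?_
    have e1 : ∀ i, pd i (Y i) y = ∑ k, y k * pd k (pd i (X i)) y := by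
      intro i
      have hXi := (hXd i y hy).self_of_nhds
      have hR : DifferentiableAt ℝ (fun y => ∑ k, y k * pd k (X i) y) y :=
        DifferentiableAt.fun_sum fun k _ => (diffAt_coord k y).fun_mul (hp k i y hy)
      rw [show Y i = fun y => (fun y => ∑ k, y k * pd k (X i) y) y - X i y from rfl, pd_sub hR hXi]
      rw [pd_sum fun k _ => (diffAt_coord k y).fun_mul (hp k i y hy)]
      simp only [pd_mul (diffAt_coord _ y) (hp _ i y hy), pd_coord, Finset.sum_add_distrib, ite_mul,
        one_mul, zero_mul, Finset.sum_ite_eq, Finset.mem_univ, if_true]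
      rw [add_sub_cancel_left]
      exact Finset.sum_congr rfl fun k _ => by rw [pd_comm (hX i y hy)]
    simp only [e1, radialDeriv]
    rw [Finset.sum_comm]
    refine Finset.sum_congr rfl fun k _ => ?_
    rw [pd_sum fun i _ => hp i i y hy, Finset.mul_sum]
  rw [h1, sphereInt_div hr hY]
  refine sphereInt_congr hr fun y hy => ?_
  have hYd : ∀ i, DifferentiableAt ℝ (Y i) y := fun i => (hY i y hy).differentiableAt (by simp)
  have e1 : radialDeriv Z y = ∑ i, ∑ j, y i * y j * pd i (Y j) y + ∑ i, Y i y * y i := by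
    simp only [radialDeriv]
    have e2 : ∀ k, pd k Z y = ∑ i, pd k (Y i) y * y i + Y k y := by
      intro k
      rw [pd_congr (hZY y hy), pd_sum fun i _ => (hYd i).fun_mul (diffAt_coord i y)]
      simp only [pd_mul (hYd _) (diffAt_coord _ y), pd_coord, Finset.sum_add_distrib, mul_ite,
        mul_one, mul_zero, Finset.sum_ite_eq, Finset.mem_univ, if_true]
    simp only [e2, mul_add, Finset.sum_add_distrib, Finset.mul_sum]
    congr 1
    · exact Finset.sum_congr rfl fun i _ => Finset.sum_congr rfl fun j _ => by ring
    · exact Finset.sum_congr rfl fun i _ => mul_comm _ _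
  rw [e1, (hZY y hy).eq_of_nhds]
  ring

end SphereIntegrals

/-! ### Fluxes at infinity. -/

section Flux
open Filter Asymptotics
variable {n : ℕ}

/-- `r^{n-2} ∫_{S^{n-1}} f(rθ) dθ` tends to `m`. -/
def HasFlux (f : Euc n → ℝ) (m : ℝ) : Prop :=
  Tendsto (fun r : ℝ => r ^ (n - 2) * sphereInt r f) atTop (𝓝 m)

theorem eventually_sphere {p : Euc n → Prop} (h : ∀ᶠ y in Bornology.cobounded (Euc n), p y) :
    ∀ᶠ r : ℝ in atTop, 0 < r ∧ ∀ y : Euc n, ‖y‖ = r → p y := by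
  rw [(Metric.hasBasis_cobounded_compl_closedBall (0 : Euc n)).eventually_iff] at h
  obtain ⟨R, -, hR⟩ := h
  filter_upwards [eventually_gt_atTop R, eventually_gt_atTop 0] with r hr h0
  refine ⟨h0, fun y hy => hR ?_⟩
  simp [hy, hr]

theorem HasFlux.congr {f g : Euc n → ℝ} {m : ℝ} (h : HasFlux f m)
    (hfg : g =ᶠ[Bornology.cobounded (Euc n)] f) : HasFlux g m := by
  refine Tendsto.congr' ?_ h
  filter_upwards [eventually_sphere hfg] with r hr
  rw [sphereInt_congr hr.1 hr.2]

theorem HasFlux.add {f g : Euc n → ℝ} {m m' : ℝ} (hf : HasFlux f m) (hg : HasFlux g m')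
    (hfc : ∀ᶠ y in Bornology.cobounded (Euc n), ContinuousAt f y)
    (hgc : ∀ᶠ y in Bornology.cobounded (Euc n), ContinuousAt g y) :
    HasFlux (fun y => f y + g y) (m + m') := by
  refine Tendsto.congr' ?_ (Tendsto.add hf hg)
  filter_upwards [eventually_sphere hfc, eventually_sphere hgc] with r hr hr'
  rw [sphereInt_add hr.1 hr.2 hr'.2, mul_add]

theorem HasFlux.const_mul {f : Euc n → ℝ} {m : ℝ} (hf : HasFlux f m) (c : ℝ) :
    HasFlux (fun y => c * f y) (c * m) := by
  refine Tendsto.congr (fun r => ?_) (Tendsto.const_mul c hf)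
  rw [sphereInt_const_mul]
  ring

theorem HasFlux.sum {ι : Type*} {S : Finset ι} {f : ι → Euc n → ℝ} {m : ι → ℝ}
    (hf : ∀ a ∈ S, HasFlux (f a) (m a))
    (hc : ∀ a ∈ S, ∀ᶠ y in Bornology.cobounded (Euc n), ContinuousAt (f a) y) :
    HasFlux (fun y => ∑ a ∈ S, f a y) (∑ a ∈ S, m a) := by
  refine Tendsto.congr' ?_ (tendsto_finsetSum S hf)
  filter_upwards [eventually_sphere ((eventually_all_finset S).2 hc), eventually_gt_atTop 0] with r hr h0
  rw [sphereInt_sum h0 fun a ha y hy => hr.2 y hy a ha, Finset.mul_sum]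

theorem tendsto_sphereInt_zero {f : Euc n → ℝ} {b : ℝ} {m : ℕ}
    (h : f =O[Bornology.cobounded (Euc n)] fun y => ‖y‖ ^ b) (hb : b + m < 0) :
    Tendsto (fun r : ℝ => r ^ m * sphereInt r f) atTop (𝓝 0) := by
  obtain ⟨C, hC⟩ := h.bound
  have h1 : Tendsto (fun r : ℝ => C * sphereArea n * r ^ (-(-(b + m)))) atTop (𝓝 0) := by
    have := (tendsto_rpow_neg_atTop (y := -(b + m)) (by linarith)).const_mul (C * sphereArea n)
    simpa using this
  refine squeeze_zero_norm' ?_ h1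
  filter_upwards [eventually_sphere hC] with r hr
  have h2 := abs_sphereInt_le (C := C * r ^ b) hr.1 (f := f) fun y hy => by
    have := hr.2 y hy
    rwa [hy, Real.norm_eq_abs, Real.norm_of_nonneg (Real.rpow_nonneg hr.1.le _)] at this
  rw [neg_neg, Real.rpow_add hr.1, Real.rpow_natCast, norm_mul, Real.norm_eq_abs (sphereInt r f),
    norm_pow, Real.norm_of_nonneg hr.1.le]
  calc r ^ m * |sphereInt r f| ≤ r ^ m * (C * r ^ b * sphereArea n) :=
        mul_le_mul_of_nonneg_left h2 (pow_nonneg hr.1.le _)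
    _ = _ := by ring

theorem IsBigODeriv.radialDeriv {F : Filter (Euc n)} (hF : IsEndFilter F) {l : ℕ} {s : ℝ}
    {f : Euc n → ℝ} (h : IsBigODeriv F (l + 1) s f) :
    IsBigODeriv F l s (PaneitzMass.radialDeriv f) := by
  refine IsBigODeriv.sum hF fun k _ => ?_
  have := (isBigODeriv_coord hF l k).mul hF (h.pd k)
  rwa [add_sub_cancel] at this

theorem IsBigODeriv.eventually_continuousAt {F : Filter (Euc n)} {l : ℕ} {s : ℝ} {f : Euc n → ℝ}
    (h : IsBigODeriv F l s f) : ∀ᶠ y in F, ContinuousAt f y :=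
  h.1.mono fun _ hy => hy.continuousAt

theorem radialDeriv_eq_fderiv (f : Euc n → ℝ) (y : Euc n) : radialDeriv f y = fderiv ℝ f y y :=
  (fderiv_eq_sum_pd f y y).symm

theorem radialDeriv_congr {f g : Euc n → ℝ} {y : Euc n} (h : f =ᶠ[𝓝 y] g) :
    radialDeriv f y = radialDeriv g y := by
  rw [radialDeriv_eq_fderiv, radialDeriv_eq_fderiv, h.fderiv_eq]

theorem radialDeriv_eventuallyEq {F : Filter (Euc n)} (hF : IsEndFilter F) {f g : Euc n → ℝ}
    (h : f =ᶠ[F] g) : radialDeriv f =ᶠ[F] radialDeriv g :=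
  (hF.eventually_nhds _ h).mono fun _ hx => radialDeriv_congr hx

theorem radialDeriv_add {f g : Euc n → ℝ} {y : Euc n} (hf : DifferentiableAt ℝ f y)
    (hg : DifferentiableAt ℝ g y) :
    radialDeriv (fun y => f y + g y) y = radialDeriv f y + radialDeriv g y := by
  simp only [radialDeriv, pd_add hf hg, mul_add, Finset.sum_add_distrib]

theorem radialDeriv_const_mul {f : Euc n → ℝ} {y : Euc n} (c : ℝ) (hf : DifferentiableAt ℝ f y) :
    radialDeriv (fun y => c * f y) y = c * radialDeriv f y := by
  simp only [radialDeriv, pd_const_mul c hf, Finset.mul_sum]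
  exact Finset.sum_congr rfl fun k _ => by ring

theorem radialDeriv_of_homogeneous {f : Euc n → ℝ} {y : Euc n} {a : ℝ}
    (hf : DifferentiableAt ℝ f y) (h : ∀ t : ℝ, 0 < t → f (t • y) = t ^ a * f y) :
    radialDeriv f y = a * f y := by
  have h1 : HasDerivAt (fun t : ℝ => t • y) y 1 := by
    simpa using (hasDerivAt_id (1 : ℝ)).smul_const y
  have h2 : HasDerivAt (fun t : ℝ => f (t • y)) (fderiv ℝ f y y) 1 := by
    have hf' : HasFDerivAt f (fderiv ℝ f y) ((1 : ℝ) • y) := by rw [one_smul]; exact hf.hasFDerivAt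
    exact hf'.comp_hasDerivAt (1 : ℝ) h1
  have h3 : HasDerivAt (fun t : ℝ => t ^ a * f y) (a * f y) 1 := by
    simpa using (Real.hasDerivAt_rpow_const (x := 1) (p := a) (Or.inl one_ne_zero)).mul_const (f y)
  have h4 : (fun t : ℝ => f (t • y)) =ᶠ[𝓝 1] fun t => t ^ a * f y := by
    filter_upwards [lt_mem_nhds (show (0 : ℝ) < 1 by norm_num)] with t ht using h t ht
  rw [radialDeriv_eq_fderiv]
  exact h2.unique (h3.congr_of_eventuallyEq h4)

/-- The flat Laplacian. -/
def flatLap (f : Euc n → ℝ) (y : Euc n) : ℝ := ∑ i, pd i (pd i f) y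

/-- The radial component of ∇f is a f by Euler's identity, so `sphereInt_radialDeriv_div` applies to
X = ∇f with Z = a(a-2) f. -/
theorem sphereInt_radialDeriv_flatLap {f : Euc n → ℝ} {a r : ℝ} (hr : 0 < r)
    (hf : ∀ y ≠ 0, ContDiffAt ℝ 3 f y) (h : ∀ y ≠ 0, ∀ t : ℝ, 0 < t → f (t • y) = t ^ a * f y) :
    r ^ 2 * sphereInt r (radialDeriv (flatLap f)) =
      a * (a - 2) * ((n : ℝ) - 2 + a) * sphereInt r f := by
  have h0 : ∀ y : Euc n, ‖y‖ = r → y ≠ 0 := fun y hy => by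
    rintro rfl
    simp at hy
    linarith
  have hd : ∀ y ≠ 0, DifferentiableAt ℝ f y := fun y hy => (hf y hy).differentiableAt (by norm_num)
  have he : ∀ y ≠ 0, radialDeriv f y = a * f y := fun y hy =>
    radialDeriv_of_homogeneous (hd y hy) (h y hy)
  have hev : ∀ y : Euc n, y ≠ 0 → ∀ᶠ z in 𝓝 y, z ≠ 0 := fun y hy => isOpen_ne.mem_nhds hy
  have h1 := sphereInt_radialDeriv_div (Z := fun y => a * (a - 2) * f y) hr
    (X := fun i => pd i f) (fun i y hy => ContDiffAt.pd (hf y (h0 y hy)) (by norm_num) i) ?_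
  · refine (show _ = _ from h1).trans ?_
    rw [← sphereInt_const_mul]
    refine sphereInt_congr hr fun y hy => ?_
    rw [radialDeriv_const_mul _ (hd y (h0 y hy)), he y (h0 y hy)]
    ring
  · intro y hy
    filter_upwards [(hev y (h0 y hy)).eventually_nhds] with z hz
    have hz0 := hz.self_of_nhds
    have e1 : (fun y => ∑ i, pd i f y * y i) =ᶠ[𝓝 z] fun y => a * f y := by
      filter_upwards [hz] with w hw
      rw [← he w hw]
      exact Finset.sum_congr rfl fun i _ => mul_comm _ _
    rw [radialDeriv_congr e1, e1.eq_of_nhds, radialDeriv_const_mul _ (hd z hz0), he z hz0]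
    ring

/-- At a = 4 - n the factor a(a-2)(n-2+a) equals 2(n-4)(n-2), and the powers of r cancel; this is
the origin of the constant ς_n. -/
theorem hasFlux_norm_rpow (hn : 4 ≤ n) :
    HasFlux (radialDeriv (flatLap fun y : Euc n => ‖y‖ ^ (4 - (n : ℝ)))) (varsigma n) := by
  refine Tendsto.congr' ?_ tendsto_const_nhds
  filter_upwards [eventually_gt_atTop 0] with r hr
  have h1 := sphereInt_radialDeriv_flatLap (n := n) (f := fun y => ‖y‖ ^ (4 - (n : ℝ))) hr
    (fun y hy => contDiffAt_norm_rpow hy _) (a := 4 - (n : ℝ)) (fun y _ t ht => by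
      rw [norm_smul, Real.norm_of_nonneg ht.le, Real.mul_rpow ht.le (norm_nonneg _)])
  have h2 : sphereInt r (fun y : Euc n => ‖y‖ ^ (4 - (n : ℝ))) = r ^ (4 - (n : ℝ)) * sphereArea n := by
    rw [sphereInt_congr (g := fun _ => r ^ (4 - (n : ℝ)) * 1) hr fun y hy => by rw [hy, mul_one],
      sphereInt_const_mul]
    rfl
  obtain ⟨k, rfl⟩ := Nat.exists_eq_add_of_le hn
  have h3 : r ^ (4 - ((4 + k : ℕ) : ℝ)) = (r ^ k)⁻¹ := by
    rw [← Real.rpow_natCast, ← Real.rpow_neg hr.le]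
    congr 1
    push_cast
    ring
  rw [h2, h3] at h1
  have h4 : r ^ (4 + k - 2) = r ^ k * r ^ 2 := by rw [← pow_add]; congr 1; omega
  rw [h4, mul_assoc, h1, varsigma]
  have : r ^ k ≠ 0 := (pow_pos hr k).ne'
  field_simp
  ring

theorem hasFlux_homogeneous {f : Euc n → ℝ} {a : ℝ}
    (hf : ∀ y ≠ 0, ContDiffAt ℝ 3 f y) (h : ∀ y ≠ 0, ∀ t : ℝ, 0 < t → f (t • y) = t ^ a * f y)
    (h0 : ∀ r > 0, sphereInt r f = 0) : HasFlux (radialDeriv (flatLap f)) 0 := by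
  refine Tendsto.congr' ?_ tendsto_const_nhds
  filter_upwards [eventually_gt_atTop 0] with r hr
  have h1 := sphereInt_radialDeriv_flatLap hr hf h
  rw [h0 r hr, mul_zero, mul_eq_zero] at h1
  rw [h1.resolve_left (by positivity), mul_zero]

theorem IsBigODeriv.flatLap {F : Filter (Euc n)} (hF : IsEndFilter F) {l : ℕ} {s : ℝ}
    {f : Euc n → ℝ} (h : IsBigODeriv F (l + 2) s f) :
    IsBigODeriv F l (s - 2) (PaneitzMass.flatLap f) :=
  IsBigODeriv.sum hF fun i _ => by
    have := IsBigODeriv.pd (IsBigODeriv.pd (l := l + 1) h i) i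
    rwa [sub_sub, one_add_one_eq_two] at this

/-- `γ_{ii,jj} - γ_{ij,ij}`. -/
def massScalar (γ : Fin n → Fin n → Euc n → ℝ) (y : Euc n) : ℝ :=
  ∑ i, ∑ j, (pd j (pd j (γ i i)) y - pd j (pd i (γ i j)) y)

/-- At rθ the radial derivative is r ∑ θ_k ∂_k, which uses up one of the n - 1 powers of r. -/
theorem massFlux_eq (hn : 2 ≤ n) {γ : Euc n → Matrix (Fin n) (Fin n) ℝ}
    (h : ∀ i j, ∀ᶠ y in Bornology.cobounded (Euc n), ContDiffAt ℝ 3 (fun y => γ y i j) y) :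
    ∀ᶠ r in atTop, massFlux γ r =
      r ^ (n - 2) * sphereInt r (radialDeriv (massScalar fun i j y => γ y i j)) := by
  have h' := eventually_all.2 fun i => eventually_all.2 fun j => h i j
  filter_upwards [eventually_sphere h'] with r hr
  have e1 : r ^ (n - 1) = r ^ (n - 2) * r := by rw [← pow_succ]; congr 1; omega
  rw [massFlux, e1, mul_assoc]
  congr 1
  rw [sphereIntegral, ← MeasureTheory.integral_const_mul]
  refine MeasureTheory.integral_congr_ae (Eventually.of_forall fun θ => ?_)
  have hθ : ‖r • (θ : Euc n)‖ = r := norm_smul_sphere hr.1 θ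
  have hγ := hr.2 _ hθ
  have hp : ∀ i j k l, DifferentiableAt ℝ (pd k (pd l fun y => γ y i j)) (r • (θ : Euc n)) :=
    fun i j k l => (ContDiffAt.pd (m := 1) (ContDiffAt.pd (m := 2) (hγ i j) (by norm_num) l)
      (by norm_num) k).differentiableAt (by norm_num)
  simp only [radialDeriv]
  have e2 : ∀ k, pd k (massScalar fun i j y => γ y i j) (r • (θ : Euc n)) = ∑ i, ∑ j,
      (pd k (pd j (pd j (fun y => γ y i i))) (r • (θ : Euc n))
      - pd k (pd j (pd i (fun y => γ y i j))) (r • (θ : Euc n))) := by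
    intro k
    rw [show massScalar (fun i j y => γ y i j) = fun y => ∑ i, ∑ j, (pd j (pd j fun y => γ y i i) y
      - pd j (pd i fun y => γ y i j) y) from rfl]
    rw [pd_sum fun i _ => DifferentiableAt.fun_sum fun j _ => (hp i i j j).fun_sub (hp i j j i)]
    refine Finset.sum_congr rfl fun i _ => ?_
    rw [pd_sum fun j _ => (hp i i j j).fun_sub (hp i j j i)]
    exact Finset.sum_congr rfl fun j _ => pd_sub (hp i i j j) (hp i j j i)
  simp only [e2, Finset.mul_sum, PiLp.smul_apply, smul_eq_mul]
  conv_rhs => rw [Finset.sum_comm]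
  refine Finset.sum_congr rfl fun i _ => ?_
  conv_rhs => rw [Finset.sum_comm]
  exact Finset.sum_congr rfl fun j _ => Finset.sum_congr rfl fun k _ => by ring

end Flux

/-! ### The mass of a metric split into a conformal and a radially trivial part. -/

section MassFormula
open Filter Asymptotics
variable {n : ℕ}

theorem pd_pd_add {f g : Euc n → ℝ} {y : Euc n} (hf : ContDiffAt ℝ 2 f y) (hg : ContDiffAt ℝ 2 g y)
    (k l : Fin n) :
    pd k (pd l fun y => f y + g y) y = pd k (pd l f) y + pd k (pd l g) y := by
  have h1 : pd l (fun y => f y + g y) =ᶠ[𝓝 y] fun y => pd l f y + pd l g y := by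
    filter_upwards [hf.eventually (by simp), hg.eventually (by simp)] with z h1 h2
    exact pd_add (h1.differentiableAt (by norm_num)) (h2.differentiableAt (by norm_num))
  rw [pd_congr h1, pd_add]
  · exact (ContDiffAt.pd (m := 1) hf (by norm_num) l).differentiableAt (by norm_num)
  · exact (ContDiffAt.pd (m := 1) hg (by norm_num) l).differentiableAt (by norm_num)

theorem pd_pd_sum {ι : Type*} {S : Finset ι} {f : ι → Euc n → ℝ} {y : Euc n}
    (hf : ∀ a ∈ S, ContDiffAt ℝ 2 (f a) y) (k l : Fin n) :
    pd k (pd l fun y => ∑ a ∈ S, f a y) y = ∑ a ∈ S, pd k (pd l (f a)) y := by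
  have h1 : pd l (fun y => ∑ a ∈ S, f a y) =ᶠ[𝓝 y] fun y => ∑ a ∈ S, pd l (f a) y := by
    filter_upwards [(eventually_all_finset S).2 fun a ha => (hf a ha).eventually (by simp)] with z hz
    exact pd_sum fun a ha => (hz a ha).differentiableAt (by norm_num)
  rw [pd_congr h1, pd_sum fun a ha =>
    (ContDiffAt.pd (m := 1) (hf a ha) (by norm_num) l).differentiableAt (by norm_num)]

theorem pd_pd_const_mul {f : Euc n → ℝ} {y : Euc n} (c : ℝ) (hf : ContDiffAt ℝ 2 f y)
    (k l : Fin n) : pd k (pd l fun y => c * f y) y = c * pd k (pd l f) y := by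
  have h1 : pd l (fun y => c * f y) =ᶠ[𝓝 y] fun y => c * pd l f y := by
    filter_upwards [hf.eventually (by simp)] with z h1
    exact pd_const_mul c (h1.differentiableAt (by norm_num))
  rw [pd_congr h1, pd_const_mul]
  exact (ContDiffAt.pd (m := 1) hf (by norm_num) l).differentiableAt (by norm_num)

theorem massScalar_add {a b : Fin n → Fin n → Euc n → ℝ} {y : Euc n}
    (ha : ∀ i j, ContDiffAt ℝ 2 (a i j) y) (hb : ∀ i j, ContDiffAt ℝ 2 (b i j) y) :
    massScalar (fun i j y => a i j y + b i j y) y = massScalar a y + massScalar b y := by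
  simp only [massScalar, pd_pd_add (ha _ _) (hb _ _), ← Finset.sum_add_distrib]
  exact Finset.sum_congr rfl fun i _ => Finset.sum_congr rfl fun j _ => by ring

theorem massScalar_conformal (w : Euc n → ℝ) (y : Euc n) :
    massScalar (fun i j y => if i = j then 1 + w y else 0) y = ((n : ℝ) - 1) * flatLap w y := by
  have h1 : ∀ i, pd i (fun y => 1 + w y) = pd i w := fun i => by
    funext x
    simp [pd, fderiv_const_add]
  have h2 : ∀ i j, pd j (pd i fun y => if i = j then 1 + w y else 0) y =
      if i = j then pd j (pd j w) y else 0 := by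
    intro i j
    split_ifs with h
    · subst h; rw [h1]
    · have : pd i (fun _ : Euc n => (0 : ℝ)) = fun _ => 0 := by funext x; exact pd_const _ _ _
      rw [this]; exact pd_const _ _ _
  simp only [massScalar, h2, if_true, h1, Finset.sum_sub_distrib, Finset.sum_ite_eq,
    Finset.mem_univ, Finset.sum_const, Finset.card_univ, Fintype.card_fin, nsmul_eq_mul, flatLap]
  ring

theorem massScalar_eq {h : Fin n → Fin n → Euc n → ℝ} {y : Euc n}
    (hh : ∀ i j, ContDiffAt ℝ 2 (h i j) y) :
    massScalar h y = flatLap (fun y => ∑ i, h i i y) y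
      + -1 * ∑ j, pd j (fun y => ∑ i, pd i (h i j) y) y := by
  have h1 : ∀ j, pd j (fun y => ∑ i, pd i (h i j) y) y = ∑ i, pd j (pd i (h i j)) y := fun j =>
    pd_sum fun i _ => (ContDiffAt.pd (m := 1) (hh i j) (by norm_num) i).differentiableAt (by norm_num)
  simp only [massScalar, flatLap, h1, pd_pd_sum fun i _ => hh i i, Finset.sum_sub_distrib]
  rw [Finset.sum_comm, Finset.sum_comm (f := fun i j => pd j (pd i (h i j)) y)]
  ring

theorem isBigODeriv_massScalar {F : Filter (Euc n)} (hF : IsEndFilter F) {l : ℕ} {s : ℝ}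
    {h : Fin n → Fin n → Euc n → ℝ} (hh : ∀ i j, IsBigODeriv F (l + 2) s (h i j)) :
    IsBigODeriv F l (s - 2) (massScalar h) := by
  have h2 : ∀ i j k m, IsBigODeriv F l (s - 2) (pd k (pd m (h i j))) := fun i j k m => by
    have := IsBigODeriv.pd (IsBigODeriv.pd (l := l + 1) (hh i j) m) k
    rwa [sub_sub, one_add_one_eq_two] at this
  exact IsBigODeriv.sum hF fun i _ => IsBigODeriv.sum hF fun j _ => (h2 i i j j).sub hF (h2 i j j i)

theorem hasFlux_zero {f : Euc n → ℝ} {b : ℝ} (hn : 2 ≤ n)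
    (h : IsBigODeriv (Bornology.cobounded (Euc n)) 0 b f) (hb : b + n < 2) : HasFlux f 0 :=
  tendsto_sphereInt_zero h.isBigO (by push_cast [Nat.cast_sub hn]; linarith)

/-- The double divergence of a tensor annihilating the radial direction has no flux at infinity
if the trace decays fast enough. -/
theorem hasFlux_double_div (hn : 4 ≤ n) {h : Fin n → Fin n → Euc n → ℝ} {a b : ℝ}
    (hh : ∀ i j, IsBigODeriv (Bornology.cobounded (Euc n)) 4 a (h i j))
    (hrad : ∀ i, ∀ᶠ y in Bornology.cobounded (Euc n), ∑ j, h i j y * y j = 0)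
    (htr : IsBigODeriv (Bornology.cobounded (Euc n)) 4 b (fun y => ∑ i, h i i y))
    (hb : b + n < 4) :
    HasFlux (radialDeriv fun y => ∑ j, pd j (fun y => ∑ i, pd i (h i j) y) y) 0 := by
  have hF := isEndFilter_cobounded (n := n)
  set T : Euc n → ℝ := fun y => ∑ i, h i i y with hT
  have hc : ∀ᶠ y in Bornology.cobounded (Euc n), ∀ i j, ContDiffAt ℝ 4 (h i j) y :=
    eventually_all.2 fun i => eventually_all.2 fun j => (hh i j).1
  -- Differentiating ∑_j h_ij y_j = 0 by ∂_i and summing over i shows that the radial component of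
  -- div h is -tr h.
  have hX : ∀ᶠ y in Bornology.cobounded (Euc n),
      (fun y => ∑ j, (∑ i, pd i (h i j) y) * y j) =ᶠ[𝓝 y] fun y => -1 * T y := by
    refine hF.eventually_nhds _ ?_
    filter_upwards [hF.eventually_nhds _ (eventually_all.2 hrad), hc] with y h1 h2
    have hd : ∀ i j, DifferentiableAt ℝ (h i j) y := fun i j =>
      (h2 i j).differentiableAt (by norm_num)
    have h3 : ∀ i, ∑ j, pd i (h i j) y * y j + h i i y = 0 := by
      intro i
      have h4 : (fun y => ∑ j, h i j y * y j) =ᶠ[𝓝 y] fun _ => 0 := h1.mono fun z hz => hz i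
      have h5 := pd_congr h4 (i := i)
      rw [pd_const, pd_sum fun j _ => (hd i j).fun_mul (diffAt_coord j y)] at h5
      simpa only [pd_mul (hd i _) (diffAt_coord _ y), pd_coord, Finset.sum_add_distrib, mul_ite,
        mul_one, mul_zero, Finset.sum_ite_eq, Finset.mem_univ, if_true] using h5
    have h6 := Finset.sum_eq_zero (s := Finset.univ) fun i _ => h3 i
    rw [Finset.sum_add_distrib, Finset.sum_comm] at h6
    simp only [Finset.sum_mul, hT]
    linarith
  set Z : Euc n → ℝ := fun y => 2 * T y + -1 * radialDeriv T y with hZ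
  have hZ' : IsBigODeriv (Bornology.cobounded (Euc n)) 3 b Z :=
    ((htr.mono_order (by norm_num)).const_mul hF 2).add hF
      ((IsBigODeriv.radialDeriv hF htr).const_mul hF (-1))
  have hW : IsBigODeriv (Bornology.cobounded (Euc n)) 0 b
      (fun y => ((n : ℝ) - 2) * Z y + radialDeriv Z y) :=
    ((hZ'.mono_order (by norm_num)).const_mul hF _).add hF
      (IsBigODeriv.radialDeriv hF (hZ'.mono_order (by norm_num)))
  -- Two of the n - 2 powers of r are spent by `sphereInt_radialDeriv_div`, so decay of the trace
  -- beyond |y|^{4-n} suffices; h itself may decay slowly.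
  have hlim := tendsto_sphereInt_zero (m := n - 4) hW.isBigO
    (by push_cast [Nat.cast_sub hn]; linarith)
  refine Tendsto.congr' ?_ hlim
  filter_upwards [eventually_sphere hc,
    eventually_sphere (hF.eventually_nhds _ hX), eventually_sphere (hF.eventually_nhds _ htr.1)]
    with r h1 h2 h3
  have h4 := sphereInt_radialDeriv_div h1.1 (X := fun j y => ∑ i, pd i (h i j) y) (Z := Z)
    (fun j y hy => ContDiffAt.sum fun i _ => ContDiffAt.pd (h1.2 y hy i j) (by norm_num) i) ?_
  · rw [← h4, ← mul_assoc, ← pow_add]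
    congr 2
    omega
  · intro y hy
    filter_upwards [h2.2 y hy, h3.2 y hy] with z hz hz'
    rw [radialDeriv_congr hz, hz.eq_of_nhds,
      radialDeriv_const_mul _ (hz'.differentiableAt (by norm_num))]
    simp only [hZ]
    ring

/-- The mass of a metric which, up to terms of fast decay, is the sum of a conformally flat part
and a radially trivial tensor with small trace. -/
theorem hasFourthOrderMass_of_decomposition (hn : 4 ≤ n)
    {γ : Euc n → Matrix (Fin n) (Fin n) ℝ} {w : Euc n → ℝ}
    {h Z : Fin n → Fin n → Euc n → ℝ} {a b c m : ℝ}
    (hγ : ∀ i j, (fun y => γ y i j) =ᶠ[Bornology.cobounded (Euc n)]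
      fun y => (if i = j then 1 + w y else 0) + h i j y + Z i j y)
    (hw : IsBigODeriv (Bornology.cobounded (Euc n)) 4 c w)
    (hm : HasFlux (radialDeriv (flatLap w)) m)
    (hh : ∀ i j, IsBigODeriv (Bornology.cobounded (Euc n)) 4 a (h i j))
    (hrad : ∀ i, ∀ᶠ y in Bornology.cobounded (Euc n), ∑ j, h i j y * y j = 0)
    (htr : IsBigODeriv (Bornology.cobounded (Euc n)) 4 b (fun y => ∑ i, h i i y))
    (hZ : ∀ i j, IsBigODeriv (Bornology.cobounded (Euc n)) 4 b (Z i j))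
    (hb : b + n < 4) : HasFourthOrderMass γ (((n : ℝ) - 1) * m) := by
  have hF := isEndFilter_cobounded (n := n)
  have hc : ∀ᶠ y in Bornology.cobounded (Euc n), ∀ i j, ContDiffAt ℝ 4 (h i j) y ∧
      ContDiffAt ℝ 4 (Z i j) y ∧ ContDiffAt ℝ 4 w y :=
    eventually_all.2 fun i => eventually_all.2 fun j => (hh i j).1.and ((hZ i j).1.and hw.1)
  have hwc : ∀ {y} (_ : ContDiffAt ℝ 4 w y) (i j : Fin n),
      ContDiffAt ℝ 4 (fun y => if i = j then 1 + w y else 0) y := by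
    intro y hy i j
    by_cases hij : i = j
    · simpa only [hij, if_true] using contDiffAt_const.add hy
    · simpa only [hij, if_false] using contDiffAt_const
  have hγc : ∀ i j, ∀ᶠ y in Bornology.cobounded (Euc n), ContDiffAt ℝ 3 (fun y => γ y i j) y := by
    intro i j
    filter_upwards [hF.eventually_nhds _ (hγ i j), hc] with y h1 h2
    have h3 := (((hwc (h2 i j).2.2 i j).add (h2 i j).1).add (h2 i j).2.1).of_le
      (show (3 : WithTop ℕ∞) ≤ 4 by norm_num)
    exact h3.congr_of_eventuallyEq h1
  set D : Euc n → ℝ := fun y => ∑ j, pd j (fun y => ∑ i, pd i (h i j) y) y with hD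
  have hscal : massScalar (fun i j y => γ y i j) =ᶠ[Bornology.cobounded (Euc n)]
      fun y => ((n : ℝ) - 1) * flatLap w y + (flatLap (fun y => ∑ i, h i i y) y + -1 * D y)
        + massScalar Z y := by
    filter_upwards [hF.eventually_nhds _ (eventually_all.2 fun i => eventually_all.2 fun j => hγ i j), hc]
      with y h1 h2
    have le : (2 : WithTop ℕ∞) ≤ 4 := by norm_num
    have e1 : massScalar (fun i j y => γ y i j) y = massScalar (fun i j y =>
        (if i = j then 1 + w y else 0) + h i j y + Z i j y) y := by
      have e2 : ∀ i j k l, pd k (pd l fun y => γ y i j) y = pd k (pd l fun y =>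
          (if i = j then 1 + w y else 0) + h i j y + Z i j y) y := fun i j k l =>
        pd_congr (pd_eventuallyEq (h1.mono fun z hz => hz i j))
      simp only [massScalar, e2]
    rw [e1, massScalar_add (a := fun i j y => (if i = j then 1 + w y else 0) + h i j y)
        (fun i j => ((hwc (h2 i j).2.2 i j).add (h2 i j).1).of_le le)
        (fun i j => (h2 i j).2.1.of_le le),
      massScalar_add (a := fun i j y => (if i = j then 1 + w y else 0))
        (fun i j => (hwc (h2 i j).2.2 i j).of_le le) (fun i j => (h2 i j).1.of_le le),
      massScalar_conformal, massScalar_eq fun i j => (h2 i j).1.of_le le]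
  have s1 := IsBigODeriv.flatLap (l := 2) hF hw
  have s2 := IsBigODeriv.flatLap (l := 2) hF htr
  have s3 : IsBigODeriv (Bornology.cobounded (Euc n)) 2 (a - 2) D := by
    refine IsBigODeriv.sum hF fun j _ => ?_
    have := IsBigODeriv.pd (l := 2) (IsBigODeriv.sum hF (S := Finset.univ) fun i _ =>
      IsBigODeriv.pd (l := 3) (hh i j) i) j
    rwa [sub_sub, one_add_one_eq_two] at this
  have s4 := isBigODeriv_massScalar (l := 2) hF hZ
  have hrd : radialDeriv (massScalar fun i j y => γ y i j) =ᶠ[Bornology.cobounded (Euc n)]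
      fun y => ((n : ℝ) - 1) * radialDeriv (flatLap w) y
        + (radialDeriv (flatLap (fun y => ∑ i, h i i y)) y + -1 * radialDeriv D y)
        + radialDeriv (massScalar Z) y := by
    filter_upwards [radialDeriv_eventuallyEq hF hscal, s1.1, s2.1, s3.1, s4.1] with y h1 h2 h3 h4 h5
    have d2 := h2.differentiableAt (by norm_num)
    have d3 := h3.differentiableAt (by norm_num)
    have d4 := h4.differentiableAt (by norm_num)
    have d5 := h5.differentiableAt (by norm_num)
    rw [h1, radialDeriv_add (f := fun y => ((n : ℝ) - 1) * flatLap w y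
        + (flatLap (fun y => ∑ i, h i i y) y + -1 * D y)) ((d2.const_mul _).add
        (d3.add (d4.const_mul _))) d5,
      radialDeriv_add (f := fun y => ((n : ℝ) - 1) * flatLap w y) (d2.const_mul _)
        (d3.fun_add (d4.const_mul _)), radialDeriv_add (g := fun y => -1 * D y) d3 (d4.const_mul _),
      radialDeriv_const_mul _ d2, radialDeriv_const_mul _ d4]
  have r1 := IsBigODeriv.radialDeriv (l := 0) hF (s1.mono_order (by norm_num))
  have r2 := IsBigODeriv.radialDeriv (l := 0) hF (s2.mono_order (by norm_num))
  have r3 := IsBigODeriv.radialDeriv (l := 0) hF (s3.mono_order (by norm_num))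
  have r4 := IsBigODeriv.radialDeriv (l := 0) hF (s4.mono_order (by norm_num))
  -- The trace and the remainder lose their flux by decay alone; the double divergence of h needs
  -- the radial relation.
  have f2 := hasFlux_zero (by omega) r2 (by linarith)
  have f3 := (hasFlux_double_div hn hh hrad htr hb).const_mul (-1)
  have f4 := hasFlux_zero (by omega) r4 (by linarith)
  have c1 := (r1.const_mul hF ((n : ℝ) - 1)).eventually_continuousAt
  have c3 := (r3.const_mul hF (-1)).eventually_continuousAt
  have c23 := r2.eventually_continuousAt.and c3 |>.mono fun y hy => hy.1.add hy.2
  have c123 := c1.and c23 |>.mono fun y hy => hy.1.add hy.2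
  have key := (((hm.const_mul ((n : ℝ) - 1)).add (f2.add f3 r2.eventually_continuousAt c3) c1 c23).add
    f4 c123 r4.eventually_continuousAt).congr hrd
  rw [mul_zero, add_zero, add_zero, add_zero] at key
  exact Tendsto.congr' ((massFlux_eq (by omega) hγc).mono fun r hr => hr.symm) key

end MassFormula

/-! ### Homogeneous polynomials under inversion. -/

section Polynomials
open Filter Asymptotics
variable {n : ℕ}

theorem polyFun_smul {p : MvPolynomial (Fin n) ℝ} {k : ℕ} (hp : p.IsHomogeneous k) (t : ℝ)
    (x : Euc n) : polyFun p (t • x) = t ^ k * polyFun p x := by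
  simp only [polyFun, MvPolynomial.eval_eq', Finset.mul_sum]
  refine Finset.sum_congr rfl fun d hd => ?_
  have h1 : ∑ i, d i = k := by
    have := hp (MvPolynomial.mem_support_iff.1 hd)
    rwa [show Finsupp.weight (1 : Fin n → ℕ) d = d.degree from
      (DFunLike.congr_fun Finsupp.degree_eq_weight_one d).symm, Finsupp.degree_eq_sum] at this
  simp only [PiLp.smul_apply, smul_eq_mul, mul_pow, Finset.prod_mul_distrib,
    Finset.prod_pow_eq_pow_sum, h1]
  ring

theorem contDiff_polyFun (p : MvPolynomial (Fin n) ℝ) :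
    ContDiff ℝ ∞ (polyFun p) := by
  have : polyFun p = fun x => ∑ d ∈ p.support, p.coeff d * ∏ i, x i ^ d i := by
    funext x
    rw [polyFun, MvPolynomial.eval_eq']
  rw [this]
  exact ContDiff.sum fun d _ => contDiff_const.mul (contDiff_prod fun i _ =>
    (smooth_coord i).pow _)

theorem isBigODeriv_prod {F : Filter (Euc n)} (hF : IsEndFilter F) {ι : Type*} {S : Finset ι}
    {l : ℕ} {s : ι → ℝ} {f : ι → Euc n → ℝ} (h : ∀ a ∈ S, IsBigODeriv F l (s a) (f a)) :
    IsBigODeriv F l (∑ a ∈ S, s a) (fun x => ∏ a ∈ S, f a x) := by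
  classical
  induction S using Finset.induction_on with
  | empty => simpa using isBigODeriv_const hF l 1
  | insert a S ha ih =>
    simp only [Finset.prod_insert ha, Finset.sum_insert ha]
    exact (h a (Finset.mem_insert_self _ _)).mul hF
      (ih fun b hb => h b (Finset.mem_insert_of_mem hb))

theorem isBigODeriv_polyFun {F : Filter (Euc n)} (hF : IsEndFilter F)
    {p : MvPolynomial (Fin n) ℝ} {k : ℕ} (hp : p.IsHomogeneous k) (l : ℕ) :
    IsBigODeriv F l k (polyFun p) := by
  have : polyFun p = fun x => ∑ d ∈ p.support, p.coeff d * ∏ i, ∏ _m ∈ Finset.range (d i), x i := by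
    funext x
    simp [polyFun, MvPolynomial.eval_eq']
  rw [this]
  refine IsBigODeriv.sum hF fun d hd => IsBigODeriv.const_mul hF _ ?_
  have h1 : ∑ i, d i = k := by
    have := hp (MvPolynomial.mem_support_iff.1 hd)
    rwa [show Finsupp.weight (1 : Fin n → ℕ) d = d.degree from
      (DFunLike.congr_fun Finsupp.degree_eq_weight_one d).symm, Finsupp.degree_eq_sum] at this
  have h2 := isBigODeriv_prod hF (S := Finset.univ) fun i _ =>
    isBigODeriv_prod hF (S := Finset.range (d i)) fun _ _ => isBigODeriv_coord hF l i
  simp only [Finset.sum_const, Finset.card_range, nsmul_eq_mul, mul_one] at h2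
  rwa [← Nat.cast_sum, h1] at h2

theorem inversion_smul {s t : ℝ} (ht : t ≠ 0) (y : Euc n) :
    inversion s (t • y) = t⁻¹ • inversion s y := by
  rw [inversion, inversion, norm_smul, smul_smul, smul_smul, mul_pow, Real.norm_eq_abs, sq_abs]
  congr 1
  rw [mul_inv]
  field_simp

theorem contDiffAt_polyFun_inversion (p : MvPolynomial (Fin n) ℝ) (s : ℝ) {y : Euc n} (hy : y ≠ 0) :
    ContDiffAt ℝ ∞ (fun y => polyFun p (inversion s y)) y :=
  (contDiff_polyFun p).contDiffAt.comp y (contDiffAt_inversion hy)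

/-- The inverted mean-zero homogeneous polynomials have no flux at infinity. -/
theorem hasFlux_polyFun_inversion {p : MvPolynomial (Fin n) ℝ} {k : ℕ} (hp : p.IsHomogeneous k)
    (h0 : sphereIntegral (polyFun p) = 0) (s : ℝ) :
    HasFlux (radialDeriv (flatLap fun y => polyFun p (inversion s y))) 0 := by
  refine hasFlux_homogeneous (a := -(k : ℝ)) (fun y hy => ?_) (fun y _ t ht => ?_) fun r hr => ?_
  · exact (contDiffAt_polyFun_inversion p s hy).of_le (WithTop.coe_le_coe.2 le_top : ((3 : ℕ∞) : WithTop ℕ∞) ≤ ∞)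
  · rw [inversion_smul ht.ne', polyFun_smul hp, Real.rpow_neg ht.le, Real.rpow_natCast, inv_pow]
  -- On a sphere the inversion is a dilation, so homogeneity reduces the integral to the mean over
  -- the unit sphere.
  · rw [sphereInt_congr (g := fun y => (s * (r ^ 2)⁻¹ * r) ^ k * polyFun p (r⁻¹ • y)) hr,
      sphereInt_const_mul]
    · have : sphereInt r (fun y : Euc n => polyFun p (r⁻¹ • y)) = 0 := by
        rw [← h0]
        simp only [sphereInt, smul_smul, inv_mul_cancel₀ hr.ne', one_smul]
      rw [this, mul_zero]
    · intro y hy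
      rw [← polyFun_smul hp, smul_smul, inversion, hy, mul_assoc _ r, mul_inv_cancel₀ hr.ne', mul_one]

end Polynomials

/-! ### The expansion of the inverted metric and its mass. -/

section Expansion
open Filter Asymptotics
variable {n : ℕ}

/-- The radius of the inversion used for the coordinates at infinity. -/
def invScale (n : ℕ) : ℝ := varsigma n ^ (-2 / ((n : ℝ) - 4))

theorem invScale_pos (hn : 5 ≤ n) : 0 < invScale n := Real.rpow_pos_of_pos (varsigma_pos hn) _

theorem invScale_rpow (hn : 5 ≤ n) : invScale n ^ (4 - (n : ℝ)) = varsigma n ^ 2 := by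
  have h : (5 : ℝ) ≤ n := by exact_mod_cast hn
  have h4 : (n : ℝ) - 4 ≠ 0 := by linarith
  rw [invScale, ← Real.rpow_mul (varsigma_pos hn).le, ← Real.rpow_natCast]
  congr 1
  push_cast
  field_simp
  ring

/-- This fixes the scale: the squared Jacobian factor of the inversion is itself a power 4/(n-4), so
it merges with the Green's function into a single conformal factor tending to one. -/
theorem invScale_sq (hn : 5 ≤ n) {t : ℝ} (ht : 0 < t) :
    (invScale n * (t ^ 2)⁻¹) ^ 2 =
      ((varsigma n)⁻¹ * t ^ (4 - (n : ℝ))) ^ (4 / ((n : ℝ) - 4)) := by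
  have h : (5 : ℝ) ≤ n := by exact_mod_cast hn
  have h4 : (n : ℝ) - 4 ≠ 0 := by linarith
  have hς := varsigma_pos hn
  rw [Real.mul_rpow (inv_nonneg.2 hς.le) (Real.rpow_nonneg ht.le _), ← Real.rpow_mul ht.le,
    Real.inv_rpow hς.le, ← Real.rpow_neg hς.le, mul_pow, invScale, ← Real.rpow_natCast,
    ← Real.rpow_mul hς.le, inv_pow, ← pow_mul]
  congr 1
  · congr 1
    push_cast
    field_simp
    ring
  · rw [show (4 - (n : ℝ)) * (4 / ((n : ℝ) - 4)) = -((2 * 2 : ℕ) : ℝ) by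
      push_cast; field_simp; ring, Real.rpow_neg ht.le, Real.rpow_natCast]

variable {γ : Euc n → Matrix (Fin n) (Fin n) ℝ} {ρ : ℝ}

/-- Asymptotics and mass of the inverted metric `f^{4/(n-4)} γ`, in terms of the expansion of `f`
in normal coordinates with vanishing Weyl tensor. -/
theorem decay_and_mass_of_greenExpansion (hn : 5 ≤ n) (hγ : IsNormalMetric γ ρ)
    (hw : ∀ m : ℕ, (m : ℤ) ≤ (dOrder n : ℤ) - 2 → ∀ I : Fin (4 + m) → Fin n,
      covDerivIter γ (weyl γ) m I 0 = 0)
    {f : Euc n → ℝ} {A : ℝ} (hf : HasGreenExpansion f A) (hpos : ∀ᶠ x in 𝓝[≠] 0, 0 < f x)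
    {η : Euc n → Matrix (Fin n) (Fin n) ℝ}
    (hη : ∀ᶠ y in Bornology.cobounded (Euc n), ∀ i j, η y i j =
      f (inversion (invScale n) y) ^ (4 / ((n : ℝ) - 4)) *
        ((invScale n * (‖y‖ ^ 2)⁻¹) ^ 2 * γ (inversion (invScale n) y) i j)) :
    (∀ i j, IsBigODeriv (Bornology.cobounded (Euc n)) 4 (-((dOrder n : ℝ) + 1))
      (fun y => η y i j - (1 : Matrix (Fin n) (Fin n) ℝ) i j)) ∧
    HasFourthOrderMass η (4 * ((n : ℝ) - 1) / ((n : ℝ) - 4) * A) := by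
  have hF := isEndFilter_cobounded (n := n)
  obtain ⟨ψ, hψ, hrem⟩ := hf
  set s := invScale n with hs_def
  have hs : 0 < s := invScale_pos hn
  have hς := varsigma_pos hn
  have hnR : (5 : ℝ) ≤ n := by exact_mod_cast hn
  have hdn : dOrder n + 1 ≤ n - 4 := by unfold dOrder; omega
  have hd1 : (dOrder n : ℝ) + 1 ≤ n - 4 := by
    have : ((dOrder n + 1 : ℕ) : ℝ) ≤ ((n - 4 : ℕ) : ℝ) := by exact_mod_cast hdn
    push_cast [Nat.cast_sub (show 4 ≤ n by omega)] at this
    linarith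
  -- The inequality that makes all quadratic terms negligible for the mass; it is an equality when n
  -- is odd.
  have hd2 : (n : ℝ) - 3 ≤ 2 * ((dOrder n : ℝ) + 1) := by
    have : n ≤ 2 * (dOrder n + 1) + 3 := by unfold dOrder; omega
    have : (n : ℝ) ≤ ((2 * (dOrder n + 1) + 3 : ℕ) : ℝ) := by exact_mod_cast this
    push_cast at this
    linarith
  have hd0 : (0 : ℝ) ≤ dOrder n := Nat.cast_nonneg _
  set q : ℝ := 4 / ((n : ℝ) - 4) with hq
  set K := Finset.Icc (dOrder n + 1) (n - 4) with hK
  set rem : Euc n → ℝ := fun x => f x - ((varsigma n)⁻¹ * ‖x‖ ^ (4 - (n : ℝ)) *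
        (1 + ∑ k ∈ K, polyFun (ψ k) x) + A) with hrem_def
  set v : Euc n → ℝ := fun y => f (inversion s y) * ((varsigma n)⁻¹ * ‖y‖ ^ (4 - (n : ℝ))) with hv
  set u : Euc n → ℝ := fun y => ∑ k ∈ K, polyFun (ψ k) (inversion s y)
    + (varsigma n)⁻¹ * A * ‖y‖ ^ (4 - (n : ℝ)) with hu
  set u₂ : Euc n → ℝ := fun y => (varsigma n)⁻¹ * (‖y‖ ^ (4 - (n : ℝ)) * rem (inversion s y)) with hu₂
  have hmono : ∀ {l : ℕ} {a b : ℝ} {g : Euc n → ℝ}, IsBigODeriv (Bornology.cobounded (Euc n)) l a g →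
      a ≤ b → IsBigODeriv (Bornology.cobounded (Euc n)) l b g := fun h hab =>
    h.mono_rate hF (norm_rpow_isBigO_cobounded (by linarith))
  have hu_ψ : ∀ k ∈ K, IsBigODeriv (Bornology.cobounded (Euc n)) 4 (-((dOrder n : ℝ) + 1))
      (fun y => polyFun (ψ k) (inversion s y)) := by
    intro k hk
    refine hmono ((isBigODeriv_polyFun isEndFilter_nhdsNE (hψ k hk).1 4).comp_inversion hs) ?_
    have : ((dOrder n + 1 : ℕ) : ℝ) ≤ k := by exact_mod_cast (Finset.mem_Icc.1 hk).1
    push_cast at this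
    linarith
  have hnorm : IsBigODeriv (Bornology.cobounded (Euc n)) 4 (4 - (n : ℝ))
      (fun y => ‖y‖ ^ (4 - (n : ℝ))) := isBigODeriv_norm_rpow hF 4 _
  have hu_sym : IsBigODeriv (Bornology.cobounded (Euc n)) 4 (-((dOrder n : ℝ) + 1)) u :=
    (IsBigODeriv.sum hF hu_ψ).add hF (hmono (hnorm.const_mul hF _) (by linarith))
  -- The remainder O(|x|) of the expansion becomes O(|y|^{-1}) and gains the factor |y|^{4-n}.
  have hu₂_sym : IsBigODeriv (Bornology.cobounded (Euc n)) 4 (3 - (n : ℝ)) u₂ := by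
    have := (hnorm.mul hF (hrem.comp_inversion hs)).const_mul hF (varsigma n)⁻¹
    rwa [show (4 - (n : ℝ)) + -1 = 3 - n by ring] at this
  -- As |x||y| = s, the leading term of f times |y|^{4-n} is constant, and the choice of s makes it
  -- cancel ς⁻².
  have hv_eq : (fun y => v y - 1) =ᶠ[Bornology.cobounded (Euc n)] fun y => u y + u₂ y := by
    filter_upwards [hF.ne_zero] with y hy
    have hy0 : 0 < ‖y‖ := norm_pos_iff.2 hy
    have h1 : ‖inversion s y‖ ^ (4 - (n : ℝ)) * ‖y‖ ^ (4 - (n : ℝ)) = varsigma n ^ 2 := by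
      rw [← Real.mul_rpow (norm_nonneg _) hy0.le, norm_inversion hs, mul_assoc,
        inv_mul_cancel₀ hy0.ne', mul_one, hs_def, invScale_rpow hn]
    have h2 : (varsigma n)⁻¹ * (varsigma n)⁻¹ * varsigma n ^ 2 = 1 := by field_simp
    have h3 : f (inversion s y) = rem (inversion s y) + ((varsigma n)⁻¹ *
        ‖inversion s y‖ ^ (4 - (n : ℝ)) * (1 + ∑ k ∈ K, polyFun (ψ k) (inversion s y)) + A) := by
      simp only [hrem_def]; ring
    simp only [hv, hu, hu₂, h3]
    linear_combination ((varsigma n)⁻¹ * (varsigma n)⁻¹ *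
      (1 + ∑ k ∈ K, polyFun (ψ k) (inversion s y))) * h1
      + (1 + ∑ k ∈ K, polyFun (ψ k) (inversion s y)) * h2
  have hv_sym : IsBigODeriv (Bornology.cobounded (Euc n)) 4 (-((dOrder n : ℝ) + 1))
      (fun y => v y - 1) := (hu_sym.add hF (hmono hu₂_sym (by linarith))).congr hF hv_eq
  have hb := norm_rpow_isBigO_cobounded (n := n) (s := -((dOrder n : ℝ) + 1)) (by linarith)
  have hv1 : Tendsto v (Bornology.cobounded (Euc n)) (𝓝 1) := by
    have h1 : Tendsto (fun y : Euc n => ‖y‖ ^ (-((dOrder n : ℝ) + 1))) (Bornology.cobounded (Euc n))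
        (𝓝 0) := (tendsto_rpow_neg_atTop (by linarith)).comp tendsto_norm_cobounded_atTop
    have h2 := (hv_sym.isBigO.trans_tendsto h1).add_const 1
    simpa using h2
  set h : Fin n → Fin n → Euc n → ℝ := fun i j y => metricDev γ i j (inversion s y) with hh
  have hdev := hγ.dev_vanishes (by omega) hw
  have hh_sym : ∀ i j, IsBigODeriv (Bornology.cobounded (Euc n)) 4 (-((dOrder n : ℝ) + 1)) (h i j) := by
    intro i j
    have := ((hdev i j).isBigODeriv 4).comp_inversion hs
    push_cast at this
    exact this
  -- Each component of h is only O(|y|^{-(d+1)}), but the trace has twice that rate.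
  have htr : IsBigODeriv (Bornology.cobounded (Euc n)) 4 (3 - (n : ℝ)) (fun y => ∑ i, h i i y) := by
    refine hmono (((hγ.trace_vanishes hdev).isBigODeriv 4).comp_inversion hs) ?_
    push_cast
    linarith
  -- The Gauss relation at x carries over to y because the two vectors are proportional.
  have hrad : ∀ i, ∀ᶠ y in Bornology.cobounded (Euc n), ∑ j, h i j y * y j = 0 := by
    intro i
    filter_upwards [(tendsto_inversion hs).eventually (nhdsWithin_le_nhds (hγ.radial_dev i)),
      hF.ne_zero] with y hy hy0
    have hc : s * (‖y‖ ^ 2)⁻¹ ≠ 0 := by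
      have : 0 < ‖y‖ := norm_pos_iff.2 hy0
      positivity
    refine (mul_eq_zero.1 (?_ : s * (‖y‖ ^ 2)⁻¹ * ∑ j, h i j y * y j = 0)).resolve_left hc
    rw [Finset.mul_sum, ← hy]
    refine Finset.sum_congr rfl fun j _ => ?_
    simp only [hh]
    rw [show (inversion s y) j = s * (‖y‖ ^ 2)⁻¹ * y j by simp [inversion]]
    ring
  set R : Euc n → ℝ := fun y => q * u₂ y + (v y ^ q - 1 - q * (v y - 1)) with hR
  have hR_sym : IsBigODeriv (Bornology.cobounded (Euc n)) 4 (3 - (n : ℝ)) R :=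
    (hu₂_sym.const_mul hF q).add hF
      (hmono (isBigODeriv_rpow_sub_linear hF hb hv1 hv_sym q) (by linarith))
  -- Everything nonlinear or of fast decay in v^q (δ + h): the error of v^q against 1 + q u, and the
  -- product (v^q - 1) h.
  set Z : Fin n → Fin n → Euc n → ℝ := fun i j y =>
    (if i = j then 1 else 0) * R y + (v y ^ q - 1) * h i j y with hZ
  have hZ_sym : ∀ i j, IsBigODeriv (Bornology.cobounded (Euc n)) 4 (3 - (n : ℝ)) (Z i j) :=
    fun i j => (hR_sym.const_mul hF _).add hF
      (hmono ((isBigODeriv_rpow_sub_one hF hb hv1 hv_sym q).mul hF (hh_sym i j)) (by linarith))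
  have hη' : ∀ i j, (fun y => η y i j) =ᶠ[Bornology.cobounded (Euc n)]
      fun y => (if i = j then 1 + q * u y else 0) + h i j y + Z i j y := by
    intro i j
    filter_upwards [hη, hv_eq, (tendsto_inversion hs).eventually hpos, hF.ne_zero]
      with y h1 h2 h3 hy
    have hy0 : 0 < ‖y‖ := norm_pos_iff.2 hy
    have h4 : f (inversion s y) ^ q * (s * (‖y‖ ^ 2)⁻¹) ^ 2 = v y ^ q := by
      rw [hs_def, invScale_sq hn hy0, ← Real.mul_rpow h3.le (by positivity)]
    have h5 : γ (inversion s y) i j = (if i = j then 1 else 0) + h i j y := by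
      simp only [hh, metricDev]; ring
    rw [h1, ← mul_assoc, h4, h5]
    simp only [hZ, hR]
    rw [h2]
    split_ifs <;> ring
  refine ⟨fun i j => ?_, ?_⟩
  · have h1 : IsBigODeriv (Bornology.cobounded (Euc n)) 4 (-((dOrder n : ℝ) + 1))
        (fun y => (if i = j then 1 else 0) * (q * u y) + h i j y + Z i j y) :=
      (((hu_sym.const_mul hF q).const_mul hF _).add hF (hh_sym i j)).add hF
        (hmono (hZ_sym i j) (by linarith))
    refine h1.congr hF ?_
    filter_upwards [hη' i j] with y hy
    rw [hy, Matrix.one_apply]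
    split_ifs <;> ring
  · have hflux : HasFlux (radialDeriv (flatLap fun y => q * u y)) (q * A) := by
      have hnc := (IsBigODeriv.radialDeriv (l := 1) hF (IsBigODeriv.flatLap (l := 2) hF hnorm))
      have hψc := fun k hk => IsBigODeriv.radialDeriv (l := 1) hF
        (IsBigODeriv.flatLap (l := 2) hF (hu_ψ k hk))
      have f1 := HasFlux.sum (fun k hk => hasFlux_polyFun_inversion (hψ k hk).1 (hψ k hk).2.1 s)
        fun k hk => (hψc k hk).eventually_continuousAt
      have f2 := (hasFlux_norm_rpow (n := n) (by omega)).const_mul ((varsigma n)⁻¹ * A)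
      have f3 := (f1.add f2 (IsBigODeriv.sum hF hψc).eventually_continuousAt
        (hnc.const_mul hF _).eventually_continuousAt).const_mul q
      -- The mean-zero polynomials carry no flux, and the flux ς_n of |y|^{4-n} cancels its
      -- coefficient ς_n⁻¹.
      have e1 : q * (∑ k ∈ K, 0 + (varsigma n)⁻¹ * A * varsigma n) = q * A := by
        rw [Finset.sum_const_zero]
        field_simp
        ring
      rw [e1] at f3
      refine f3.congr ?_
      have hlap : flatLap (fun y => q * u y) =ᶠ[Bornology.cobounded (Euc n)] fun y =>
          q * (∑ k ∈ K, flatLap (fun y => polyFun (ψ k) (inversion s y)) y +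
            (varsigma n)⁻¹ * A * flatLap (fun y => ‖y‖ ^ (4 - (n : ℝ))) y) := by
        filter_upwards [hF.ne_zero] with y hy
        have c1 : ∀ k ∈ K, ContDiffAt ℝ 2 (fun y => polyFun (ψ k) (inversion s y)) y := fun k _ =>
          (contDiffAt_polyFun_inversion (ψ k) s hy).of_le (WithTop.coe_le_coe.2 le_top : ((2 : ℕ∞) : WithTop ℕ∞) ≤ ∞)
        have c2 : ContDiffAt ℝ 2 (fun y : Euc n => ‖y‖ ^ (4 - (n : ℝ))) y := contDiffAt_norm_rpow hy _
        have c3 : ContDiffAt ℝ 2 (fun y => ∑ k ∈ K, polyFun (ψ k) (inversion s y)) y :=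
          ContDiffAt.sum c1
        simp only [flatLap]
        have c4 : ContDiffAt ℝ 2 (fun y : Euc n => (varsigma n)⁻¹ * A * ‖y‖ ^ (4 - (n : ℝ))) y :=
          contDiffAt_const.mul c2
        rw [Finset.sum_congr rfl fun i _ => pd_pd_const_mul q (c3.add c4) i i,
          Finset.sum_congr rfl fun i _ => congrArg (q * ·) (pd_pd_add c3 c4 i i)]
        simp only [pd_pd_sum c1, pd_pd_const_mul _ c2, Finset.mul_sum, mul_add,
          Finset.sum_add_distrib]
        rw [Finset.sum_comm]
      filter_upwards [radialDeriv_eventuallyEq hF hlap,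
        (eventually_all_finset K).2 fun k hk => (IsBigODeriv.flatLap (l := 2) hF (hu_ψ k hk)).1,
        (IsBigODeriv.flatLap (l := 2) hF hnorm).1] with y h1 h2 h3
      have d2 := fun k hk => (h2 k hk).differentiableAt (by norm_num)
      have d3 := h3.differentiableAt (by norm_num)
      have e2 : radialDeriv (fun y => ∑ k ∈ K, flatLap (fun y => polyFun (ψ k) (inversion s y)) y) y
          = ∑ k ∈ K, radialDeriv (flatLap fun y => polyFun (ψ k) (inversion s y)) y := by
        simp only [radialDeriv]
        rw [Finset.sum_comm]
        exact Finset.sum_congr rfl fun i _ => by rw [pd_sum d2, Finset.mul_sum]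
      rw [h1, radialDeriv_const_mul _ ((DifferentiableAt.fun_sum d2).fun_add (d3.const_mul _)),
        radialDeriv_add (DifferentiableAt.fun_sum d2) (d3.const_mul _), e2, radialDeriv_const_mul _ d3]
    have hmass := hasFourthOrderMass_of_decomposition (by omega) hη' (hu_sym.const_mul hF q) hflux
      hh_sym hrad htr hZ_sym (by linarith)
    rwa [show ((n : ℝ) - 1) * (q * A) = 4 * ((n : ℝ) - 1) / ((n : ℝ) - 4) * A by
      rw [hq]; ring] at hmass

end Expansion

end PaneitzMass

end

/-! ### Assembly of the theorem. -/

theorem proposition8p2 {n : ℕ} (hn : 5 ≤ n)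
    {M : Type*} [TopologicalSpace M] [T2Space M] [CompactSpace M]
    [ChartedSpace (PaneitzMass.Euc n) M] [IsManifold (𝓡 n) ∞ M]
    (g : Bundle.ContMDiffRiemannianMetric (𝓡 n) ∞ (PaneitzMass.Euc n)
      (fun p : M => TangentSpace (𝓡 n) p))
    (hker : PaneitzMass.PaneitzKerTrivial g.inner)
    (σ : M) (G : M → ℝ)
    (hG : PaneitzMass.IsGreenFunction g.inner σ G)
    (hpos : ∀ p, p ≠ σ → 0 < G p)
    (e : OpenPartialHomeomorph M (PaneitzMass.Euc n))
    (he : PaneitzMass.IsNormalChart g.inner σ e)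
    (hdet : ∀ᶠ x in 𝓝 (0 : PaneitzMass.Euc n), (PaneitzMass.comps g.inner e x).det = 1)
    (hweyl : PaneitzMass.WeylVanishes g.inner e)
    (A : ℝ)
    (hexp : PaneitzMass.HasGreenExpansion (fun x => G (e.symm x)) A) :
    PaneitzMass.QCurvZeroOn (PaneitzMass.conformalMetric G g.inner) {σ}ᶜ ∧
    ∃ einf : OpenPartialHomeomorph M (PaneitzMass.Euc n),
      PaneitzMass.IsInvertedChart e σ einf ∧
      (∃ τ : ℝ, ((n : ℝ) - 4) / 2 < τ ∧
        PaneitzMass.IsAsymptoticallyFlat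
          (PaneitzMass.conformalMetric G g.inner) {σ}ᶜ einf τ) ∧
      PaneitzMass.HasFourthOrderMass
        (PaneitzMass.comps (PaneitzMass.conformalMetric G g.inner) einf)
        (4 * ((n : ℝ) - 1) / ((n : ℝ) - 4) * A) := by
  obtain ⟨ρ₀, hρ₀, htarget⟩ := he.target_eq
  obtain ⟨ρ₁, hρ₁, hdet₁⟩ := Metric.eventually_nhds_iff_ball.1 hdet
  have hs : 0 < PaneitzMass.invScale n := PaneitzMass.invScale_pos hn
  -- The determinant is one only near the center, so the ball of the chart is shrunk; the end of the
  -- manifold still uses the full chart.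
  have hnormal : PaneitzMass.IsNormalMetric (PaneitzMass.comps g.inner e) (min ρ₀ ρ₁) := by
    have hsub : Metric.ball (0 : PaneitzMass.Euc n) (min ρ₀ ρ₁) ⊆ e.target := by
      rw [htarget]
      exact Metric.ball_subset_ball (min_le_left _ _)
    exact
      { pos := lt_min hρ₀ hρ₁
        metric := (PaneitzMass.isCoordMetric_comps g he.mem_atlas).mono Metric.isOpen_ball hsub
        center := he.orthonormal
        geodesic := fun x hx => he.radial_geodesic x (hsub hx)
        det_eq := fun x hx => hdet₁ x (Metric.ball_subset_ball (min_le_right _ _) hx) }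
  have htgt : ∀ᶠ x in 𝓝[≠] (0 : PaneitzMass.Euc n), x ∈ Metric.ball 0 (min ρ₀ ρ₁) ∧
      x ∈ e.target ∧ e.symm x ≠ σ := by
    filter_upwards [nhdsWithin_le_nhds (Metric.ball_mem_nhds _ (lt_min hρ₀ hρ₁)),
      eventually_mem_nhdsWithin] with x hx hx0
    have hxt : x ∈ e.target := by
      rw [htarget]
      exact Metric.ball_subset_ball (min_le_left _ _) hx
    refine ⟨hx, hxt, fun h => hx0 ?_⟩
    have := e.right_inv hxt
    rw [h, he.map_center] at this
    exact this.symm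
  obtain ⟨hdecay, hmass⟩ := PaneitzMass.decay_and_mass_of_greenExpansion hn hnormal hweyl hexp
    (htgt.mono fun x hx => hpos _ hx.2.2)
    (η := PaneitzMass.comps (PaneitzMass.conformalMetric G g.inner)
      (PaneitzMass.invertedChart e _ hs)) (by
    filter_upwards [(PaneitzMass.tendsto_inversion hs).eventually htgt,
      PaneitzMass.isEndFilter_cobounded.ne_zero] with y hy hy0 i j
    have hsq : PaneitzMass.invScale n * (‖y‖ ^ 2)⁻¹ ≠ 0 := by
      have : 0 < ‖y‖ := norm_pos_iff.2 hy0
      positivity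
    -- The Gauss lemma at x, divided by the positive scalar with x = (s/|y|²) y, is what
    -- `sum_inversion_metric` needs.
    have hrad : ∀ i, ∑ j, PaneitzMass.comps g.inner e (PaneitzMass.inversion
        (PaneitzMass.invScale n) y) i j * y j = y i := by
      intro i
      have h1 := hnormal.gauss hy.1 i
      have h2 : ∀ k, (PaneitzMass.inversion (PaneitzMass.invScale n) y) k =
          PaneitzMass.invScale n * (‖y‖ ^ 2)⁻¹ * y k := fun k => by simp [PaneitzMass.inversion]
      simp only [h2] at h1
      refine mul_left_cancel₀ hsq (Eq.trans ?_ h1)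
      rw [Finset.mul_sum]
      exact Finset.sum_congr rfl fun j _ => by ring
    rw [PaneitzMass.comps_conformalMetric, ← PaneitzMass.sum_inversion_metric hy0
      (PaneitzMass.comps g.inner e _) (hnormal.metric.symm _ hy.1) hrad i j,
      ← PaneitzMass.comps_invertedChart hs he.mem_atlas g.inner hy0 hy.2.1]
    rfl)
  refine ⟨PaneitzMass.qCurvZeroOn_conformal hn hG hpos, PaneitzMass.invertedChart e _ hs,
    ⟨PaneitzMass.invertedChart_source hs he.mem_source he.map_center, fun p _ => rfl⟩,
    ⟨(PaneitzMass.dOrder n : ℝ) + 1, ?_, ?_⟩, hmass⟩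
  -- The rate is τ = d + 1; the floor loses at most 1/2, so (n-4)/2 ≤ d + 1/2 < τ.
  · have h1 : n ≤ 2 * PaneitzMass.dOrder n + 5 := by unfold PaneitzMass.dOrder; omega
    have h2 : (n : ℝ) ≤ ((2 * PaneitzMass.dOrder n + 5 : ℕ) : ℝ) := by exact_mod_cast h1
    push_cast at h2
    linarith
  · exact
      { isOpen := isOpen_compl_singleton
        metric := PaneitzMass.isRiemannianMetricOn_conformal hG.smooth hpos
        rate_pos := by positivity
        mem_atlas := PaneitzMass.invertedChart_mem hs he.mem_atlas
        source_subset := by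
          rw [PaneitzMass.invertedChart_source hs he.mem_source he.map_center]
          exact fun p hp => hp.2
        exterior := ⟨_, div_pos hs hρ₀, PaneitzMass.invertedChart_target hs hρ₀ htarget,
          fun R hR => PaneitzMass.isCompact_compl_invertedChart hs he.mem_source he.map_center
            hρ₀ htarget hR⟩
        decay := hdecay }
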